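/- Fix an integer $N\geqslant 2$. All algebras and modules are over $\mathbb{C}[[h]]$; an algebra given by generators and relations is $h$-adically completed and topologically free (that is, one divides by the smallest $h$-adically closed ideal which contains the relations and is saturated with respect to division by $h$). Let $P$ be the permutation operator on $\mathbb{C}^N\otimes\mathbb{C}^N$, $R(u)=1-\frac{h}{u}P$, and $\overline R(u)=f(u/h)R(u)$, where $f(u)\in 1+u^{-1}\mathbb{C}[[u^{-1}]]$ is the unique series with $f(u+N)=(1-u^{-2})f(u)$. Negative powers of sums such as $u-v$, $z+u_i$, $2z+u_i+u_j$ are expanded in nonnegative powers of all terms other than the first. The double Yangian $\mathrm{DY}(\mathfrak{gl}_N)$ is generated by a central element $C$ and $t_{ij}^{(\pm r)}$ ($1\leqslant i,j\leqslant N$, $r\geqslant 1$), subject to $$R(u-v)T_1^\pm(u)T_2^\pm(v)=T_2^\pm(v)T_1^\pm(u)R(u-v),\qquad \overline R(u-v+\tfrac{hC}{2})T_1^-(u)T_2^+(v)=T_2^+(v)T_1^-(u)\overline R(u-v-\tfrac{hC}{2}),$$ where $T^\pm(u)=(t_{ij}^\pm(u))$, $t^-_{ij}(u)=\delta_{ij}+h\sum_{r\geqslant1}t_{ij}^{(r)}u^{-r}$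 and $t^+_{ij}(u)=\delta_{ij}-h\sum_{r\geqslant1}t_{ij}^{(-r)}u^{r-1}$. Let $\mathcal V=\mathcal V^{\mathrm{crit}}(\mathfrak{gl}_N)$ be the vacuum module at the critical level, that is, the quotient of $\mathrm{DY}(\mathfrak{gl}_N)$ by the smallest $h$-adically closed, $h$-saturated left ideal which contains $C+N$ and all $t_{ij}^{(r)}$ with $r\geqslant1$. Let $\mathbf 1\in\mathcal V$ be the class of $1$. For $u=(u_1,\dots,u_m)$ put $T^+_{[m]}(u)=T_1^+(u_1)\cdots T_m^+(u_m)$. Let $\mathcal V^\circ\subseteq\mathcal V$ be the submodule of all $h$-adically convergent series $\sum_{k\geqslant0}h^ks_k$, where each $s_k$ is a $\mathbb{C}[[h]]$-linear combination of coefficients of matrix entries of the series $T^+_{[m]}(u)\mathbf 1$, $m\geqslant0$. With $\mathcal E_{[n]}$ the action of the anti-symmetrizer $\frac1{n!}\sum_{p\in\mathfrak S_n}\operatorname{sgn}(p)\,p$ on $(\mathbb{C}^N)^{\otimes n}$, let $$\mathbb T^+_{[n]}(0)=\operatorname{tr}_{1,\dots,n}\mathcal E_{[n]}\,T_1^+(0)\,T_2^+(-h)\cdots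 T_n^+(-(n-1)h)\,\mathbf 1\in\mathcal V .$$ Let $B(u)=T^-(u)\,T^-(-u)^{-1}=\big(\delta_{ij}+h\sum_{r\geqslant1}b_{ij}^{(r)}u^{-r}\big)_{i,j=1}^N$, and let the reflection algebra $\mathcal B(N)$ be the $h$-adic closure of the subalgebra generated by all $b_{ij}^{(r)}$, $1\leqslant i,j\leqslant N$, $r\geqslant 1$. For $m\geqslant0$ put $$B_{[m]}(u|z)=\prod_{i=1,\dots,m}^{\longrightarrow}\Big(B_i(z+u_i)\,\overline R_{i\,i+1}(2z+u_i+u_{i+1})\cdots\overline R_{i\,m}(2z+u_i+u_m)\Big).$$ Then $\mathbb T^+_{[1]}(0),\mathbb T^+_{[N]}(0)\in\mathcal V^\circ$, and there exists a unique $\mathbb{C}[[h]]$-linear map $Y(\cdot,z)\colon\mathcal V^\circ\to\mathcal B(N)[[z^{-1}]]$ (the module map) such that $Y(T^+_{[m]}(u)\mathbf 1,z)=B_{[m]}(u|z)$ for all $m\geqslant0$. Moreover, with $\mathbb B_{[n]}(z)=Y(\mathbb T^+_{[n]}(0),z)$ for $n=1,N$: (a) The $h$-adic closure of the subalgebra of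 $\mathcal B(N)$ generated by all coefficients of $\mathbb B_{[1]}(z)$ and $\mathbb B_{[N]}(z)$ is commutative. (b) All coefficients of $\mathbb B_{[N]}(z)$ belong to the center of $\mathcal B(N)$. -/

import Mathlib

open scoped BigOperators

namespace ReflAlg

noncomputable section

/-! ### The ground ring and h-adic notions -/

/-- The ring of formal power series in `h` with complex coefficients. -/
abbrev Ch : Type := PowerSeries ℂ

/-- The formal parameter `h`. -/
def hbar : Ch := PowerSeries.X

/-- `M / I` is `h`-torsion free and `h`-adically separated, that is, `I` is saturated with respect
to division by `h` and closed in the `h`-adic topology. If `M` is `h`-adically complete, this says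
that `M / I` is topologically free. -/
def IsClosedSaturated {M : Type*} [AddCommGroup M] [Module Ch M] (I : Set M) : Prop :=
  (∀ x : M, hbar • x ∈ I → x ∈ I) ∧
    ∀ x : M, (∀ n : ℕ, ∃ y ∈ I, ∃ w : M, x = y + hbar ^ n • w) → x ∈ I

/-- The closure of a subalgebra in the `h`-adic topology. -/
def hClosure {A : Type*} [Ring A] [Algebra Ch A] (S : Subalgebra Ch A) : Subalgebra Ch A where
  carrier := {x | ∀ n : ℕ, ∃ a ∈ S, ∃ y : A, x = a + hbar ^ n • y}
  mul_mem' := by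
    intro x y hx hy n
    obtain ⟨a, ha, s, rfl⟩ := hx n
    obtain ⟨b, hb, t, rfl⟩ := hy n
    refine ⟨a * b, S.mul_mem ha hb, a * t + s * b + hbar ^ n • (s * t), ?_⟩
    simp only [mul_add, add_mul, smul_add, mul_smul_comm, smul_mul_assoc]
    abel
  add_mem' := by
    intro x y hx hy n
    obtain ⟨a, ha, s, rfl⟩ := hx n
    obtain ⟨b, hb, t, rfl⟩ := hy n
    exact ⟨a + b, S.add_mem ha hb, s + t, by rw [smul_add]; abel⟩
  algebraMap_mem' := fun c _ => ⟨algebraMap Ch A c, S.algebraMap_mem c, 0, by simp⟩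

theorem subset_hClosure {A : Type*} [Ring A] [Algebra Ch A] (S : Subalgebra Ch A) {x : A}
    (hx : x ∈ S) : x ∈ hClosure S :=
  fun _ => ⟨x, hx, 0, by simp⟩

/-! ### Matrices with values in algebras, tensor factors, R-matrices -/

/-- `(End ℂ^N)^{⊗ m} ⊗ A`, realized as matrices whose rows and columns are indexed by the
standard basis of `(ℂ^N)^{⊗ m}`. -/
abbrev Ten (N m : ℕ) (A : Type*) : Type _ := Matrix (Fin m → Fin N) (Fin m → Fin N) A

/-- `M_i`: the matrix `M ∈ End ℂ^N ⊗ A` acting in the `i`-th tensor factor. -/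
def site {N m : ℕ} {A : Type*} [Zero A] (i : Fin m) (M : Matrix (Fin N) (Fin N) A) : Ten N m A :=
  Matrix.of fun a b => if ∀ k, k ≠ i → a k = b k then M (a i) (b i) else 0

/-- `P_{ij}`: the permutation of the tensor factors `i` and `j`. -/
def perm {N m : ℕ} {A : Type*} [Zero A] [One A] (i j : Fin m) : Ten N m A :=
  Matrix.of fun a b => if a = b ∘ Equiv.swap i j then 1 else 0

/-- The action `E_{[n]}` of the anti-symmetrizer `(1/n!) ∑_p sgn(p) p` on `(ℂ^N)^{⊗ n}`. -/
def antisym (N n : ℕ) (A : Type*) [Ring A] [Algebra Ch A] : Ten N n A :=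
  Matrix.of fun a b => algebraMap Ch A
    (PowerSeries.C ((n.factorial : ℂ)⁻¹) *
      ∑ p : Equiv.Perm (Fin n), if a = b ∘ p then ((Equiv.Perm.sign p : ℤ) : Ch) else 0)

/-- `∑_r a_r w^r`, for coefficients `a_r ∈ A` and a scalar series `w` without constant term. Since
`w ^ r` has no terms of total degree less than `r`, the sum is finite in each degree. -/
def subs {σ S A : Type*} [CommRing S] [Ring A] [Algebra S A] (a : ℕ → A)
    (w : MvPowerSeries σ S) : MvPowerSeries σ A :=
  fun d => ∑ r ∈ Finset.range (d.degree + 1), MvPowerSeries.coeff d (w ^ r) • a r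

/-- The matrix series `∑_r T_r w^r` placed in the `i`-th tensor factor. -/
def siteSeries {σ A : Type*} [Ring A] [Algebra Ch A] {N m : ℕ} (i : Fin m)
    (T : ℕ → Matrix (Fin N) (Fin N) A) (w : MvPowerSeries σ Ch) :
    Ten N m (MvPowerSeries σ A) :=
  site i (Matrix.of fun k l => subs (fun r => T r k l) w)

/-- Extension of scalars, coefficientwise and entrywise. -/
def extScal {σ S A : Type*} [Semiring S] [Semiring A] {N m : ℕ} (φ : S →+* A)
    (M : Ten N m (MvPowerSeries σ S)) : Ten N m (MvPowerSeries σ A) :=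
  M.map (MvPowerSeries.map φ)

/-- The coefficients `f_r` of the series `f(u) = ∑_r f_r u^{-r} ∈ 1 + u^{-1} ℂ[[u^{-1}]]` which is
uniquely determined by `f(u + N) = (1 - u^{-2}) f(u)`; see `normSeries_shift`. -/
def normCoeff (N : ℕ) : ℕ → ℂ
  | 0 => 1
  | m + 1 => ((N : ℂ) * (m + 1))⁻¹ *
      (normCoeff N m + ∑ k : Fin (m + 1),
        normCoeff N k * (-(N : ℂ)) ^ (m + 2 - (k : ℕ)) * ((m + 1).choose (m + 2 - (k : ℕ)) : ℂ))

theorem coeff_subs_unit (a : ℕ → ℂ) (w : PowerSeries ℂ) (n : ℕ) :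
    PowerSeries.coeff n (subs a (w : MvPowerSeries Unit ℂ) : MvPowerSeries Unit ℂ) =
      ∑ r ∈ Finset.range (n + 1), PowerSeries.coeff n (w ^ r) * a r := by
  have h : (Finsupp.single () n).degree = n := by simp
  change ∑ r ∈ Finset.range ((Finsupp.single () n).degree + 1), _ = _
  rw [h]
  rfl

theorem coeff_shift_pow (N : ℕ) (n k : ℕ) (hk : k < n + 1) :
    PowerSeries.coeff (n + 1) ((PowerSeries.X * PowerSeries.invOfUnit
      (1 + PowerSeries.C (N : ℂ) * PowerSeries.X) 1 : PowerSeries ℂ) ^ (k + 1)) =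
      (-(N : ℂ)) ^ (n - k) * (n.choose (n - k) : ℂ) := by
  have h1 : PowerSeries.invOfUnit (1 + PowerSeries.C (N : ℂ) * PowerSeries.X) 1 =
      PowerSeries.rescale (-(N : ℂ)) (PowerSeries.mk 1) := by
    have h2 : (1 + PowerSeries.C (N : ℂ) * PowerSeries.X) *
        PowerSeries.rescale (-(N : ℂ)) (PowerSeries.mk 1) = 1 := by
      have h3 := congrArg (PowerSeries.rescale (-(N : ℂ))) (PowerSeries.mk_one_mul_one_sub_eq_one ℂ)
      rw [map_mul, map_sub, map_one, PowerSeries.rescale_X, mul_comm] at h3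
      simpa using h3
    have h4 := PowerSeries.invOfUnit_mul (1 + PowerSeries.C (N : ℂ) * PowerSeries.X) 1 (by simp)
    exact left_inv_eq_right_inv h4 h2
  obtain ⟨j, rfl⟩ : ∃ j, n = k + j := ⟨n - k, by omega⟩
  rw [h1, mul_pow, ← map_pow, PowerSeries.mk_one_pow_eq_mk_choose_add,
    show k + j + 1 = j + (k + 1) by ring, PowerSeries.coeff_X_pow_mul]
  simp [PowerSeries.coeff_rescale, Nat.choose_symm_add (a := k) (b := j)]

/-- The functional equation `f(u + N) = (1 - u^{-2}) f(u)`, with `X = u^{-1}`, so that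
`1/(u + N) = X / (1 + N X)`. -/
theorem normSeries_shift (N : ℕ) (hN : N ≠ 0) :
    (subs (normCoeff N) (PowerSeries.X * PowerSeries.invOfUnit
        (1 + PowerSeries.C (N : ℂ) * PowerSeries.X) 1 : PowerSeries ℂ) : PowerSeries ℂ) =
      (1 - PowerSeries.X ^ 2) * subs (normCoeff N) (PowerSeries.X : PowerSeries ℂ) := by
  have hX : ∀ n, PowerSeries.coeff n
      (subs (normCoeff N) (PowerSeries.X : PowerSeries ℂ) : PowerSeries ℂ) = normCoeff N n := by
    intro n
    refine (coeff_subs_unit _ _ n).trans ?_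
    simp [PowerSeries.coeff_X_pow]
  refine PowerSeries.ext fun n => (coeff_subs_unit _ _ n).trans ?_
  rw [sub_mul, one_mul, map_sub, hX, PowerSeries.coeff_X_pow_mul', hX]
  rcases n with _ | _ | m
  · simp
  · rw [Finset.sum_range_succ', Finset.sum_range_succ, coeff_shift_pow N 0 0 (by omega)]
    simp
  · have hN' : (N : ℂ) ≠ 0 := by exact_mod_cast hN
    have hm : (m + 1 : ℂ) ≠ 0 := by exact_mod_cast Nat.succ_ne_zero m
    have hrec : (N : ℂ) * (m + 1) * normCoeff N (m + 1) = normCoeff N m +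
        ∑ k ∈ Finset.range (m + 1), normCoeff N k * (-(N : ℂ)) ^ (m + 2 - k) *
          ((m + 1).choose (m + 2 - k) : ℂ) := by
      rw [normCoeff, mul_inv_cancel_left₀ (mul_ne_zero hN' hm), Finset.sum_range]
    rw [Finset.sum_range_succ'] at hrec ⊢
    rw [Finset.sum_range_succ, Finset.sum_range_succ,
      coeff_shift_pow N (m + 1) (m + 1) (by omega), coeff_shift_pow N (m + 1) m (by omega),
      Finset.sum_congr rfl fun k hk => by
        rw [coeff_shift_pow N (m + 1) k (by have := Finset.mem_range.1 hk; omega)]]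
    have e1 : m + 1 - m = 1 := by omega
    have e2 : ∀ k, m + 2 - (k + 1) = m + 1 - k := by intro k; omega
    simp only [e1, e2, Nat.sub_self, pow_zero, pow_one, Nat.choose_zero_right, Nat.choose_one_right,
      PowerSeries.coeff_one, Nat.sub_zero] at hrec ⊢
    have e3 : (m + 1).choose (m + 2) = 0 := Nat.choose_eq_zero_of_lt (by omega)
    rw [e3] at hrec
    have e4 : ∀ k, (-(N : ℂ)) ^ (m + 1 - k) * ((m + 1).choose (m + 1 - k) : ℂ) * normCoeff N (k + 1)
        = normCoeff N (k + 1) * (-(N : ℂ)) ^ (m + 1 - k) * ((m + 1).choose (m + 1 - k) : ℂ) := by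
      intro k; ring
    simp only [e4]
    simp
    push_cast at hrec
    linear_combination -hrec

/-- The constant series `h`. -/
def hC {σ : Type*} (S : Type*) [CommRing S] [Algebra Ch S] : MvPowerSeries σ S :=
  MvPowerSeries.C (algebraMap Ch S hbar)

/-- The normalized R-matrix `f(x/h) (1 - (h/x) P_{ij})` of type `A`, written in terms of
`w = 1/x`. -/
def normR {σ S : Type*} [CommRing S] [Algebra Ch S] {N m : ℕ} (i j : Fin m)
    (w : MvPowerSeries σ S) : Ten N m (MvPowerSeries σ S) :=
  subs (fun r => algebraMap Ch S (PowerSeries.C (normCoeff N r))) (hC S * w) •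
    (1 - (hC S * w) • perm i j)

/-! ### The double Yangian of `gl_N` -/

theorem map_algebraMap_commutes (A : Type*) [Ring A] [Algebra ℂ A] (c : Ch) (x : PowerSeries A) :
    PowerSeries.map (algebraMap ℂ A) c * x = x * PowerSeries.map (algebraMap ℂ A) c := by
  refine PowerSeries.ext fun n => ?_
  rw [PowerSeries.coeff_mul, PowerSeries.coeff_mul, ← Finset.Nat.sum_antidiagonal_swap]
  refine Finset.sum_congr rfl fun p _ => ?_
  simp only [Prod.fst_swap, Prod.snd_swap, PowerSeries.coeff_map]
  exact Algebra.commutes _ _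

/-- Generators of the double Yangian: `C`, `t_{ij}^{(r+1)}` and `t_{ij}^{(-r-1)}` for `r ≥ 0`. -/
inductive Gen (N : ℕ) : Type
  | cen : Gen N
  | pos (i j : Fin N) (r : ℕ) : Gen N
  | neg (i j : Fin N) (r : ℕ) : Gen N

/-- The `h`-adically completed free associative algebra over `ℂ[[h]]` on the generators. The
`h`-adic completion of `ℂ[[h]]⟨X⟩` is `ℂ⟨X⟩[[h]]`. -/
def FreeTop (N : ℕ) : Type := PowerSeries (FreeAlgebra ℂ (Gen N))

instance (N : ℕ) : Ring (FreeTop N) := inferInstanceAs (Ring (PowerSeries (FreeAlgebra ℂ (Gen N))))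

instance (N : ℕ) : Algebra Ch (FreeTop N) :=
  RingHom.toAlgebra' (PowerSeries.map (algebraMap ℂ (FreeAlgebra ℂ (Gen N))))
    (map_algebraMap_commutes (FreeAlgebra ℂ (Gen N)))

/-- A generator as an element of the completed free algebra. -/
def FreeTop.gen {N : ℕ} (g : Gen N) : FreeTop N :=
  PowerSeries.C (FreeAlgebra.ι ℂ g)

/-- The `h`-adically convergent sum `∑_r h^r a_r`. -/
def FreeTop.hSum {N : ℕ} (a : ℕ → FreeTop N) : FreeTop N :=
  PowerSeries.mk fun n =>
    ∑ r ∈ Finset.range (n + 1), PowerSeries.coeff (R := FreeAlgebra ℂ (Gen N)) (n - r) (a r)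

/-- The coefficients of `1 + h ∑_{r ≥ 1} x^{(r)} u^{-r}` in powers of `u^{-1}`, where `x r` stands
for `x^{(r+1)}`. -/
def serMinus {N : ℕ} {A : Type*} [Ring A] [Algebra Ch A] (x : Fin N → Fin N → ℕ → A) :
    ℕ → Matrix (Fin N) (Fin N) A
  | 0 => 1
  | r + 1 => Matrix.of fun i j => hbar • x i j r

/-- The coefficients of `1 - h ∑_{r ≥ 1} x^{(-r)} u^{r-1}` in powers of `u`, where `x r` stands for
`x^{(-r-1)}`. -/
def serPlus {N : ℕ} {A : Type*} [Ring A] [Algebra Ch A] (x : Fin N → Fin N → ℕ → A) (r : ℕ) :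
    Matrix (Fin N) (Fin N) A :=
  (if r = 0 then 1 else 0) - Matrix.of fun i j => hbar • x i j r

/-- All coefficients of all entries of a matrix of series. -/
def coeffSet {σ A : Type*} [Semiring A] {N m : ℕ} (M : Ten N m (MvPowerSeries σ A)) : Set A :=
  {x | ∃ a b d, x = MvPowerSeries.coeff d (M a b)}

section Relations

variable (N : ℕ)

/-- `T^+(w)` and `T^-(1/w)` over the free algebra, in the tensor factor `i` of two. -/
def freeT (plus : Bool) (i : Fin 2) (w : MvPowerSeries (Fin 2) Ch) :
    Ten N 2 (MvPowerSeries (Fin 2) (FreeTop N)) :=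
  siteSeries i
    (if plus then serPlus (fun k l r => FreeTop.gen (Gen.neg k l r))
      else serMinus (fun k l r => FreeTop.gen (Gen.pos k l r))) w

/-- The relation `R(u-v) T_1^+(u) T_2^+(v) = T_2^+(v) T_1^+(u) R(u-v)`, multiplied by `u - v`;
here `X 0 = u`, `X 1 = v`. -/
def relPlus : Ten N 2 (MvPowerSeries (Fin 2) (FreeTop N)) :=
  let u : MvPowerSeries (Fin 2) Ch := MvPowerSeries.X 0
  let v : MvPowerSeries (Fin 2) Ch := MvPowerSeries.X 1
  let P : Ten N 2 (MvPowerSeries (Fin 2) Ch) := perm 0 1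
  let R := extScal (algebraMap Ch (FreeTop N)) ((u - v) • 1 - (hC Ch : MvPowerSeries (Fin 2) Ch) • P)
  R * freeT N true 0 u * freeT N true 1 v - freeT N true 1 v * freeT N true 0 u * R

/-- The relation `R(u-v) T_1^-(u) T_2^-(v) = T_2^-(v) T_1^-(u) R(u-v)`, multiplied by
`u^{-1} v^{-1} (u - v) = v^{-1} - u^{-1}`; here `X 0 = u^{-1}`, `X 1 = v^{-1}`. -/
def relMinus : Ten N 2 (MvPowerSeries (Fin 2) (FreeTop N)) :=
  let x : MvPowerSeries (Fin 2) Ch := MvPowerSeries.X 0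
  let y : MvPowerSeries (Fin 2) Ch := MvPowerSeries.X 1
  let P : Ten N 2 (MvPowerSeries (Fin 2) Ch) := perm 0 1
  let R := extScal (algebraMap Ch (FreeTop N)) ((y - x) • 1 - (hC Ch * x * y) • P)
  R * freeT N false 0 x * freeT N false 1 y - freeT N false 1 y * freeT N false 0 x * R

/-- `1 / (u - v + s h C)` expanded in nonnegative powers of `v` and `h`, where `X 0 = u^{-1}`,
`X 1 = v` and `C` is a polynomial variable. -/
def shiftInv (s : ℂ) : MvPowerSeries (Fin 2) (Polynomial Ch) :=
  MvPowerSeries.X 0 * MvPowerSeries.invOfUnit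
    (1 - MvPowerSeries.X 0 * (MvPowerSeries.X 1 -
      MvPowerSeries.C (Polynomial.C (PowerSeries.C s * hbar) * Polynomial.X))) 1

/-- The relation
`Rbar(u-v+hC/2) T_1^-(u) T_2^+(v) = T_2^+(v) T_1^-(u) Rbar(u-v-hC/2)`;
here `X 0 = u^{-1}`, `X 1 = v`. -/
def relMixed : Ten N 2 (MvPowerSeries (Fin 2) (FreeTop N)) :=
  let φ : Polynomial Ch →+* FreeTop N := (Polynomial.aeval (FreeTop.gen Gen.cen)).toRingHom
  let T₁ := freeT N false 0 (MvPowerSeries.X 0)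
  let T₂ := freeT N true 1 (MvPowerSeries.X 1)
  extScal φ (normR 0 1 (shiftInv (1 / 2))) * T₁ * T₂ -
    T₂ * T₁ * extScal φ (normR 0 1 (shiftInv (-1 / 2)))

/-- All defining relations of the double Yangian. -/
def dyRel : Set (FreeTop N) :=
  {x | ∃ g : Gen N, x = FreeTop.gen Gen.cen * FreeTop.gen g -
      FreeTop.gen g * FreeTop.gen Gen.cen} ∪
    coeffSet (relPlus N) ∪ coeffSet (relMinus N) ∪ coeffSet (relMixed N)

/-- The smallest two-sided ideal that contains the defining relations and has a topologically free
quotient. -/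
def dyIdeal : TwoSidedIdeal (FreeTop N) :=
  sInf {I | dyRel N ⊆ (I : Set (FreeTop N)) ∧ IsClosedSaturated (I : Set (FreeTop N))}

end Relations

/-- The double Yangian `DY(gl_N)`. -/
def DY (N : ℕ) : Type := (dyIdeal N).ringCon.Quotient

instance (N : ℕ) : Ring (DY N) := inferInstanceAs (Ring (dyIdeal N).ringCon.Quotient)

instance (N : ℕ) : Algebra Ch (DY N) :=
  inferInstanceAs (Algebra Ch (dyIdeal N).ringCon.Quotient)

/-- The quotient map onto the double Yangian. -/
def DY.mk (N : ℕ) : FreeTop N →+* DY N := (dyIdeal N).ringCon.mk'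

/-- The generator `C`. -/
def cenC (N : ℕ) : DY N := DY.mk N (FreeTop.gen Gen.cen)

/-- The generators `t_{ij}^{(r+1)}`. -/
def tPos {N : ℕ} (i j : Fin N) (r : ℕ) : DY N := DY.mk N (FreeTop.gen (Gen.pos i j r))

/-- The generators `t_{ij}^{(-r-1)}`. -/
def tNeg {N : ℕ} (i j : Fin N) (r : ℕ) : DY N := DY.mk N (FreeTop.gen (Gen.neg i j r))

/-! ### The vacuum module -/

/-- The smallest left ideal of the double Yangian which contains `C - c` and all `t_{ij}^{(r)}`,
`r ≥ 1`, and has a topologically free quotient. -/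
def vacIdeal (N : ℕ) (c : ℂ) : Submodule (DY N) (DY N) :=
  sInf {L | cenC N - algebraMap Ch (DY N) (PowerSeries.C c) ∈ L ∧
    (∀ i j r, tPos (N := N) i j r ∈ L) ∧ IsClosedSaturated (L : Set (DY N))}

/-- The vacuum module `V^c(gl_N)` at the level `c`. -/
abbrev Vac (N : ℕ) (c : ℂ) : Type := DY N ⧸ vacIdeal N c

/-- The vacuum module at the critical level `c = -N`. -/
abbrev VacCrit (N : ℕ) : Type := Vac N (-(N : ℂ))

/-- The element `x 𝟏` of the vacuum module, for `x` in the double Yangian. -/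
def onVac {N : ℕ} (x : DY N) : VacCrit N := Submodule.Quotient.mk x

/-- `T^+_{[m]}(u) = T^+_1(u_1) ... T^+_m(u_m)`. -/
def TplusProd (N m : ℕ) : Ten N m (MvPowerSeries (Fin m) (DY N)) :=
  (List.ofFn fun i : Fin m => siteSeries i (serPlus tNeg) (MvPowerSeries.X i)).prod

/-- The matrix `T^+(-k h)`. -/
def TplusAt (N k : ℕ) : Matrix (Fin N) (Fin N) (DY N) :=
  Matrix.of fun i j => DY.mk N (FreeTop.hSum fun r =>
    (-(k : Ch)) ^ r • serPlus (fun i j s => FreeTop.gen (Gen.neg i j s)) r i j)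

/-- The fused element
`𝕋^+_{[n]}(0) = tr_{1,…,n} E_{[n]} T^+_1(0) T^+_2(-h) ... T^+_n(-(n-1)h) 𝟏`. -/
def fused (N n : ℕ) : VacCrit N :=
  onVac (Matrix.trace
    (antisym N n (DY N) * (List.ofFn fun i : Fin n => site i (TplusAt N i)).prod))

/-- The coefficients of all matrix entries of all `T^+_{[m]}(u) 𝟏`. -/
def vacCoeffs (N : ℕ) : Set (VacCrit N) :=
  {x | ∃ (m : ℕ) (a b : Fin m → Fin N) (d : Fin m →₀ ℕ),
    x = onVac (MvPowerSeries.coeff d (TplusProd N m a b))}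

/-- The `ℂ[[h]]`-submodule of the vacuum module consisting of all `h`-adically convergent series
`∑_k h^k s_k`, where every `s_k` is a linear combination of coefficients of the matrix entries of
the series `T^+_{[m]}(u) 𝟏`, `m ≥ 0`. -/
def vacLattice (N : ℕ) : Submodule Ch (VacCrit N) where
  carrier := {x | ∃ s : ℕ → VacCrit N, (∀ k, s k ∈ Submodule.span Ch (vacCoeffs N)) ∧
    ∀ n, ∃ y : VacCrit N, x = ∑ k ∈ Finset.range n, hbar ^ k • s k + hbar ^ n • y}
  add_mem' := by
    rintro x y ⟨s, hs, hx⟩ ⟨t, ht, hy⟩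
    refine ⟨fun k => s k + t k, fun k => Submodule.add_mem _ (hs k) (ht k), fun n => ?_⟩
    obtain ⟨x', hx'⟩ := hx n
    obtain ⟨y', hy'⟩ := hy n
    refine ⟨x' + y', ?_⟩
    rw [hx', hy']
    simp only [smul_add, Finset.sum_add_distrib]
    abel
  zero_mem' := ⟨fun _ => 0, fun _ => Submodule.zero_mem _, fun n => ⟨0, by simp⟩⟩
  smul_mem' := by
    rintro c x ⟨s, hs, hx⟩
    refine ⟨fun k => c • s k, fun k => Submodule.smul_mem _ c (hs k), fun n => ?_⟩
    obtain ⟨x', hx'⟩ := hx n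
    refine ⟨c • x', ?_⟩
    rw [hx']
    simp only [smul_add, Finset.smul_sum, smul_comm c]

theorem vacCoeffs_subset (N : ℕ) {x : VacCrit N} (hx : x ∈ vacCoeffs N) : x ∈ vacLattice N := by
  refine ⟨fun k => if k = 0 then x else 0, fun k => ?_, fun n => ?_⟩
  · by_cases hk : k = 0
    · simpa [hk] using Submodule.subset_span hx
    · simp [hk]
  · cases n with
    | zero => exact ⟨x, by simp⟩
    | succ n => exact ⟨0, by simp⟩

/-- The coefficient of `u^d` in the `(a, b)` entry of `T^+_{[m]}(u) 𝟏`. -/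
def TplusVac (N m : ℕ) (a b : Fin m → Fin N) (d : Fin m →₀ ℕ) : vacLattice N :=
  ⟨onVac (MvPowerSeries.coeff d (TplusProd N m a b)), vacCoeffs_subset N ⟨m, a, b, d, rfl⟩⟩

/-! ### The reflection algebra -/

/-- `p(u) ↦ p(-u)` for a series in `u^{-1}`. -/
def evalNeg {A : Type*} [Ring A] (p : PowerSeries A) : PowerSeries A :=
  PowerSeries.mk fun r => (-1) ^ r * PowerSeries.coeff r p

/-- `T(u) = T^-(u)` as a series in `u^{-1}` with coefficients in `End ℂ^N ⊗ DY(gl_N)`. -/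
def Tser (N : ℕ) : PowerSeries (Matrix (Fin N) (Fin N) (DY N)) :=
  PowerSeries.mk (serMinus tPos)

/-- `τ(u) = ∑_{r ≥ 1} t^{(r)} u^{-r}`, so that `T(u) = 1 + h τ(u)`. -/
def tauSer (N : ℕ) : PowerSeries (Matrix (Fin N) (Fin N) (DY N)) :=
  PowerSeries.mk fun r => match r with
    | 0 => 0
    | r + 1 => Matrix.of fun i j => tPos i j r

/-- `B(u) = T(u) T(-u)^{-1}`. -/
def Bser (N : ℕ) : PowerSeries (Matrix (Fin N) (Fin N) (DY N)) :=
  Tser N * PowerSeries.invOfUnit (evalNeg (Tser N)) 1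

/-- The elements `b_{ij}^{(r+1)}` with `b_{ij}(u) = δ_{ij} + h ∑_{r ≥ 1} b_{ij}^{(r)} u^{-r}`; they
are the coefficients of `(τ(u) - τ(-u)) T(-u)^{-1} = h^{-1} (T(u) T(-u)^{-1} - 1)`. -/
def bCoeff {N : ℕ} (i j : Fin N) (r : ℕ) : DY N :=
  PowerSeries.coeff (r + 1)
    ((tauSer N - evalNeg (tauSer N)) * PowerSeries.invOfUnit (evalNeg (Tser N)) 1) i j

theorem Bser_eq (N : ℕ) : Bser N = PowerSeries.mk (serMinus bCoeff) := by
  have h0 : PowerSeries.constantCoeff (evalNeg (Tser N)) = ((1 : (Matrix (Fin N) (Fin N) (DY N))ˣ) :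
      Matrix (Fin N) (Fin N) (DY N)) := by
    rw [← PowerSeries.coeff_zero_eq_constantCoeff_apply]
    simp [evalNeg, Tser, serMinus]
  have h1 : Tser N - evalNeg (Tser N) = PowerSeries.C (algebraMap Ch _ hbar) *
      (tauSer N - evalNeg (tauSer N)) := by
    refine PowerSeries.ext fun r => ?_
    cases r with
    | zero => simp [evalNeg, Tser, tauSer, serMinus]
    | succ r =>
      have h2 : (Matrix.of fun i j => hbar • tPos (N := N) i j r) =
          hbar • (Matrix.of fun i j => tPos i j r : Matrix (Fin N) (Fin N) (DY N)) := rfl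
      simp only [map_sub, evalNeg, Tser, tauSer, PowerSeries.coeff_mk, serMinus,
        PowerSeries.coeff_C_mul, h2, ← Algebra.smul_def, smul_sub, mul_smul_comm]
  have h3 : Bser N = PowerSeries.C (algebraMap Ch _ hbar) *
      ((tauSer N - evalNeg (tauSer N)) * PowerSeries.invOfUnit (evalNeg (Tser N)) 1) + 1 := by
    rw [← mul_assoc, ← h1, ← PowerSeries.mul_invOfUnit _ 1 h0, ← add_mul, sub_add_cancel, Bser]
  rw [h3]
  refine PowerSeries.ext fun r => ?_
  cases r with
  | zero =>
    simp [tauSer, evalNeg, serMinus]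
  | succ r =>
    ext i j
    simp [PowerSeries.coeff_C_mul, ← Algebra.smul_def, serMinus, bCoeff, PowerSeries.coeff_one]

/-- The reflection algebra `B(N)`: the `h`-adically completed subalgebra generated by the elements
`b_{ij}^{(r)}`, `r ≥ 1`, of the Yangian `Y(gl_N) ⊆ DY(gl_N)`. -/
def reflAlg (N : ℕ) : Subalgebra Ch (DY N) :=
  hClosure (Algebra.adjoin Ch {x | ∃ (i j : Fin N) (r : ℕ), x = bCoeff i j r})

/-- `b_{ij}^{(r+1)}` as an element of the reflection algebra. -/
def bGen {N : ℕ} (i j : Fin N) (r : ℕ) : reflAlg N :=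
  ⟨bCoeff i j r, subset_hClosure _ (Algebra.subset_adjoin ⟨i, j, r, rfl⟩)⟩

/-- `1 / (z + u_i)`, expanded in nonnegative powers of `u_i`; here `X none = z^{-1}` and
`X (some i) = u_i`. -/
def invZ {m : ℕ} (i : Fin m) : MvPowerSeries (Option (Fin m)) Ch :=
  MvPowerSeries.X none *
    MvPowerSeries.invOfUnit (1 + MvPowerSeries.X none * MvPowerSeries.X (some i)) 1

/-- `1 / (2z + u_i + u_j)`, expanded in nonnegative powers of `u_i` and `u_j`. -/
def invZZ {m : ℕ} (i j : Fin m) : MvPowerSeries (Option (Fin m)) Ch :=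
  let y : MvPowerSeries (Option (Fin m)) Ch :=
    MvPowerSeries.C (PowerSeries.C (1 / 2 : ℂ)) * MvPowerSeries.X none
  y * MvPowerSeries.invOfUnit
    (1 + y * (MvPowerSeries.X (some i) + MvPowerSeries.X (some j))) 1

/-- `B_{[m]}(u|z)`, the ordered product over `i = 1, …, m` of
`B_i(z+u_i) Rbar_{i,i+1}(2z+u_i+u_{i+1}) ... Rbar_{i,m}(2z+u_i+u_m)`. -/
def Bprod (N m : ℕ) : Ten N m (MvPowerSeries (Option (Fin m)) (reflAlg N)) :=
  (List.ofFn fun i : Fin m =>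
    siteSeries i (serMinus bGen) (invZ i) *
      (((List.finRange m).filter fun j => i < j).map fun j =>
        extScal (algebraMap Ch (reflAlg N)) (normR i j (invZZ i j))).prod).prod

/-- `Y` is the module map: `Y(T^+_{[m]}(u) 𝟏, z) = B_{[m]}(u|z)` for all `m ≥ 0` (where `m = 0` is
the vacuum property `Y(𝟏, z) = 1`). Series in `z^{-1}` are written as power series. -/
def IsModuleMap {N : ℕ} (Y : vacLattice N →ₗ[Ch] PowerSeries (reflAlg N)) : Prop :=
  ∀ (m : ℕ) (a b : Fin m → Fin N) (d : Fin m →₀ ℕ) (k : ℕ),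
    PowerSeries.coeff k (Y (TplusVac N m a b d)) =
      MvPowerSeries.coeff (d.optionElim k) (Bprod N m a b)

/-- The coefficients of a series in `z^{-1}`. -/
def serCoeffs {A : Type*} [Semiring A] (p : PowerSeries A) : Set A :=
  Set.range fun k => PowerSeries.coeff k p

end

end ReflAlg

/-!
The vacuum module is only needed through a map out of it. Let `Yp N` be the dual Yangian, the
algebra generated by the `t_{ij}^{(-r)}` alone with the relation for `T⁺`. For each level `c` the
double Yangian acts on `Yp N`: `T⁺` by left multiplication, and `T⁻` by operators that fix the
vacuum and are exchanged with `T⁺` by the mixed relation. Such operators are the product of two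
operators of evaluation type, one for each `R`-matrix in that relation (`exists_tMinus`). The
quadratic relation of `T⁻` follows: by the Yang–Baxter equation its defect is exchanged with `T⁺`,
and it annihilates `1`, hence it is zero (`Exch.rtt`). At the critical level this gives a linear map
from the vacuum module to `Yp N`, `x 𝟏 ↦ x · 1` (`exists_vacCrit_map`).

The module map comes from an algebra homomorphism. On the linear maps from `Yp N` to the double
Yangian there act the left multiplication by `B(1/z)`, the right multiplication `T` by `T⁺`, taken
on the source, and the precomposition `S` with an evaluation type operator. The reflection equation
for `B` and the exchange of `S` with `T` imply that `S(1/(2z + v)) B(1/(z + v)) T(v)` satisfies the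
relation of `T⁺(v)` (`rtt_sbt`), so there is a homomorphism from `Yp N` which sends `T⁺(v)` to this
product (`sbtHom`). It is integral after the substitution of `h z⁻¹` for `z⁻¹`. Moving all `S` to
the left and all `T` to the right in a product over `m` tensor factors produces the `R`-matrices
with arguments `2z + u_i + u_j` (`normal_order`). When the augmentation is inserted and the value at
`1` is taken, `S` and `T` disappear, and `B_{[m]}(u|z)` remains, with the coefficient of `z^{-k}`
multiplied by `h^k` (`yHat_yProd`). These coefficients can be divided by `h^k`, uniquely, because
the double Yangian is free of `h`-torsion (`exists_moduleMap`). The module map is unique because a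
linear map on the lattice is `h`-adically continuous (`moduleMap_unique`).

The fused vectors lie in the lattice (`fused_mem`), and their images are the traces of the
anti-symmetrizer times the product `B_{[n]}(u|z)` at `u_i = -i h` (`moduleMap_fused_trace`). For
`n = 1` this is the trace of `B(z)`, whose coefficients commute by the reflection equation
(`trace_bD_comm`). For `n = N` the crossing relation collects the factors `T` and `T⁻¹` of the
matrices `B`, and the anti-symmetrizer turns the product into a scalar series times the quantum
determinants of `T(z)` and of `T(-z)⁻¹` (`antisym_mul_bProd`). A quantum determinant commutes with
the entries of its matrix (`qDet_comm`): in `N + 1` tensor factors the anti-symmetrizer of `N` of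
them reduces the product of the `R`-matrices with the remaining factor to a scalar, since `ℂ^N` has
no antisymmetric tensors of degree `N + 1`. So these coefficients are central
(`moduleMap_fused_central`), and both parts follow by closure.
-/

namespace ReflAlg

noncomputable section

/-! ### Topologically free modules -/

/-- An `h`-torsion free, `h`-adically separated and complete module. -/
structure HTF (M : Type*) [AddCommGroup M] [Module Ch M] : Prop where
  tf : ∀ x : M, hbar • x = 0 → x = 0
  sep : ∀ x : M, (∀ n : ℕ, ∃ y : M, x = hbar ^ n • y) → x = 0
  compl : ∀ a : ℕ → M, ∃ x : M, ∀ n : ℕ, ∃ y : M,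
    x = ∑ k ∈ Finset.range n, hbar ^ k • a k + hbar ^ n • y

namespace HTF

variable {M M' : Type*} [AddCommGroup M] [Module Ch M] [AddCommGroup M'] [Module Ch M']

theorem tf_pow (h : HTF M) (n : ℕ) {x : M} (hx : hbar ^ n • x = 0) : x = 0 := by
  induction n with
  | zero => simpa using hx
  | succ n ih => rw [pow_succ', mul_smul] at hx; exact ih (h.tf _ hx)

theorem tf_inj (h : HTF M) {x y : M} (hx : hbar • x = hbar • y) : x = y :=
  sub_eq_zero.1 (h.tf _ (by rw [smul_sub, hx, sub_self]))

theorem tf_pow_inj (h : HTF M) (n : ℕ) {x y : M} (hx : hbar ^ n • x = hbar ^ n • y) : x = y :=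
  sub_eq_zero.1 (h.tf_pow n (by rw [smul_sub, hx, sub_self]))

theorem eq_of_congr (h : HTF M) {x y : M} (hxy : ∀ n : ℕ, ∃ w, x = y + hbar ^ n • w) : x = y :=
  sub_eq_zero.1 (h.sep _ fun n => by
    obtain ⟨w, hw⟩ := hxy n
    exact ⟨w, by rw [hw]; abel⟩)

theorem pi {ι : Type*} {M : ι → Type*} [∀ i, AddCommGroup (M i)] [∀ i, Module Ch (M i)]
    (h : ∀ i, HTF (M i)) : HTF (∀ i, M i) where
  tf x hx := funext fun i => (h i).tf _ (congrFun hx i)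
  sep x hx := funext fun i => (h i).sep _ fun n => by
    obtain ⟨y, hy⟩ := hx n
    exact ⟨y i, congrFun hy i⟩
  compl a := by
    choose x hx using fun i => (h i).compl fun k => a k i
    refine ⟨x, fun n => ?_⟩
    choose y hy using fun i => hx i n
    refine ⟨y, funext fun i => ?_⟩
    simp [hy i]

/-- Divisibility of a linear map by a power of `h` can be checked pointwise. -/
theorem exists_linearMap (h : HTF M') (n : ℕ) (f : M →ₗ[Ch] M')
    (hf : ∀ m, ∃ y, f m = hbar ^ n • y) : ∃ g : M →ₗ[Ch] M', f = hbar ^ n • g := by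
  choose y hy using hf
  refine ⟨⟨⟨y, fun a b => ?_⟩, fun c a => ?_⟩, LinearMap.ext hy⟩
  · exact h.tf_pow_inj n (by rw [← hy, map_add, hy, hy, smul_add])
  · exact h.tf_pow_inj n (by rw [← hy, map_smul, hy, RingHom.id_apply, smul_comm])

theorem linearMap (h : HTF M') : HTF (M →ₗ[Ch] M') where
  tf x hx := LinearMap.ext fun i => h.tf _ (LinearMap.congr_fun hx i)
  sep x hx := LinearMap.ext fun i => h.sep _ fun n => by
    obtain ⟨y, hy⟩ := hx n
    exact ⟨y i, LinearMap.congr_fun hy i⟩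
  compl a := by
    choose x hx using fun i => h.compl fun k => a k i
    let X : M →ₗ[Ch] M' :=
      { toFun := x
        map_add' := fun p q => h.eq_of_congr fun n => by
          obtain ⟨y1, h1⟩ := hx p n
          obtain ⟨y2, h2⟩ := hx q n
          obtain ⟨y3, h3⟩ := hx (p + q) n
          refine ⟨y3 - y1 - y2, ?_⟩
          rw [h1, h2, h3]
          simp only [map_add, smul_add, smul_sub, Finset.sum_add_distrib]
          abel
        map_smul' := fun c p => h.eq_of_congr fun n => by
          obtain ⟨y1, h1⟩ := hx p n
          obtain ⟨y3, h3⟩ := hx (c • p) n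
          refine ⟨y3 - c • y1, ?_⟩
          rw [h1, h3]
          simp only [map_smul, smul_add, smul_sub, Finset.smul_sum, RingHom.id_apply,
            smul_comm c]
          abel }
    refine ⟨X, fun n => ?_⟩
    obtain ⟨g, hg⟩ := h.exists_linearMap n (X - ∑ k ∈ Finset.range n, hbar ^ k • a k) fun m => by
      obtain ⟨y, hy⟩ := hx m n
      refine ⟨y, ?_⟩
      have : X m = x m := rfl
      simp [this, hy]
    exact ⟨g, by rw [← hg]; abel⟩

theorem mvPowerSeries {σ A : Type*} [Ring A] [Algebra Ch A] (h : HTF A) :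
    HTF (MvPowerSeries σ A) :=
  HTF.pi fun _ : σ →₀ ℕ => h

theorem powerSeries {A : Type*} [Ring A] [Algebra Ch A] (h : HTF A) : HTF (PowerSeries A) :=
  h.mvPowerSeries

theorem matrix {m n A : Type*} [Ring A] [Algebra Ch A] (h : HTF A) : HTF (Matrix m n A) :=
  HTF.pi fun _ : m => HTF.pi fun _ : n => h

end HTF

/-! ### Quotients of the completed free algebra -/

section Quotients

variable {N : ℕ}

/-- The coefficient of `h ^ k`. -/
def FreeTop.cf (k : ℕ) : FreeTop N →+ FreeAlgebra ℂ (Gen N) :=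
  (PowerSeries.coeff (R := FreeAlgebra ℂ (Gen N)) k).toAddMonoidHom

/-- The elements of the free algebra, as constant series in `h`. -/
def FreeTop.const : FreeAlgebra ℂ (Gen N) →+* FreeTop N :=
  PowerSeries.C (R := FreeAlgebra ℂ (Gen N))

namespace FreeTop

theorem gen_eq (g : Gen N) : gen g = const (FreeAlgebra.ι ℂ g) := rfl

theorem ext {x y : FreeTop N} (h : ∀ k, cf k x = cf k y) : x = y :=
  PowerSeries.ext h

theorem cf_const (k : ℕ) (a : FreeAlgebra ℂ (Gen N)) :
    cf k (const a) = if k = 0 then a else 0 :=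
  PowerSeries.coeff_C k a

theorem cf_one (k : ℕ) : cf k (1 : FreeTop N) = if k = 0 then 1 else 0 :=
  PowerSeries.coeff_one k

theorem cf_mul (k : ℕ) (x y : FreeTop N) :
    cf k (x * y) = ∑ p ∈ Finset.HasAntidiagonal.antidiagonal k, cf p.1 x * cf p.2 y :=
  PowerSeries.coeff_mul k x y

theorem cf_hbar_pow (n k : ℕ) (x : FreeTop N) :
    cf k (hbar ^ n • x) = if n ≤ k then cf (k - n) x else 0 := by
  have h : hbar ^ n • x = ((PowerSeries.X ^ n * (id x : PowerSeries (FreeAlgebra ℂ (Gen N))) :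
      PowerSeries (FreeAlgebra ℂ (Gen N)))) := by
    change (PowerSeries.map (algebraMap ℂ (FreeAlgebra ℂ (Gen N))) (PowerSeries.X ^ n)) * _ = _
    rw [map_pow, PowerSeries.map_X]
    rfl
  exact (congrArg (PowerSeries.coeff k) h).trans (PowerSeries.coeff_X_pow_mul' _ _ _)

theorem cf_algebraMap (k : ℕ) (c : Ch) :
    cf k (algebraMap Ch (FreeTop N) c) = algebraMap ℂ _ (PowerSeries.coeff k c) :=
  PowerSeries.coeff_map (algebraMap ℂ (FreeAlgebra ℂ (Gen N))) k c

theorem cf_hSum (a : ℕ → FreeTop N) (k : ℕ) :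
    cf k (hSum a) = ∑ r ∈ Finset.range (k + 1), cf (k - r) (a r) :=
  PowerSeries.coeff_mk k fun n => ∑ r ∈ Finset.range (n + 1), cf (n - r) (a r)

theorem const_smul (c : ℂ) (a : FreeAlgebra ℂ (Gen N)) :
    const (c • a) = (PowerSeries.C c : Ch) • const a := by
  refine ext fun k => ?_
  rw [Algebra.smul_def (PowerSeries.C c : Ch), cf_mul, cf_const, Finset.sum_eq_single_of_mem (0, k)
    (by simp)]
  · rw [cf_algebraMap, cf_const, PowerSeries.coeff_zero_C]
    split_ifs <;> simp [Algebra.smul_def]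
  · rintro ⟨i, j⟩ hij hne
    rw [cf_algebraMap, PowerSeries.coeff_C, if_neg, map_zero, zero_mul]
    rintro rfl
    have := Finset.HasAntidiagonal.mem_antidiagonal.1 hij
    exact hne (by simpa using this)

theorem exists_hSum (a : ℕ → FreeTop N) (n : ℕ) :
    ∃ y, hSum a = ∑ k ∈ Finset.range n, hbar ^ k • a k + hbar ^ n • y := by
  refine ⟨hSum fun k => a (n + k), ext fun m => ?_⟩
  rw [map_add, map_sum, cf_hbar_pow, cf_hSum, cf_hSum]
  simp only [cf_hbar_pow]
  by_cases h : n ≤ m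
  · rw [if_pos h, show m + 1 = n + (m - n + 1) by omega, Finset.sum_range_add]
    congr 1
    · refine Finset.sum_congr rfl fun k hk => ?_
      rw [if_pos (by have := Finset.mem_range.1 hk; omega)]
    · refine Finset.sum_congr rfl fun k hk => ?_
      rw [Nat.sub_sub]
  · rw [if_neg h, add_zero, ← Finset.sum_subset (s₁ := Finset.range (m + 1)) (s₂ := Finset.range n)
      (Finset.range_subset_range.2 (by omega))]
    · refine Finset.sum_congr rfl fun k hk => ?_
      rw [if_pos (by have := Finset.mem_range.1 hk; omega)]
    · intro k _ hk
      rw [if_neg (by simpa using hk)]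

theorem eq_hSum (x : FreeTop N) : x = hSum fun k => const (cf k x) := by
  refine ext fun m => ?_
  rw [cf_hSum, Finset.sum_range_succ, Finset.sum_eq_zero, Nat.sub_self, cf_const,
    if_pos rfl, zero_add]
  intro k hk
  rw [cf_const, if_neg (by have := Finset.mem_range.1 hk; omega)]

/-- The truncation modulo `h ^ n`, as a polynomial in `h`. -/
def tr (n : ℕ) (x : FreeTop N) : Polynomial (FreeAlgebra ℂ (Gen N)) :=
  ∑ k ∈ Finset.range n, Polynomial.monomial k (cf k x)

theorem coeff_tr {n k : ℕ} (hk : k < n) (x : FreeTop N) : (tr n x).coeff k = cf k x := by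
  rw [tr, Polynomial.finsetSum_coeff, Finset.sum_eq_single_of_mem k (by simpa using hk)]
  · simp
  · intro j _ hj
    simp [Polynomial.coeff_monomial, hj]

end FreeTop

theorem HTF.freeTop : HTF (FreeTop N) where
  tf x hx := FreeTop.ext fun k => by
    have := FreeTop.cf_hbar_pow 1 (k + 1) x
    rw [pow_one, hx, if_pos (by omega), map_zero, Nat.add_sub_cancel] at this
    rw [map_zero, this]
  sep x hx := FreeTop.ext fun k => by
    obtain ⟨y, rfl⟩ := hx (k + 1)
    rw [FreeTop.cf_hbar_pow, if_neg (by omega), map_zero]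
  compl a := ⟨FreeTop.hSum a, FreeTop.exists_hSum a⟩

/-- The two-sided ideal generated by `S`, closed and saturated with respect to `h`. -/
def hull (S : Set (FreeTop N)) : TwoSidedIdeal (FreeTop N) :=
  sInf {I | S ⊆ (I : Set (FreeTop N)) ∧ IsClosedSaturated (I : Set (FreeTop N))}

theorem subset_hull (S : Set (FreeTop N)) {x : FreeTop N} (hx : x ∈ S) : x ∈ hull S :=
  (TwoSidedIdeal.mem_sInf _).2 fun _ hI => hI.1 hx

theorem hull_le (S : Set (FreeTop N)) (I : TwoSidedIdeal (FreeTop N))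
    (h : S ⊆ (I : Set (FreeTop N))) (h' : IsClosedSaturated (I : Set (FreeTop N))) :
    hull S ≤ I :=
  sInf_le (a := I) ⟨h, h'⟩

theorem isClosedSaturated_hull (S : Set (FreeTop N)) :
    IsClosedSaturated (hull S : Set (FreeTop N)) := by
  refine ⟨fun x hx => ?_, fun x hx => ?_⟩
  · exact (TwoSidedIdeal.mem_sInf _).2 fun I hI => hI.2.1 x ((TwoSidedIdeal.mem_sInf _).1 hx I hI)
  · refine (TwoSidedIdeal.mem_sInf _).2 fun I hI => hI.2.2 x fun n => ?_
    obtain ⟨y, hy, w, h⟩ := hx n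
    exact ⟨y, (TwoSidedIdeal.mem_sInf _).1 hy I hI, w, h⟩

/-- The topologically free algebra with generators `Gen N` and relations `S`. -/
def Pres (S : Set (FreeTop N)) : Type := (hull S).ringCon.Quotient

instance (S : Set (FreeTop N)) : Ring (Pres S) :=
  inferInstanceAs (Ring (hull S).ringCon.Quotient)

instance (S : Set (FreeTop N)) : Algebra Ch (Pres S) :=
  inferInstanceAs (Algebra Ch (hull S).ringCon.Quotient)

/-- The quotient map onto `Pres S`. -/
def Pres.mk (S : Set (FreeTop N)) : FreeTop N →ₐ[Ch] Pres S :=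
  { (hull S).ringCon.mk' with commutes' := fun _ => rfl }

theorem Pres.mk_surjective (S : Set (FreeTop N)) : Function.Surjective (Pres.mk S) :=
  (hull S).ringCon.mk'_surjective

theorem Pres.mk_eq_zero (S : Set (FreeTop N)) (x : FreeTop N) :
    Pres.mk S x = 0 ↔ x ∈ hull S :=
  (RingCon.eq (hull S).ringCon).trans Iff.rfl

theorem HTF.pres (S : Set (FreeTop N)) : HTF (Pres S) where
  tf x hx := by
    obtain ⟨x, rfl⟩ := Pres.mk_surjective S x
    rw [← map_smul, Pres.mk_eq_zero] at hx
    exact (Pres.mk_eq_zero S x).2 ((isClosedSaturated_hull S).1 x hx)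
  sep x hx := by
    obtain ⟨x, rfl⟩ := Pres.mk_surjective S x
    refine (Pres.mk_eq_zero S x).2 ((isClosedSaturated_hull S).2 x fun n => ?_)
    obtain ⟨y, hy⟩ := hx n
    obtain ⟨y, rfl⟩ := Pres.mk_surjective S y
    refine ⟨x - hbar ^ n • y, (Pres.mk_eq_zero S _).1 ?_, y, by abel⟩
    rw [map_sub, map_smul, hy, sub_self]
  compl a := by
    choose b hb using fun k => Pres.mk_surjective S (a k)
    obtain ⟨x, hx⟩ := HTF.freeTop.compl b
    refine ⟨Pres.mk S x, fun n => ?_⟩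
    obtain ⟨y, hy⟩ := hx n
    refine ⟨Pres.mk S y, ?_⟩
    conv_lhs => rw [hy]
    simp [hb]

theorem HTF.dy : HTF (DY N) := HTF.pres (dyRel N)

/-- The universal property of the completed free algebra. -/
theorem exists_lift_freeTop {A : Type*} [Ring A] [Algebra Ch A] (hA : HTF A) (g : Gen N → A) :
    ∃ φ : FreeTop N →ₐ[Ch] A, ∀ x, φ (FreeTop.gen x) = g x := by
  let _ : Algebra ℂ A := Algebra.compHom A (PowerSeries.C : ℂ →+* Ch)
  let φ₀ : FreeAlgebra ℂ (Gen N) →ₐ[ℂ] A := FreeAlgebra.lift ℂ g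
  choose L hL using fun x : FreeTop N => hA.compl fun k => φ₀ (FreeTop.cf k x)
  let ψ : Polynomial (FreeAlgebra ℂ (Gen N)) →+* A :=
    Polynomial.eval₂RingHom' φ₀.toRingHom (algebraMap Ch A hbar)
      fun a => (Algebra.commutes hbar (φ₀ a)).symm
  have hmono : ∀ k a, ψ (Polynomial.monomial k a) = hbar ^ k • φ₀ a := by
    intro k a
    change Polynomial.eval₂ _ _ _ = _
    rw [Polynomial.eval₂_monomial, ← map_pow, ← Algebra.commutes, Algebra.smul_def]
    rfl
  have hψ : ∀ x n, ψ (FreeTop.tr n x) =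
      ∑ k ∈ Finset.range n, hbar ^ k • φ₀ (FreeTop.cf k x) := by
    intro x n
    rw [FreeTop.tr, map_sum]
    exact Finset.sum_congr rfl fun k _ => hmono _ _
  have hL' : ∀ x n, ∃ y, L x = ψ (FreeTop.tr n x) + hbar ^ n • y := by
    intro x n
    rw [hψ]
    exact hL x n
  have key : ∀ (p : Polynomial (FreeAlgebra ℂ (Gen N))) n, (∀ k < n, p.coeff k = 0) →
      ∃ y, ψ p = hbar ^ n • y := by
    intro p n hp
    obtain ⟨q, rfl⟩ := Polynomial.X_pow_dvd_iff.2 hp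
    refine ⟨ψ q, ?_⟩
    rw [map_mul, map_pow, Algebra.smul_def, map_pow]
    congr 2
    exact Polynomial.eval₂_X _ _
  have huniq : ∀ (x : FreeTop N) (z : A), (∀ n, ∃ p : Polynomial (FreeAlgebra ℂ (Gen N)), ∃ w,
      (∀ k < n, p.coeff k = FreeTop.cf k x) ∧ z = ψ p + hbar ^ n • w) → L x = z := by
    intro x z hz
    refine hA.eq_of_congr fun n => ?_
    obtain ⟨p, w, hp, rfl⟩ := hz n
    obtain ⟨y, hy⟩ := hL' x n
    obtain ⟨v, hv⟩ := key (FreeTop.tr n x - p) n fun k hk => by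
      rw [Polynomial.coeff_sub, FreeTop.coeff_tr hk, hp k hk, sub_self]
    rw [map_sub] at hv
    refine ⟨v + y - w, ?_⟩
    rw [hy, smul_sub, smul_add, ← hv]
    abel
  refine ⟨AlgHom.mk ⟨⟨⟨L, ?_⟩, ?_⟩, ?_, ?_⟩ ?_, ?_⟩
  · refine huniq 1 1 fun n => ⟨1, 0, fun k _ => ?_, by simp⟩
    rw [Polynomial.coeff_one, FreeTop.cf_one]
  · intro x y
    refine huniq _ _ fun n => ?_
    obtain ⟨p, hp⟩ := hL' x n
    obtain ⟨q, hq⟩ := hL' y n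
    refine ⟨FreeTop.tr n x * FreeTop.tr n y,
      ψ (FreeTop.tr n x) * q + p * L y, fun k hk => ?_, ?_⟩
    · rw [Polynomial.coeff_mul, FreeTop.cf_mul]
      refine Finset.sum_congr rfl fun ij hij => ?_
      have := Finset.HasAntidiagonal.mem_antidiagonal.1 hij
      rw [FreeTop.coeff_tr (by omega), FreeTop.coeff_tr (by omega)]
    · change L x * L y = _
      conv_lhs => rw [hp, add_mul, smul_mul_assoc]
      conv_lhs => enter [1]; rw [hq, mul_add, mul_smul_comm]
      rw [map_mul, smul_add, add_assoc]
  · refine huniq 0 0 fun n => ⟨0, 0, fun k _ => by simp, by simp⟩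
  · intro x y
    refine huniq _ _ fun n => ?_
    obtain ⟨p, hp⟩ := hL' x n
    obtain ⟨q, hq⟩ := hL' y n
    refine ⟨FreeTop.tr n x + FreeTop.tr n y, p + q, fun k hk => ?_, ?_⟩
    · rw [Polynomial.coeff_add, FreeTop.coeff_tr hk, FreeTop.coeff_tr hk, map_add]
    · change L x + L y = _
      rw [hp, hq, map_add, smul_add]
      abel
  · intro c
    refine huniq _ _ fun n => ?_
    refine ⟨∑ k ∈ Finset.range n, Polynomial.monomial k (algebraMap ℂ _ (PowerSeries.coeff k c)),
      algebraMap Ch A (PowerSeries.mk fun k => PowerSeries.coeff (k + n) c), fun k hk => ?_, ?_⟩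
    · rw [Polynomial.finsetSum_coeff, FreeTop.cf_algebraMap,
        Finset.sum_eq_single_of_mem k (by simpa using hk)]
      · simp
      · intro j _ hj
        simp [Polynomial.coeff_monomial, hj]
    · have h1 : c = ∑ k ∈ Finset.range n, hbar ^ k * PowerSeries.C (PowerSeries.coeff k c) +
          hbar ^ n * PowerSeries.mk fun k => PowerSeries.coeff (k + n) c := by
        refine PowerSeries.ext fun k => ?_
        simp only [map_add, map_sum, hbar, PowerSeries.coeff_X_pow_mul', PowerSeries.coeff_mk,
          PowerSeries.coeff_C]
        by_cases hk : k < n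
        · rw [if_neg (by omega), add_zero, Finset.sum_eq_single_of_mem k (by simpa using hk)]
          · simp
          · intro j _ hj
            split_ifs <;> first | rfl | omega
        · rw [if_pos (by omega), Nat.sub_add_cancel (by omega), Finset.sum_eq_zero, zero_add]
          intro j hj
          have := Finset.mem_range.1 hj
          split_ifs <;> first | rfl | omega
      conv_lhs => rw [h1]
      rw [map_add, map_mul, Algebra.smul_def, map_sum, map_sum]
      congr 1
      refine Finset.sum_congr rfl fun k _ => ?_
      rw [hmono, map_mul, Algebra.smul_def]
      congr 1
      exact (φ₀.commutes _).symm
  · intro x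
    refine huniq _ _ fun n => ⟨Polynomial.C (FreeAlgebra.ι ℂ x), 0, fun k _ => ?_, ?_⟩
    · rw [Polynomial.coeff_C, FreeTop.gen_eq, FreeTop.cf_const]
    · rw [smul_zero, add_zero]
      exact ((Polynomial.eval₂_C _ _).trans (FreeAlgebra.lift_ι_apply g x)).symm

/-- The universal property of a topologically free algebra given by relations. -/
theorem Pres.exists_lift {A : Type*} [Ring A] [Algebra Ch A] (hA : HTF A) {S : Set (FreeTop N)}
    (φ : FreeTop N →ₐ[Ch] A) (h : ∀ x ∈ S, φ x = 0) :
    ∃ ψ : Pres S →ₐ[Ch] A, ∀ x, ψ (Pres.mk S x) = φ x := by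
  have hle : hull S ≤ TwoSidedIdeal.ker φ := by
    refine hull_le S _ (fun x hx => (TwoSidedIdeal.mem_ker φ).2 (h x hx))
      ⟨fun x hx => ?_, fun x hx => ?_⟩
    · have hx' := (TwoSidedIdeal.mem_ker φ).1 hx
      rw [map_smul] at hx'
      exact (TwoSidedIdeal.mem_ker φ).2 (hA.tf _ hx')
    · refine (TwoSidedIdeal.mem_ker φ).2 (hA.sep _ fun n => ?_)
      obtain ⟨y, hy, w, rfl⟩ := hx n
      refine ⟨φ w, ?_⟩
      rw [map_add, map_smul, (TwoSidedIdeal.mem_ker φ).1 hy, zero_add]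
  refine ⟨(hull S).ringCon.liftₐ φ fun x y hxy => ?_, fun x => rfl⟩
  have h1 := hle ((TwoSidedIdeal.rel_iff _ x y).1 hxy)
  have h2 := (TwoSidedIdeal.mem_ker φ).1 h1
  rw [map_sub] at h2
  exact sub_eq_zero.1 h2

/-- An `h`-adically closed submodule which contains `1` and is stable under left multiplication by
the generators is everything. -/
theorem Pres.induction_left {S : Set (FreeTop N)} (U : Submodule Ch (Pres S)) (h1 : 1 ∈ U)
    (hg : ∀ g : Gen N, ∀ x ∈ U, Pres.mk S (FreeTop.gen g) * x ∈ U)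
    (hcl : ∀ x, (∀ n : ℕ, ∃ y ∈ U, ∃ w, x = y + hbar ^ n • w) → x ∈ U) (x : Pres S) : x ∈ U := by
  have key : ∀ a : FreeAlgebra ℂ (Gen N), ∀ x ∈ U,
      Pres.mk S (FreeTop.const a) * x ∈ U := by
    intro a
    refine FreeAlgebra.induction ℂ (Gen N)
      (motive := fun a => ∀ x ∈ U,
        Pres.mk S (FreeTop.const a) * x ∈ U)
      (fun c x hx => ?_) hg (fun a b ha hb x hx => ?_) (fun a b ha hb x hx => ?_) a
    · rw [Algebra.algebraMap_eq_smul_one, FreeTop.const_smul, map_smul, map_one, map_one,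
        smul_mul_assoc, one_mul]
      exact U.smul_mem _ hx
    · rw [map_mul, map_mul, mul_assoc]
      exact ha _ (hb _ hx)
    · rw [map_add, map_add, add_mul]
      exact U.add_mem (ha _ hx) (hb _ hx)
  obtain ⟨x, rfl⟩ := Pres.mk_surjective S x
  refine hcl _ fun n => ?_
  obtain ⟨y, hy⟩ := FreeTop.exists_hSum (fun k => FreeTop.const (FreeTop.cf k x)) n
  rw [← FreeTop.eq_hSum] at hy
  refine ⟨_, ?_, Pres.mk S y, (congrArg (Pres.mk S) hy).trans (by rw [map_add, map_smul])⟩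
  rw [map_sum]
  refine U.sum_mem fun k _ => ?_
  rw [map_smul]
  refine U.smul_mem _ ?_
  have := key (FreeTop.cf k x) 1 h1
  rwa [mul_one] at this

end Quotients

/-! ### Power series with coefficients in a noncommutative algebra -/

section Series

variable {σ τ υ A A' : Type*} [Ring A] [Algebra Ch A] [Ring A'] [Algebra Ch A']

theorem map_algebraMap_mul_comm (s : MvPowerSeries σ Ch) (f : MvPowerSeries σ A) :
    MvPowerSeries.map (algebraMap Ch A) s * f = f * MvPowerSeries.map (algebraMap Ch A) s := by
  classical
  refine MvPowerSeries.ext fun n => ?_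
  rw [MvPowerSeries.coeff_mul, MvPowerSeries.coeff_mul]
  refine Finset.sum_nbij' Prod.swap Prod.swap ?_ ?_ (fun _ _ => rfl) (fun _ _ => rfl) ?_
  · intro p hp
    rwa [Finset.HasAntidiagonal.mem_antidiagonal, Prod.fst_swap, Prod.snd_swap, add_comm,
      ← Finset.HasAntidiagonal.mem_antidiagonal]
  · intro p hp
    rwa [Finset.HasAntidiagonal.mem_antidiagonal, Prod.fst_swap, Prod.snd_swap, add_comm,
      ← Finset.HasAntidiagonal.mem_antidiagonal]
  · intro p _
    simp only [Prod.fst_swap, Prod.snd_swap, MvPowerSeries.coeff_map]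
    exact Algebra.commutes _ _

/-- Scalar series act on series with coefficients in a noncommutative algebra. -/
instance scalarSeriesAlgebra : Algebra (MvPowerSeries σ Ch) (MvPowerSeries σ A) :=
  RingHom.toAlgebra' (MvPowerSeries.map (algebraMap Ch A)) map_algebraMap_mul_comm

theorem scalarSeries_eq (s : MvPowerSeries σ Ch) :
    algebraMap (MvPowerSeries σ Ch) (MvPowerSeries σ A) s =
      MvPowerSeries.map (algebraMap Ch A) s := rfl

theorem coeff_scalarSeries (d : σ →₀ ℕ) (s : MvPowerSeries σ Ch) :
    MvPowerSeries.coeff d (algebraMap (MvPowerSeries σ Ch) (MvPowerSeries σ A) s) =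
      algebraMap Ch A (MvPowerSeries.coeff d s) :=
  MvPowerSeries.coeff_map _ _ _

theorem coeff_series_smul [DecidableEq σ] (d : σ →₀ ℕ) (s : MvPowerSeries σ Ch)
    (f : MvPowerSeries σ A) :
    MvPowerSeries.coeff d (s • f) = ∑ p ∈ Finset.HasAntidiagonal.antidiagonal d,
      MvPowerSeries.coeff p.1 s • MvPowerSeries.coeff p.2 f := by
  rw [Algebra.smul_def, MvPowerSeries.coeff_mul]
  exact Finset.sum_congr rfl fun p _ => by rw [coeff_scalarSeries, Algebra.smul_def]

theorem C_smul_series (c : Ch) (f : MvPowerSeries σ A) :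
    (MvPowerSeries.C c : MvPowerSeries σ Ch) • f = c • f := by
  refine MvPowerSeries.ext fun d => ?_
  rw [Algebra.smul_def, scalarSeries_eq, MvPowerSeries.map_C, MvPowerSeries.coeff_C_mul,
    ← Algebra.smul_def]
  rfl

/-- The monomial `∏_t w_t^{e_t}` in the series `w_t`. -/
def wpow [Fintype τ] (w : τ → MvPowerSeries σ Ch) (e : τ →₀ ℕ) : MvPowerSeries σ Ch :=
  ∏ t, w t ^ e t

theorem wpow_add [Fintype τ] (w : τ → MvPowerSeries σ Ch) (e e' : τ →₀ ℕ) :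
    wpow w (e + e') = wpow w e * wpow w e' := by
  simp [wpow, pow_add, Finset.prod_mul_distrib]

theorem wpow_zero [Fintype τ] (w : τ → MvPowerSeries σ Ch) : wpow w 0 = 1 := by
  simp [wpow]

theorem wpow_single [Fintype τ] (w : τ → MvPowerSeries σ Ch) (t : τ) (n : ℕ) :
    wpow w (Finsupp.single t n) = w t ^ n := by
  classical
  rw [wpow, Finset.prod_eq_single t]
  · simp
  · intro b _ hb
    simp [hb.symm]
  · simp

theorem coeff_wpow_eq_zero [Fintype τ] {w : τ → MvPowerSeries σ Ch}
    (hw : ∀ t, MvPowerSeries.constantCoeff (w t) = 0) {e : τ →₀ ℕ} {d : σ →₀ ℕ}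
    (h : d.degree < e.degree) : MvPowerSeries.coeff d (wpow w e) = 0 := by
  refine MvPowerSeries.coeff_of_lt_order (lt_of_lt_of_le (Nat.cast_lt.2 h) ?_)
  rw [Finsupp.degree_eq_sum, wpow]
  refine le_trans ?_ (MvPowerSeries.le_order_prod _ _)
  push_cast
  exact Finset.sum_le_sum fun t _ => MvPowerSeries.le_order_pow_of_constantCoeff_eq_zero _ (hw t)

/-- The exponents of total degree at most `n`. -/
def expo (τ : Type*) [Fintype τ] (n : ℕ) : Finset (τ →₀ ℕ) :=
  (Finsupp.finite_of_degree_le n).toFinset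

theorem mem_expo [Fintype τ] {n : ℕ} {e : τ →₀ ℕ} : e ∈ expo τ n ↔ e.degree ≤ n := by
  simp [expo]

/-- The substitution of scalar series `w_t` without constant term into a series. -/
def substFun [Fintype τ] (w : τ → MvPowerSeries σ Ch) (f : MvPowerSeries τ A) :
    MvPowerSeries σ A :=
  fun d => ∑ e ∈ expo τ d.degree, MvPowerSeries.coeff d (wpow w e) • MvPowerSeries.coeff e f

theorem coeff_substFun [Fintype τ] {w : τ → MvPowerSeries σ Ch}
    (hw : ∀ t, MvPowerSeries.constantCoeff (w t) = 0) (f : MvPowerSeries τ A) (d : σ →₀ ℕ)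
    (n : ℕ) (hn : d.degree ≤ n) :
    MvPowerSeries.coeff d (substFun w f) =
      ∑ e ∈ expo τ n, MvPowerSeries.coeff d (wpow w e) • MvPowerSeries.coeff e f := by
  change ∑ e ∈ expo τ d.degree, _ = _
  refine Finset.sum_subset (fun e he => mem_expo.2 ((mem_expo.1 he).trans hn)) fun e _ he => ?_
  rw [mem_expo, not_le] at he
  rw [coeff_wpow_eq_zero hw he, zero_smul]

theorem coeff_substFun_eq_single [Fintype τ] {w : τ → MvPowerSeries σ Ch}
    (hw : ∀ t, MvPowerSeries.constantCoeff (w t) = 0) (f : MvPowerSeries τ A) (d : σ →₀ ℕ)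
    (e : τ →₀ ℕ) (he : ∀ e', e' ≠ e →
      MvPowerSeries.coeff d (wpow w e') • MvPowerSeries.coeff e' f = 0) :
    MvPowerSeries.coeff d (substFun w f) =
      MvPowerSeries.coeff d (wpow w e) • MvPowerSeries.coeff e f := by
  rw [coeff_substFun hw f d _ (le_max_left _ e.degree),
    Finset.sum_eq_single_of_mem e (mem_expo.2 (le_max_right _ _))]
  exact fun e' _ h => he e' h

theorem substFun_monomial [Fintype τ] {w : τ → MvPowerSeries σ Ch}
    (hw : ∀ t, MvPowerSeries.constantCoeff (w t) = 0) (e : τ →₀ ℕ) :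
    substFun w (MvPowerSeries.monomial e (1 : A)) = MvPowerSeries.map (algebraMap Ch A) (wpow w e) := by
  classical
  refine MvPowerSeries.ext fun d => ?_
  rw [coeff_substFun_eq_single hw _ d e, MvPowerSeries.coeff_monomial_same,
    MvPowerSeries.coeff_map, Algebra.algebraMap_eq_smul_one]
  intro e' h
  rw [MvPowerSeries.coeff_monomial_ne h, smul_zero]

/-- Substitution as a ring homomorphism. -/
def substHom [Fintype τ] (w : τ → MvPowerSeries σ Ch)
    (hw : ∀ t, MvPowerSeries.constantCoeff (w t) = 0) :
    MvPowerSeries τ A →+* MvPowerSeries σ A where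
  toFun := substFun w
  map_one' := by
    have := substFun_monomial (A := A) hw 0
    rw [wpow_zero, (MvPowerSeries.map (algebraMap Ch A)).map_one] at this
    exact this
  map_zero' := MvPowerSeries.ext fun d => by
    rw [coeff_substFun hw _ d _ le_rfl]
    simp
  map_add' f g := MvPowerSeries.ext fun d => by
    simp only [map_add, coeff_substFun hw _ d _ le_rfl, smul_add, Finset.sum_add_distrib]
  map_mul' f g := MvPowerSeries.ext fun d => by
    classical
    have h1 : MvPowerSeries.coeff d (substFun w (f * g)) =
        ∑ e ∈ expo τ d.degree, ∑ p ∈ Finset.HasAntidiagonal.antidiagonal e,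
          MvPowerSeries.coeff d (wpow w (p.1 + p.2)) •
            (MvPowerSeries.coeff p.1 f * MvPowerSeries.coeff p.2 g) := by
      rw [coeff_substFun hw _ d _ le_rfl]
      refine Finset.sum_congr rfl fun e _ => ?_
      rw [MvPowerSeries.coeff_mul, Finset.smul_sum]
      refine Finset.sum_congr rfl fun p hp => ?_
      rw [Finset.HasAntidiagonal.mem_antidiagonal.1 hp]
    have h2 : MvPowerSeries.coeff d (substFun w f * substFun w g) =
        ∑ p ∈ expo τ d.degree ×ˢ expo τ d.degree,
          MvPowerSeries.coeff d (wpow w (p.1 + p.2)) •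
            (MvPowerSeries.coeff p.1 f * MvPowerSeries.coeff p.2 g) := by
      rw [MvPowerSeries.coeff_mul, Finset.sum_product]
      have : ∀ p ∈ Finset.HasAntidiagonal.antidiagonal d,
          MvPowerSeries.coeff p.1 (substFun w f) * MvPowerSeries.coeff p.2 (substFun w g) =
          ∑ e ∈ expo τ d.degree, ∑ e' ∈ expo τ d.degree,
            (MvPowerSeries.coeff p.1 (wpow w e) * MvPowerSeries.coeff p.2 (wpow w e')) •
            (MvPowerSeries.coeff e f * MvPowerSeries.coeff e' g) := by
        intro p hp
        have hp' := Finset.HasAntidiagonal.mem_antidiagonal.1 hp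
        have hd : p.1.degree + p.2.degree = d.degree := by rw [← map_add, hp']
        rw [coeff_substFun hw f p.1 d.degree (by omega), coeff_substFun hw g p.2 d.degree (by omega),
          Finset.sum_mul_sum]
        refine Finset.sum_congr rfl fun e _ => Finset.sum_congr rfl fun e' _ => ?_
        rw [smul_mul_smul_comm]
      rw [Finset.sum_congr rfl this, Finset.sum_comm]
      refine Finset.sum_congr rfl fun e _ => ?_
      rw [Finset.sum_comm]
      refine Finset.sum_congr rfl fun e' _ => ?_
      rw [wpow_add, MvPowerSeries.coeff_mul, Finset.sum_smul]
    rw [h1, h2, Finset.sum_sigma']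
    refine Finset.sum_bij_ne_zero (fun x _ _ => x.2) ?_ ?_ ?_ ?_
    · rintro ⟨e, p⟩ hx _
      simp only [Finset.mem_sigma, mem_expo, Finset.HasAntidiagonal.mem_antidiagonal] at hx
      obtain ⟨h3, rfl⟩ := hx
      rw [map_add] at h3
      rw [Finset.mem_product, mem_expo, mem_expo]
      exact ⟨by change p.1.degree ≤ _; omega, by change p.2.degree ≤ _; omega⟩
    · rintro ⟨e, p⟩ hx _ ⟨e', p'⟩ hx' _ h
      simp only [Finset.mem_sigma, Finset.HasAntidiagonal.mem_antidiagonal] at hx hx' h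
      obtain ⟨_, rfl⟩ := hx
      obtain ⟨_, rfl⟩ := hx'
      subst h
      rfl
    · intro p _ hne
      refine ⟨⟨p.1 + p.2, p⟩, ?_, hne, rfl⟩
      simp only [Finset.mem_sigma, mem_expo, Finset.HasAntidiagonal.mem_antidiagonal, and_true]
      by_contra hlt
      exact hne (by rw [coeff_wpow_eq_zero hw (not_le.1 hlt), zero_smul])
    · intros
      rfl

theorem substHom_apply [Fintype τ] {w : τ → MvPowerSeries σ Ch}
    (hw : ∀ t, MvPowerSeries.constantCoeff (w t) = 0) (f : MvPowerSeries τ A) :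
    substHom w hw f = substFun w f := rfl

theorem substHom_X [Fintype τ] {w : τ → MvPowerSeries σ Ch}
    (hw : ∀ t, MvPowerSeries.constantCoeff (w t) = 0) (t : τ) :
    substHom w hw (MvPowerSeries.X t : MvPowerSeries τ A) =
      MvPowerSeries.map (algebraMap Ch A) (w t) := by
  have := substFun_monomial (A := A) hw (Finsupp.single t 1)
  rwa [wpow_single, pow_one] at this

theorem substHom_X' [Fintype τ] {w : τ → MvPowerSeries σ Ch}
    (hw : ∀ t, MvPowerSeries.constantCoeff (w t) = 0) (t : τ) :
    substHom w hw (MvPowerSeries.X t : MvPowerSeries τ Ch) = w t := by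
  rw [substHom_X]
  exact MvPowerSeries.ext fun d => MvPowerSeries.coeff_map _ _ _

theorem substHom_C [Fintype τ] {w : τ → MvPowerSeries σ Ch}
    (hw : ∀ t, MvPowerSeries.constantCoeff (w t) = 0) (a : A) :
    substHom w hw (MvPowerSeries.C a) = MvPowerSeries.C a := by
  classical
  refine MvPowerSeries.ext fun d => ?_
  rw [substHom_apply, coeff_substFun_eq_single hw _ d 0, wpow_zero, MvPowerSeries.coeff_one,
    MvPowerSeries.coeff_C, MvPowerSeries.coeff_C, if_pos rfl]
  · split_ifs <;> simp
  · intro e h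
    rw [MvPowerSeries.coeff_C, if_neg h, smul_zero]

theorem map_substHom [Fintype τ] {w : τ → MvPowerSeries σ Ch}
    (hw : ∀ t, MvPowerSeries.constantCoeff (w t) = 0) (φ : A →ₐ[Ch] A') (f : MvPowerSeries τ A) :
    MvPowerSeries.map φ.toRingHom (substHom w hw f) =
      substHom w hw (MvPowerSeries.map φ.toRingHom f) := by
  refine MvPowerSeries.ext fun d => ?_
  rw [MvPowerSeries.coeff_map, substHom_apply, substHom_apply, coeff_substFun hw _ d _ le_rfl,
    coeff_substFun hw _ d _ le_rfl]
  change φ _ = _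
  rw [map_sum]
  refine Finset.sum_congr rfl fun e _ => ?_
  rw [map_smul, MvPowerSeries.coeff_map]
  rfl

theorem substHom_scalar [Fintype τ] {w : τ → MvPowerSeries σ Ch}
    (hw : ∀ t, MvPowerSeries.constantCoeff (w t) = 0) (s : MvPowerSeries τ Ch) :
    substHom w hw (MvPowerSeries.map (algebraMap Ch A) s) =
      MvPowerSeries.map (algebraMap Ch A) (substHom w hw s) :=
  (map_substHom hw (Algebra.ofId Ch A) s).symm

theorem substHom_smul [Fintype τ] {w : τ → MvPowerSeries σ Ch}
    (hw : ∀ t, MvPowerSeries.constantCoeff (w t) = 0) (s : MvPowerSeries τ Ch)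
    (f : MvPowerSeries τ A) :
    substHom w hw (s • f) = substHom w hw s • substHom w hw f := by
  rw [Algebra.smul_def, map_mul, Algebra.smul_def, scalarSeries_eq, substHom_scalar]
  rfl

theorem constantCoeff_substHom [Fintype τ] {w : τ → MvPowerSeries σ Ch}
    (hw : ∀ t, MvPowerSeries.constantCoeff (w t) = 0) (f : MvPowerSeries τ A) :
    MvPowerSeries.constantCoeff (substHom w hw f) = MvPowerSeries.constantCoeff f := by
  classical
  rw [← MvPowerSeries.coeff_zero_eq_constantCoeff_apply, substHom_apply,
    coeff_substFun_eq_single hw _ _ 0, wpow_zero, MvPowerSeries.coeff_one, if_pos rfl, one_smul,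
    MvPowerSeries.coeff_zero_eq_constantCoeff_apply]
  intro e he
  rw [coeff_wpow_eq_zero hw, zero_smul]
  rw [map_zero]
  exact Nat.pos_of_ne_zero fun h => he ((Finsupp.degree_eq_zero_iff e).1 h)

theorem substHom_comp [Fintype τ] [Fintype σ] {w : τ → MvPowerSeries σ Ch}
    (hw : ∀ t, MvPowerSeries.constantCoeff (w t) = 0) {v : σ → MvPowerSeries υ Ch}
    (hv : ∀ t, MvPowerSeries.constantCoeff (v t) = 0) (f : MvPowerSeries τ A) :
    substHom v hv (substHom w hw f) = substHom (fun t => substHom v hv (w t))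
      (fun t => by rw [constantCoeff_substHom, hw]) f := by
  have hvw : ∀ t, MvPowerSeries.constantCoeff (substHom v hv (w t)) = 0 := fun t => by
    rw [constantCoeff_substHom, hw]
  refine MvPowerSeries.ext fun d => ?_
  rw [substHom_apply, substHom_apply, substHom_apply, coeff_substFun hv _ d _ le_rfl,
    coeff_substFun hvw _ d _ le_rfl]
  have h1 : ∀ e, wpow (fun t => substHom v hv (w t)) e = substHom v hv (wpow w e) := by
    intro e
    simp [wpow]
  have h2 : ∀ e ∈ expo σ d.degree, MvPowerSeries.coeff d (wpow v e) •
      MvPowerSeries.coeff e (substFun w f) = ∑ e' ∈ expo τ d.degree,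
        (MvPowerSeries.coeff d (wpow v e) * MvPowerSeries.coeff e (wpow w e')) •
          MvPowerSeries.coeff e' f := by
    intro e he
    rw [coeff_substFun hw _ e _ (mem_expo.1 he), Finset.smul_sum]
    simp only [smul_smul]
  rw [Finset.sum_congr rfl h2, Finset.sum_comm]
  refine Finset.sum_congr rfl fun e' _ => ?_
  rw [h1, substHom_apply, coeff_substFun hv _ d _ le_rfl, ← Finset.sum_smul]
  rfl

/-! ### Substitution into a series in one variable -/

theorem subs_eq_substFun {w : MvPowerSeries σ Ch} (a : ℕ → A) :
    subs a w = substFun (fun _ : Unit => w) (fun e : Unit →₀ ℕ => a (e ())) := by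
  refine funext fun d => ?_
  change ∑ r ∈ _, _ = ∑ e ∈ _, _
  symm
  refine Finset.sum_bij (fun (e : Unit →₀ ℕ) _ => e ()) ?_ ?_ ?_ ?_
  · intro e he
    rw [mem_expo, Finsupp.degree_eq_sum] at he
    simpa [Nat.lt_succ_iff] using he
  · intro e _ e' _ h
    exact Finsupp.ext fun _ => h
  · intro r hr
    refine ⟨Finsupp.single () r, ?_, by simp⟩
    rw [mem_expo, Finsupp.degree_single]
    have := Finset.mem_range.1 hr
    omega
  · intro e _
    congr 3
    simp [wpow]

/-- The substitution of a series without constant term into a series in one variable. -/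
def subsHom (w : MvPowerSeries σ Ch) (hw : MvPowerSeries.constantCoeff w = 0) :
    PowerSeries A →+* MvPowerSeries σ A :=
  substHom (fun _ : Unit => w) fun _ => hw

theorem subs_eq_subsHom {w : MvPowerSeries σ Ch} (hw : MvPowerSeries.constantCoeff w = 0)
    (a : ℕ → A) : subs a w = subsHom w hw (PowerSeries.mk a) := by
  rw [subs_eq_substFun]
  rfl

theorem substHom_subs [Fintype σ] {w : MvPowerSeries σ Ch}
    (hw : MvPowerSeries.constantCoeff w = 0) {v : σ → MvPowerSeries τ Ch}
    (hv : ∀ t, MvPowerSeries.constantCoeff (v t) = 0) (a : ℕ → A) :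
    substHom v hv (subs a w) = subs a (substHom v hv w) := by
  rw [subs_eq_subsHom hw, subs_eq_subsHom (by rw [constantCoeff_substHom, hw])]
  exact substHom_comp (fun _ => hw) hv _

theorem coeff_subs {w : MvPowerSeries σ Ch} (hw : MvPowerSeries.constantCoeff w = 0)
    (a : ℕ → A) (d : σ →₀ ℕ) (n : ℕ) (hn : d.degree ≤ n) :
    MvPowerSeries.coeff d (subs a w) =
      ∑ r ∈ Finset.range (n + 1), MvPowerSeries.coeff d (w ^ r) • a r := by
  change ∑ r ∈ Finset.range (d.degree + 1), _ = _
  refine Finset.sum_subset (Finset.range_subset_range.2 (by omega)) fun r _ hr => ?_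
  have : d.degree < r := by
    rw [Finset.mem_range] at hr
    omega
  rw [MvPowerSeries.coeff_of_lt_order, zero_smul]
  exact lt_of_lt_of_le (Nat.cast_lt.2 this)
    (MvPowerSeries.le_order_pow_of_constantCoeff_eq_zero _ hw)

theorem map_subs (φ : A →ₐ[Ch] A') (a : ℕ → A) (w : MvPowerSeries σ Ch) :
    MvPowerSeries.map φ.toRingHom (subs a w) = subs (fun r => φ (a r)) w := by
  refine MvPowerSeries.ext fun d => ?_
  rw [MvPowerSeries.coeff_map]
  change φ (∑ r ∈ Finset.range (d.degree + 1), MvPowerSeries.coeff d (w ^ r) • a r) =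
    ∑ r ∈ Finset.range (d.degree + 1), MvPowerSeries.coeff d (w ^ r) • φ (a r)
  rw [map_sum]
  simp only [map_smul]

theorem coeff_subs_X [DecidableEq σ] (i : σ) (a : ℕ → A) (d : σ →₀ ℕ) :
    MvPowerSeries.coeff d (subs a (MvPowerSeries.X i : MvPowerSeries σ Ch)) =
      if d = Finsupp.single i (d i) then a (d i) else 0 := by
  have hw : MvPowerSeries.constantCoeff (MvPowerSeries.X i : MvPowerSeries σ Ch) = 0 := by simp
  rw [coeff_subs hw a d _ le_rfl]
  simp only [MvPowerSeries.coeff_X_pow]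
  by_cases h : d = Finsupp.single i (d i)
  · rw [if_pos h, Finset.sum_eq_single_of_mem (d i)
      (Finset.mem_range.2 (Nat.lt_succ_of_le (Finsupp.le_degree i d))), if_pos h, one_smul]
    intro r _ hr
    rw [if_neg, zero_smul]
    intro h'
    rw [h'] at hr
    simp at hr
  · rw [if_neg h]
    refine Finset.sum_eq_zero fun r _ => ?_
    rw [if_neg, zero_smul]
    rintro rfl
    simp at h

/-! ### Separating one variable -/

/-- The underlying map of `optHom`. -/
def optFun {B : Type*} [Ring B] (f : MvPowerSeries (Option τ) B) : MvPowerSeries τ (PowerSeries B) :=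
  fun d => PowerSeries.mk fun k => MvPowerSeries.coeff (d.optionElim k) f

theorem coeff_optFun {B : Type*} [Ring B] (f : MvPowerSeries (Option τ) B) (d : τ →₀ ℕ) (k : ℕ) :
    PowerSeries.coeff k (MvPowerSeries.coeff d (optFun f)) =
      MvPowerSeries.coeff (d.optionElim k) f :=
  PowerSeries.coeff_mk k fun k => MvPowerSeries.coeff (d.optionElim k) f

/-- A series in `z⁻¹` and the `u_i`, as a series in the `u_i` whose coefficients are series in
`z⁻¹`. -/
def optHom {B : Type*} [Ring B] :
    MvPowerSeries (Option τ) B →+* MvPowerSeries τ (PowerSeries B) where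
  toFun := optFun
  map_one' := by
    classical
    refine MvPowerSeries.ext fun d => PowerSeries.ext fun k => ?_
    have h : d.optionElim k = 0 ↔ d = 0 ∧ k = 0 := by
      constructor
      · intro h
        refine ⟨Finsupp.ext fun i => ?_, ?_⟩
        · simpa using DFunLike.congr_fun h (some i)
        · simpa using DFunLike.congr_fun h none
      · rintro ⟨rfl, rfl⟩
        refine Finsupp.ext fun i => ?_
        cases i <;> simp
    rw [coeff_optFun, MvPowerSeries.coeff_one, MvPowerSeries.coeff_one, if_congr h rfl rfl]
    by_cases hd : d = 0 <;> by_cases hk : k = 0 <;> simp [hd, hk, PowerSeries.coeff_one]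
  map_zero' := MvPowerSeries.ext fun d => PowerSeries.ext fun k => by
    rw [coeff_optFun]
    simp
  map_add' f g := MvPowerSeries.ext fun d => PowerSeries.ext fun k => by
    simp only [map_add, coeff_optFun]
  map_mul' f g := by
    classical
    refine MvPowerSeries.ext fun d => PowerSeries.ext fun k => ?_
    rw [MvPowerSeries.coeff_mul, map_sum, coeff_optFun, MvPowerSeries.coeff_mul]
    simp only [PowerSeries.coeff_mul, coeff_optFun]
    rw [← Finset.sum_product']
    refine Finset.sum_nbij' (fun p => ((p.1.some, p.2.some), (p.1 none, p.2 none)))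
      (fun q => (q.1.1.optionElim q.2.1, q.1.2.optionElim q.2.2)) ?_ ?_ ?_ ?_ ?_
    · intro p hp
      rw [Finset.HasAntidiagonal.mem_antidiagonal] at hp
      rw [Finset.mem_product, Finset.HasAntidiagonal.mem_antidiagonal,
        Finset.HasAntidiagonal.mem_antidiagonal]
      constructor
      · rw [← Finsupp.some_add, hp, Finsupp.some_optionElim]
      · change p.1 none + p.2 none = k
        rw [← Finsupp.add_apply, hp, Finsupp.optionElim_apply_none]
    · intro q hq
      rw [Finset.mem_product, Finset.HasAntidiagonal.mem_antidiagonal,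
        Finset.HasAntidiagonal.mem_antidiagonal] at hq
      rw [Finset.HasAntidiagonal.mem_antidiagonal]
      refine Finsupp.ext fun i => ?_
      rw [← hq.1, ← hq.2]
      cases i <;> simp
    · intro p _
      simp [Finsupp.optionElim_some]
    · intro q _
      simp [Finsupp.some_optionElim]
    · intro p _
      simp [Finsupp.optionElim_some]

theorem coeff_optHom {B : Type*} [Ring B] (f : MvPowerSeries (Option τ) B) (d : τ →₀ ℕ) (k : ℕ) :
    PowerSeries.coeff k (MvPowerSeries.coeff d (optHom f)) =
      MvPowerSeries.coeff (d.optionElim k) f :=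
  coeff_optFun f d k

/-! ### Scalars which are not zero divisors -/

/-- The scalar series `s` acts without torsion on series with coefficients in `A`. -/
def NonTorsion (A : Type*) [Ring A] [Algebra Ch A] (s : MvPowerSeries σ Ch) : Prop :=
  ∀ f : MvPowerSeries σ A, s • f = 0 → f = 0

theorem NonTorsion.mul {s t : MvPowerSeries σ Ch} (hs : NonTorsion A s) (ht : NonTorsion A t) :
    NonTorsion A (s * t) := fun f hf => ht f (hs _ (by rw [← mul_smul, hf]))

theorem NonTorsion.cancel {s : MvPowerSeries σ Ch} (hs : NonTorsion A s) {f g : MvPowerSeries σ A}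
    (h : s • f = s • g) : f = g :=
  sub_eq_zero.1 (hs _ (by rw [smul_sub, h, sub_self]))

theorem NonTorsion.matrix {s : MvPowerSeries σ Ch} (hs : NonTorsion A s) {m n : Type*}
    {f g : Matrix m n (MvPowerSeries σ A)} (h : s • f = s • g) : f = g :=
  Matrix.ext fun i j => hs.cancel (congrFun (congrFun h i) j)

theorem NonTorsion.of_unit {s t : MvPowerSeries σ Ch} (h : t * s = 1) : NonTorsion A s :=
  fun f hf => by rw [← one_smul (MvPowerSeries σ Ch) f, ← h, mul_smul, hf, smul_zero]

theorem NonTorsion.hC (hA : HTF A) : NonTorsion A (hC Ch : MvPowerSeries σ Ch) := fun f hf => by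
  have h : (ReflAlg.hC Ch : MvPowerSeries σ Ch) = MvPowerSeries.C hbar := rfl
  rw [h, C_smul_series] at hf
  exact hA.mvPowerSeries.tf f hf

theorem NonTorsion.X (i : σ) : NonTorsion A (MvPowerSeries.X i : MvPowerSeries σ Ch) :=
  fun f hf => by
    classical
    rw [Algebra.smul_def, scalarSeries_eq, MvPowerSeries.map_X] at hf
    refine MvPowerSeries.ext fun d => ?_
    have := congrArg (MvPowerSeries.coeff (Finsupp.single i 1 + d)) hf
    rwa [MvPowerSeries.X, MvPowerSeries.coeff_add_monomial_mul, one_mul, map_zero] at this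

/-- A series of the form `x_i v + c x_j`, with an invertible constant `c` and `i ≠ j`, acts without
torsion. -/
theorem NonTorsion.X_add {i j : σ} (hij : i ≠ j) (v : MvPowerSeries σ Ch) {c c' : Ch}
    (hc : c' * c = 1) :
    NonTorsion A (MvPowerSeries.X i * v + MvPowerSeries.C c * MvPowerSeries.X j) := by
  classical
  intro f hf
  have key : ∀ n : ℕ, ∀ d : σ →₀ ℕ, d i = n → MvPowerSeries.coeff d f = 0 := by
    intro n
    induction n using Nat.strong_induction_on with
    | _ n ih =>
      intro d hd
      have h1 := congrArg (MvPowerSeries.coeff (Finsupp.single j 1 + d)) hf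
      have h2 : MvPowerSeries.coeff (Finsupp.single j 1 + d)
          ((MvPowerSeries.X i * v) • f) = 0 := by
        rw [mul_smul, Algebra.smul_def, scalarSeries_eq, MvPowerSeries.map_X]
        by_cases h : Finsupp.single i 1 ≤ Finsupp.single j 1 + d
        · obtain ⟨e, he⟩ := exists_add_of_le h
          rw [he, MvPowerSeries.X, MvPowerSeries.coeff_add_monomial_mul, one_mul,
            coeff_series_smul]
          refine Finset.sum_eq_zero fun p hp => ?_
          rw [ih (p.2 i) ?_ p.2 rfl, smul_zero]
          have h3 := DFunLike.congr_fun (Finset.HasAntidiagonal.mem_antidiagonal.1 hp) i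
          have h4 := DFunLike.congr_fun he i
          simp [hij.symm] at h3 h4
          omega
        · rw [MvPowerSeries.X, MvPowerSeries.coeff_monomial_mul, if_neg h]
      rw [add_smul, map_add, h2, zero_add, mul_smul, C_smul_series,
        Algebra.smul_def (MvPowerSeries.X j : MvPowerSeries σ Ch),
        scalarSeries_eq, MvPowerSeries.map_X, map_zero] at h1
      have h3 : MvPowerSeries.coeff (Finsupp.single j 1 + d)
          (c • ((MvPowerSeries.X j : MvPowerSeries σ A) * f)) = c • MvPowerSeries.coeff d f := by
        change c • MvPowerSeries.coeff (Finsupp.single j 1 + d)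
          ((MvPowerSeries.X j : MvPowerSeries σ A) * f) = _
        rw [MvPowerSeries.X, MvPowerSeries.coeff_add_monomial_mul, one_mul]
      rw [h3] at h1
      rw [← one_smul Ch (MvPowerSeries.coeff d f), ← hc, mul_smul, h1, smul_zero]
  exact MvPowerSeries.ext fun d => key _ d rfl

end Series

/-! ### Tensor factors and permutation operators -/

section Tensor

variable {N m : ℕ} {S R : Type*} [CommRing S] [Ring R] [Algebra S R]

theorem site_apply (i : Fin m) (M : Matrix (Fin N) (Fin N) R) (a b : Fin m → Fin N) :
    site i M a b = if ∀ k, k ≠ i → a k = b k then M (a i) (b i) else 0 := rfl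

theorem site_one (i : Fin m) : site i (1 : Matrix (Fin N) (Fin N) R) = 1 := by
  ext a b
  rw [site_apply, Matrix.one_apply, Matrix.one_apply]
  by_cases h : a = b
  · subst h; simp
  · rw [if_neg h]
    split_ifs with h1 h2
    · exact absurd (funext fun k => by by_cases hk : k = i; · rw [hk, h2]
                                       · exact h1 k hk) h
    · rfl
    · rfl

theorem site_sub (i : Fin m) (M M' : Matrix (Fin N) (Fin N) R) :
    site i (M - M') = site i M - site i M' := by
  ext a b
  simp only [site_apply, Matrix.sub_apply]
  split_ifs <;> simp

theorem site_smul (i : Fin m) (s : S) (M : Matrix (Fin N) (Fin N) R) :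
    site i (s • M) = s • site i M := by
  ext a b
  simp only [site_apply, Matrix.smul_apply]
  split_ifs <;> simp

theorem site_map {R' : Type*} [Ring R'] (i : Fin m) (φ : R →+* R') (M : Matrix (Fin N) (Fin N) R) :
    (site i M).map φ = site i (M.map φ) := by
  ext a b
  simp only [site_apply, Matrix.map_apply]
  split_ifs <;> simp

theorem site_mul_apply (i : Fin m) (M : Matrix (Fin N) (Fin N) R) (X : Ten N m R)
    (a b : Fin m → Fin N) :
    (site i M * X) a b = ∑ c, M (a i) c * X (Function.update a i c) b := by
  rw [Matrix.mul_apply]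
  symm
  refine Finset.sum_of_injOn (fun c => Function.update a i c) ?_ (by simp) ?_ ?_
  · intro c _ c' _ h
    simpa using congrFun h i
  · intro c _ hc
    rw [site_apply, if_neg, zero_mul]
    intro h
    refine hc ⟨c i, by simp, ?_⟩
    ext k
    by_cases hk : k = i
    · subst hk; simp
    · simp [hk, h k hk]
  · intro c _
    rw [site_apply, if_pos]
    · simp
    · intro k hk
      simp [hk]

theorem mul_site_apply (i : Fin m) (M : Matrix (Fin N) (Fin N) R) (X : Ten N m R)
    (a b : Fin m → Fin N) :
    (X * site i M) a b = ∑ c, X a (Function.update b i c) * M c (b i) := by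
  rw [Matrix.mul_apply]
  symm
  refine Finset.sum_of_injOn (fun c => Function.update b i c) ?_ (by simp) ?_ ?_
  · intro c _ c' _ h
    simpa using congrFun h i
  · intro c _ hc
    rw [site_apply, if_neg, mul_zero]
    intro h
    refine hc ⟨c i, by simp, ?_⟩
    ext k
    by_cases hk : k = i
    · subst hk; simp
    · simp [hk, h k hk]
  · intro c _
    rw [site_apply, if_pos]
    · simp
    · intro k hk
      simp [hk]

theorem site_mul (i : Fin m) (M M' : Matrix (Fin N) (Fin N) R) :
    site i (M * M') = site i M * site i M' := by
  ext a b
  rw [site_mul_apply, site_apply]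
  have h : ∀ c, site i M' (Function.update a i c) b =
      if ∀ k, k ≠ i → a k = b k then M' c (b i) else 0 := by
    intro c
    rw [site_apply]
    have : (∀ k, k ≠ i → Function.update a i c k = b k) ↔ ∀ k, k ≠ i → a k = b k :=
      forall_congr' fun k => forall_congr' fun hk => by simp [hk]
    simp [this]
  simp only [h]
  split_ifs
  · rw [Matrix.mul_apply]
  · simp

theorem site_mul_site_apply {i j : Fin m} (hij : i ≠ j) (M M' : Matrix (Fin N) (Fin N) R)
    (a b : Fin m → Fin N) :
    (site i M * site j M') a b =
      if ∀ k, k ≠ i → k ≠ j → a k = b k then M (a i) (b i) * M' (a j) (b j) else 0 := by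
  rw [site_mul_apply, Finset.sum_eq_single (b i)]
  · rw [site_apply]
    have : (∀ k, k ≠ j → Function.update a i (b i) k = b k) ↔
        ∀ k, k ≠ i → k ≠ j → a k = b k := by
      refine forall_congr' fun k => ?_
      by_cases hk : k = i
      · subst hk; simp
      · simp [hk]
    simp [this, hij.symm]
  · intro c _ hc
    rw [site_apply, if_neg, mul_zero]
    intro h
    exact hc (by simpa using h i hij)
  · simp

/-- Matrices with commuting entries commute when placed in different tensor factors. -/
theorem site_comm {i j : Fin m} (hij : i ≠ j) {M M' : Matrix (Fin N) (Fin N) R}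
    (h : ∀ a b c d, M a b * M' c d = M' c d * M a b) :
    site i M * site j M' = site j M' * site i M := by
  ext a b
  rw [site_mul_site_apply hij, site_mul_site_apply hij.symm, h]
  refine if_congr (forall_congr' fun k => ?_) rfl rfl
  tauto

/-- The action of a permutation on the tensor factors. -/
def permOp (p : Equiv.Perm (Fin m)) : Ten N m R :=
  Matrix.of fun a b => if a = b ∘ p then 1 else 0

theorem perm_eq (i j : Fin m) : (perm i j : Ten N m R) = permOp (Equiv.swap i j) := rfl

theorem permOp_mul_apply (p : Equiv.Perm (Fin m)) (X : Ten N m R) (a b : Fin m → Fin N) :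
    ((permOp p : Ten N m R) * X) a b = X (a ∘ p.symm) b := by
  rw [Matrix.mul_apply, Finset.sum_eq_single (a ∘ p.symm)]
  · rw [permOp, Matrix.of_apply, if_pos, one_mul]
    ext k; simp
  · intro c _ hc
    rw [permOp, Matrix.of_apply, if_neg, zero_mul]
    rintro rfl
    exact hc (by ext k; simp)
  · simp

theorem mul_permOp_apply (p : Equiv.Perm (Fin m)) (X : Ten N m R) (a b : Fin m → Fin N) :
    (X * (permOp p : Ten N m R)) a b = X a (b ∘ p) := by
  rw [Matrix.mul_apply, Finset.sum_eq_single (b ∘ p)]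
  · rw [permOp, Matrix.of_apply, if_pos rfl, mul_one]
  · intro c _ hc
    rw [permOp, Matrix.of_apply, if_neg hc, mul_zero]
  · simp

theorem permOp_mul (p q : Equiv.Perm (Fin m)) :
    (permOp p * permOp q : Ten N m R) = permOp (q * p) := by
  ext a b
  rw [mul_permOp_apply]
  rfl

theorem permOp_one : (permOp 1 : Ten N m R) = 1 := by
  ext a b
  rw [Matrix.one_apply]
  rfl

theorem permOp_site (p : Equiv.Perm (Fin m)) (j : Fin m) (M : Matrix (Fin N) (Fin N) R) :
    permOp p * site (p j) M = site j M * (permOp p : Ten N m R) := by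
  ext a b
  rw [permOp_mul_apply, mul_permOp_apply, site_apply, site_apply]
  simp only [Function.comp, Equiv.symm_apply_apply]
  refine if_congr ?_ rfl rfl
  constructor
  · intro h k hk
    simpa using h (p k) (by simpa using hk)
  · intro h k hk
    simpa using h (p.symm k) (fun h' => hk (by rw [← h']; simp))

theorem perm_comm (i j : Fin m) : (perm i j : Ten N m R) = perm j i := by
  rw [perm_eq, perm_eq, Equiv.swap_comm]

theorem perm_mul_self (i j : Fin m) : (perm i j * perm i j : Ten N m R) = 1 := by
  rw [perm_eq, permOp_mul, Equiv.swap_mul_self, permOp_one]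

theorem perm_site_left (i j : Fin m) (M : Matrix (Fin N) (Fin N) R) :
    perm i j * site i M = site j M * perm i j := by
  have := permOp_site (Equiv.swap i j) j M
  rwa [Equiv.swap_apply_right] at this

theorem perm_site_of_ne {i j k : Fin m} (hi : k ≠ i) (hj : k ≠ j)
    (M : Matrix (Fin N) (Fin N) R) :
    perm i j * site k M = site k M * perm i j := by
  have := permOp_site (Equiv.swap i j) k M
  rwa [Equiv.swap_apply_of_ne_of_ne hi hj] at this

theorem perm_perm_left {i j k : Fin m} (hik : i ≠ k) (hjk : j ≠ k) :
    (perm i j * perm i k : Ten N m R) = perm j k * perm i j := by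
  rw [perm_eq, perm_eq, perm_eq, permOp_mul, permOp_mul]
  congr 1
  have := Equiv.swap_mul_eq_mul_swap (Equiv.swap i j) i k
  rw [Equiv.swap_inv, Equiv.swap_apply_left, Equiv.swap_apply_of_ne_of_ne hik.symm hjk.symm] at this
  rw [this]

theorem permOp_map {R' : Type*} [Ring R'] (φ : R →+* R') (p : Equiv.Perm (Fin m)) :
    (permOp p : Ten N m R).map φ = permOp p := by
  ext a b
  simp only [permOp, Matrix.map_apply, Matrix.of_apply]
  split_ifs <;> simp

/-- The operator `α - β P_{ij}`. -/
def rm (α β : S) (i j : Fin m) : Ten N m R := α • (1 : Ten N m R) - β • perm i j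

theorem rm_comm (α β : S) (i j : Fin m) : (rm α β i j : Ten N m R) = rm α β j i := by
  rw [rm, rm, perm_comm]

theorem rm_smul (s α β : S) (i j : Fin m) :
    (rm (s * α) (s * β) i j : Ten N m R) = s • rm α β i j := by
  rw [rm, rm, smul_sub, mul_smul, mul_smul]

theorem rm_mul_rm_self (α β α' β' : S) (i j : Fin m) :
    (rm α β i j * rm α' β' i j : Ten N m R) = rm α' β' i j * rm α β i j := by
  simp only [rm, sub_mul, mul_sub, smul_mul_assoc, mul_smul_comm, one_mul, mul_one, perm_mul_self]
  module

theorem rm_site_of_ne {i j k : Fin m} (hi : k ≠ i) (hj : k ≠ j) (α β : S)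
    (M : Matrix (Fin N) (Fin N) R) :
    rm α β i j * site k M = site k M * rm α β i j := by
  simp only [rm, sub_mul, mul_sub, smul_mul_assoc, mul_smul_comm, one_mul, mul_one,
    perm_site_of_ne hi hj]

/-- The Yang–Baxter equation. -/
theorem yang_baxter {i j k : Fin m} (hij : i ≠ j) (hik : i ≠ k) (hjk : j ≠ k)
    (α₁ β₁ α₂ β₂ α₃ β₃ : S) (h : β₁ * β₃ * α₂ = β₂ * (β₁ * α₃ + β₃ * α₁)) :
    (rm α₁ β₁ i j * rm α₂ β₂ i k * rm α₃ β₃ j k : Ten N m R) =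
      rm α₃ β₃ j k * rm α₂ β₂ i k * rm α₁ β₁ i j := by
  simp only [rm]
  set a : Ten N m R := perm i j
  set b : Ten N m R := perm i k
  set c : Ten N m R := perm j k
  have e1 : a * b = c * a := perm_perm_left hik hjk
  have e2 : b * c = a * b := by
    have := perm_perm_left (R := R) (N := N) (i := k) (j := i) (k := j) hjk.symm hij
    rwa [perm_comm k i, perm_comm k j] at this
  have e3 : a * c = b * a := by
    have := perm_perm_left (R := R) (N := N) (i := j) (j := i) (k := k) hjk hik
    rwa [perm_comm j i] at this
  have e4 : c * b = b * a := by
    have := perm_perm_left (R := R) (N := N) (i := k) (j := j) (k := i) hik.symm hij.symm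
    rwa [perm_comm k j, perm_comm k i, perm_comm j i, e3] at this
  have ea : a * a = 1 := perm_mul_self i j
  have e5 : a * b * c = b := by rw [mul_assoc, e2, ← mul_assoc, ea, one_mul]
  have e6 : b * a * a = b := by rw [mul_assoc, ea, mul_one]
  simp only [sub_mul, mul_sub, smul_mul_assoc, mul_smul_comm, one_mul, mul_one, e5, e6, e3, e2, e4]
  rw [← e1]
  have h' := congrArg (fun s : S => s • (a * b - b * a)) h
  rw [← sub_eq_zero] at h' ⊢
  refine Eq.trans ?_ (neg_eq_zero.2 h')
  module

end Tensor

/-! ### RTT relations -/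

section RTTsec

variable {N m : ℕ} {S R : Type*} [CommRing S] [Ring R] [Algebra S R]

/-- The relation `(α - β P) M₁ M'₂ = M'₂ M₁ (α - β P)`, written in terms of matrix entries. -/
def RTT (α β : S) (M M' : Matrix (Fin N) (Fin N) R) : Prop :=
  ∀ i j k l, α • (M i j * M' k l - M' k l * M i j) = β • (M k j * M' i l - M' k j * M i l)

theorem rm_mul_apply (α β : S) (i j : Fin m) (X : Ten N m R) (a b : Fin m → Fin N) :
    ((rm α β i j : Ten N m R) * X) a b = α • X a b - β • X (a ∘ Equiv.swap i j) b := by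
  rw [rm, sub_mul, smul_mul_assoc, smul_mul_assoc, one_mul, Matrix.sub_apply, Matrix.smul_apply,
    Matrix.smul_apply, perm_eq, permOp_mul_apply, Equiv.symm_swap]

theorem mul_rm_apply (α β : S) (i j : Fin m) (X : Ten N m R) (a b : Fin m → Fin N) :
    (X * (rm α β i j : Ten N m R)) a b = α • X a b - β • X a (b ∘ Equiv.swap i j) := by
  rw [rm, mul_sub, mul_smul_comm, mul_smul_comm, mul_one, Matrix.sub_apply, Matrix.smul_apply,
    Matrix.smul_apply, perm_eq, mul_permOp_apply]

theorem RTT.site {α β : S} {M M' : Matrix (Fin N) (Fin N) R} (h : RTT α β M M') {i j : Fin m}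
    (hij : i ≠ j) :
    rm α β i j * site i M * site j M' = site j M' * site i M * rm α β i j := by
  ext a b
  rw [mul_assoc, rm_mul_apply, mul_rm_apply]
  simp only [site_mul_site_apply hij, site_mul_site_apply hij.symm]
  have e1 : (∀ k, k ≠ i → k ≠ j → (a ∘ Equiv.swap i j) k = b k) ↔
      ∀ k, k ≠ i → k ≠ j → a k = b k :=
    forall_congr' fun k => forall_congr' fun hi => forall_congr' fun hj => by
      simp [Equiv.swap_apply_of_ne_of_ne hi hj]
  have e2 : (∀ k, k ≠ j → k ≠ i → a k = (b ∘ Equiv.swap i j) k) ↔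
      ∀ k, k ≠ i → k ≠ j → a k = b k := by
    rw [forall_congr']
    intro k
    by_cases hi : k = i
    · simp [hi]
    by_cases hj : k = j
    · simp [hj]
    simp [hi, hj, Equiv.swap_apply_of_ne_of_ne hi hj]
  have e3 : (∀ k, k ≠ j → k ≠ i → a k = b k) ↔ ∀ k, k ≠ i → k ≠ j → a k = b k :=
    forall_congr' fun k => ⟨fun h a b => h b a, fun h a b => h b a⟩
  simp only [e1, e2, e3]
  simp only [Function.comp, Equiv.swap_apply_left, Equiv.swap_apply_right]
  split_ifs
  · have := h (a i) (b i) (a j) (b j)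
    rw [smul_sub, smul_sub] at this
    rw [sub_eq_sub_iff_add_eq_add] at this ⊢
    rw [this, add_comm]
  · simp

theorem RTT.of_site {α β : S} {M M' : Matrix (Fin N) (Fin N) R}
    (h : rm α β 0 1 * ReflAlg.site (0 : Fin 2) M * ReflAlg.site 1 M' =
      ReflAlg.site 1 M' * ReflAlg.site 0 M * rm α β 0 1) : RTT α β M M' := by
  intro i j k l
  have h1 := congrFun (congrFun h ![i, k]) ![j, l]
  rw [mul_assoc, rm_mul_apply, mul_rm_apply] at h1
  simp only [site_mul_site_apply (show (0 : Fin 2) ≠ 1 by decide),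
    site_mul_site_apply (show (1 : Fin 2) ≠ 0 by decide)] at h1
  have e1 : ∀ a b : Fin 2 → Fin N, (∀ k, k ≠ (0 : Fin 2) → k ≠ 1 → a k = b k) ↔ True :=
    fun a b => iff_true_intro fun k h0 h1 => by fin_cases k <;> simp_all
  have e2 : ∀ a b : Fin 2 → Fin N, (∀ k, k ≠ (1 : Fin 2) → k ≠ 0 → a k = b k) ↔ True :=
    fun a b => iff_true_intro fun k h0 h1 => by fin_cases k <;> simp_all
  simp only [e1, e2, if_true, Function.comp, Equiv.swap_apply_left, Equiv.swap_apply_right,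
    Matrix.cons_val_zero, Matrix.cons_val_one] at h1
  rw [smul_sub, smul_sub]
  rw [sub_eq_sub_iff_add_eq_add] at h1 ⊢
  rw [h1, add_comm]

theorem RTT.mul {α β : S} {M M' T T' : Matrix (Fin N) (Fin N) R} (hM : RTT α β M M')
    (hT : RTT α β T T') (h₁ : ∀ a b c d, M' a b * T c d = T c d * M' a b)
    (h₂ : ∀ a b c d, M a b * T' c d = T' c d * M a b) : RTT α β (M * T) (M' * T') := by
  have h01 : (0 : Fin 2) ≠ 1 := by decide
  apply RTT.of_site
  have hM := hM.site h01
  have hT := hT.site h01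
  have e1 := site_comm h01.symm h₁
  have e2 := site_comm h01 h₂
  rw [site_mul, site_mul]
  generalize ReflAlg.site (0 : Fin 2) M = M1 at *
  generalize ReflAlg.site (1 : Fin 2) M' = M2 at *
  generalize ReflAlg.site (0 : Fin 2) T = T1 at *
  generalize ReflAlg.site (1 : Fin 2) T' = T2 at *
  generalize (rm α β 0 1 : Ten N 2 R) = r at *
  calc r * (M1 * T1) * (M2 * T2) = r * M1 * (T1 * M2) * T2 := by simp only [mul_assoc]
    _ = (r * M1 * M2) * T1 * T2 := by rw [← e1]; simp only [mul_assoc]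
    _ = M2 * M1 * (r * T1 * T2) := by rw [hM]; simp only [mul_assoc]
    _ = M2 * (M1 * T2) * T1 * r := by rw [hT]; simp only [mul_assoc]
    _ = _ := by rw [e2]; simp only [mul_assoc]

theorem RTT.smul {α β : S} {M M' : Matrix (Fin N) (Fin N) R} (h : RTT α β M M') (s s' : S) :
    RTT α β (s • M) (s' • M') := by
  intro i j k l
  have := congrArg (fun x => (s * s') • x) (h i j k l)
  simp only [Matrix.smul_apply, smul_mul_assoc, mul_smul_comm]
  simp only [smul_sub] at this ⊢
  convert this using 2 <;> module

theorem RTT.map {S' R' : Type*} [CommRing S'] [Ring R'] [Algebra S' R'] {α β : S} {α' β' : S'}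
    {M M' : Matrix (Fin N) (Fin N) R} (h : RTT α β M M') (φ : R →+* R')
    (hα : ∀ x, φ (α • x) = α' • φ x) (hβ : ∀ x, φ (β • x) = β' • φ x) :
    RTT α' β' (M.map φ) (M'.map φ) := by
  intro i j k l
  have := congrArg φ (h i j k l)
  simpa only [hα, hβ, map_sub, map_mul, Matrix.map_apply] using this

theorem RTT.cancel {s α β : S} {M M' : Matrix (Fin N) (Fin N) R} (h : RTT (s * α) (s * β) M M')
    (hs : ∀ x : R, s • x = 0 → x = 0) : RTT α β M M' := by
  intro i j k l
  have := h i j k l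
  rw [← sub_eq_zero] at this ⊢
  apply hs
  rw [smul_sub, smul_smul, smul_smul]
  exact this

/-- Evaluation-type solutions of the RTT relation: `ε i j` behaves like the matrix unit
`E_{ji}`. -/
theorem RTT.evalV {α β κ κ' : S} {ε : Matrix (Fin N) (Fin N) R}
    (hε : ∀ i j k l, ε i j * ε k l = if i = l then ε k j else 0)
    (h : α * (κ * κ') = -(β * (κ - κ'))) : RTT α β (1 - κ • ε) (1 - κ' • ε) := by
  intro i j k l
  let d : Fin N → Fin N → S := fun i j => if i = j then 1 else 0
  have hd : ∀ i j, (1 : Matrix (Fin N) (Fin N) R) i j = d i j • (1 : R) := by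
    intro i j
    rw [Matrix.one_apply]
    simp only [d]
    split_ifs <;> simp
  have hε' : ∀ i j k l, ε i j * ε k l = d i l • ε k j := by
    intro i j k l
    rw [hε]
    simp only [d]
    split_ifs <;> simp
  have hds : ∀ i j, d i j = d j i := fun i j => by simp only [d, eq_comm]
  simp only [Matrix.sub_apply, Matrix.smul_apply, hd, sub_mul, mul_sub, smul_mul_assoc,
    mul_smul_comm, one_mul, mul_one, hε']
  rw [hds k j]
  have h' := congrArg (fun s : S => s • (d i l • ε k j - d j k • ε i l)) h
  rw [← sub_eq_zero] at h' ⊢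
  refine Eq.trans ?_ h'
  module

/-- Evaluation-type solutions of the RTT relation: `ε i j` behaves like the matrix unit
`E_{ij}`. -/
theorem RTT.evalU {α β κ κ' : S} {ε : Matrix (Fin N) (Fin N) R}
    (hε : ∀ i j k l, ε i j * ε k l = if j = k then ε i l else 0)
    (h : α * (κ * κ') = β * (κ - κ')) : RTT α β (1 - κ • ε) (1 - κ' • ε) := by
  intro i j k l
  let d : Fin N → Fin N → S := fun i j => if i = j then 1 else 0
  have hd : ∀ i j, (1 : Matrix (Fin N) (Fin N) R) i j = d i j • (1 : R) := by
    intro i j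
    rw [Matrix.one_apply]
    simp only [d]
    split_ifs <;> simp
  have hε' : ∀ i j k l, ε i j * ε k l = d j k • ε i l := by
    intro i j k l
    rw [hε]
    simp only [d]
    split_ifs <;> simp
  have hds : ∀ i j, d i j = d j i := fun i j => by simp only [d, eq_comm]
  simp only [Matrix.sub_apply, Matrix.smul_apply, hd, sub_mul, mul_sub, smul_mul_assoc,
    mul_smul_comm, one_mul, mul_one, hε']
  rw [hds k j, hds l i]
  have h' := congrArg (fun s : S => s • (d j k • ε i l - d i l • ε k j)) h
  rw [← sub_eq_zero] at h' ⊢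
  refine Eq.trans ?_ h'
  module

end RTTsec

/-! ### The normalized R-matrix over scalar series -/

section Rbar

variable {σ τ A A' : Type*} [Ring A] [Algebra Ch A] [Ring A'] [Algebra Ch A'] {N m : ℕ}

/-- The matrix series `∑_r T_r w^r`. -/
def mser (T : ℕ → Matrix (Fin N) (Fin N) A) (w : MvPowerSeries σ Ch) :
    Matrix (Fin N) (Fin N) (MvPowerSeries σ A) :=
  Matrix.of fun k l => subs (fun r => T r k l) w

theorem siteSeries_eq (i : Fin m) (T : ℕ → Matrix (Fin N) (Fin N) A) (w : MvPowerSeries σ Ch) :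
    siteSeries i T w = site i (mser T w) := rfl

theorem subs_eq_C_add {w : MvPowerSeries σ Ch} (hw : MvPowerSeries.constantCoeff w = 0)
    (a : ℕ → A) : subs a w = MvPowerSeries.C (a 0) + w • subs (fun r => a (r + 1)) w := by
  rw [subs_eq_subsHom hw, subs_eq_subsHom hw]
  have e : PowerSeries.mk a = PowerSeries.C (a 0) +
      PowerSeries.X * PowerSeries.mk fun r => a (r + 1) := by
    refine PowerSeries.ext fun n => ?_
    cases n with
    | zero => simp
    | succ n => simp [PowerSeries.coeff_succ_X_mul]
  rw [e, map_add, map_mul]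
  congr 1
  · exact substHom_C _ _
  · rw [Algebra.smul_def]
    congr 1
    exact substHom_X _ _

theorem scalarSeries_self (s : MvPowerSeries σ Ch) :
    MvPowerSeries.map (algebraMap Ch Ch) s = s :=
  MvPowerSeries.ext fun d => by rw [MvPowerSeries.coeff_map]; rfl

theorem scalar_smul_def (s : MvPowerSeries σ Ch) (f : MvPowerSeries σ A) :
    s • f = MvPowerSeries.map (algebraMap Ch A) s * f := rfl

theorem hC_smul (f : MvPowerSeries σ A) : (hC Ch : MvPowerSeries σ Ch) • f = hbar • f :=
  C_smul_series _ _

/-- The normalizing scalar series `f(x/h)` as a series in `w = 1/x`. -/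
def nser (N : ℕ) (w : MvPowerSeries σ Ch) : MvPowerSeries σ Ch :=
  subs (fun r => (PowerSeries.C (normCoeff N r) : Ch)) (hC Ch * w)

theorem constantCoeff_hC_mul {w : MvPowerSeries σ Ch} (hw : MvPowerSeries.constantCoeff w = 0) :
    MvPowerSeries.constantCoeff (hC Ch * w) = 0 := by
  rw [map_mul, hw, mul_zero]

theorem exists_nser {w : MvPowerSeries σ Ch} (hw : MvPowerSeries.constantCoeff w = 0) :
    ∃ g : MvPowerSeries σ Ch, nser N w = 1 + hC Ch * (w * g) := by
  refine ⟨subs (fun r => (PowerSeries.C (normCoeff N (r + 1)) : Ch)) (hC Ch * w), ?_⟩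
  rw [nser, subs_eq_C_add (constantCoeff_hC_mul hw), scalar_smul_def,
    scalarSeries_self, mul_assoc]
  simp [normCoeff]

theorem substHom_hC [Fintype τ] {w : τ → MvPowerSeries σ Ch}
    (hw : ∀ t, MvPowerSeries.constantCoeff (w t) = 0) :
    substHom w hw (hC Ch : MvPowerSeries τ Ch) = hC Ch :=
  substHom_C _ _

theorem substHom_nser [Fintype τ] {v : τ → MvPowerSeries σ Ch}
    (hv : ∀ t, MvPowerSeries.constantCoeff (v t) = 0) {w : MvPowerSeries τ Ch}
    (hw : MvPowerSeries.constantCoeff w = 0) :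
    substHom v hv (nser N w) = nser N (substHom v hv w) := by
  rw [nser, substHom_subs (constantCoeff_hC_mul hw), map_mul, substHom_hC]
  rfl

/-- The normalized R-matrix `f(x/h)(1 - (h/x) P_{ij})` with `w = 1/x`, as an operator over an
arbitrary algebra. -/
def rbar (i j : Fin m) (w : MvPowerSeries σ Ch) : Ten N m (MvPowerSeries σ A) :=
  nser N w • rm (1 : MvPowerSeries σ Ch) (hC Ch * w) i j

theorem map_smul_series (φ : A →ₐ[Ch] A') (s : MvPowerSeries σ Ch) (f : MvPowerSeries σ A) :
    MvPowerSeries.map φ.toRingHom (s • f) = s • MvPowerSeries.map φ.toRingHom f := by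
  rw [Algebra.smul_def, Algebra.smul_def, map_mul]
  congr 1
  refine MvPowerSeries.ext fun d => ?_
  rw [MvPowerSeries.coeff_map, coeff_scalarSeries, coeff_scalarSeries]
  exact φ.commutes _

theorem rm_map {S S' R R' : Type*} [CommRing S] [Ring R] [Algebra S R] [CommRing S'] [Ring R']
    [Algebra S' R'] (φ : R →+* R') (ψ : S → S') (hφ : ∀ s x, φ (s • x) = ψ s • φ x) (α β : S)
    (i j : Fin m) : (rm α β i j : Ten N m R).map φ = rm (ψ α) (ψ β) i j := by
  ext a b
  simp only [rm, Matrix.map_apply, Matrix.sub_apply, Matrix.smul_apply, map_sub, hφ, perm_eq]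
  congr 3
  · rw [Matrix.one_apply, Matrix.one_apply]; split_ifs <;> simp
  · exact congrFun (congrFun (permOp_map φ _) a) b

theorem extScal_normR {S : Type*} [CommRing S] [Algebra Ch S] (χ : S →ₐ[Ch] Ch) (i j : Fin m)
    (w : MvPowerSeries σ S) :
    extScal ((algebraMap Ch A).comp χ.toRingHom) (normR i j w : Ten N m (MvPowerSeries σ S)) =
      rbar i j (MvPowerSeries.map χ.toRingHom w) := by
  have hh : MvPowerSeries.map χ.toRingHom (hC S : MvPowerSeries σ S) = hC Ch := by
    rw [hC, hC, MvPowerSeries.map_C]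
    exact congrArg _ (χ.commutes _)
  have hs : MvPowerSeries.map χ.toRingHom (subs (fun r => algebraMap Ch S
      (PowerSeries.C (normCoeff N r))) (hC S * w)) = nser N (MvPowerSeries.map χ.toRingHom w) := by
    refine MvPowerSeries.ext fun d => ?_
    rw [MvPowerSeries.coeff_map]
    change χ.toRingHom (∑ r ∈ Finset.range (d.degree + 1), _) =
      ∑ r ∈ Finset.range (d.degree + 1), _
    rw [map_sum]
    refine Finset.sum_congr rfl fun r _ => ?_
    rw [smul_eq_mul, smul_eq_mul, map_mul χ.toRingHom, ← hh, ← map_mul (MvPowerSeries.map _),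
      ← map_pow (MvPowerSeries.map _), MvPowerSeries.coeff_map]
    congr 1
    exact χ.commutes _
  have hφ : ∀ (s : MvPowerSeries σ S) (x : MvPowerSeries σ S),
      MvPowerSeries.map ((algebraMap Ch A).comp χ.toRingHom) (s • x) =
        MvPowerSeries.map χ.toRingHom s •
          MvPowerSeries.map ((algebraMap Ch A).comp χ.toRingHom) x := by
    intro s x
    rw [smul_eq_mul, map_mul, Algebra.smul_def, scalarSeries_eq]
    congr 1
  have e : (normR i j w : Ten N m (MvPowerSeries σ S)) =
      subs (fun r => algebraMap Ch S (PowerSeries.C (normCoeff N r))) (hC S * w) •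
        rm (1 : MvPowerSeries σ S) (hC S * w) i j := by
    rw [normR, rm, one_smul]
  rw [e, extScal, rbar]
  have h2 := rm_map (N := N) (m := m) _ _ hφ (1 : MvPowerSeries σ S) (hC S * w) i j
  rw [map_one, map_mul, hh] at h2
  rw [← h2, ← hs]
  ext a b : 2
  simp only [Matrix.map_apply, Matrix.smul_apply, hφ]

end Rbar

/-! ### The dual Yangian -/

/-- The first of two variables. -/
notation "𝐮" => (MvPowerSeries.X 0 : MvPowerSeries (Fin 2) Ch)

/-- The second of two variables. -/
notation "𝐯" => (MvPowerSeries.X 1 : MvPowerSeries (Fin 2) Ch)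

section RenameVars

variable {σ τ A A' : Type*} [Ring A] [Algebra Ch A] [Ring A'] [Algebra Ch A'] {N m : ℕ}

theorem wpow_X [Fintype τ] (ι : τ → σ) (e : τ →₀ ℕ) :
    wpow (fun t => (MvPowerSeries.X (ι t) : MvPowerSeries σ Ch)) e =
      MvPowerSeries.monomial (e.mapDomain ι) 1 := by
  classical
  simp only [wpow, MvPowerSeries.X_pow_eq, MvPowerSeries.prod_monomial, Finset.prod_const_one]
  congr 1
  rw [Finsupp.mapDomain, Finsupp.sum_fintype _ _ (by simp)]

theorem coeff_substHom_X [Fintype τ] {ι : τ → σ} (hι : Function.Injective ι)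
    (hw : ∀ t, MvPowerSeries.constantCoeff (MvPowerSeries.X (ι t) : MvPowerSeries σ Ch) = 0)
    (f : MvPowerSeries τ A) (e : τ →₀ ℕ) :
    MvPowerSeries.coeff (e.mapDomain ι) (substHom (fun t => MvPowerSeries.X (ι t)) hw f) =
      MvPowerSeries.coeff e f := by
  rw [substHom_apply, coeff_substFun_eq_single hw f _ e, wpow_X,
    MvPowerSeries.coeff_monomial_same, one_smul]
  intro e' he'
  rw [wpow_X, MvPowerSeries.coeff_monomial_ne, zero_smul]
  exact fun h => he' (Finsupp.mapDomain_injective hι h).symm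

theorem coeff_substHom_X_of_notMem [Fintype τ] {ι : τ → σ}
    (hw : ∀ t, MvPowerSeries.constantCoeff (MvPowerSeries.X (ι t) : MvPowerSeries σ Ch) = 0)
    (f : MvPowerSeries τ A) (d : σ →₀ ℕ) (hd : ∀ e : τ →₀ ℕ, d ≠ e.mapDomain ι) :
    MvPowerSeries.coeff d (substHom (fun t => MvPowerSeries.X (ι t)) hw f) = 0 := by
  rw [substHom_apply, coeff_substFun hw f d _ le_rfl]
  refine Finset.sum_eq_zero fun e _ => ?_
  rw [wpow_X, MvPowerSeries.coeff_monomial_ne (hd e), zero_smul]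

theorem mser_map (φ : A →ₐ[Ch] A') (T : ℕ → Matrix (Fin N) (Fin N) A) (w : MvPowerSeries σ Ch) :
    (mser T w).map (MvPowerSeries.map φ.toRingHom) = mser (fun r => (T r).map φ) w := by
  ext a b : 1
  exact map_subs φ (fun r => T r a b) w

theorem mser_subst [Fintype σ] (T : ℕ → Matrix (Fin N) (Fin N) A) {w : MvPowerSeries σ Ch}
    (hw : MvPowerSeries.constantCoeff w = 0) {v : σ → MvPowerSeries τ Ch}
    (hv : ∀ t, MvPowerSeries.constantCoeff (v t) = 0) :
    (mser T w).map (substHom v hv) = mser T (substHom v hv w) := by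
  ext a b : 1
  exact substHom_subs hw hv (fun r => T r a b)

theorem constantCoeff_pair {w w' : MvPowerSeries σ Ch} (hw : MvPowerSeries.constantCoeff w = 0)
    (hw' : MvPowerSeries.constantCoeff w' = 0) (t : Fin 2) :
    MvPowerSeries.constantCoeff (![w, w'] t) = 0 := by
  fin_cases t
  · exact hw
  · exact hw'

theorem RTT.mser_subst {α β : MvPowerSeries (Fin 2) Ch} {T T' : ℕ → Matrix (Fin N) (Fin N) A}
    (h : RTT α β (mser T 𝐮) (mser T' 𝐯))
    {w w' : MvPowerSeries σ Ch} (hw : MvPowerSeries.constantCoeff w = 0)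
    (hw' : MvPowerSeries.constantCoeff w' = 0) :
    RTT (substHom ![w, w'] (constantCoeff_pair hw hw') α)
      (substHom ![w, w'] (constantCoeff_pair hw hw') β) (mser T w) (mser T' w') := by
  have := h.map (substHom ![w, w'] (constantCoeff_pair hw hw'))
    (fun x => substHom_smul _ _ x) (fun x => substHom_smul _ _ x)
  rwa [ReflAlg.mser_subst T (by simp), ReflAlg.mser_subst T' (by simp), substHom_X', substHom_X']
    at this

theorem RTT.mser_map {α β : MvPowerSeries σ Ch} {T T' : ℕ → Matrix (Fin N) (Fin N) A}
    {w w' : MvPowerSeries σ Ch} (h : RTT α β (mser T w) (mser T' w')) (φ : A →ₐ[Ch] A') :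
    RTT α β (mser (fun r => (T r).map φ) w) (mser (fun r => (T' r).map φ) w') := by
  have := h.map (MvPowerSeries.map φ.toRingHom) (fun x => map_smul_series φ _ x)
    (fun x => map_smul_series φ _ x)
  rwa [ReflAlg.mser_map, ReflAlg.mser_map] at this

theorem serPlus_map (φ : A →ₐ[Ch] A') (x : Fin N → Fin N → ℕ → A) (r : ℕ) :
    (serPlus x r).map φ = serPlus (fun i j r => φ (x i j r)) r := by
  ext i j
  simp only [serPlus, Matrix.map_apply, Matrix.sub_apply, Matrix.of_apply, map_sub, map_smul]
  congr 1
  split_ifs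
  · rw [Matrix.one_apply, Matrix.one_apply]; split_ifs <;> simp
  · simp

theorem serMinus_map (φ : A →ₐ[Ch] A') (x : Fin N → Fin N → ℕ → A) (r : ℕ) :
    (serMinus x r).map φ = serMinus (fun i j r => φ (x i j r)) r := by
  ext i j
  cases r with
  | zero =>
    simp only [serMinus, Matrix.map_apply]
    rw [Matrix.one_apply, Matrix.one_apply]; split_ifs <;> simp
  | succ r => simp [serMinus]

theorem extScal_rm (α β : MvPowerSeries σ Ch) (i j : Fin m) :
    extScal (algebraMap Ch A) (α • 1 - β • perm i j : Ten N m (MvPowerSeries σ Ch)) =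
      rm α β i j := by
  have hφ : ∀ s x : MvPowerSeries σ Ch, MvPowerSeries.map (algebraMap Ch A) (s • x) =
      s • MvPowerSeries.map (algebraMap Ch A) x := by
    intro s x
    rw [smul_eq_mul, map_mul]
    rfl
  exact rm_map (N := N) (MvPowerSeries.map (algebraMap Ch A)) id hφ α β i j

end RenameVars

section Relations

variable {A : Type*} [Ring A] [Algebra Ch A] {N m : ℕ}

theorem Ten.map_mul {σ : Type*} {B B' : Type*} [Ring B] [Ring B'] (φ : B →+* B')
    (X Y : Ten N m (MvPowerSeries σ B)) : (X * Y).map (MvPowerSeries.map φ) =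
      X.map (MvPowerSeries.map φ) * Y.map (MvPowerSeries.map φ) :=
  Matrix.map_mul (f := (MvPowerSeries.map φ : MvPowerSeries σ B →+* MvPowerSeries σ B'))

theorem Ten.map_sub {σ : Type*} {B B' : Type*} [Ring B] [Ring B'] (φ : B →+* B')
    (X Y : Ten N m (MvPowerSeries σ B)) : (X - Y).map (MvPowerSeries.map φ) =
      X.map (MvPowerSeries.map φ) - Y.map (MvPowerSeries.map φ) := by
  ext a b : 1
  exact (MvPowerSeries.map φ).map_sub (X a b) (Y a b)

theorem map_rm {σ A' : Type*} [Ring A'] [Algebra Ch A'] (φ : A →ₐ[Ch] A') (α β : MvPowerSeries σ Ch)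
    (i j : Fin m) : (rm α β i j : Ten N m (MvPowerSeries σ A)).map (MvPowerSeries.map φ.toRingHom) =
      rm α β i j :=
  rm_map _ id (fun s x => map_smul_series φ s x) α β i j

theorem extScal_map {σ S B B' : Type*} [Semiring S] [Ring B] [Ring B'] (χ : S →+* B) (φ : B →+* B')
    (X : Ten N m (MvPowerSeries σ S)) :
    (extScal χ X).map (MvPowerSeries.map φ) = extScal (φ.comp χ) X := by
  ext a b : 1
  exact MvPowerSeries.ext fun d => rfl

theorem forall_coeffSet {σ : Type*} (φ : FreeTop N →ₐ[Ch] A)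
    (X : Ten N m (MvPowerSeries σ (FreeTop N))) :
    (∀ x ∈ coeffSet X, φ x = 0) ↔ X.map (MvPowerSeries.map φ.toRingHom) = 0 := by
  constructor
  · intro h
    ext a b d
    exact h _ ⟨a, b, d, rfl⟩
  · rintro h x ⟨a, b, d, rfl⟩
    have := congrArg (MvPowerSeries.coeff d) (congrFun (congrFun h a) b)
    exact this

theorem freeT_map_plus (φ : FreeTop N →ₐ[Ch] A) (i : Fin 2) (w : MvPowerSeries (Fin 2) Ch) :
    (freeT N true i w).map (MvPowerSeries.map φ.toRingHom) =
      site i (mser (serPlus fun i j r => φ (FreeTop.gen (Gen.neg i j r))) w) := by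
  rw [freeT, if_pos rfl, siteSeries_eq, site_map, mser_map]
  simp only [serPlus_map]

theorem freeT_map_minus (φ : FreeTop N →ₐ[Ch] A) (i : Fin 2) (w : MvPowerSeries (Fin 2) Ch) :
    (freeT N false i w).map (MvPowerSeries.map φ.toRingHom) =
      site i (mser (serMinus fun i j r => φ (FreeTop.gen (Gen.pos i j r))) w) := by
  rw [freeT, if_neg (by decide), siteSeries_eq, site_map, mser_map]
  simp only [serMinus_map]

theorem relPlus_iff (φ : FreeTop N →ₐ[Ch] A) :
    (∀ x ∈ coeffSet (relPlus N), φ x = 0) ↔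
      RTT (𝐮 - 𝐯) (hC Ch)
        (mser (serPlus fun i j r => φ (FreeTop.gen (Gen.neg i j r))) 𝐮)
        (mser (serPlus fun i j r => φ (FreeTop.gen (Gen.neg i j r))) 𝐯) := by
  rw [forall_coeffSet]
  have e : (relPlus N).map (MvPowerSeries.map φ.toRingHom) =
      rm (𝐮 - 𝐯) (hC Ch) 0 1 *
        site 0 (mser (serPlus fun i j r => φ (FreeTop.gen (Gen.neg i j r))) 𝐮) *
        site 1 (mser (serPlus fun i j r => φ (FreeTop.gen (Gen.neg i j r))) 𝐯) -
      site 1 (mser (serPlus fun i j r => φ (FreeTop.gen (Gen.neg i j r))) 𝐯) *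
        site 0 (mser (serPlus fun i j r => φ (FreeTop.gen (Gen.neg i j r))) 𝐮) *
        rm (𝐮 - 𝐯) (hC Ch) 0 1 := by
    rw [relPlus]
    simp only [Ten.map_sub, Ten.map_mul, extScal_rm, map_rm, freeT_map_plus]
  rw [e, sub_eq_zero]
  exact ⟨RTT.of_site, fun h => h.site (by decide)⟩

theorem relMinus_iff (φ : FreeTop N →ₐ[Ch] A) :
    (∀ x ∈ coeffSet (relMinus N), φ x = 0) ↔
      RTT (𝐯 - 𝐮) (hC Ch * 𝐮 * 𝐯)
        (mser (serMinus fun i j r => φ (FreeTop.gen (Gen.pos i j r))) 𝐮)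
        (mser (serMinus fun i j r => φ (FreeTop.gen (Gen.pos i j r))) 𝐯) := by
  rw [forall_coeffSet]
  have e : (relMinus N).map (MvPowerSeries.map φ.toRingHom) =
      rm (𝐯 - 𝐮)
          (hC Ch * 𝐮 * 𝐯) 0 1 *
        site 0 (mser (serMinus fun i j r => φ (FreeTop.gen (Gen.pos i j r))) 𝐮) *
        site 1 (mser (serMinus fun i j r => φ (FreeTop.gen (Gen.pos i j r))) 𝐯) -
      site 1 (mser (serMinus fun i j r => φ (FreeTop.gen (Gen.pos i j r))) 𝐯) *
        site 0 (mser (serMinus fun i j r => φ (FreeTop.gen (Gen.pos i j r))) 𝐮) *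
        rm (𝐯 - 𝐮)
          (hC Ch * 𝐮 * 𝐯) 0 1 := by
    rw [relMinus]
    simp only [Ten.map_sub, Ten.map_mul, extScal_rm, map_rm, freeT_map_minus]
  rw [e, sub_eq_zero]
  exact ⟨RTT.of_site, fun h => h.site (by decide)⟩

theorem relMixed_iff (φ : FreeTop N →ₐ[Ch] A) (c : Ch)
    (hcen : φ (FreeTop.gen Gen.cen) = algebraMap Ch A c) :
    (∀ x ∈ coeffSet (relMixed N), φ x = 0) ↔
      (rbar 0 1 (MvPowerSeries.map (Polynomial.aeval c : Polynomial Ch →ₐ[Ch] Ch).toRingHom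
          (shiftInv (1 / 2))) : Ten N 2 (MvPowerSeries (Fin 2) A)) *
        site 0 (mser (serMinus fun i j r => φ (FreeTop.gen (Gen.pos i j r))) 𝐮) *
        site 1 (mser (serPlus fun i j r => φ (FreeTop.gen (Gen.neg i j r))) 𝐯) =
      site 1 (mser (serPlus fun i j r => φ (FreeTop.gen (Gen.neg i j r))) 𝐯) *
        site 0 (mser (serMinus fun i j r => φ (FreeTop.gen (Gen.pos i j r))) 𝐮) *
        rbar 0 1 (MvPowerSeries.map (Polynomial.aeval c : Polynomial Ch →ₐ[Ch] Ch).toRingHom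
          (shiftInv (-1 / 2))) := by
  have hc : φ.toRingHom.comp (Polynomial.aeval (R := Ch)
      (FreeTop.gen Gen.cen : FreeTop N)).toRingHom =
      (algebraMap Ch A).comp (Polynomial.aeval c : Polynomial Ch →ₐ[Ch] Ch).toRingHom := by
    have : (φ.comp (Polynomial.aeval (R := Ch) (FreeTop.gen Gen.cen : FreeTop N))) =
        (Algebra.ofId Ch A).comp (Polynomial.aeval c) := by
      apply Polynomial.algHom_ext
      simp only [AlgHom.comp_apply, Polynomial.aeval_X, hcen]
      rfl
    exact congrArg AlgHom.toRingHom this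
  rw [forall_coeffSet, relMixed]
  simp only [Ten.map_sub, Ten.map_mul, extScal_map, hc, extScal_normR, freeT_map_plus,
    freeT_map_minus]
  rw [sub_eq_zero]

end Relations

section DualYangian

variable {N : ℕ}

/-- The relations of the dual Yangian: the relations between the `t_{ij}^{(-r)}` of the double
Yangian, and the vanishing of all other generators. -/
def dualRel (N : ℕ) : Set (FreeTop N) :=
  coeffSet (relPlus N) ∪
    {x | x = FreeTop.gen Gen.cen ∨ ∃ i j r, x = FreeTop.gen (Gen.pos i j r)}

/-- The dual Yangian: the topologically free algebra generated by the `t_{ij}^{(-r)}`. -/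
abbrev Yp (N : ℕ) : Type := Pres (dualRel N)

/-- The generators `t_{ij}^{(-r-1)}` of the dual Yangian. -/
def yNeg (i j : Fin N) (r : ℕ) : Yp N := Pres.mk (dualRel N) (FreeTop.gen (Gen.neg i j r))

/-- The coefficients of the series `T⁺(u)` with values in the dual Yangian. -/
def tY (N : ℕ) : ℕ → Matrix (Fin N) (Fin N) (Yp N) := serPlus yNeg

theorem Pres.mk_of_mem {S : Set (FreeTop N)} {x : FreeTop N} (hx : x ∈ S) : Pres.mk S x = 0 :=
  (Pres.mk_eq_zero S x).2 (subset_hull S hx)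

theorem rtt_tY : RTT (𝐮 - 𝐯) (hC Ch) (mser (tY N) 𝐮) (mser (tY N) 𝐯) :=
  (relPlus_iff (Pres.mk (dualRel N))).1 fun _ hx => Pres.mk_of_mem (Or.inl hx)

theorem Yp.induction_left (U : Submodule Ch (Yp N)) (h1 : 1 ∈ U)
    (hg : ∀ i j r, ∀ x ∈ U, yNeg i j r * x ∈ U)
    (hcl : ∀ x, (∀ n : ℕ, ∃ y ∈ U, ∃ w, x = y + hbar ^ n • w) → x ∈ U) (x : Yp N) : x ∈ U := by
  refine Pres.induction_left U h1 (fun g x hx => ?_) hcl x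
  cases g with
  | cen =>
    rw [Pres.mk_of_mem (Or.inr (Or.inl rfl)), zero_mul]
    exact U.zero_mem
  | pos i j r =>
    rw [Pres.mk_of_mem (Or.inr (Or.inr ⟨i, j, r, rfl⟩)), zero_mul]
    exact U.zero_mem
  | neg i j r => exact hg i j r x hx

theorem tY_apply (i j : Fin N) (r : ℕ) :
    tY N r i j = (if r = 0 then (1 : Matrix (Fin N) (Fin N) (Yp N)) else 0) i j -
      hbar • yNeg i j r := rfl

/-- Homomorphisms out of the dual Yangian correspond to solutions of the `RTT` relation which are
congruent to the identity modulo `h`. -/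
theorem Yp.exists_lift {A : Type*} [Ring A] [Algebra Ch A] (hA : HTF A)
    (x : Fin N → Fin N → ℕ → A)
    (h : RTT (𝐮 - 𝐯) (hC Ch) (mser (serPlus x) 𝐮) (mser (serPlus x) 𝐯)) :
    ∃ ψ : Yp N →ₐ[Ch] A, ∀ i j r, ψ (yNeg i j r) = x i j r := by
  obtain ⟨φ, hφ⟩ := exists_lift_freeTop (N := N) hA fun g => match g with
    | Gen.cen => 0
    | Gen.pos _ _ _ => 0
    | Gen.neg i j r => x i j r
  obtain ⟨ψ, hψ⟩ := Pres.exists_lift (S := dualRel N) hA φ (by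
    rintro y (hy | rfl | ⟨i, j, r, rfl⟩)
    · refine (relPlus_iff φ).2 ?_ y hy
      simpa only [hφ] using h
    · exact hφ _
    · exact hφ _)
  exact ⟨ψ, fun i j r => (hψ _).trans (hφ _)⟩

theorem tY_map {A : Type*} [Ring A] [Algebra Ch A] (ψ : Yp N →ₐ[Ch] A) {x : Fin N → Fin N → ℕ → A}
    (h : ∀ i j r, ψ (yNeg i j r) = x i j r) (r : ℕ) (i j : Fin N) :
    ψ (tY N r i j) = serPlus x r i j := by
  have := congrFun (congrFun (serPlus_map ψ yNeg r) i) j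
  simp only [h] at this
  exact this

end DualYangian

/-! ### Homomorphisms into series with parameters -/

section Param

variable {N : ℕ} {σ : Type*} {A : Type*} [Ring A] [Algebra Ch A]

/-- The exponent of `𝐮 ^ k 𝐯 ^ r`. -/
def ex (k r : ℕ) : Fin 2 →₀ ℕ := Finsupp.single 0 k + Finsupp.single 1 r

theorem ex_zero (k r : ℕ) : ex k r 0 = k := by simp [ex]

theorem ex_one (k r : ℕ) : ex k r 1 = r := by simp [ex]

theorem eq_ex (d : Fin 2 →₀ ℕ) : d = ex (d 0) (d 1) := by
  ext i
  fin_cases i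
  · exact (ex_zero _ _).symm
  · exact (ex_one _ _).symm

theorem ex_inj {k r k' r' : ℕ} : ex k r = ex k' r' ↔ k = k' ∧ r = r' := by
  constructor
  · intro h
    have h0 := DFunLike.congr_fun h 0
    have h1 := DFunLike.congr_fun h 1
    rw [ex_zero, ex_zero] at h0
    rw [ex_one, ex_one] at h1
    exact ⟨h0, h1⟩
  · rintro ⟨rfl, rfl⟩
    rfl

/-- The variables `z⁻¹` and `v_i`. -/
def optPair (i : σ) : Fin 2 → Option σ := ![none, some i]

theorem optPair_injective (i : σ) : Function.Injective (optPair i) := by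
  intro a b h
  fin_cases a <;> fin_cases b <;> simp_all [optPair]

/-- The substitution of `z⁻¹` and `v_i` for the two variables. -/
def optSubst [Fintype σ] (i : σ) : MvPowerSeries (Fin 2) A →+* MvPowerSeries (Option σ) A :=
  substHom (fun t => MvPowerSeries.X (optPair i t)) fun _ => MvPowerSeries.constantCoeff_X _

theorem optSubst_smul [Fintype σ] (i : σ) (s : MvPowerSeries (Fin 2) Ch)
    (f : MvPowerSeries (Fin 2) A) : optSubst i (s • f) = optSubst i s • optSubst i f :=
  substHom_smul _ s f

theorem mapDomain_optPair (i : σ) (k r : ℕ) :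
    (ex k r).mapDomain (optPair i) = (Finsupp.single i r).optionElim k := by
  classical
  rw [ex, Finsupp.mapDomain_add, Finsupp.mapDomain_single, Finsupp.mapDomain_single]
  ext j
  cases j with
  | none => simp [optPair]
  | some j => simp [optPair, Finsupp.single_apply]

theorem coeff_optSubst [Fintype σ] [DecidableEq σ] (i : σ) (f : MvPowerSeries (Fin 2) A)
    (d : σ →₀ ℕ) (k : ℕ) :
    MvPowerSeries.coeff (d.optionElim k) (optSubst i f) =
      if d = Finsupp.single i (d i) then MvPowerSeries.coeff (ex k (d i)) f else 0 := by
  split_ifs with h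
  · rw [h, ← mapDomain_optPair, optSubst, coeff_substHom_X (optPair_injective i)]
    simp
  · refine coeff_substHom_X_of_notMem _ f _ fun e he => h ?_
    rw [eq_ex e, mapDomain_optPair] at he
    have h1 := congrArg Finsupp.some he
    rw [Finsupp.some_optionElim, Finsupp.some_optionElim] at h1
    rw [h1]
    simp

theorem optHom_X_smul (i : σ) (f : MvPowerSeries (Option σ) A) :
    optHom ((MvPowerSeries.X (some i) : MvPowerSeries (Option σ) Ch) • f) =
      (MvPowerSeries.X i : MvPowerSeries σ Ch) • optHom f := by
  classical
  rw [scalar_smul_def, scalar_smul_def, map_mul, MvPowerSeries.map_X, MvPowerSeries.map_X]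
  congr 1
  refine MvPowerSeries.ext fun d => PowerSeries.ext fun k => ?_
  rw [coeff_optHom, MvPowerSeries.coeff_X, MvPowerSeries.coeff_X]
  have h : d.optionElim k = Finsupp.single (some i) 1 ↔ d = Finsupp.single i 1 ∧ k = 0 := by
    constructor
    · intro h
      refine ⟨Finsupp.ext fun j => ?_, ?_⟩
      · have := DFunLike.congr_fun h (some j)
        rw [Finsupp.optionElim_apply_some] at this
        rw [this, Finsupp.single_apply, Finsupp.single_apply]
        simp
      · simpa using DFunLike.congr_fun h none
    · rintro ⟨rfl, rfl⟩
      refine Finsupp.ext fun j => ?_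
      cases j <;> simp [Finsupp.single_apply]
  rw [if_congr h rfl rfl]
  by_cases hd : d = Finsupp.single i 1 <;> by_cases hk : k = 0 <;>
    simp [hd, hk, PowerSeries.coeff_one]

theorem optHom_smul (c : Ch) (f : MvPowerSeries (Option σ) A) : optHom (c • f) = c • optHom f := by
  refine MvPowerSeries.ext fun d => PowerSeries.ext fun k => ?_
  rw [coeff_optHom]
  change c • _ = c • PowerSeries.coeff k (MvPowerSeries.coeff d (optHom f))
  rw [coeff_optHom]
  rfl

theorem optHom_optSubst [Fintype σ] (i : σ) (f : MvPowerSeries (Fin 2) A) :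
    optHom (optSubst i f) = subs (fun r => PowerSeries.mk fun k => MvPowerSeries.coeff (ex k r) f)
      (MvPowerSeries.X i : MvPowerSeries σ Ch) := by
  classical
  refine MvPowerSeries.ext fun d => PowerSeries.ext fun k => ?_
  rw [coeff_optHom, coeff_optSubst, coeff_subs_X]
  split_ifs
  · rw [PowerSeries.coeff_mk]
  · rw [map_zero]

/-- A family of solutions of the `RTT` relation, depending on a parameter `𝐮`, gives a homomorphism
from the dual Yangian to series in the parameter. -/
theorem Yp.exists_hom (hA : HTF A) (M M' : Matrix (Fin N) (Fin N) (MvPowerSeries (Fin 2) A))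
    (hM : M = 1 + hbar • M')
    (hR : RTT (MvPowerSeries.X (some 0) - MvPowerSeries.X (some 1) :
      MvPowerSeries (Option (Fin 2)) Ch) (hC Ch) (M.map (optSubst (σ := Fin 2) 0))
        (M.map (optSubst (σ := Fin 2) 1))) :
    ∃ ψ : Yp N →ₐ[Ch] PowerSeries A, ∀ i j r k,
      PowerSeries.coeff k (ψ (tY N r i j)) = MvPowerSeries.coeff (ex k r) (M i j) := by
  set x : Fin N → Fin N → ℕ → PowerSeries A := fun i j r =>
    PowerSeries.mk fun k => -MvPowerSeries.coeff (ex k r) (M' i j) with hx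
  have hxM : ∀ i j r k, PowerSeries.coeff k (serPlus x r i j) =
      MvPowerSeries.coeff (ex k r) (M i j) := by
    intro i j r k
    have e1 : MvPowerSeries.coeff (ex k r) ((1 : Matrix (Fin N) (Fin N) (MvPowerSeries (Fin 2) A)) i j)
        = if k = 0 ∧ r = 0 then (1 : Matrix (Fin N) (Fin N) A) i j else 0 := by
      rw [Matrix.one_apply, Matrix.one_apply]
      have e0 : (0 : Fin 2 →₀ ℕ) = ex 0 0 := by simp [ex]
      split_ifs with h h1 h2
      · rw [h1.1, h1.2, ← e0, MvPowerSeries.coeff_zero_one]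
      · rw [MvPowerSeries.coeff_one, if_neg]
        rw [e0, ex_inj]
        exact h1
      · simp
      · simp
    rw [hM, Matrix.add_apply, Matrix.smul_apply, map_add, e1]
    change PowerSeries.coeff k ((if r = 0 then (1 : Matrix (Fin N) (Fin N) (PowerSeries A)) else 0) i j -
      hbar • x i j r) = _ + hbar • MvPowerSeries.coeff (ex k r) (M' i j)
    have e2 : PowerSeries.coeff k (hbar • x i j r) = hbar • PowerSeries.coeff k (x i j r) := rfl
    rw [map_sub, e2, hx, PowerSeries.coeff_mk, smul_neg, sub_neg_eq_add]
    congr 1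
    by_cases hr : r = 0
    · rw [if_pos hr, Matrix.one_apply, Matrix.one_apply]
      by_cases hk : k = 0 <;> by_cases hij : i = j <;> simp [hr, hk, hij, PowerSeries.coeff_one]
    · simp [hr]
  have hopt : ∀ i : Fin 2, (M.map (optSubst i)).map optHom =
      mser (serPlus x) (MvPowerSeries.X i : MvPowerSeries (Fin 2) Ch) := by
    intro i
    ext a b : 1
    rw [Matrix.map_apply, Matrix.map_apply, optHom_optSubst]
    change _ = subs (fun r => serPlus x r a b) _
    congr 1
    funext r
    refine PowerSeries.ext fun k => ?_
    rw [PowerSeries.coeff_mk, hxM]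
  obtain ⟨ψ, hψ⟩ := Yp.exists_lift hA.powerSeries x (by
    have := RTT.map (α' := 𝐮 - 𝐯) (β' := hC Ch) hR optHom (fun f => by
        rw [sub_smul, sub_smul, map_sub, optHom_X_smul, optHom_X_smul])
      (fun f => by rw [hC_smul, hC_smul, optHom_smul])
    rwa [hopt, hopt] at this)
  exact ⟨ψ, fun i j r k => by rw [tY_map ψ hψ, hxM]⟩

end Param

/-! ### Elements congruent to one modulo `h` -/

section OneMod

variable {X : Type*} [Ring X] [Algebra Ch X]

/-- The elements congruent to `1` modulo `h`. -/
def OneModH (x : X) : Prop := ∃ y : X, x = 1 + hbar • y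

theorem OneModH.one : OneModH (1 : X) := ⟨0, by simp⟩

theorem OneModH.mul {x y : X} (hx : OneModH x) (hy : OneModH y) : OneModH (x * y) := by
  obtain ⟨x', rfl⟩ := hx
  obtain ⟨y', rfl⟩ := hy
  refine ⟨x' + y' + hbar • (x' * y'), ?_⟩
  simp only [add_mul, mul_add, one_mul, mul_one, smul_add, smul_mul_assoc, mul_smul_comm]
  abel

theorem OneModH.sub {x : X} (hx : OneModH x) (y : X) : OneModH (x - hbar • y) := by
  obtain ⟨x', rfl⟩ := hx
  exact ⟨x' - y, by rw [smul_sub]; abel⟩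

variable {σ A : Type*} [Ring A] [Algebra Ch A]

theorem hC_mul_smul_matrix {n : Type*} (s : MvPowerSeries σ Ch) (M : Matrix n n (MvPowerSeries σ A)) :
    (hC Ch * s) • M = hbar • (s • M) := by
  ext a b : 1
  rw [mul_smul, Matrix.smul_apply, hC_smul]
  rfl

theorem OneModH.smul {n : Type*} [Fintype n] [DecidableEq n] {s : MvPowerSeries σ Ch}
    (hs : ∃ g, s = 1 + hC Ch * g)
    {M : Matrix n n (MvPowerSeries σ A)} (hM : OneModH M) : OneModH (s • M) := by
  obtain ⟨g, rfl⟩ := hs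
  obtain ⟨M', rfl⟩ := hM
  refine ⟨M' + g • (1 + hbar • M'), ?_⟩
  rw [add_smul, one_smul, hC_mul_smul_matrix, smul_add hbar, add_assoc]

end OneMod

section Ser

variable {σ A : Type*} [Ring A] [Algebra Ch A] {N : ℕ}

theorem subs_smul (c : Ch) (a : ℕ → A) (w : MvPowerSeries σ Ch) :
    subs (fun r => c • a r) w = c • subs a w := by
  refine MvPowerSeries.ext fun d => ?_
  change ∑ r ∈ Finset.range (d.degree + 1), MvPowerSeries.coeff d (w ^ r) • c • a r =
    c • ∑ r ∈ Finset.range (d.degree + 1), MvPowerSeries.coeff d (w ^ r) • a r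
  rw [Finset.smul_sum]
  exact Finset.sum_congr rfl fun r _ => smul_comm _ _ _

theorem subs_sub (a b : ℕ → A) (w : MvPowerSeries σ Ch) :
    subs (fun r => a r - b r) w = subs a w - subs b w := by
  refine MvPowerSeries.ext fun d => ?_
  change ∑ r ∈ Finset.range (d.degree + 1), MvPowerSeries.coeff d (w ^ r) • (a r - b r) =
    (∑ r ∈ Finset.range (d.degree + 1), MvPowerSeries.coeff d (w ^ r) • a r) -
    ∑ r ∈ Finset.range (d.degree + 1), MvPowerSeries.coeff d (w ^ r) • b r
  simp only [smul_sub, Finset.sum_sub_distrib]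

theorem subs_const {w : MvPowerSeries σ Ch} (hw : MvPowerSeries.constantCoeff w = 0) (a : A) :
    subs (fun r => if r = 0 then a else 0) w = MvPowerSeries.C a := by
  rw [subs_eq_subsHom hw]
  have : PowerSeries.mk (fun r => if r = 0 then a else 0) = PowerSeries.C a :=
    PowerSeries.ext fun n => by simp [PowerSeries.coeff_C]
  rw [this]
  exact substHom_C _ _

theorem mser_serPlus {w : MvPowerSeries σ Ch} (hw : MvPowerSeries.constantCoeff w = 0)
    (x : Fin N → Fin N → ℕ → A) :
    mser (serPlus x) w = 1 - hbar • mser (fun r => Matrix.of fun i j => x i j r) w := by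
  ext a b : 1
  change subs (fun r => (if r = 0 then (1 : Matrix (Fin N) (Fin N) A) else 0) a b -
    hbar • x a b r) w = (1 : Matrix (Fin N) (Fin N) (MvPowerSeries σ A)) a b -
      hbar • subs (fun r => x a b r) w
  rw [subs_sub, subs_smul]
  congr 1
  have : (fun r => (if r = 0 then (1 : Matrix (Fin N) (Fin N) A) else 0) a b) =
      fun r : ℕ => if r = 0 then (1 : Matrix (Fin N) (Fin N) A) a b else 0 := by
    funext r
    split_ifs <;> rfl
  rw [this, subs_const hw, Matrix.one_apply, Matrix.one_apply]
  split_ifs <;> simp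

theorem oneModH_serPlus {w : MvPowerSeries σ Ch} (hw : MvPowerSeries.constantCoeff w = 0)
    (x : Fin N → Fin N → ℕ → A) : OneModH (mser (serPlus x) w) := by
  rw [mser_serPlus hw]
  exact OneModH.one.sub _

theorem mser_mul {w : MvPowerSeries σ Ch} (hw : MvPowerSeries.constantCoeff w = 0)
    (T T' : ℕ → Matrix (Fin N) (Fin N) A) :
    mser T w * mser T' w =
      mser (fun k => ∑ p ∈ Finset.HasAntidiagonal.antidiagonal k, T p.1 * T' p.2) w := by
  ext a b : 1
  rw [Matrix.mul_apply]
  change ∑ c, subs (fun r => T r a c) w * subs (fun r => T' r c b) w =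
    subs (fun k => (∑ p ∈ Finset.HasAntidiagonal.antidiagonal k, T p.1 * T' p.2) a b) w
  simp only [subs_eq_subsHom hw, ← map_mul, ← map_sum]
  congr 1
  refine PowerSeries.ext fun k => ?_
  rw [map_sum, PowerSeries.coeff_mk, Matrix.sum_apply]
  simp only [PowerSeries.coeff_mul, PowerSeries.coeff_mk, Matrix.mul_apply]
  rw [Finset.sum_comm]

theorem coeff_subs_first (a : ℕ → A) (p q : ℕ) :
    MvPowerSeries.coeff (ex p q) (subs a 𝐮) = if q = 0 then a p else 0 := by
  rw [coeff_subs_X, ex_zero]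
  refine if_congr ?_ rfl rfl
  have : Finsupp.single (0 : Fin 2) p = ex p 0 := by simp [ex]
  rw [this, ex_inj]
  simp

theorem coeff_subs_second (a : ℕ → A) (p q : ℕ) :
    MvPowerSeries.coeff (ex p q) (subs a 𝐯) = if p = 0 then a q else 0 := by
  rw [coeff_subs_X, ex_one]
  refine if_congr ?_ rfl rfl
  have : Finsupp.single (1 : Fin 2) q = ex 0 q := by simp [ex]
  rw [this, ex_inj]
  simp

theorem ex_add (p q p' q' : ℕ) : ex p q + ex p' q' = ex (p + p') (q + q') := by
  ext i
  fin_cases i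
  · simp [ex]
  · simp [ex]

theorem coeff_ex_mul {A : Type*} [Ring A] (f g : MvPowerSeries (Fin 2) A) (k r : ℕ) :
    MvPowerSeries.coeff (ex k r) (f * g) =
      ∑ p ∈ Finset.HasAntidiagonal.antidiagonal k, ∑ q ∈ Finset.HasAntidiagonal.antidiagonal r,
        MvPowerSeries.coeff (ex p.1 q.1) f * MvPowerSeries.coeff (ex p.2 q.2) g := by
  rw [MvPowerSeries.coeff_mul, ← Finset.sum_product']
  refine Finset.sum_nbij' (fun p => ((p.1 0, p.2 0), (p.1 1, p.2 1)))
    (fun p => (ex p.1.1 p.2.1, ex p.1.2 p.2.2)) ?_ ?_ ?_ ?_ ?_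
  · intro p hp
    rw [Finset.HasAntidiagonal.mem_antidiagonal] at hp
    rw [Finset.mem_product, Finset.HasAntidiagonal.mem_antidiagonal,
      Finset.HasAntidiagonal.mem_antidiagonal]
    have h0 := DFunLike.congr_fun hp 0
    have h1 := DFunLike.congr_fun hp 1
    rw [ex_zero] at h0
    rw [ex_one] at h1
    exact ⟨h0, h1⟩
  · intro p hp
    rw [Finset.mem_product, Finset.HasAntidiagonal.mem_antidiagonal,
      Finset.HasAntidiagonal.mem_antidiagonal] at hp
    rw [Finset.HasAntidiagonal.mem_antidiagonal, ex_add, hp.1, hp.2]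
  · intro p _
    simp only [← eq_ex]
  · intro p _
    simp only [ex_zero, ex_one]
  · intro p _
    simp only [← eq_ex]

theorem coeff_mul_subs_first (f : MvPowerSeries (Fin 2) A) (a : ℕ → A) (k r : ℕ) :
    MvPowerSeries.coeff (ex k r) (f * subs a 𝐮) =
      ∑ p ∈ Finset.HasAntidiagonal.antidiagonal k,
        MvPowerSeries.coeff (ex p.1 r) f * a p.2 := by
  rw [coeff_ex_mul]
  refine Finset.sum_congr rfl fun p _ => ?_
  rw [Finset.sum_eq_single (r, 0)]
  · rw [coeff_subs_first, if_pos rfl]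
  · intro q hq hne
    rw [coeff_subs_first, if_neg, mul_zero]
    intro h0
    rw [Finset.HasAntidiagonal.mem_antidiagonal, h0, add_zero] at hq
    exact hne (Prod.ext hq h0)
  · intro h
    exact absurd (Finset.HasAntidiagonal.mem_antidiagonal.2 (add_zero r)) h

theorem coeff_subs_mul_subs (a b : ℕ → A) (k r : ℕ) :
    MvPowerSeries.coeff (ex k r) (subs a 𝐮 * subs b 𝐯) = a k * b r := by
  rw [coeff_ex_mul, Finset.sum_eq_single (k, 0), Finset.sum_eq_single (0, r)]
  · rw [coeff_subs_first, coeff_subs_second, if_pos rfl, if_pos rfl]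
  · intro q hq hne
    rw [coeff_subs_first, if_neg, zero_mul]
    intro h0
    rw [Finset.HasAntidiagonal.mem_antidiagonal, h0, zero_add] at hq
    exact hne (Prod.ext h0 hq)
  · intro h
    exact absurd (Finset.HasAntidiagonal.mem_antidiagonal.2 (zero_add r)) h
  · intro p hp hne
    refine Finset.sum_eq_zero fun q _ => ?_
    rw [coeff_subs_second, if_neg, mul_zero]
    intro h0
    rw [Finset.HasAntidiagonal.mem_antidiagonal, h0, add_zero] at hp
    exact hne (Prod.ext hp h0)
  · intro h
    exact absurd (Finset.HasAntidiagonal.mem_antidiagonal.2 (add_zero k)) h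

end Ser

/-! ### Evaluation homomorphisms -/

section Eval

variable {N : ℕ}

/-- Operators of the dual Yangian with values in a matrix algebra. -/
abbrev MatY (N : ℕ) : Type := Matrix (Fin N) (Fin N) (Yp N)

/-- The embedding of the dual Yangian as scalar matrices. -/
def diagY (N : ℕ) : Yp N →ₐ[Ch] MatY N := Matrix.scalarAlgHom (Fin N) Ch

theorem diagY_apply (x : Yp N) (a b : Fin N) : diagY N x a b = if a = b then x else 0 := by
  change Matrix.scalar (Fin N) x a b = _
  rw [Matrix.scalar_apply, Matrix.diagonal_apply]

variable {σ : Type*}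

/-- The matrix units, as constant series. -/
def unitSer (N : ℕ) (σ : Type*) (i j : Fin N) : MvPowerSeries σ (MatY N) :=
  MvPowerSeries.C (Matrix.single i j 1)

theorem unitSer_mul (i j k l : Fin N) :
    unitSer N σ i j * unitSer N σ k l = if j = k then unitSer N σ i l else 0 := by
  rw [unitSer, unitSer, ← map_mul]
  split_ifs with h
  · subst h
    rw [Matrix.single_mul_single_same, mul_one]
    rfl
  · rw [Matrix.single_mul_single_of_ne _ _ _ _ h, map_zero]

theorem substHom_unitSer [Fintype σ] {τ : Type*} {w : σ → MvPowerSeries τ Ch}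
    (hw : ∀ t, MvPowerSeries.constantCoeff (w t) = 0) (i j : Fin N) :
    substHom w hw (unitSer N σ i j) = unitSer N τ i j :=
  substHom_C _ _

/-- The series `T(w)` as scalar matrices. -/
def tDiag (N : ℕ) (w : MvPowerSeries σ Ch) :
    Matrix (Fin N) (Fin N) (MvPowerSeries σ (MatY N)) :=
  mser (fun r => (tY N r).map (diagY N)) w

theorem tDiag_comm (w : MvPowerSeries σ Ch) (i j k l : Fin N) :
    tDiag N w i j * unitSer N σ k l = unitSer N σ k l * tDiag N w i j := by
  refine MvPowerSeries.ext fun d => ?_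
  rw [unitSer, MvPowerSeries.coeff_C_mul, MvPowerSeries.coeff_mul_C]
  change (∑ r ∈ Finset.range (d.degree + 1),
    MvPowerSeries.coeff d (w ^ r) • diagY N (tY N r i j)) * Matrix.single k l 1 =
      Matrix.single k l 1 * (∑ r ∈ Finset.range (d.degree + 1),
    MvPowerSeries.coeff d (w ^ r) • diagY N (tY N r i j))
  rw [Finset.sum_mul, Finset.mul_sum]
  refine Finset.sum_congr rfl fun r _ => ?_
  rw [smul_mul_assoc, mul_smul_comm]
  congr 1
  ext a b
  simp only [Matrix.mul_apply, diagY_apply, Matrix.single_apply]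
  rw [Finset.sum_eq_single a, Finset.sum_eq_single b]
  · by_cases h1 : k = a <;> by_cases h2 : l = b <;> simp [h1, h2]
  · intro c _ hc
    simp [hc]
  · simp
  · intro c _ hc
    simp [hc.symm]
  · simp

theorem rtt_tDiag {w w' : MvPowerSeries σ Ch} (hw : MvPowerSeries.constantCoeff w = 0)
    (hw' : MvPowerSeries.constantCoeff w' = 0) :
    RTT (w - w') (hC Ch) (tDiag N w) (tDiag N w') := by
  have := (rtt_tY (N := N)).mser_subst hw hw'
  rw [map_sub, substHom_X', substHom_X', substHom_hC] at this
  exact this.mser_map (diagY N)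

theorem optSubst_second {A : Type*} [Ring A] [Algebra Ch A] [Fintype σ]
    (T : ℕ → Matrix (Fin N) (Fin N) A) (i : σ) :
    (mser T 𝐯).map (optSubst i) = mser T (MvPowerSeries.X (some i)) := by
  have := mser_subst T (w := 𝐯) (by simp) (v := fun t => (MvPowerSeries.X (optPair i t) :
    MvPowerSeries (Option σ) Ch)) fun _ => MvPowerSeries.constantCoeff_X _
  rw [substHom_X'] at this
  exact this

theorem comm_one_sub {S R : Type*} [CommRing S] [Ring R] [Algebra S R]
    {ε T : Matrix (Fin N) (Fin N) R} (h : ∀ a b c d, ε a b * T c d = T c d * ε a b) (κ : S)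
    (a b c d : Fin N) : (1 - κ • ε) a b * T c d = T c d * (1 - κ • ε) a b := by
  rw [Matrix.sub_apply, Matrix.smul_apply, sub_mul, mul_sub, smul_mul_assoc, mul_smul_comm, h,
    Matrix.one_apply]
  split_ifs <;> simp

/-- The entries of a series of matrices. -/
def ent (a b : Fin N) (f : MvPowerSeries σ (MatY N)) : MvPowerSeries σ (Yp N) :=
  fun d => MvPowerSeries.coeff d f a b

theorem coeff_ent (a b : Fin N) (f : MvPowerSeries σ (MatY N)) (d : σ →₀ ℕ) :
    MvPowerSeries.coeff d (ent a b f) = MvPowerSeries.coeff d f a b := rfl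

theorem ent_smul (a b : Fin N) (s : MvPowerSeries σ Ch) (f : MvPowerSeries σ (MatY N)) :
    ent a b (s • f) = s • ent a b f := by
  classical
  refine MvPowerSeries.ext fun d => ?_
  rw [coeff_ent, coeff_series_smul, coeff_series_smul, Matrix.sum_apply]
  rfl

theorem ent_sub (a b : Fin N) (f g : MvPowerSeries σ (MatY N)) :
    ent a b (f - g) = ent a b f - ent a b g := by
  refine MvPowerSeries.ext fun d => ?_
  rw [coeff_ent, map_sub, map_sub]
  rfl

theorem ent_tDiag (a b : Fin N) (w : MvPowerSeries σ Ch) (i j : Fin N) :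
    ent a b (tDiag N w i j) = if a = b then mser (tY N) w i j else 0 := by
  refine MvPowerSeries.ext fun d => ?_
  rw [coeff_ent]
  change (∑ r ∈ Finset.range (d.degree + 1),
    MvPowerSeries.coeff d (w ^ r) • diagY N (tY N r i j)) a b = _
  rw [Matrix.sum_apply]
  simp only [Matrix.smul_apply, diagY_apply]
  split_ifs
  · rfl
  · simp

theorem ent_unitSer_mul (a b c i : Fin N) (f : MvPowerSeries σ (MatY N)) :
    ent a b (unitSer N σ c i * f) = if a = c then ent i b f else 0 := by
  refine MvPowerSeries.ext fun d => ?_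
  rw [coeff_ent, unitSer, MvPowerSeries.coeff_C_mul]
  split_ifs with h
  · subst h
    rw [Matrix.single_mul_apply_same, one_mul, coeff_ent]
  · rw [Matrix.single_mul_apply_of_ne _ _ _ _ _ h, map_zero]

variable {κ ρ : MvPowerSeries (Fin 2) Ch}

theorem optSubst_one_sub (i : Fin 2) (e : Fin N → Fin N → Fin N × Fin N) :
    (1 - κ • Matrix.of fun a b => unitSer N (Fin 2) (e a b).1 (e a b).2).map (optSubst i) =
      1 - optSubst i κ •
        Matrix.of fun a b => unitSer N (Option (Fin 2)) (e a b).1 (e a b).2 := by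
  ext a b : 1
  rw [Matrix.map_apply, Matrix.sub_apply, Matrix.sub_apply, map_sub, Matrix.smul_apply,
    Matrix.smul_apply, optSubst_smul]
  congr 1
  · rw [Matrix.one_apply, Matrix.one_apply]
    split_ifs <;> simp
  · congr 1
    exact substHom_unitSer _ _ _

theorem optSubst_smul_mul (i : Fin 2)
    (X Y : Matrix (Fin N) (Fin N) (MvPowerSeries (Fin 2) (MatY N))) :
    (ρ • (X * Y)).map (optSubst i) =
      optSubst i ρ • (X.map (optSubst i) * Y.map (optSubst i)) := by
  rw [← Matrix.map_mul]
  ext a b : 1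
  exact optSubst_smul i ρ _

theorem oneModH_tDiag : OneModH (tDiag N 𝐯) := by
  have e : tDiag N 𝐯 = mser (serPlus fun i j r => diagY N (yNeg (N := N) i j r)) 𝐯 := by
    rw [tDiag]
    congr 1
    funext r
    exact serPlus_map _ _ _
  rw [e]
  exact oneModH_serPlus (by simp) _

theorem tDiag_optSubst (i : Fin 2) :
    (tDiag N 𝐯).map (optSubst i) = tDiag N (MvPowerSeries.X (some i)) :=
  optSubst_second _ i

/-- The homomorphism `T₁(v) ↦ ρ (1 - κ P₀₁) T₁(v)` from the dual Yangian to matrices over it. -/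
theorem exists_homV (hκ : ∃ g, κ = hC Ch * g) (hρ : ∃ g, ρ = 1 + hC Ch * g)
    (h : (MvPowerSeries.X (some 0) - MvPowerSeries.X (some 1) :
        MvPowerSeries (Option (Fin 2)) Ch) * (optSubst 0 κ * optSubst 1 κ) =
      -(hC Ch * (optSubst 0 κ - optSubst 1 κ))) :
    ∃ ψ : Yp N →ₐ[Ch] PowerSeries (MatY N), ∀ i j r k a b,
      PowerSeries.coeff k (ψ (tY N r i j)) a b =
        MvPowerSeries.coeff (ex k r) (ρ • ((if a = b then mser (tY N) 𝐯 i j else 0) -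
          κ • if i = b then mser (tY N) 𝐯 a j else 0)) := by
  obtain ⟨g, hg⟩ := hκ
  obtain ⟨M', hM'⟩ : OneModH (ρ • ((1 - κ • Matrix.of fun a b => unitSer N (Fin 2) b a) *
      tDiag N 𝐯)) := by
    refine OneModH.smul hρ (OneModH.mul ?_ oneModH_tDiag)
    rw [hg, hC_mul_smul_matrix]
    exact OneModH.one.sub _
  have hR : RTT (MvPowerSeries.X (some 0) - MvPowerSeries.X (some 1) :
      MvPowerSeries (Option (Fin 2)) Ch) (hC Ch)
      ((ρ • ((1 - κ • Matrix.of fun a b => unitSer N (Fin 2) b a) *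
        tDiag N 𝐯)).map (optSubst (σ := Fin 2) 0))
      ((ρ • ((1 - κ • Matrix.of fun a b => unitSer N (Fin 2) b a) *
        tDiag N 𝐯)).map (optSubst (σ := Fin 2) 1)) := by
    rw [optSubst_smul_mul, optSubst_smul_mul, tDiag_optSubst, tDiag_optSubst,
      optSubst_one_sub 0 fun a b => (b, a), optSubst_one_sub 1 fun a b => (b, a)]
    exact RTT.smul (RTT.mul (RTT.evalV (fun i j k l => unitSer_mul _ _ _ _) h)
      (rtt_tDiag (by simp) (by simp))
      (comm_one_sub (fun _ _ _ _ => (tDiag_comm _ _ _ _ _).symm) _)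
      (comm_one_sub (fun _ _ _ _ => (tDiag_comm _ _ _ _ _).symm) _)) _ _
  obtain ⟨ψ, hψ⟩ := Yp.exists_hom (N := N) (HTF.pres (dualRel N)).matrix _ M' hM' hR
  refine ⟨ψ, fun i j r k a b => ?_⟩
  rw [hψ, ← coeff_ent]
  congr 1
  rw [Matrix.smul_apply, sub_mul, one_mul, smul_mul_assoc, Matrix.sub_apply, Matrix.smul_apply,
    ent_smul, ent_sub, ent_smul, ent_tDiag]
  congr 3
  have : ent a b (((Matrix.of fun a b => unitSer N (Fin 2) b a) * tDiag N 𝐯) i j) =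
      ∑ c, ent a b (unitSer N (Fin 2) c i * tDiag N 𝐯 c j) := by
    refine MvPowerSeries.ext fun d => ?_
    rw [coeff_ent, Matrix.mul_apply, map_sum, map_sum, Matrix.sum_apply]
    rfl
  rw [this]
  simp only [ent_unitSer_mul, ent_tDiag]
  rw [Finset.sum_ite_eq, if_pos (Finset.mem_univ _)]

/-- The homomorphism `T₁(v) ↦ ρ T₁(v) (1 - κ P₀₁)`, transposed in the tensor factor `0`, from the
dual Yangian to matrices over it. -/
theorem exists_homU (hκ : ∃ g, κ = hC Ch * g) (hρ : ∃ g, ρ = 1 + hC Ch * g)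
    (h : (MvPowerSeries.X (some 0) - MvPowerSeries.X (some 1) :
        MvPowerSeries (Option (Fin 2)) Ch) * (optSubst 0 κ * optSubst 1 κ) =
      hC Ch * (optSubst 0 κ - optSubst 1 κ)) :
    ∃ ψ : Yp N →ₐ[Ch] PowerSeries (MatY N), ∀ i j r k a b,
      PowerSeries.coeff k (ψ (tY N r i j)) a b =
        MvPowerSeries.coeff (ex k r) (ρ • ((if a = b then mser (tY N) 𝐯 i j else 0) -
          κ • if b = j then mser (tY N) 𝐯 i a else 0)) := by
  obtain ⟨g, hg⟩ := hκ
  obtain ⟨M', hM'⟩ : OneModH (ρ • (tDiag N 𝐯 *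
      (1 - κ • Matrix.of fun a b => unitSer N (Fin 2) a b))) := by
    refine OneModH.smul hρ (OneModH.mul oneModH_tDiag ?_)
    rw [hg, hC_mul_smul_matrix]
    exact OneModH.one.sub _
  have hR : RTT (MvPowerSeries.X (some 0) - MvPowerSeries.X (some 1) :
      MvPowerSeries (Option (Fin 2)) Ch) (hC Ch)
      ((ρ • (tDiag N 𝐯 *
      (1 - κ • Matrix.of fun a b => unitSer N (Fin 2) a b))).map (optSubst (σ := Fin 2) 0))
      ((ρ • (tDiag N 𝐯 *
      (1 - κ • Matrix.of fun a b => unitSer N (Fin 2) a b))).map (optSubst (σ := Fin 2) 1)) := by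
    rw [optSubst_smul_mul, optSubst_smul_mul, tDiag_optSubst, tDiag_optSubst,
      optSubst_one_sub 0 fun a b => (a, b), optSubst_one_sub 1 fun a b => (a, b)]
    exact RTT.smul (RTT.mul (rtt_tDiag (by simp) (by simp))
      (RTT.evalU (fun i j k l => unitSer_mul _ _ _ _) h)
      (fun a b c d => (comm_one_sub (fun _ _ _ _ => (tDiag_comm _ _ _ _ _).symm) _ c d a b).symm)
      (fun a b c d => (comm_one_sub (fun _ _ _ _ => (tDiag_comm _ _ _ _ _).symm) _ c d a b).symm))
      _ _
  obtain ⟨ψ, hψ⟩ := Yp.exists_hom (N := N) (HTF.pres (dualRel N)).matrix _ M' hM' hR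
  refine ⟨ψ, fun i j r k a b => ?_⟩
  rw [hψ, ← coeff_ent]
  congr 1
  rw [Matrix.smul_apply, mul_sub, mul_one, mul_smul_comm, Matrix.sub_apply, Matrix.smul_apply,
    ent_smul, ent_sub, ent_smul, ent_tDiag]
  congr 3
  have : ent a b ((tDiag N 𝐯 * (Matrix.of fun a b => unitSer N (Fin 2) a b)) i j) =
      ∑ c, ent a b (unitSer N (Fin 2) c j * tDiag N 𝐯 i c) := by
    refine MvPowerSeries.ext fun d => ?_
    simp only [← tDiag_comm]
    rw [coeff_ent, Matrix.mul_apply, map_sum, map_sum, Matrix.sum_apply]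
    rfl
  rw [this]
  simp only [ent_unitSer_mul, ent_tDiag]
  rw [Finset.sum_ite_eq, if_pos (Finset.mem_univ _)]
  simp only [eq_comm]

end Eval

/-! ### Embedding tensor factors -/

section Emb

variable {N m n : ℕ} {R : Type*} [Ring R]

/-- The operator `X` acting in the tensor factors `ι 0, ι 1, …`. -/
def embFun (ι : Fin m → Fin n) (X : Ten N m R) : Ten N n R :=
  Matrix.of fun a b => if ∀ l, l ∉ Set.range ι → a l = b l then X (a ∘ ι) (b ∘ ι) else 0

theorem embFun_apply (ι : Fin m → Fin n) (X : Ten N m R) (a b : Fin n → Fin N) :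
    embFun ι X a b = if ∀ l, l ∉ Set.range ι → a l = b l then X (a ∘ ι) (b ∘ ι) else 0 := rfl

theorem comp_range_ext {ι : Fin m → Fin n} {a b : Fin n → Fin N}
    (h : ∀ l, l ∉ Set.range ι → a l = b l) (h' : a ∘ ι = b ∘ ι) : a = b := by
  ext l : 1
  by_cases hl : l ∈ Set.range ι
  · obtain ⟨t, rfl⟩ := hl
    exact congrFun h' t
  · exact h l hl

/-- The operators acting in the tensor factors `ι 0, ι 1, …`, as a ring homomorphism. -/
def emb (ι : Fin m → Fin n) (hι : Function.Injective ι) : Ten N m R →+* Ten N n R where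
  toFun := embFun ι
  map_zero' := by
    ext a b
    simp [embFun_apply]
  map_add' X Y := by
    ext a b
    simp only [embFun_apply, Matrix.add_apply]
    split_ifs <;> simp
  map_one' := by
    ext a b
    rw [embFun_apply, Matrix.one_apply, Matrix.one_apply]
    by_cases h : a = b
    · subst h; simp
    · rw [if_neg h]
      split_ifs with h1 h2
      · exact absurd (comp_range_ext h1 h2) h
      · rfl
      · rfl
  map_mul' X Y := by
    ext a b
    rw [embFun_apply, Matrix.mul_apply, Matrix.mul_apply]
    have hext : ∀ (d : Fin m → Fin N), Function.extend ι d a ∘ ι = d := fun d =>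
      Function.extend_comp hι d a
    have hext' : ∀ (d : Fin m → Fin N) l, l ∉ Set.range ι → Function.extend ι d a l = a l :=
      fun d l hl => Function.extend_apply' d a l hl
    split_ifs with h
    · refine Finset.sum_of_injOn (fun d => Function.extend ι d a) ?_ (by simp) ?_ ?_
      · intro d _ d' _ hd
        have := congrArg (fun c => c ∘ ι) hd
        simpa only [hext] using this
      · intro c _ hc
        rw [embFun_apply, if_neg, zero_mul]
        intro h'
        refine hc ⟨c ∘ ι, by simp, comp_range_ext (ι := ι) ?_ (hext _)⟩
        intro l hl
        exact (hext' _ l hl).trans (h' l hl)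
      · intro d _
        rw [embFun_apply, embFun_apply, if_pos, if_pos]
        · rw [hext]
        · intro l hl
          rw [hext' _ l hl, h l hl]
        · intro l hl
          rw [hext' _ l hl]
    · symm
      refine Finset.sum_eq_zero fun c _ => ?_
      rw [embFun_apply, embFun_apply]
      split_ifs with h1 h2
      · exact absurd (fun l hl => (h1 l hl).trans (h2 l hl)) h
      · rw [mul_zero]
      · rw [zero_mul]
      · rw [zero_mul]

variable {ι : Fin m → Fin n} (hι : Function.Injective ι)

theorem emb_apply (X : Ten N m R) (a b : Fin n → Fin N) :
    emb ι hι X a b = if ∀ l, l ∉ Set.range ι → a l = b l then X (a ∘ ι) (b ∘ ι) else 0 := rfl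

theorem emb_smul {S : Type*} [CommRing S] [Algebra S R] (s : S) (X : Ten N m R) :
    emb ι hι (s • X) = s • emb ι hι X := by
  ext a b
  rw [emb_apply, Matrix.smul_apply, Matrix.smul_apply, emb_apply]
  split_ifs <;> simp

theorem emb_site (i : Fin m) (M : Matrix (Fin N) (Fin N) R) :
    emb ι hι (site i M) = site (ι i) M := by
  ext a b
  rw [emb_apply, site_apply, site_apply]
  by_cases h : ∀ k, k ≠ ι i → a k = b k
  · rw [if_pos h, if_pos, if_pos]
    · rfl
    · exact fun k hk => h _ fun h' => hk (hι h')
    · exact fun l hl => h l fun h' => hl ⟨i, h'.symm⟩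
  · rw [if_neg h]
    split_ifs with h1 h2
    · refine absurd (fun k hk => ?_) h
      by_cases hk' : k ∈ Set.range ι
      · obtain ⟨t, rfl⟩ := hk'
        exact h2 t fun h' => hk (by rw [h'])
      · exact h1 k hk'
    · rfl
    · rfl

theorem emb_perm (i j : Fin m) :
    emb ι hι (perm i j : Ten N m R) = perm (ι i) (ι j) := by
  ext a b
  rw [emb_apply, perm_eq, perm_eq]
  simp only [permOp, Matrix.of_apply]
  have key : ∀ l, l ∉ Set.range ι → Equiv.swap (ι i) (ι j) l = l := fun l hl =>
    Equiv.swap_apply_of_ne_of_ne (fun h => hl ⟨i, h.symm⟩) (fun h => hl ⟨j, h.symm⟩)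
  have key' : ∀ t, Equiv.swap (ι i) (ι j) (ι t) = ι (Equiv.swap i j t) := fun t =>
    (hι.map_swap i j t).symm
  by_cases h : a = b ∘ Equiv.swap (ι i) (ι j)
  · rw [if_pos h, if_pos, if_pos]
    · ext t : 1
      simp only [h, Function.comp, key']
    · intro l hl
      simp only [h, Function.comp, key l hl]
  · rw [if_neg h]
    split_ifs with h1 h2
    · refine absurd (comp_range_ext (ι := ι) ?_ ?_) h
      · intro l hl
        simp only [Function.comp, key l hl, h1 l hl]
      · ext t : 1
        rw [h2]
        simp only [Function.comp, key']
    · rfl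
    · rfl

theorem emb_rm {S : Type*} [CommRing S] [Algebra S R] (α β : S) (i j : Fin m) :
    emb ι hι (rm α β i j : Ten N m R) = rm α β (ι i) (ι j) := by
  rw [rm, rm, map_sub, emb_smul, emb_smul, map_one, emb_perm]

theorem pair_injective {i j : Fin n} (hij : i ≠ j) : Function.Injective ![i, j] := by
  intro a b h
  fin_cases a <;> fin_cases b <;> simp_all [eq_comm]

end Emb

/-! ### Operators on the dual Yangian -/

section Operators

variable {N : ℕ}

theorem coeff_ch_smul {A : Type*} [Ring A] [Algebra Ch A] (k : ℕ) (c : Ch) (f : PowerSeries A) :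
    PowerSeries.coeff k (c • f) = c • PowerSeries.coeff k f := rfl

/-- The algebra of endomorphisms of a module over the ground ring. -/
def Op (M : Type*) [AddCommGroup M] [Module Ch M] : Type _ := M →ₗ[Ch] M

section Op

variable {M : Type*} [AddCommGroup M] [Module Ch M]

instance : Ring (Op M) := inferInstanceAs (Ring (Module.End Ch M))

instance : Algebra Ch (Op M) := inferInstanceAs (Algebra Ch (Module.End Ch M))

instance : FunLike (Op M) M M := inferInstanceAs (FunLike (M →ₗ[Ch] M) M M)

instance : LinearMapClass (Op M) Ch M M :=
  inferInstanceAs (LinearMapClass (M →ₗ[Ch] M) Ch M M)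

/-- A linear endomorphism as an element of the algebra of endomorphisms. -/
def Op.of (f : M →ₗ[Ch] M) : Op M := f

theorem Op.ext {f g : Op M} (h : ∀ x, f x = g x) : f = g := LinearMap.ext h

theorem Op.zero_apply (x : M) : (0 : Op M) x = 0 := rfl

theorem Op.one_apply (x : M) : (1 : Op M) x = x := rfl

theorem Op.add_apply (f g : Op M) (x : M) : (f + g) x = f x + g x := rfl

theorem Op.sub_apply (f g : Op M) (x : M) : (f - g) x = f x - g x := rfl

theorem Op.mul_apply (f g : Op M) (x : M) : (f * g) x = f (g x) := rfl

theorem Op.smul_apply (c : Ch) (f : Op M) (x : M) : (c • f) x = c • f x := rfl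

/-- Evaluation at a vector, as a linear map. -/
def Op.eval (x : M) : Op M →ₗ[Ch] M where
  toFun f := f x
  map_add' _ _ := rfl
  map_smul' _ _ := rfl

theorem Op.sum_apply {ι : Type*} (s : Finset ι) (f : ι → Op M) (x : M) :
    (∑ i ∈ s, f i) x = ∑ i ∈ s, f i x := map_sum (Op.eval x) f s

theorem HTF.op (hM : HTF M) : HTF (Op M) := HTF.linearMap hM

end Op

/-- The algebra of operators on the dual Yangian. -/
abbrev EndY (N : ℕ) : Type := Op (Yp N)

/-- The coefficients of the matrix entries of a homomorphism to matrix series, as operators. -/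
def opE (ψ : Yp N →ₐ[Ch] PowerSeries (MatY N)) (k : ℕ) (a b : Fin N) : EndY N :=
  Op.of
    { toFun := fun x => PowerSeries.coeff k (ψ x) a b
      map_add' := fun x y => by rw [map_add, map_add, Matrix.add_apply]
      map_smul' := fun c x => by
        rw [map_smul]
        rfl }

theorem opE_apply (ψ : Yp N →ₐ[Ch] PowerSeries (MatY N)) (k : ℕ) (a b : Fin N) (x : Yp N) :
    opE ψ k a b x = PowerSeries.coeff k (ψ x) a b := rfl

/-- Left multiplication. -/
def lamY (N : ℕ) : Yp N →ₐ[Ch] EndY N :=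
  (Algebra.lmul Ch (Yp N) : Yp N →ₐ[Ch] Module.End Ch (Yp N))

theorem lamY_apply (x y : Yp N) : lamY N x y = x * y := rfl

theorem opE_one (ψ : Yp N →ₐ[Ch] PowerSeries (MatY N)) (k : ℕ) (a b : Fin N) :
    opE ψ k a b 1 = if k = 0 then (1 : MatY N) a b else 0 := by
  rw [opE_apply, map_one, PowerSeries.coeff_one]
  split_ifs <;> simp

theorem opE_exchange (ψ : Yp N →ₐ[Ch] PowerSeries (MatY N)) (y : ℕ → Yp N) (a b : Fin N)
    (Z : Fin N → MvPowerSeries (Fin 2) (Yp N))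
    (hZ : ∀ k r c, PowerSeries.coeff k (ψ (y r)) a c = MvPowerSeries.coeff (ex k r) (Z c)) :
    subs (fun k => opE ψ k a b) 𝐮 * subs (fun r => lamY N (y r)) 𝐯 =
      ∑ c, MvPowerSeries.map (lamY N).toRingHom (Z c) * subs (fun k => opE ψ k c b) 𝐮 := by
  refine MvPowerSeries.ext fun d => ?_
  rw [eq_ex d, coeff_subs_mul_subs, map_sum]
  refine Op.ext fun x => ?_
  rw [Op.sum_apply]
  change PowerSeries.coeff (d 0) (ψ (y (d 1) * x)) a b = _
  rw [map_mul, PowerSeries.coeff_mul, Matrix.sum_apply]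
  simp only [Matrix.mul_apply, coeff_mul_subs_first, Op.sum_apply]
  rw [Finset.sum_comm]
  refine Finset.sum_congr rfl fun c _ => Finset.sum_congr rfl fun p _ => ?_
  rw [hZ]
  rfl

/-- The series `T⁺(w)` acting by left multiplication. -/
def tE (N : ℕ) (r : ℕ) : Matrix (Fin N) (Fin N) (EndY N) := (tY N r).map (lamY N)

theorem map_lam_mser (w : MvPowerSeries (Fin 2) Ch) (i j : Fin N) :
    MvPowerSeries.map (lamY N).toRingHom (mser (tY N) w i j) = mser (tE N) w i j :=
  map_subs (lamY N) (fun r => tY N r i j) w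

variable {κ ρ : MvPowerSeries (Fin 2) Ch}

theorem mul_site_site_rm {S R : Type*} [CommRing S] [Ring R] [Algebra S R]
    (M T : Matrix (Fin N) (Fin N) R) (s α β : S) (a b : Fin 2 → Fin N) :
    (site 1 T * site 0 M * (s • rm α β 0 1) : Ten N 2 R) a b =
      s • (α • (T (a 1) (b 1) * M (a 0) (b 0)) - β • (T (a 1) (b 0) * M (a 0) (b 1))) := by
  rw [mul_smul_comm, Matrix.smul_apply, mul_rm_apply,
    site_mul_site_apply (by decide), site_mul_site_apply (by decide),
    if_pos (fun k h0 h1 => by fin_cases k <;> simp_all),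
    if_pos (fun k h0 h1 => by fin_cases k <;> simp_all)]
  simp

theorem rm_mul_site_site {S R : Type*} [CommRing S] [Ring R] [Algebra S R]
    (M T : Matrix (Fin N) (Fin N) R) (s α β : S) (a b : Fin 2 → Fin N) :
    ((s • rm α β 0 1) * site 1 T * site 0 M : Ten N 2 R) a b =
      s • (α • (T (a 1) (b 1) * M (a 0) (b 0)) - β • (T (a 0) (b 1) * M (a 1) (b 0))) := by
  rw [smul_mul_assoc, smul_mul_assoc, mul_assoc, Matrix.smul_apply, rm_mul_apply,
    site_mul_site_apply (by decide), site_mul_site_apply (by decide),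
    if_pos (fun k h0 h1 => by fin_cases k <;> simp_all),
    if_pos (fun k h0 h1 => by fin_cases k <;> simp_all)]
  simp

theorem site_site_two {R : Type*} [Ring R] (M T : Matrix (Fin N) (Fin N) R)
    (a b : Fin 2 → Fin N) :
    (site 0 M * site 1 T : Ten N 2 R) a b = M (a 0) (b 0) * T (a 1) (b 1) := by
  rw [site_mul_site_apply (by decide), if_pos (fun k h0 h1 => by fin_cases k <;> simp_all)]

theorem sum_smul_sub_mul {ι σ A A' : Type*} [Fintype ι] [Ring A] [Algebra Ch A] [Ring A']
    [Algebra Ch A'] (φ : A →ₐ[Ch] A') (s t : MvPowerSeries σ Ch) (f g : ι → MvPowerSeries σ A)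
    (x : ι → MvPowerSeries σ A') :
    ∑ c, MvPowerSeries.map φ.toRingHom (s • (f c - t • g c)) * x c =
      s • ((∑ c, MvPowerSeries.map φ.toRingHom (f c) * x c) -
        t • ∑ c, MvPowerSeries.map φ.toRingHom (g c) * x c) := by
  rw [Finset.smul_sum, ← Finset.sum_sub_distrib, Finset.smul_sum]
  refine Finset.sum_congr rfl fun c _ => ?_
  rw [map_smul_series, map_sub, map_smul_series, smul_mul_assoc, sub_mul, smul_mul_assoc]

theorem opE_exchange_V {ψ : Yp N →ₐ[Ch] PowerSeries (MatY N)}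
    (hψ : ∀ i j r k a b, PowerSeries.coeff k (ψ (tY N r i j)) a b =
        MvPowerSeries.coeff (ex k r) (ρ • ((if a = b then mser (tY N) 𝐯 i j else 0) -
          κ • if i = b then mser (tY N) 𝐯 a j else 0))) :
    site 0 (mser (fun k => Matrix.of (opE ψ k)) 𝐮) * site 1 (mser (tE N) 𝐯) =
      (ρ • rm 1 κ 0 1 : Ten N 2 (MvPowerSeries (Fin 2) (EndY N))) * site 1 (mser (tE N) 𝐯) *
        site 0 (mser (fun k => Matrix.of (opE ψ k)) 𝐮) := by
  ext a b : 1
  rw [site_site_two, rm_mul_site_site]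
  refine (opE_exchange ψ (fun r => tY N r (a 1) (b 1)) (a 0) (b 0) _
    fun k r c => hψ (a 1) (b 1) r k (a 0) c).trans ?_
  refine (sum_smul_sub_mul (lamY N) ρ κ _ _ _).trans ?_
  rw [one_smul]
  congr 3
  · rw [Finset.sum_eq_single (a 0)]
    · rw [if_pos rfl, map_lam_mser]
      rfl
    · intro c _ hc
      rw [if_neg hc.symm, map_zero, zero_mul]
    · simp
  · rw [Finset.sum_eq_single (a 1)]
    · rw [if_pos rfl, map_lam_mser]
      rfl
    · intro c _ hc
      rw [if_neg hc.symm, map_zero, zero_mul]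
    · simp

theorem opE_exchange_U {ψ : Yp N →ₐ[Ch] PowerSeries (MatY N)}
    (hψ : ∀ i j r k a b, PowerSeries.coeff k (ψ (tY N r i j)) a b =
        MvPowerSeries.coeff (ex k r) (ρ • ((if a = b then mser (tY N) 𝐯 i j else 0) -
          κ • if b = j then mser (tY N) 𝐯 i a else 0))) :
    site 0 (mser (fun k => Matrix.of fun a b => opE ψ k b a) 𝐮) * site 1 (mser (tE N) 𝐯) =
      site 1 (mser (tE N) 𝐯) * site 0 (mser (fun k => Matrix.of fun a b => opE ψ k b a) 𝐮) *
        (ρ • rm 1 κ 0 1 : Ten N 2 (MvPowerSeries (Fin 2) (EndY N))) := by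
  ext a b : 1
  rw [site_site_two, mul_site_site_rm]
  refine (opE_exchange ψ (fun r => tY N r (a 1) (b 1)) (b 0) (a 0) _
    fun k r c => hψ (a 1) (b 1) r k (b 0) c).trans ?_
  refine (sum_smul_sub_mul (lamY N) ρ κ _ _ _).trans ?_
  rw [one_smul]
  congr 3
  · rw [Finset.sum_eq_single (b 0)]
    · rw [if_pos rfl, map_lam_mser]
      rfl
    · intro c _ hc
      rw [if_neg hc.symm, map_zero, zero_mul]
    · simp
  · rw [Finset.sum_eq_single (b 1)]
    · rw [if_pos rfl, map_lam_mser]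
      rfl
    · intro c _ hc
      rw [if_neg hc, map_zero, zero_mul]
    · simp

/-- At the value `0` of the parameter, the evaluation homomorphisms are the scalar embedding. -/
theorem opE_zero {ψ : Yp N →ₐ[Ch] PowerSeries (MatY N)}
    (h : ∀ i j r a b, PowerSeries.coeff 0 (ψ (tY N r i j)) a b = if a = b then tY N r i j else 0)
    (a b : Fin N) : opE ψ 0 a b = if a = b then 1 else 0 := by
  have hH : HTF (MatY N) := (HTF.pres (dualRel N)).matrix
  have key : ∀ x : Yp N, PowerSeries.coeff 0 (ψ x) = diagY N x := by
    have hg : ∀ i j r, PowerSeries.coeff 0 (ψ (yNeg i j r)) = diagY N (yNeg i j r) := by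
      intro i j r
      have h1 : PowerSeries.coeff 0 (ψ (tY N r i j)) = diagY N (tY N r i j) := by
        ext a b : 1
        rw [h, diagY_apply]
      rw [tY_apply, map_sub, map_sub, map_sub, map_smul ψ, map_smul (diagY N), coeff_ch_smul] at h1
      have h2 : PowerSeries.coeff 0 (ψ ((if r = 0 then (1 : MatY N) else 0) i j)) =
          diagY N ((if r = 0 then (1 : MatY N) else 0) i j) := by
        split_ifs
        · rw [Matrix.one_apply]
          split_ifs <;> simp
        · simp
      rw [h2, sub_right_inj] at h1
      exact hH.tf_inj h1
    let U : Submodule Ch (Yp N) :=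
      { carrier := {x | PowerSeries.coeff 0 (ψ x) = diagY N x}
        zero_mem' := by simp
        add_mem' := fun {x y} hx hy => by
          change PowerSeries.coeff 0 (ψ (x + y)) = diagY N (x + y)
          rw [map_add, map_add, map_add, hx, hy]
        smul_mem' := fun c x hx => by
          change PowerSeries.coeff 0 (ψ (c • x)) = diagY N (c • x)
          rw [map_smul ψ, map_smul (diagY N), coeff_ch_smul, ← hx] }
    intro x
    refine Yp.induction_left U ?_ ?_ ?_ x
    · change PowerSeries.coeff 0 (ψ 1) = diagY N 1
      simp
    · intro i j r x hx
      change PowerSeries.coeff 0 (ψ (yNeg i j r * x)) = diagY N (yNeg i j r * x)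
      rw [map_mul ψ, map_mul (diagY N), ← hx, ← hg]
      simp only [PowerSeries.coeff_zero_eq_constantCoeff_apply]
      exact map_mul PowerSeries.constantCoeff _ _
    · intro x hx
      refine hH.eq_of_congr fun n => ?_
      obtain ⟨y, hy, w, rfl⟩ := hx n
      refine ⟨PowerSeries.coeff 0 (ψ w) - diagY N w, ?_⟩
      rw [map_add, map_add, map_add, hy, map_smul ψ, map_smul (diagY N), smul_sub,
        coeff_ch_smul]
      abel
  refine Op.ext fun x => ?_
  rw [opE_apply, key, diagY_apply]
  split_ifs <;> rfl

end Operators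

/-! ### Evaluating operators at a vector -/

section EvalVec

variable {N m : ℕ} {σ : Type*}

/-- The evaluation of a series of operators at an element of the dual Yangian. -/
def evS (x : Yp N) : MvPowerSeries σ (EndY N) →+ MvPowerSeries σ (Yp N) where
  toFun f := fun d => MvPowerSeries.coeff d f x
  map_zero' := MvPowerSeries.ext fun d => by
    change MvPowerSeries.coeff d (0 : MvPowerSeries σ (EndY N)) x =
      MvPowerSeries.coeff d (0 : MvPowerSeries σ (Yp N))
    rw [map_zero, map_zero]
    rfl
  map_add' f g := MvPowerSeries.ext fun d => by
    change MvPowerSeries.coeff d (f + g) x =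
      MvPowerSeries.coeff d f x + MvPowerSeries.coeff d g x
    rw [map_add]
    rfl

theorem coeff_evS (x : Yp N) (f : MvPowerSeries σ (EndY N)) (d : σ →₀ ℕ) :
    MvPowerSeries.coeff d (evS x f) = MvPowerSeries.coeff d f x := rfl

theorem evS_smul (x : Yp N) (s : MvPowerSeries σ Ch) (f : MvPowerSeries σ (EndY N)) :
    evS x (s • f) = s • evS x f := by
  classical
  refine MvPowerSeries.ext fun d => ?_
  rw [coeff_evS, coeff_series_smul, coeff_series_smul, Op.sum_apply]
  rfl

theorem evS_lam_mul (x : Yp N) (f : MvPowerSeries σ (Yp N)) (g : MvPowerSeries σ (EndY N)) :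
    evS x (MvPowerSeries.map (lamY N).toRingHom f * g) = f * evS x g := by
  classical
  refine MvPowerSeries.ext fun d => ?_
  rw [coeff_evS, MvPowerSeries.coeff_mul, MvPowerSeries.coeff_mul, Op.sum_apply]
  rfl

/-- The evaluation of a matrix of series of operators at an element of the dual Yangian. -/
def evT (x : Yp N) (X : Ten N m (MvPowerSeries σ (EndY N))) : Ten N m (MvPowerSeries σ (Yp N)) :=
  X.map (evS x)

theorem evT_apply (x : Yp N) (X : Ten N m (MvPowerSeries σ (EndY N))) (a b : Fin m → Fin N) :
    evT x X a b = evS x (X a b) := rfl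

theorem evT_sub (x : Yp N) (X Y : Ten N m (MvPowerSeries σ (EndY N))) :
    evT x (X - Y) = evT x X - evT x Y := by
  ext a b : 1
  exact map_sub (evS x) _ _

theorem evT_smul (x : Yp N) (s : MvPowerSeries σ Ch) (X : Ten N m (MvPowerSeries σ (EndY N))) :
    evT x (s • X) = s • evT x X := by
  ext a b : 1
  exact evS_smul x s _

theorem evT_rm_mul (x : Yp N) (α β : MvPowerSeries σ Ch) (i j : Fin m)
    (X : Ten N m (MvPowerSeries σ (EndY N))) :
    evT x (rm α β i j * X) = rm α β i j * evT x X := by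
  ext a b : 1
  rw [rm_mul_apply, evT_apply, rm_mul_apply, map_sub, evS_smul, evS_smul]
  rfl

theorem evT_mul_rm (x : Yp N) (α β : MvPowerSeries σ Ch) (i j : Fin m)
    (X : Ten N m (MvPowerSeries σ (EndY N))) :
    evT x (X * rm α β i j) = evT x X * rm α β i j := by
  ext a b : 1
  rw [mul_rm_apply, evT_apply, mul_rm_apply, map_sub, evS_smul, evS_smul]
  rfl

theorem mser_tE_apply (w : MvPowerSeries σ Ch) (i j : Fin N) :
    mser (tE N) w i j = MvPowerSeries.map (lamY N).toRingHom (mser (tY N) w i j) :=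
  (map_subs (lamY N) (fun r => tY N r i j) w).symm

theorem evT_site_mul (x : Yp N) (w : MvPowerSeries σ Ch) (i : Fin m)
    (X : Ten N m (MvPowerSeries σ (EndY N))) :
    evT x (site i (mser (tE N) w) * X) = site i (mser (tY N) w) * evT x X := by
  ext a b : 1
  rw [evT_apply, site_mul_apply, site_mul_apply, map_sum]
  refine Finset.sum_congr rfl fun c _ => ?_
  rw [mser_tE_apply, evS_lam_mul]
  rfl

end EvalVec

/-! ### Exchange relations -/

section Exchange

variable {N : ℕ}

/-- The relation `M₀(u) T₁(v) = K(u, v) T₁(v) M₀(u) K'(u, v)` between operators `M` on the dual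
Yangian and the left multiplication by `T`, with `K = ρ (1 - κ P)` and `K' = ρ' (1 - κ' P)`. -/
def Exch (ρ κ ρ' κ' : MvPowerSeries (Fin 2) Ch) (M : ℕ → Matrix (Fin N) (Fin N) (EndY N)) :
    Prop :=
  site 0 (mser M 𝐮) * site 1 (mser (tE N) 𝐯) =
    (ρ • rm 1 κ 0 1 : Ten N 2 (MvPowerSeries (Fin 2) (EndY N))) * site 1 (mser (tE N) 𝐯) *
      site 0 (mser M 𝐮) * (ρ' • rm 1 κ' 0 1 : Ten N 2 (MvPowerSeries (Fin 2) (EndY N)))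

variable {ρ κ ρ' κ' : MvPowerSeries (Fin 2) Ch} {M : ℕ → Matrix (Fin N) (Fin N) (EndY N)}

theorem mapMatrix_smul_rm {σ τ A : Type*} [Fintype τ] [Ring A] [Algebra Ch A] {m : ℕ}
    {v : τ → MvPowerSeries σ Ch} (hv : ∀ t, MvPowerSeries.constantCoeff (v t) = 0)
    (s α β : MvPowerSeries τ Ch) (i j : Fin m) :
    (s • rm α β i j : Ten N m (MvPowerSeries τ A)).map (substHom v hv) =
      substHom v hv s • rm (substHom v hv α) (substHom v hv β) i j := by
  rw [← rm_map (substHom v hv) (substHom v hv) (substHom_smul hv)]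
  ext a b : 1
  exact substHom_smul hv s _

theorem Exch.at {σ : Type*} (h : Exch ρ κ ρ' κ' M) {x v : MvPowerSeries σ Ch}
    (hx : MvPowerSeries.constantCoeff x = 0) (hv : MvPowerSeries.constantCoeff v = 0) {m : ℕ}
    {i j : Fin m} (hij : i ≠ j) :
    site i (mser M x) * site j (mser (tE N) v) =
      (substHom ![x, v] (constantCoeff_pair hx hv) ρ •
        rm 1 (substHom ![x, v] (constantCoeff_pair hx hv) κ) i j :
          Ten N m (MvPowerSeries σ (EndY N))) * site j (mser (tE N) v) *
      site i (mser M x) * (substHom ![x, v] (constantCoeff_pair hx hv) ρ' •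
        rm 1 (substHom ![x, v] (constantCoeff_pair hx hv) κ') i j) := by
  have h1 := congrArg (fun X => (substHom ![x, v] (constantCoeff_pair hx hv) :
    MvPowerSeries (Fin 2) (EndY N) →+* MvPowerSeries σ (EndY N)).mapMatrix X) h
  simp only [map_mul] at h1
  simp only [RingHom.mapMatrix_apply, mapMatrix_smul_rm, map_one, site_map,
    mser_subst M (MvPowerSeries.constantCoeff_X 0) (constantCoeff_pair hx hv),
    mser_subst (tE N) (MvPowerSeries.constantCoeff_X 1) (constantCoeff_pair hx hv),
    substHom_X'] at h1
  have h2 := congrArg (emb ![i, j] (pair_injective hij)) h1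
  simp only [map_mul, emb_smul, emb_rm, emb_site] at h2
  exact h2

/-- The operators `1`, acting diagonally. -/
def diagT (m : ℕ) {σ : Type*} (x : Yp N) : Ten N m (MvPowerSeries σ (Yp N)) :=
  Matrix.diagonal fun _ => MvPowerSeries.C x

theorem rm_diagT {m : ℕ} {σ : Type*} (x : Yp N) (α β : MvPowerSeries σ Ch) (i j : Fin m) :
    rm α β i j * (diagT m x : Ten N m (MvPowerSeries σ (Yp N))) = diagT m x * rm α β i j := by
  ext a b : 1
  rw [rm_mul_apply, mul_rm_apply, diagT, Matrix.diagonal_apply, Matrix.diagonal_apply,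
    Matrix.diagonal_apply]
  congr 2
  refine if_congr ⟨?_, ?_⟩ rfl rfl
  · rintro rfl
    ext k
    simp
  · rintro rfl
    ext k
    simp

theorem tY_eq {σ : Type*} {w : MvPowerSeries σ Ch} (hw : MvPowerSeries.constantCoeff w = 0) :
    mser (tY N) w = 1 - (hC Ch : MvPowerSeries σ Ch) •
      mser (fun r => Matrix.of fun i j => yNeg i j r) w := by
  rw [tY, mser_serPlus hw]
  congr 1
  ext a b : 1
  exact (hC_smul _).symm

theorem tE_eq {σ : Type*} {w : MvPowerSeries σ Ch} (hw : MvPowerSeries.constantCoeff w = 0) :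
    mser (tE N) w = 1 - (hC Ch : MvPowerSeries σ Ch) •
      mser (fun r => Matrix.of fun i j => lamY N (yNeg i j r)) w := by
  have : tE N = serPlus fun i j r => lamY N (yNeg i j r) := by
    funext r
    exact serPlus_map (lamY N) yNeg r
  rw [this, mser_serPlus hw]
  congr 1
  ext a b : 1
  exact (hC_smul _).symm

theorem nonTorsion_hC_ten {A : Type*} [Ring A] [Algebra Ch A] (hA : HTF A) {m : ℕ} {σ : Type*}
    {X Y : Ten N m (MvPowerSeries σ A)}
    (h : (hC Ch : MvPowerSeries σ Ch) • X = (hC Ch : MvPowerSeries σ Ch) • Y) : X = Y := by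
  rw [← sub_eq_zero, ← smul_sub] at h
  exact sub_eq_zero.1 ((NonTorsion.hC hA).matrix (h.trans (smul_zero _).symm))

theorem congr_conj_aux {S R : Type*} [CommRing S] [Ring R] [Algebra S R] {h w w' g g' ρ : S}
    {p D Z τ V : R} (hp : p * p = 1) (hD : p * D = D * p) (hw : w = w' + h * g')
    (hρ : ρ = 1 + h * (h * g))
    (hV : D + h • Z - h • V =
      ρ • ((1 + (h * w) • p) * ((1 - h • τ) * (D + h • Z) * (1 - (h * w') • p)))) :
    ∃ W, h • V = h • (τ * D + h • W) := by
  have hpDp : p * D * p = D := by rw [hD, mul_assoc, hp, mul_one]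
  obtain ⟨Q, hQ⟩ : ∃ Q, Q = Z - τ * D - h • (τ * Z) := ⟨_, rfl⟩
  have e1 : (1 - h • τ) * (D + h • Z) = D + h • Q := by
    rw [hQ]
    simp only [sub_mul, mul_add, one_mul, smul_mul_assoc, mul_smul_comm]
    module
  have e2 : (1 + (h * w) • p) * ((D + h • Q) * (1 - (h * w') • p)) =
      D + h • Q + (h * h) • (g' • (p * D) - (w * w') • D + w • (p * Q) - w' • (Q * p) -
        (h * w * w') • (p * Q * p)) := by
    simp only [mul_sub, add_mul, mul_add, one_mul, mul_one, smul_mul_assoc, mul_smul_comm,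
      ← mul_assoc, hpDp]
    rw [← hD, hw]
    module
  refine ⟨τ * Z - (g' • (p * D) - (w * w') • D + w • (p * Q) - w' • (Q * p) -
    (h * w * w') • (p * Q * p)) - g • ((1 + (h * w) • p) * ((D + h • Q) * (1 - (h * w') • p))), ?_⟩
  rw [e1, hρ] at hV
  have e3 : h • V = D + h • Z - (1 + h * (h * g)) •
      ((1 + (h * w) • p) * ((D + h • Q) * (1 - (h * w') • p))) := by
    rw [← hV]
    abel
  rw [e3, e2, hQ]
  module

/-- If `K` and `K'` are inverse to each other modulo `h²`, up to a multiple of `h P`, then the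
operators `M` are congruent to the identity modulo `h`. -/
theorem Exch.congr_one {w g g' w' : MvPowerSeries (Fin 2) Ch}
    (h : Exch ρ (-(hC Ch * w)) ρ' (hC Ch * w') M) (hw : w = w' + hC Ch * g')
    (hρ : ρ * ρ' = 1 + hC Ch * (hC Ch * g))
    (h1 : ∀ k a b, M k a b 1 = if k = 0 then (1 : MatY N) a b else 0) (k : ℕ) (a b : Fin N)
    (x : Yp N) : ∃ y, M k a b x = (if k = 0 ∧ a = b then x else 0) + hbar • y := by
  let U : Submodule Ch (Yp N) :=
    { carrier := {x | ∀ k a b, ∃ y, M k a b x = (if k = 0 ∧ a = b then x else 0) + hbar • y}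
      zero_mem' := fun k a b => ⟨0, by simp⟩
      add_mem' := fun {x y} hx hy k a b => by
        obtain ⟨x', hx'⟩ := hx k a b
        obtain ⟨y', hy'⟩ := hy k a b
        refine ⟨x' + y', ?_⟩
        rw [map_add, hx', hy', smul_add]
        split_ifs <;> abel
      smul_mem' := fun c x hx k a b => by
        obtain ⟨x', hx'⟩ := hx k a b
        refine ⟨c • x', ?_⟩
        rw [map_smul, hx', smul_add, smul_comm c hbar]
        split_ifs
        · rfl
        · rw [smul_zero] }
  -- The congruence holds at `1`, survives left multiplication by a generator because of the
  -- exchange relation, and is stable under `h`-adic limits.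
  refine Yp.induction_left U ?_ ?_ ?_ x k a b
  · intro k a b
    refine ⟨0, ?_⟩
    rw [h1, smul_zero, add_zero, Matrix.one_apply]
    split_ifs <;> simp_all
  · intro i j r x hx k a b
    choose y hy using hx
    set Z : Ten N 2 (MvPowerSeries (Fin 2) (Yp N)) :=
      site 0 (mser (fun k => Matrix.of fun a b => y k a b) 𝐮) with hZ
    set τ : Ten N 2 (MvPowerSeries (Fin 2) (Yp N)) :=
      site 1 (mser (fun r => Matrix.of fun i j => yNeg i j r) 𝐯) with hτ
    set τE : Ten N 2 (MvPowerSeries (Fin 2) (EndY N)) :=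
      site 1 (mser (fun r => Matrix.of fun i j => lamY N (yNeg i j r)) 𝐯) with hτE
    set M0 : Ten N 2 (MvPowerSeries (Fin 2) (EndY N)) := site 0 (mser M 𝐮) with hM0
    have e1 : evT x M0 = diagT 2 x + (hC Ch : MvPowerSeries (Fin 2) Ch) • Z := by
      ext a b d
      rw [eq_ex d, evT_apply, coeff_evS, Matrix.add_apply, Matrix.smul_apply, hC_smul, map_add,
        hM0, hZ, site_apply, site_apply, diagT, Matrix.diagonal_apply]
      by_cases hab : ∀ k, k ≠ 0 → a k = b k
      · rw [if_pos hab, if_pos hab]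
        change MvPowerSeries.coeff _ (subs (fun k => M k (a 0) (b 0)) 𝐮) x =
          _ + hbar • MvPowerSeries.coeff _ (subs (fun k => y k (a 0) (b 0)) 𝐮)
        rw [coeff_subs_first, coeff_subs_first]
        have hab' : a = b ↔ a 0 = b 0 := ⟨fun h => by rw [h], fun h => by
          ext k : 1
          by_cases hk : k = 0
          · rw [hk, h]
          · exact hab k hk⟩
        have e0 : (0 : Fin 2 →₀ ℕ) = ex 0 0 := by simp [ex]
        by_cases hd : d 1 = 0
        · rw [if_pos hd, if_pos hd, hy]
          congr 1
          by_cases h0 : a 0 = b 0 <;> by_cases hk : d 0 = 0 <;>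
            simp [hab', h0, hk, hd, MvPowerSeries.coeff_C, e0, ex_inj]
        · rw [if_neg hd, if_neg hd]
          split_ifs <;> simp [MvPowerSeries.coeff_C, e0, ex_inj, hd, Op.zero_apply]
      · rw [if_neg hab, if_neg hab, if_neg, map_zero, map_zero, smul_zero]
        · exact (add_zero _).symm
        · exact fun h => hab fun k _ => by rw [h]
    have eT : (site 1 (mser (tY N) 𝐯) : Ten N 2 (MvPowerSeries (Fin 2) (Yp N))) =
        1 - (hC Ch : MvPowerSeries (Fin 2) Ch) • τ := by
      rw [tY_eq (by simp), site_sub, site_one, site_smul]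
    have eE : (site 1 (mser (tE N) 𝐯) : Ten N 2 (MvPowerSeries (Fin 2) (EndY N))) =
        1 - (hC Ch : MvPowerSeries (Fin 2) Ch) • τE := by
      rw [tE_eq (by simp), site_sub, site_one, site_smul]
    have h2 := congrArg (evT x) h
    rw [mul_smul_comm, smul_mul_assoc, smul_mul_assoc, smul_mul_assoc, mul_assoc (rm _ _ _ _),
      mul_assoc (rm _ _ _ _), evT_smul, evT_smul, evT_rm_mul, evT_mul_rm, evT_site_mul, eT,
      eE, mul_sub, mul_one, mul_smul_comm, evT_sub, evT_smul, e1, smul_smul] at h2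
    have hP : (perm 0 1 : Ten N 2 (MvPowerSeries (Fin 2) (Yp N))) * diagT 2 x =
        diagT 2 x * perm 0 1 := by
      have := rm_diagT (m := 2) x (0 : MvPowerSeries (Fin 2) Ch) (-1) 0 1
      simpa [rm] using this
    -- The constant terms of the exchange relation cancel, so one power of `h` can be divided out.
    -- What remains of the two factors `1 ∓ h w P` is a multiple of `h`, since `K K' ≡ 1` modulo
    -- `h²`.
    have key : ∃ W, evT x (M0 * τE) = τ * diagT 2 x + (hC Ch : MvPowerSeries (Fin 2) Ch) • W := by
      rw [rm, rm, one_smul, neg_smul, sub_neg_eq_add, mul_comm ρ' ρ] at h2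
      obtain ⟨W, hW⟩ := congr_conj_aux (perm_mul_self 0 1) hP hw hρ h2
      exact ⟨W, nonTorsion_hC_ten (HTF.pres _) hW⟩
    obtain ⟨W, hW⟩ := key
    have h3 := congrArg (MvPowerSeries.coeff (ex k r)) (congrFun (congrFun hW ![a, i]) ![b, j])
    refine ⟨MvPowerSeries.coeff (ex k r) (W ![a, i] ![b, j]), ?_⟩
    rw [evT_apply, coeff_evS, hM0, hτE, site_site_two, Matrix.add_apply, Matrix.smul_apply,
      hC_smul, map_add] at h3
    have h4 : MvPowerSeries.coeff (ex k r) (mser M 𝐮 (![a, i] 0) (![b, j] 0) *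
        mser (fun r => Matrix.of fun i j => lamY N (yNeg i j r)) 𝐯 (![a, i] 1) (![b, j] 1)) x =
        M k a b (yNeg i j r * x) := by
      rw [show mser M 𝐮 (![a, i] 0) (![b, j] 0) = subs (fun k => M k a b) 𝐮 from rfl,
        show mser (fun r => Matrix.of fun i j => lamY N (yNeg i j r)) 𝐯 (![a, i] 1) (![b, j] 1) =
          subs (fun r => lamY N (yNeg i j r)) 𝐯 from rfl, coeff_subs_mul_subs]
      rfl
    rw [h4] at h3
    rw [h3]
    congr 1
    rw [diagT, Matrix.mul_diagonal, hτ, site_apply]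
    have hab : (∀ k : Fin 2, k ≠ 1 → (![a, i] : Fin 2 → Fin N) k = (![b, j] : Fin 2 → Fin N) k) ↔
        a = b := by
      constructor
      · exact fun h => h 0 (by decide)
      · rintro rfl k hk
        fin_cases k
        · rfl
        · exact absurd rfl hk
    by_cases h : a = b
    · rw [if_pos (hab.2 h), MvPowerSeries.coeff_mul_C]
      change MvPowerSeries.coeff (ex k r) (subs (fun r => yNeg i j r) 𝐯) * x = _
      rw [coeff_subs_second]
      by_cases hk : k = 0
      · simp [h, hk]
      · simp [hk]
    · rw [if_neg fun h' => h (hab.1 h'), zero_mul, map_zero, if_neg fun h' => h h'.2]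
  · intro x hx k a b
    obtain ⟨y, hy, w, rfl⟩ := hx 1
    obtain ⟨y', hy'⟩ := hy k a b
    refine ⟨y' + M k a b w - if k = 0 ∧ a = b then w else 0, ?_⟩
    rw [map_add, hy', pow_one, map_smul, smul_sub, smul_add]
    split_ifs
    · abel
    · rw [smul_zero]
      abel

end Exchange

/-! ### The inverse of `u - v + γ` -/

section Shift

/-- `1 / (u - v + γ)`, where `X 0 = u⁻¹` and `X 1 = v`. -/
def shiftW (γ : Ch) : MvPowerSeries (Fin 2) Ch :=
  𝐮 * MvPowerSeries.invOfUnit (1 - 𝐮 * (𝐯 - MvPowerSeries.C γ)) 1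

theorem shiftW_mul (γ : Ch) : shiftW γ * (1 - 𝐮 * (𝐯 - MvPowerSeries.C γ)) = 𝐮 := by
  rw [shiftW, mul_assoc, MvPowerSeries.invOfUnit_mul, mul_one]
  simp

theorem constantCoeff_shiftW (γ : Ch) : MvPowerSeries.constantCoeff (shiftW γ) = 0 := by
  rw [shiftW, map_mul, MvPowerSeries.constantCoeff_X, zero_mul]

theorem eq_of_mul_unit {σ : Type*} {D a b : MvPowerSeries σ Ch}
    (hD : MvPowerSeries.constantCoeff D = 1) (h : a * D = b * D) : a = b := by
  have h1 := congrArg (fun x => x * MvPowerSeries.invOfUnit D 1) h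
  simpa only [mul_assoc, MvPowerSeries.mul_invOfUnit D 1 hD, mul_one] using h1

theorem map_shiftInv (c : Ch) (s : ℂ) :
    MvPowerSeries.map (Polynomial.aeval c : Polynomial Ch →ₐ[Ch] Ch).toRingHom (shiftInv s) =
      shiftW (PowerSeries.C s * hbar * c) := by
  refine eq_of_mul_unit (D := 1 - 𝐮 * (𝐯 - MvPowerSeries.C (PowerSeries.C s * hbar * c)))
    (by simp) ?_
  rw [shiftW_mul]
  have h : shiftInv s * (1 - MvPowerSeries.X 0 * (MvPowerSeries.X 1 -
      MvPowerSeries.C (Polynomial.C (PowerSeries.C s * hbar) * Polynomial.X))) =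
      MvPowerSeries.X 0 := by
    rw [shiftInv, mul_assoc, MvPowerSeries.invOfUnit_mul, mul_one]
    simp
  have h1 := congrArg
    (MvPowerSeries.map (Polynomial.aeval c : Polynomial Ch →ₐ[Ch] Ch).toRingHom) h
  simpa [MvPowerSeries.map_X, MvPowerSeries.map_C] using h1

/-- Two inverses of linear forms that differ by `x (v₀ - v₁)`. -/
theorem sub_of_mul_eq {σ : Type*} {x v₀ v₁ w₀ w₁ : MvPowerSeries σ Ch}
    (hx : MvPowerSeries.constantCoeff x = 0)
    (h₀ : w₀ * (1 - x * v₀) = x) (h₁ : w₁ * (1 - x * v₁) = x) :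
    w₀ - w₁ = w₀ * w₁ * (v₀ - v₁) := by
  refine eq_of_mul_unit (D := (1 - x * v₀) * (1 - x * v₁)) (by simp [hx]) ?_
  linear_combination (1 - x * v₁) * h₀ - (1 - x * v₀) * h₁ -
    (v₀ - v₁) * (w₁ * (1 - x * v₁) * h₀ + x * h₁)

theorem shiftW_sub (γ γ' : Ch) :
    shiftW γ - shiftW γ' = shiftW γ * shiftW γ' * MvPowerSeries.C (γ' - γ) := by
  rw [sub_of_mul_eq (by simp) (shiftW_mul γ) (shiftW_mul γ'), map_sub]
  ring

theorem optSubst_shiftW (γ : Ch) :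
    (MvPowerSeries.X (some 0) - MvPowerSeries.X (some 1) : MvPowerSeries (Option (Fin 2)) Ch) *
      (optSubst (σ := Fin 2) 0 (shiftW γ) * optSubst (σ := Fin 2) 1 (shiftW γ)) =
      optSubst (σ := Fin 2) 0 (shiftW γ) - optSubst (σ := Fin 2) 1 (shiftW γ) := by
  have h : ∀ i : Fin 2, optSubst (σ := Fin 2) i (shiftW γ) *
      (1 - (MvPowerSeries.X none : MvPowerSeries (Option (Fin 2)) Ch) *
        (MvPowerSeries.X (some i) - MvPowerSeries.C γ)) = MvPowerSeries.X none := by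
    intro i
    have := congrArg (optSubst (σ := Fin 2) (A := Ch) i) (shiftW_mul γ)
    simpa [optSubst, substHom_X', substHom_C, optPair] using this
  rw [sub_of_mul_eq (by simp) (h 0) (h 1)]
  ring

theorem exists_nser_sq {σ : Type*} (N : ℕ) {w : MvPowerSeries σ Ch}
    (hw : MvPowerSeries.constantCoeff w = 0) : ∃ g : MvPowerSeries σ Ch,
      nser N w = 1 + hC Ch * (MvPowerSeries.C (PowerSeries.C (normCoeff N 1)) * w) +
        hC Ch * (hC Ch * g) := by
  have hw' := constantCoeff_hC_mul hw
  refine ⟨w * w * subs (fun r => (PowerSeries.C (normCoeff N (r + 2)) : Ch)) (hC Ch * w), ?_⟩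
  rw [nser, subs_eq_C_add hw', subs_eq_C_add hw']
  simp only [scalar_smul_def, scalarSeries_self]
  simp only [normCoeff, map_one, zero_add, add_assoc, Nat.reduceAdd]
  ring

end Shift

/-! ### The operators `T⁻` on the dual Yangian -/

section TMinus

variable {N : ℕ}

theorem coeff_first_mul_smul {A : Type*} [Ring A] [Algebra Ch A] (s : MvPowerSeries (Fin 2) Ch)
    (f : MvPowerSeries (Fin 2) A) (r : ℕ) :
    MvPowerSeries.coeff (ex 0 r) ((𝐮 * s) • f) = 0 := by
  rw [mul_smul, scalar_smul_def, MvPowerSeries.map_X, MvPowerSeries.X,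
    MvPowerSeries.coeff_monomial_mul, if_neg]
  intro h
  have := h 0
  simp [ex] at this

theorem coeff_zero_smul_sub {A : Type*} [Ring A] [Algebra Ch A] {ρ κ : MvPowerSeries (Fin 2) Ch}
    (hρ : ∃ g, ρ = 1 + 𝐮 * g) (hκ : ∃ g, κ = 𝐮 * g) (f f' : MvPowerSeries (Fin 2) A) (r : ℕ) :
    MvPowerSeries.coeff (ex 0 r) (ρ • (f - κ • f')) = MvPowerSeries.coeff (ex 0 r) f := by
  obtain ⟨g, rfl⟩ := hρ
  obtain ⟨g', rfl⟩ := hκ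
  rw [add_smul, one_smul, map_add, coeff_first_mul_smul, add_zero, map_sub, coeff_first_mul_smul,
    sub_zero]

theorem coeff_ex_zero_diag (i j : Fin N) (r : ℕ) (a b : Fin N) :
    MvPowerSeries.coeff (ex 0 r) (if a = b then mser (tY N) 𝐯 i j else 0) =
      if a = b then tY N r i j else 0 := by
  split_ifs
  · change MvPowerSeries.coeff (ex 0 r) (subs (fun r => tY N r i j) 𝐯) = _
    rw [coeff_subs_second, if_pos rfl]
  · simp

/-- The operators `T⁻` on the dual Yangian at the level `c`: a solution of the mixed relation which
annihilates the vacuum. -/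
theorem exists_tMinus (γ γ' : Ch) (hγ : ∃ g, γ' - γ = hbar * g) :
    ∃ (ρ : MvPowerSeries (Fin 2) Ch) (τ : Fin N → Fin N → ℕ → EndY N),
      ρ * (nser N (shiftW γ) * (1 - (hC Ch * shiftW γ) * (hC Ch * shiftW γ))) = 1 ∧
      Exch ρ (-(hC Ch * shiftW γ)) (nser N (shiftW γ')) (hC Ch * shiftW γ') (serMinus τ) ∧
      ∀ i j r, τ i j r 1 = 0 := by
  have hw := constantCoeff_shiftW γ
  have hw' := constantCoeff_shiftW γ'
  obtain ⟨u, hu⟩ : ∃ u, shiftW γ = 𝐮 * u := ⟨_, rfl⟩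
  obtain ⟨u', hu'⟩ : ∃ u, shiftW γ' = 𝐮 * u := ⟨_, rfl⟩
  obtain ⟨f, hf⟩ := exists_nser (N := N) hw
  obtain ⟨f', hf'⟩ := exists_nser (N := N) hw'
  -- Since `R(u) R(-u) = 1 - h² u⁻²`, the matrix `ρ R(-u)` with `ρ = D⁻¹` is the inverse of the
  -- normalized `R`-matrix at `u`, where `u⁻¹ = shiftW γ`.
  set D := nser N (shiftW γ) * (1 - (hC Ch * shiftW γ) * (hC Ch * shiftW γ)) with hD
  have hD0 : MvPowerSeries.constantCoeff D = 1 := by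
    rw [hD, hf]
    simp [hw]
  obtain ⟨ρ, hρ⟩ : ∃ ρ, ρ * D = 1 :=
    ⟨MvPowerSeries.invOfUnit D 1, MvPowerSeries.invOfUnit_mul D 1 hD0⟩
  obtain ⟨q, hq⟩ : ∃ q, ρ = 1 + hC Ch * (𝐮 * q) := by
    refine ⟨-(u * (f - hC Ch * shiftW γ * nser N (shiftW γ)) * ρ), ?_⟩
    have e : D = 1 + hC Ch * (𝐮 * (u * (f - hC Ch * shiftW γ * nser N (shiftW γ)))) := by
      rw [hD]
      linear_combination hf + hC Ch * (f - hC Ch * shiftW γ * nser N (shiftW γ)) * hu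
    rw [e] at hρ
    linear_combination hρ
  obtain ⟨ψV, hV⟩ := exists_homV (N := N) (κ := -(hC Ch * shiftW γ)) (ρ := ρ)
    ⟨-shiftW γ, by ring⟩ ⟨_, hq⟩ (by
      simp only [map_neg, map_mul]
      rw [show optSubst (σ := Fin 2) 0 (hC Ch : MvPowerSeries (Fin 2) Ch) = hC Ch from
          substHom_hC _, show optSubst (σ := Fin 2) 1 (hC Ch : MvPowerSeries (Fin 2) Ch) = hC Ch
          from substHom_hC _]
      linear_combination (hC Ch * hC Ch) * optSubst_shiftW γ)
  obtain ⟨ψU, hU⟩ := exists_homU (N := N) (κ := hC Ch * shiftW γ') (ρ := nser N (shiftW γ'))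
    ⟨shiftW γ', rfl⟩ ⟨_, hf'⟩ (by
      simp only [map_mul]
      rw [show optSubst (σ := Fin 2) 0 (hC Ch : MvPowerSeries (Fin 2) Ch) = hC Ch from
          substHom_hC _, show optSubst (σ := Fin 2) 1 (hC Ch : MvPowerSeries (Fin 2) Ch) = hC Ch
          from substHom_hC _]
      linear_combination (hC Ch * hC Ch) * optSubst_shiftW γ')
  -- `V` is exchanged with `T` at the cost of the `R`-matrix on the left, and `U` at the cost of the
  -- one on the right; the product `V U` solves the mixed relation.
  set V : ℕ → Matrix (Fin N) (Fin N) (EndY N) := fun k => Matrix.of (opE ψV k) with hVdef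
  set U : ℕ → Matrix (Fin N) (Fin N) (EndY N) := fun k => Matrix.of fun a b => opE ψU k b a
    with hUdef
  set M : ℕ → Matrix (Fin N) (Fin N) (EndY N) := fun k =>
    ∑ p ∈ Finset.HasAntidiagonal.antidiagonal k, V p.1 * U p.2 with hMdef
  have hM : mser M 𝐮 = mser V 𝐮 * mser U 𝐮 := (mser_mul (by simp) V U).symm
  have hE : Exch ρ (-(hC Ch * shiftW γ)) (nser N (shiftW γ')) (hC Ch * shiftW γ') M := by
    rw [Exch, hM, site_mul, mul_assoc, opE_exchange_U hU, ← mul_assoc, ← mul_assoc,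
      opE_exchange_V hV]
    simp only [mul_assoc]
    rfl
  have hM1 : ∀ k a b, M k a b 1 = if k = 0 then (1 : MatY N) a b else 0 := by
    intro k a b
    have e : M k a b 1 = ∑ p ∈ Finset.HasAntidiagonal.antidiagonal k, ∑ c,
        V p.1 a c (U p.2 c b 1) := by
      rw [show M k a b = ∑ p ∈ Finset.HasAntidiagonal.antidiagonal k, (V p.1 * U p.2) a b from
        Matrix.sum_apply a b _ _, Op.sum_apply]
      refine Finset.sum_congr rfl fun p _ => ?_
      rw [Matrix.mul_apply, Op.sum_apply]
      rfl
    have e2 : ∀ p : ℕ × ℕ, ∑ c, V p.1 a c (U p.2 c b 1) =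
        if p = 0 then (1 : MatY N) a b else 0 := by
      rintro ⟨p, q⟩
      have e3 : ∀ c, V p a c (U q c b 1) = if (p, q) = 0 then
          (1 : MatY N) a c * (1 : MatY N) c b else 0 := by
        intro c
        rw [show U q c b 1 = if q = 0 then (1 : MatY N) b c else 0 from opE_one ψU q b c]
        by_cases hq : q = 0
        · rw [if_pos hq, Matrix.one_apply]
          by_cases hbc : b = c
          · subst hbc
            rw [if_pos rfl, show V p a b 1 = if p = 0 then (1 : MatY N) a b else 0 from
              opE_one ψV p a b]
            simp [hq, Prod.ext_iff]
          · rw [if_neg hbc, map_zero, Matrix.one_apply_ne (Ne.symm hbc), mul_zero, ite_self]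
        · rw [if_neg hq, map_zero, if_neg]
          exact fun h => hq (congrArg Prod.snd h)
      simp only [e3]
      by_cases hpq : (p, q) = 0
      · simp only [if_pos hpq]
        rw [← Matrix.mul_apply, one_mul]
      · simp [hpq]
    simp only [e, e2]
    rw [Finset.sum_ite_eq' (Finset.HasAntidiagonal.antidiagonal k) (0 : ℕ × ℕ)]
    refine if_congr ?_ rfl rfl
    rw [Finset.HasAntidiagonal.mem_antidiagonal]
    simp [eq_comm]
  have hM0 : M 0 = 1 := by
    have hV0 : V 0 = 1 := by
      ext a b : 1
      refine (opE_zero (fun i j r a b => ?_) a b).trans (Matrix.one_apply).symm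
      rw [hV, coeff_zero_smul_sub ⟨hC Ch * q, by rw [hq]; ring⟩
        ⟨-(hC Ch * u), by rw [hu]; ring⟩, coeff_ex_zero_diag]
    have hU0 : U 0 = 1 := by
      ext a b : 1
      refine (opE_zero (fun i j r a b => ?_) b a).trans ?_
      · rw [hU, coeff_zero_smul_sub ⟨hC Ch * (u' * f'), by rw [hf', hu']; ring⟩
          ⟨hC Ch * u', by rw [hu']; ring⟩, coeff_ex_zero_diag]
      · rw [Matrix.one_apply]
        exact if_congr eq_comm rfl rfl
    simp [hMdef, hV0, hU0]
  obtain ⟨g', hg'⟩ := hγ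
  have hww : shiftW γ = shiftW γ' + hC Ch * (shiftW γ * shiftW γ' * MvPowerSeries.C g') := by
    have := shiftW_sub γ γ'
    rw [hg', map_mul] at this
    change _ = _ * (hC Ch * MvPowerSeries.C g') at this
    linear_combination this
  obtain ⟨e, he⟩ := exists_nser_sq N hw
  obtain ⟨e', he'⟩ := exists_nser_sq N hw'
  have hcong := Exch.congr_one (g := ρ * (shiftW γ * shiftW γ * nser N (shiftW γ) + e' - e -
      MvPowerSeries.C (PowerSeries.C (normCoeff N 1)) *
        (shiftW γ * shiftW γ' * MvPowerSeries.C g'))) hE hww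
    (by
      rw [hD] at hρ
      linear_combination hρ + ρ * he' - ρ * he -
        ρ * hC Ch * MvPowerSeries.C (PowerSeries.C (normCoeff N 1)) * hww) hM1
  have hH : HTF (Yp N) := HTF.pres _
  -- The operators `M - 1` are divisible by `h`; the quotients are the modes of `T⁻`.
  have hτ : ∀ i j r, ∃ t : EndY N, M (r + 1) i j = hbar • t := by
    intro i j r
    obtain ⟨t, ht⟩ := hH.exists_linearMap 1 (M (r + 1) i j : Yp N →ₗ[Ch] Yp N) fun x => by
      obtain ⟨y, hy⟩ := hcong (r + 1) i j x
      refine ⟨y, ?_⟩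
      rw [pow_one]
      refine hy.trans ?_
      simp
    exact ⟨t, by rw [pow_one] at ht; exact ht⟩
  choose τ hτ using hτ
  have hMτ : M = serMinus τ := by
    funext k
    cases k with
    | zero => exact hM0
    | succ r =>
      ext i j : 1
      exact hτ i j r
  refine ⟨ρ, τ, hρ, hMτ ▸ hE, fun i j r => hH.tf _ ?_⟩
  have := hM1 (r + 1) i j
  rw [hτ] at this
  exact this.trans (if_neg (Nat.succ_ne_zero r))

end TMinus

/-! ### Quadratic relations from exchange relations -/

section Quadratic

/-- Two operators `A`, `B` that are exchanged with `T` by solutions of the Yang–Baxter equation: the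
defect of their quadratic relation is exchanged with `T`, too. -/
theorem defect_exchange {R : Type*} [Ring R] {r A B T K L K' L' : R} (hA : A * T = K * T * A * K')
    (hB : B * T = L * T * B * L') (hAL : A * L = L * A) (hBK : B * K = K * B)
    (hAL' : L' * A = A * L') (hBK' : K' * B = B * K') (hT : r * T = T * r)
    (hY : r * L * K = K * L * r) (hY' : L' * K' * r = r * K' * L') :
    (r * A * B - B * A * r) * T = K * L * T * (r * A * B - B * A * r) * K' * L' := by
  have e1 : r * A * B * T = K * L * T * (r * A * B) * K' * L' := by
    calc r * A * B * T = r * A * (B * T) := by rw [mul_assoc _ B T]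
      _ = r * (A * L) * T * B * L' := by rw [hB]; simp only [mul_assoc]
      _ = r * L * (A * T) * B * L' := by rw [hAL]; simp only [mul_assoc]
      _ = (r * L * K) * T * A * (K' * B) * L' := by rw [hA]; simp only [mul_assoc]
      _ = K * L * (r * T) * A * (K' * B) * L' := by rw [hY]; simp only [mul_assoc]
      _ = _ := by rw [hT, hBK']; simp only [mul_assoc]
  have e2 : B * A * r * T = K * L * T * (B * A * r) * K' * L' := by
    calc B * A * r * T = B * (A * T) * r := by rw [mul_assoc _ r T, hT]; simp only [mul_assoc]
      _ = (B * K) * T * A * K' * r := by rw [hA]; simp only [mul_assoc]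
      _ = K * (B * T) * A * K' * r := by rw [hBK]; simp only [mul_assoc]
      _ = K * L * T * B * (L' * A) * K' * r := by rw [hB]; simp only [mul_assoc]
      _ = K * L * T * B * A * (L' * K' * r) := by rw [hAL']; simp only [mul_assoc]
      _ = _ := by rw [hY']; simp only [mul_assoc]
  rw [sub_mul, e1, e2]
  simp only [mul_sub, sub_mul]

variable {N m : ℕ} {σ : Type*}

theorem evT_mul_eq_zero {x : Yp N} (X : Ten N m (MvPowerSeries σ (EndY N)))
    {Y : Ten N m (MvPowerSeries σ (EndY N))} (hY : evT x Y = 0) : evT x (X * Y) = 0 := by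
  classical
  ext a b d
  rw [evT_apply, coeff_evS, Matrix.mul_apply, map_sum, Op.sum_apply]
  refine Finset.sum_eq_zero fun c _ => ?_
  rw [MvPowerSeries.coeff_mul, Op.sum_apply]
  refine Finset.sum_eq_zero fun p _ => ?_
  have h : MvPowerSeries.coeff p.2 (Y c b) x = 0 :=
    congrArg (MvPowerSeries.coeff p.2) (congrFun (congrFun hY c) b)
  rw [Op.mul_apply, h, map_zero]

theorem evT_one : evT 1 (1 : Ten N m (MvPowerSeries σ (EndY N))) = 1 := by
  classical
  ext a b d
  rw [evT_apply, coeff_evS, Matrix.one_apply, Matrix.one_apply]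
  split_ifs
  · rw [MvPowerSeries.coeff_one, MvPowerSeries.coeff_one]
    split_ifs <;> rfl
  · rw [map_zero, map_zero]
    rfl

theorem evT_one_mul_site {M : ℕ → Matrix (Fin N) (Fin N) (EndY N)}
    (h1 : ∀ k a b, M k a b 1 = if k = 0 then (1 : MatY N) a b else 0) {w : MvPowerSeries σ Ch}
    (hw : MvPowerSeries.constantCoeff w = 0) (i : Fin m)
    (X : Ten N m (MvPowerSeries σ (EndY N))) : evT 1 (X * site i (mser M w)) = evT 1 X := by
  have h : evT 1 (site i (mser M w - 1) : Ten N m (MvPowerSeries σ (EndY N))) = 0 := by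
    ext a b d
    rw [evT_apply, coeff_evS, site_apply]
    split_ifs
    · rw [Matrix.sub_apply, map_sub, Op.sub_apply]
      change MvPowerSeries.coeff d (subs (fun r => M r (a i) (b i)) w) 1 - _ = _
      rw [coeff_subs hw _ d _ le_rfl, Op.sum_apply]
      simp only [Op.smul_apply, h1]
      rw [Finset.sum_eq_single 0]
      · classical
        rw [if_pos rfl, pow_zero, Matrix.one_apply, Matrix.one_apply, MvPowerSeries.coeff_one]
        split_ifs with h h' <;> simp [MvPowerSeries.coeff_one, h, Op.one_apply, Op.zero_apply]
      · intro r _ hr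
        rw [if_neg hr, smul_zero]
      · simp
    · rw [map_zero]
      rfl
  have e : X * site i (mser M w) = X + X * site i (mser M w - 1) := by
    rw [site_sub, site_one]
    noncomm_ring
  rw [e, ← sub_eq_zero, ← evT_sub, add_sub_cancel_left, evT_mul_eq_zero X h]

theorem coeff_rename_mul_subs {A : Type*} [Ring A] [Algebra Ch A] [DecidableEq σ] {τ : Type*}
    [Fintype τ] {ι : τ → σ} (hι : Function.Injective ι) {j : σ} (hj : ∀ t, ι t ≠ j)
    (hw : ∀ t, MvPowerSeries.constantCoeff (MvPowerSeries.X (ι t) : MvPowerSeries σ Ch) = 0)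
    (f : MvPowerSeries τ A) (a : ℕ → A) (e : τ →₀ ℕ) (r : ℕ) :
    MvPowerSeries.coeff (e.mapDomain ι + Finsupp.single j r)
      (substHom (fun t => MvPowerSeries.X (ι t)) hw f *
        subs a (MvPowerSeries.X j : MvPowerSeries σ Ch)) = MvPowerSeries.coeff e f * a r := by
  have hj' : ∀ e' : τ →₀ ℕ, e'.mapDomain ι j = 0 := fun e' =>
    Finsupp.mapDomain_of_notMem_range _ _ fun ⟨t, ht⟩ => hj t ht
  classical
  rw [MvPowerSeries.coeff_mul, Finset.sum_eq_single (e.mapDomain ι, Finsupp.single j r)]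
  · rw [coeff_substHom_X hι, coeff_subs_X, Finsupp.single_eq_same, if_pos rfl]
  · rintro ⟨p, q⟩ hpq hne
    rw [Finset.HasAntidiagonal.mem_antidiagonal] at hpq
    change _ * MvPowerSeries.coeff q _ = 0
    rw [coeff_subs_X]
    by_cases hq : q = Finsupp.single j (q j)
    · by_cases hp : ∃ e' : τ →₀ ℕ, p = e'.mapDomain ι
      · exfalso
        obtain ⟨e', rfl⟩ := hp
        have h := DFunLike.congr_fun hpq j
        change e'.mapDomain ι j + q j = e.mapDomain ι j + Finsupp.single j r j at h
        rw [hj', hj', Finsupp.single_eq_same, zero_add, zero_add] at h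
        rw [h] at hq
        subst hq
        exact hne (Prod.ext (add_right_cancel hpq) rfl)
      · rw [coeff_substHom_X_of_notMem, zero_mul]
        exact fun e' he' => hp ⟨e', he'⟩
    · rw [if_neg hq, mul_zero]
  · intro h
    refine absurd ?_ h
    rw [Finset.HasAntidiagonal.mem_antidiagonal]

theorem evS_substHom {τ : Type*} [Fintype τ] {w : τ → MvPowerSeries σ Ch}
    (hw : ∀ t, MvPowerSeries.constantCoeff (w t) = 0) (x : Yp N)
    (f : MvPowerSeries τ (EndY N)) : evS x (substHom w hw f) = substHom w hw (evS x f) := by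
  refine MvPowerSeries.ext fun d => ?_
  rw [coeff_evS, substHom_apply, substHom_apply, coeff_substFun hw f d _ le_rfl,
    coeff_substFun hw _ d _ le_rfl, Op.sum_apply]
  rfl

theorem emb_succ_mul_site_apply {R : Type*} [Ring R] (X : Ten N m R)
    (M : Matrix (Fin N) (Fin N) R) (a b : Fin m → Fin N) (i j : Fin N) :
    (emb Fin.succ (Fin.succ_injective m) X * site 0 M : Ten N (m + 1) R)
      (Fin.cons i a : Fin (m + 1) → Fin N) (Fin.cons j b : Fin (m + 1) → Fin N) =
        X a b * M i j := by
  have h : ∀ c, emb Fin.succ (Fin.succ_injective m) X (Fin.cons i a : Fin (m + 1) → Fin N)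
      (Function.update (Fin.cons j b : Fin (m + 1) → Fin N) 0 c) = if i = c then X a b else 0 := by
    intro c
    rw [emb_apply]
    refine if_congr ⟨fun h => ?_, ?_⟩ ?_ rfl
    · simpa using h 0 (by simp)
    · rintro rfl l hl
      cases l using Fin.cases with
      | zero => simp
      | succ l => simp at hl
    · congr 1
  rw [mul_site_apply, Finset.sum_eq_single i]
  · rw [h, if_pos rfl]
    rfl
  · intro c _ hc
    rw [h, if_neg hc.symm, zero_mul]
  · simp

theorem evT_exch_eq_zero {x : Yp N} {D : Ten N m (MvPowerSeries σ (EndY N))} (hD : evT x D = 0)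
    (s s' t t' α α' β β' γ γ' δ δ' : MvPowerSeries σ Ch) (i i' j j' k k' l l' n : Fin m)
    (v : MvPowerSeries σ Ch) :
    evT x ((s • rm α α' i i') * (t • rm β β' j j') * site n (mser (tE N) v) * D *
      (s' • rm γ γ' k k') * (t' • rm δ δ' l l')) = 0 := by
  simp only [smul_mul_assoc, mul_smul_comm, evT_smul, mul_assoc, evT_rm_mul, evT_site_mul]
  simp only [← mul_assoc, evT_mul_rm, hD, mul_zero, zero_mul, smul_zero]

/-- Operators that fix the vacuum and are exchanged with `T` by solutions of the Yang–Baxter equation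
satisfy the quadratic relation. -/
theorem Exch.rtt {ρ κ ρ' κ' α β : MvPowerSeries (Fin 2) Ch}
    {M : ℕ → Matrix (Fin N) (Fin N) (EndY N)} (h : Exch ρ κ ρ' κ' M)
    (h1 : ∀ k a b, M k a b 1 = if k = 0 then (1 : MatY N) a b else 0)
    {α₃ β₃ κ₁ κ₂ κ₁' κ₂' : MvPowerSeries (Fin 3) Ch}
    (hα : substHom (fun t => MvPowerSeries.X (Fin.succ t))
      (fun _ => MvPowerSeries.constantCoeff_X _) α = α₃)
    (hβ : substHom (fun t => MvPowerSeries.X (Fin.succ t))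
      (fun _ => MvPowerSeries.constantCoeff_X _) β = β₃)
    (hκ₁ : substHom ![MvPowerSeries.X 1, MvPowerSeries.X 0] (constantCoeff_pair
      (MvPowerSeries.constantCoeff_X _) (MvPowerSeries.constantCoeff_X _)) κ = κ₁)
    (hκ₂ : substHom ![MvPowerSeries.X 2, MvPowerSeries.X 0] (constantCoeff_pair
      (MvPowerSeries.constantCoeff_X _) (MvPowerSeries.constantCoeff_X _)) κ = κ₂)
    (hκ₁' : substHom ![MvPowerSeries.X 1, MvPowerSeries.X 0] (constantCoeff_pair
      (MvPowerSeries.constantCoeff_X _) (MvPowerSeries.constantCoeff_X _)) κ' = κ₁')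
    (hκ₂' : substHom ![MvPowerSeries.X 2, MvPowerSeries.X 0] (constantCoeff_pair
      (MvPowerSeries.constantCoeff_X _) (MvPowerSeries.constantCoeff_X _)) κ' = κ₂')
    (hY : β₃ * κ₁ = κ₂ * (β₃ + κ₁ * α₃)) (hY' : β₃ * κ₂' = κ₁' * (β₃ + κ₂' * α₃)) :
    RTT α β (mser M 𝐮) (mser M 𝐯) := by
  apply RTT.of_site
  rw [← sub_eq_zero]
  -- The defect `D` of the quadratic relation is shown to be the zero operator. By the Yang–Baxter
  -- equation it is exchanged with a copy of `T` in a third tensor factor.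
  set D := (rm α β 0 1 * site 0 (mser M 𝐮) * site 1 (mser M 𝐯) -
    site 1 (mser M 𝐯) * site 0 (mser M 𝐮) * rm α β 0 1 : Ten N 2 (MvPowerSeries (Fin 2) (EndY N)))
    with hD
  set s : MvPowerSeries (Fin 2) (EndY N) →+* MvPowerSeries (Fin 3) (EndY N) :=
    substHom (fun t => MvPowerSeries.X (Fin.succ t)) fun _ => MvPowerSeries.constantCoeff_X _
    with hs
  set D₃ : Ten N 3 (MvPowerSeries (Fin 3) (EndY N)) :=
    emb Fin.succ (Fin.succ_injective 2) (s.mapMatrix D) with hD₃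
  have hc : ∀ i : Fin 3, MvPowerSeries.constantCoeff (MvPowerSeries.X i : MvPowerSeries (Fin 3) Ch)
    = 0 := fun i => MvPowerSeries.constantCoeff_X _
  have e₃ : D₃ = rm α₃ β₃ 1 2 * site 1 (mser M (MvPowerSeries.X 1)) *
      site 2 (mser M (MvPowerSeries.X 2)) - site 2 (mser M (MvPowerSeries.X 2)) *
        site 1 (mser M (MvPowerSeries.X 1)) * rm α₃ β₃ 1 2 := by
    have e1 : (rm α β 0 1 : Ten N 2 (MvPowerSeries (Fin 2) (EndY N))).map s = rm α₃ β₃ 0 1 := by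
      rw [← hα, ← hβ]
      exact rm_map s _ (substHom_smul _) α β 0 1
    have eM : ∀ i : Fin 2, (mser M (MvPowerSeries.X i)).map s =
        mser M (MvPowerSeries.X (Fin.succ i)) := fun i => by
      rw [hs, mser_subst M (MvPowerSeries.constantCoeff_X _), substHom_X']
    rw [hD₃, hD]
    simp only [map_sub, map_mul, RingHom.mapMatrix_apply, site_map, e1, eM, emb_rm, emb_site,
      Fin.succ_zero_eq_one, Fin.succ_one_eq_two]
  have hT := defect_exchange (r := (rm α₃ β₃ 1 2 : Ten N 3 (MvPowerSeries (Fin 3) (EndY N))))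
    (h.at (hc 1) (hc 0) (i := (1 : Fin 3)) (j := 0) (by decide))
    (h.at (hc 2) (hc 0) (i := (2 : Fin 3)) (j := 0) (by decide))
    (by rw [mul_smul_comm, smul_mul_assoc, rm_site_of_ne (by decide) (by decide)])
    (by rw [mul_smul_comm, smul_mul_assoc, rm_site_of_ne (by decide) (by decide)])
    (by rw [mul_smul_comm, smul_mul_assoc, rm_site_of_ne (by decide) (by decide)])
    (by rw [mul_smul_comm, smul_mul_assoc, rm_site_of_ne (by decide) (by decide)])
    (rm_site_of_ne (by decide) (by decide) _ _ _)
    (by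
      have := yang_baxter (R := MvPowerSeries (Fin 3) (EndY N)) (N := N) (i := (2 : Fin 3))
        (j := 1) (k := 0) (by decide) (by decide) (by decide) α₃ β₃ 1 κ₂ 1 κ₁
        (by linear_combination hY)
      rw [hκ₁, hκ₂]
      simp only [mul_smul_comm, smul_mul_assoc, rm_comm α₃ β₃ 1 2, this]
      rw [smul_comm])
    (by
      have := yang_baxter (R := MvPowerSeries (Fin 3) (EndY N)) (N := N) (i := (1 : Fin 3))
        (j := 2) (k := 0) (by decide) (by decide) (by decide) α₃ β₃ 1 κ₁' 1 κ₂'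
        (by linear_combination hY')
      rw [hκ₁', hκ₂']
      simp only [mul_smul_comm, smul_mul_assoc, ← this]
      rw [smul_comm])
  rw [← e₃] at hT
  have key : ∀ x : Yp N, ∀ a b d, MvPowerSeries.coeff d (D a b) x = 0 := by
    let U : Submodule Ch (Yp N) :=
      { carrier := {x | ∀ a b d, MvPowerSeries.coeff d (D a b) x = 0}
        zero_mem' := fun a b d => map_zero _
        add_mem' := fun {x y} hx hy a b d => by rw [map_add, hx, hy, add_zero]
        smul_mem' := fun c x hx a b d => by rw [map_smul, hx, smul_zero] }
    intro x
    refine Yp.induction_left U ?_ ?_ ?_ x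
    -- On the vacuum both orders of the product reduce to the `R`-matrix.
    · have e : evT 1 D = 0 := by
        rw [hD, mul_assoc, evT_sub, evT_rm_mul, evT_mul_rm,
          evT_one_mul_site h1 (MvPowerSeries.constantCoeff_X _),
          evT_one_mul_site h1 (MvPowerSeries.constantCoeff_X _),
          ← one_mul (site 0 (mser M 𝐮)), ← one_mul (site 1 (mser M 𝐯)),
          evT_one_mul_site h1 (MvPowerSeries.constantCoeff_X _),
          evT_one_mul_site h1 (MvPowerSeries.constantCoeff_X _), evT_one, one_mul, mul_one,
          sub_self]
      exact fun a b d => congrArg (MvPowerSeries.coeff d) (congrFun (congrFun e a) b)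
    · intro i j r x hx a b d
      have e0 : evT x D₃ = 0 := by
        ext a b : 1
        rw [evT_apply, hD₃, emb_apply]
        split_ifs
        · change evS x (s (D _ _)) = 0
          rw [hs]
          rw [evS_substHom (fun _ => MvPowerSeries.constantCoeff_X _),
            show evS x (D (a ∘ Fin.succ) (b ∘ Fin.succ)) = 0 from
            MvPowerSeries.ext fun d => hx _ _ d, map_zero]
        · exact map_zero _
      have e1 : evT x (D₃ * site 0 (mser (tE N) (MvPowerSeries.X 0))) = 0 := by
        rw [hT]
        exact evT_exch_eq_zero e0 _ _ _ _ _ _ _ _ _ _ _ _ _ _ _ _ _ _ _ _ _ _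
      -- As `T = 1 - h (…)` and `D x = 0`, the operator `D` annihilates `h t x` for the generators
      -- `t`, hence annihilates `t x`.
      rw [tE_eq (MvPowerSeries.constantCoeff_X _), site_sub, site_one, site_smul, mul_sub, mul_one,
        mul_smul_comm, evT_sub, e0, evT_smul, zero_sub, neg_eq_zero] at e1
      have e2 := nonTorsion_hC_ten (HTF.pres _) (e1.trans (smul_zero _).symm)
      have e3 := congrArg (MvPowerSeries.coeff (d.mapDomain Fin.succ + Finsupp.single 0 r))
        (congrFun (congrFun e2 (Fin.cons i a)) (Fin.cons j b))
      rw [evT_apply, coeff_evS, hD₃, emb_succ_mul_site_apply] at e3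
      have e4 := coeff_rename_mul_subs (Fin.succ_injective 2) (fun t => Fin.succ_ne_zero t)
        (fun _ => MvPowerSeries.constantCoeff_X _) (D a b) (fun r => lamY N (yNeg i j r)) d r
      exact (congrArg (fun f : EndY N => f x) e4).symm.trans e3
    · intro x hx a b d
      refine (HTF.pres (dualRel N)).sep _ fun n => ?_
      obtain ⟨y, hy, w, rfl⟩ := hx n
      refine ⟨MvPowerSeries.coeff d (D a b) w, ?_⟩
      rw [map_add, map_smul, hy a b d, zero_add]
  ext a b d
  exact Op.ext fun x => key x a b d

end Quadratic

/-! ### The action of the double Yangian on the dual Yangian -/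

section Action

variable {N : ℕ}

theorem rm_mul_rm_neg {S R : Type*} [CommRing S] [Ring R] [Algebra S R] {m : ℕ} (β : S)
    (i j : Fin m) : (rm 1 β i j * rm 1 (-β) i j : Ten N m R) = (1 - β * β) • 1 := by
  simp only [rm, sub_mul, mul_sub, smul_mul_assoc, mul_smul_comm, one_mul, mul_one, perm_mul_self]
  module

theorem inv_sub_inv_mul {σ : Type*} {x y v w w' : MvPowerSeries σ Ch} (h : w * (1 - x * v) = x)
    (h' : w' * (1 - y * v) = y) : x * y * (w' - w) = w * w' * (y - x) := by
  linear_combination (-(y * w')) * h + (x * w) * h'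

theorem substHom_shiftW {σ : Type*} {x v : MvPowerSeries σ Ch}
    (hx : MvPowerSeries.constantCoeff x = 0) (hv : MvPowerSeries.constantCoeff v = 0) (γ : Ch) :
    substHom ![x, v] (constantCoeff_pair hx hv) (shiftW γ) *
      (1 - x * (v - MvPowerSeries.C γ)) = x := by
  have := congrArg (substHom (A := Ch) ![x, v] (constantCoeff_pair hx hv)) (shiftW_mul γ)
  simpa [substHom_X', substHom_C] using this

theorem Exch.rtt_minus {ρ ρ' : MvPowerSeries (Fin 2) Ch} {γ γ' : Ch}
    {τ : Fin N → Fin N → ℕ → EndY N}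
    (h : Exch ρ (-(hC Ch * shiftW γ)) ρ' (hC Ch * shiftW γ') (serMinus τ))
    (hτ : ∀ i j r, τ i j r 1 = 0) :
    RTT (𝐯 - 𝐮) (hC Ch * 𝐮 * 𝐯) (mser (serMinus τ) 𝐮) (mser (serMinus τ) 𝐯) := by
  have hc : ∀ i : Fin 3, MvPowerSeries.constantCoeff (MvPowerSeries.X i : MvPowerSeries (Fin 3) Ch)
    = 0 := fun i => MvPowerSeries.constantCoeff_X _
  refine h.rtt ?_ rfl rfl rfl rfl rfl rfl ?_ ?_
  · intro k a b
    cases k with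
    | zero =>
      rw [if_pos rfl, serMinus, Matrix.one_apply, Matrix.one_apply]
      split_ifs <;> rfl
    | succ k =>
      rw [if_neg (Nat.succ_ne_zero k)]
      change (hbar • τ a b k) 1 = 0
      rw [Op.smul_apply, hτ, smul_zero]
  · have h1 := substHom_shiftW (hc 1) (hc 0) γ
    have h2 := substHom_shiftW (hc 2) (hc 0) γ
    have := inv_sub_inv_mul h1 h2
    simp only [map_sub, map_mul, map_neg, substHom_X', substHom_hC, Fin.succ_zero_eq_one,
      Fin.succ_one_eq_two]
    linear_combination (hC Ch * hC Ch) * this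
  · have h1 := substHom_shiftW (hc 1) (hc 0) γ'
    have h2 := substHom_shiftW (hc 2) (hc 0) γ'
    have := inv_sub_inv_mul h1 h2
    simp only [map_sub, map_mul, substHom_X', substHom_hC, Fin.succ_zero_eq_one,
      Fin.succ_one_eq_two]
    linear_combination (hC Ch * hC Ch) * this

theorem tE_eq_serPlus (N : ℕ) : tE N = serPlus fun i j r => lamY N (yNeg i j r) :=
  funext fun r => serPlus_map (lamY N) yNeg r

/-- The action of the double Yangian at the level `c` on the dual Yangian, which fills the role of
the vacuum module. -/
theorem exists_action (N : ℕ) (c : Ch) :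
    ∃ act : DY N →ₐ[Ch] EndY N, act (cenC N) = algebraMap Ch (EndY N) c ∧
      (∀ i j r, act (tPos i j r) 1 = 0) ∧ ∀ i j r, act (tNeg i j r) = lamY N (yNeg i j r) := by
  have hA : HTF (EndY N) := (HTF.pres (dualRel N)).op
  -- The level enters only through the shifts `± h c / 2` of the spectral parameter.
  set γ := PowerSeries.C (1 / 2 : ℂ) * hbar * c
  set γ' := PowerSeries.C (-1 / 2 : ℂ) * hbar * c
  obtain ⟨ρ, τ, hρ, hE, hτ⟩ := exists_tMinus (N := N) γ γ'
    ⟨(PowerSeries.C (-1 / 2 : ℂ) - PowerSeries.C (1 / 2 : ℂ)) * c, by ring⟩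
  obtain ⟨φ, hφ⟩ := exists_lift_freeTop (N := N) hA fun g => match g with
    | Gen.cen => algebraMap Ch (EndY N) c
    | Gen.pos i j r => τ i j r
    | Gen.neg i j r => lamY N (yNeg i j r)
  have hcen : φ (FreeTop.gen Gen.cen) = algebraMap Ch (EndY N) c := hφ _
  have hpos : ∀ i j r, φ (FreeTop.gen (Gen.pos i j r)) = τ i j r := fun i j r => hφ _
  have hneg : ∀ i j r, φ (FreeTop.gen (Gen.neg i j r)) = lamY N (yNeg i j r) := fun i j r => hφ _
  obtain ⟨act, hact⟩ := Pres.exists_lift (S := dyRel N) hA φ (by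
    rintro x (((⟨g, rfl⟩ | hx) | hx) | hx)
    · rw [map_sub, map_mul, map_mul, hcen, Algebra.commutes, sub_self]
    · refine (relPlus_iff φ).2 ?_ x hx
      simp only [hneg]
      have := rtt_tY.mser_map (lamY N)
      rwa [show (fun r => (tY N r).map (lamY N)) = tE N from rfl, tE_eq_serPlus] at this
    · refine (relMinus_iff φ).2 ?_ x hx
      simp only [hpos]
      exact hE.rtt_minus hτ
    · refine (relMixed_iff φ c hcen).2 ?_ x hx
      simp only [hpos, hneg]
      rw [← tE_eq_serPlus, map_shiftInv, map_shiftInv, mul_assoc, hE]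
      simp only [← mul_assoc]
      have e : (rbar 0 1 (shiftW γ) : Ten N 2 (MvPowerSeries (Fin 2) (EndY N))) *
          (ρ • rm 1 (-(hC Ch * shiftW γ)) 0 1) = 1 := by
        rw [rbar, smul_mul_assoc, mul_smul_comm, rm_mul_rm_neg, smul_smul, smul_smul,
          mul_comm (nser N (shiftW γ)) ρ, mul_assoc, hρ, one_smul]
      rw [e, one_mul]
      rfl)
  refine ⟨act, (hact _).trans hcen, fun i j r => ?_, fun i j r => (hact _).trans (hneg i j r)⟩
  exact (congrArg (fun f : EndY N => f 1) ((hact _).trans (hpos i j r))).trans (hτ i j r)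

/-- The vacuum module at the critical level maps to the dual Yangian by `x 𝟏 ↦ x · 1`. -/
theorem exists_vacCrit_map (N : ℕ) : ∃ π : VacCrit N →ₗ[Ch] Yp N,
    ∃ act : DY N →ₐ[Ch] EndY N, (∀ i j r, act (tNeg i j r) = lamY N (yNeg i j r)) ∧
      ∀ x, π (onVac x) = act x 1 := by
  obtain ⟨act, hcen, hpos, hneg⟩ := exists_action N (PowerSeries.C (-(N : ℂ)))
  have hH : HTF (Yp N) := HTF.pres (dualRel N)
  -- The annihilator of `1` is a closed saturated left ideal which contains `C + N` and all
  -- `t_{ij}^{(r)}`, hence it contains the ideal that defines the vacuum module.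
  let L : Submodule (DY N) (DY N) :=
    { carrier := {x | act x 1 = 0}
      zero_mem' := by
        change act 0 1 = 0
        rw [map_zero, Op.zero_apply]
      add_mem' := fun {x y} hx hy => by
        change act (x + y) 1 = 0
        rw [map_add, Op.add_apply, hx, hy, add_zero]
      smul_mem' := fun c x hx => by
        change act (c * x) 1 = 0
        rw [map_mul, Op.mul_apply, hx, map_zero] }
  have hle : vacIdeal N (-(N : ℂ)) ≤ L := by
    refine sInf_le ⟨?_, hpos, ?_, ?_⟩
    · change act (cenC N - algebraMap Ch (DY N) (PowerSeries.C (-(N : ℂ)))) 1 = 0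
      rw [map_sub, hcen, AlgHom.commutes, sub_self, Op.zero_apply]
    · intro x hx
      refine hH.tf _ ?_
      change act (hbar • x) 1 = 0 at hx
      rwa [map_smul, Op.smul_apply] at hx
    · intro x hx
      refine hH.sep _ fun n => ?_
      obtain ⟨y, hy, w, rfl⟩ := hx n
      refine ⟨act w 1, ?_⟩
      change act y 1 = 0 at hy
      rw [map_add, map_smul, Op.add_apply, Op.smul_apply, hy, zero_add]
  have hwell : ∀ x y : DY N, onVac x = onVac y → act x 1 = act y 1 := by
    intro x y hxy
    have h : act (x - y) 1 = 0 := hle ((Submodule.Quotient.eq _).1 hxy)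
    rw [map_sub, Op.sub_apply] at h
    exact sub_eq_zero.1 h
  have hsurj : ∀ v : VacCrit N, ∃ x : DY N, onVac x = v := Submodule.Quotient.mk_surjective _
  choose f hf using hsurj
  refine ⟨{ toFun := fun v => act (f v) 1, map_add' := fun v w => ?_, map_smul' := fun c v => ?_ },
    act, hneg, fun x => hwell _ _ (hf _)⟩
  · rw [← Op.add_apply, ← map_add]
    refine hwell _ _ ?_
    rw [hf]
    refine Eq.trans ?_ (Submodule.Quotient.mk_add _).symm
    exact congrArg₂ _ (hf v).symm (hf w).symm
  · rw [RingHom.id_apply, ← Op.smul_apply, ← map_smul]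
    refine hwell _ _ ?_
    rw [hf]
    refine Eq.trans ?_ (Submodule.Quotient.mk_smul _ c _).symm
    exact congrArg _ (hf v).symm

/-- The product `T⁺₁(u₁) ⋯ T⁺ₘ(uₘ)` over the dual Yangian. -/
def yProd (N m : ℕ) : Ten N m (MvPowerSeries (Fin m) (Yp N)) :=
  (List.ofFn fun i : Fin m => siteSeries i (tY N) (MvPowerSeries.X i)).prod

theorem Ten.map_list_prod {R R' : Type*} [Ring R] [Ring R'] {m : ℕ} (φ : R →+* R')
    (l : List (Ten N m R)) :
    Matrix.map l.prod φ = (l.map fun X => Matrix.map X φ).prod :=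
  _root_.map_list_prod (φ.mapMatrix (m := Fin m → Fin N)) l

theorem siteSeries_map {σ A A' : Type*} [Ring A] [Algebra Ch A] [Ring A'] [Algebra Ch A'] {m : ℕ}
    (φ : A →ₐ[Ch] A') (i : Fin m) (T : ℕ → Matrix (Fin N) (Fin N) A) (w : MvPowerSeries σ Ch) :
    (siteSeries i T w).map (MvPowerSeries.map φ.toRingHom) =
      siteSeries i (fun r => (T r).map φ) w := by
  rw [siteSeries_eq, siteSeries_eq, site_map, mser_map]

theorem act_TplusProd {act : DY N →ₐ[Ch] EndY N}
    (h : ∀ i j r, act (tNeg i j r) = lamY N (yNeg i j r)) (m : ℕ) (a b : Fin m → Fin N)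
    (d : Fin m →₀ ℕ) : act (MvPowerSeries.coeff d (TplusProd N m a b)) 1 =
      MvPowerSeries.coeff d (yProd N m a b) := by
  have e1 : (TplusProd N m).map (MvPowerSeries.map act.toRingHom) =
      (yProd N m).map (MvPowerSeries.map (lamY N).toRingHom) := by
    rw [TplusProd, yProd, Ten.map_list_prod, Ten.map_list_prod, List.map_ofFn, List.map_ofFn]
    congr 2
    funext i
    simp only [Function.comp, siteSeries_map]
    congr 1
    funext r
    rw [serPlus_map]
    simp only [h]
    exact (congrFun (tE_eq_serPlus N) r).symm
  have e2 := congrArg (MvPowerSeries.coeff d) (congrFun (congrFun e1 a) b)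
  rw [Matrix.map_apply, Matrix.map_apply, MvPowerSeries.coeff_map, MvPowerSeries.coeff_map] at e2
  refine (congrArg (fun f : EndY N => f 1) e2).trans ?_
  exact (lamY_apply _ _).trans (mul_one _)

end Action

/-! ### The Yangian and the reflection equation -/

section Yangian

variable {N m : ℕ} {σ : Type*}

/-- The coefficients of `T(u)`. -/
def tD (N : ℕ) : ℕ → Matrix (Fin N) (Fin N) (DY N) := serMinus tPos

/-- The coefficients of `T(-u)⁻¹`. -/
def tInv (N : ℕ) (k : ℕ) : Matrix (Fin N) (Fin N) (DY N) :=
  PowerSeries.coeff k (PowerSeries.invOfUnit (evalNeg (Tser N)) 1)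

/-- The coefficients of `B(u)`. -/
def bD (N : ℕ) : ℕ → Matrix (Fin N) (Fin N) (DY N) := serMinus bCoeff

theorem subs_neg {A : Type*} [Ring A] [Algebra Ch A] (a : ℕ → A) (w : MvPowerSeries σ Ch) :
    subs a (-w) = subs (fun r => (-1) ^ r * a r) w := by
  refine MvPowerSeries.ext fun d => ?_
  change ∑ r ∈ Finset.range (d.degree + 1), MvPowerSeries.coeff d ((-w) ^ r) • a r =
    ∑ r ∈ Finset.range (d.degree + 1), MvPowerSeries.coeff d (w ^ r) • ((-1) ^ r * a r)
  refine Finset.sum_congr rfl fun r _ => ?_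
  rw [neg_pow]
  rcases neg_one_pow_eq_or (MvPowerSeries σ Ch) r with h | h <;>
    rcases Nat.even_or_odd r with hr | hr <;> simp [hr.neg_one_pow]

theorem mser_coeff_mul (F G : PowerSeries (Matrix (Fin N) (Fin N) (DY N)))
    {w : MvPowerSeries σ Ch} (hw : MvPowerSeries.constantCoeff w = 0) :
    mser (fun k => PowerSeries.coeff k (F * G)) w =
      mser (fun k => PowerSeries.coeff k F) w * mser (fun k => PowerSeries.coeff k G) w := by
  rw [mser_mul hw]
  simp only [PowerSeries.coeff_mul]

theorem mser_coeff_one (w : MvPowerSeries σ Ch) (hw : MvPowerSeries.constantCoeff w = 0) :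
    mser (fun k => PowerSeries.coeff k (1 : PowerSeries (Matrix (Fin N) (Fin N) (DY N)))) w =
      1 := by
  ext a b : 1
  have : (fun k => PowerSeries.coeff k (1 : PowerSeries (Matrix (Fin N) (Fin N) (DY N))) a b) =
      fun k => PowerSeries.coeff k (PowerSeries.C ((1 : Matrix (Fin N) (Fin N) (DY N)) a b)) := by
    funext k
    rw [PowerSeries.coeff_one, PowerSeries.coeff_C]
    split_ifs <;> rfl
  change subs (fun k => _) w = _
  rw [this, subs_eq_subsHom hw, show (PowerSeries.mk fun k => PowerSeries.coeff k
    (PowerSeries.C ((1 : Matrix (Fin N) (Fin N) (DY N)) a b))) =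
    PowerSeries.C ((1 : Matrix (Fin N) (Fin N) (DY N)) a b) from
      PowerSeries.ext fun k => PowerSeries.coeff_mk _ _]
  rw [Matrix.one_apply, Matrix.one_apply]
  split_ifs
  · rw [map_one, map_one]
  · rw [map_zero, map_zero]

theorem constantCoeff_evalNeg_Tser :
    PowerSeries.constantCoeff (evalNeg (Tser N)) =
      ((1 : (Matrix (Fin N) (Fin N) (DY N))ˣ) : Matrix (Fin N) (Fin N) (DY N)) := by
  rw [← PowerSeries.coeff_zero_eq_constantCoeff_apply]
  simp [evalNeg, Tser, serMinus]

theorem mser_evalNeg (w : MvPowerSeries σ Ch) :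
    mser (fun k => PowerSeries.coeff k (evalNeg (Tser N))) w = mser (tD N) (-w) := by
  ext a b : 1
  change subs (fun k => _) w = subs (fun k => tD N k a b) (-w)
  rw [subs_neg]
  congr 1
  funext k
  simp only [evalNeg, Tser, PowerSeries.coeff_mk]
  rcases Nat.even_or_odd k with hk | hk
  · simp only [hk.neg_one_pow, one_mul]
    rfl
  · simp only [hk.neg_one_pow, neg_mul, one_mul]
    rfl

variable {x y w : MvPowerSeries σ Ch}

theorem mser_tInv_mul (hw : MvPowerSeries.constantCoeff w = 0) :
    mser (tInv N) w * mser (tD N) (-w) = 1 := by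
  rw [← mser_evalNeg, ← mser_coeff_one w hw,
    ← PowerSeries.invOfUnit_mul _ 1 constantCoeff_evalNeg_Tser, mser_coeff_mul _ _ hw]
  rfl

theorem mser_mul_tInv (hw : MvPowerSeries.constantCoeff w = 0) :
    mser (tD N) (-w) * mser (tInv N) w = 1 := by
  rw [← mser_evalNeg, ← mser_coeff_one w hw,
    ← PowerSeries.mul_invOfUnit _ 1 constantCoeff_evalNeg_Tser, mser_coeff_mul _ _ hw]
  rfl

theorem mser_bD (hw : MvPowerSeries.constantCoeff w = 0) :
    mser (bD N) w = mser (tD N) w * mser (tInv N) w := by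
  have e1 : bD N = fun k => PowerSeries.coeff k (Bser N) := by
    funext k
    rw [Bser_eq, PowerSeries.coeff_mk]
    rfl
  have e2 : tD N = fun k => PowerSeries.coeff k (Tser N) := by
    funext k
    rw [Tser, PowerSeries.coeff_mk]
    rfl
  rw [e1, e2, Bser, mser_coeff_mul _ _ hw]
  rfl

theorem rtt_tD (hx : MvPowerSeries.constantCoeff x = 0) (hy : MvPowerSeries.constantCoeff y = 0) :
    RTT (y - x) (hC Ch * x * y) (mser (tD N) x) (mser (tD N) y) := by
  have h : RTT (𝐯 - 𝐮) (hC Ch * 𝐮 * 𝐯) (mser (tD N) 𝐮) (mser (tD N) 𝐯) :=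
    (relMinus_iff (Pres.mk (dyRel N))).1 fun _ hx =>
      Pres.mk_of_mem (Or.inl (Or.inr hx))
  have := h.mser_subst hx hy
  simpa only [map_sub, map_mul, substHom_X', substHom_hC, Matrix.cons_val_zero,
    Matrix.cons_val_one] using this

theorem rm_neg {S R : Type*} [CommRing S] [Ring R] [Algebra S R] (α β : S) (i j : Fin m) :
    (rm (-α) (-β) i j : Ten N m R) = -rm α β i j := by
  rw [rm, rm, neg_smul, neg_smul]
  abel

variable {i j : Fin m}

theorem tD_site (hij : i ≠ j) (hx : MvPowerSeries.constantCoeff x = 0)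
    (hy : MvPowerSeries.constantCoeff y = 0) :
    (rm (y - x) (hC Ch * x * y) i j : Ten N m (MvPowerSeries σ (DY N))) *
      site i (mser (tD N) x) * site j (mser (tD N) y) =
    site j (mser (tD N) y) * site i (mser (tD N) x) * rm (y - x) (hC Ch * x * y) i j :=
  (rtt_tD hx hy).site hij

theorem site_tInv_mul (i : Fin m) (hw : MvPowerSeries.constantCoeff w = 0) :
    (site i (mser (tInv N) w) * site i (mser (tD N) (-w)) :
      Ten N m (MvPowerSeries σ (DY N))) = 1 := by
  rw [← site_mul, mser_tInv_mul hw, site_one]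

theorem site_mul_tInv (i : Fin m) (hw : MvPowerSeries.constantCoeff w = 0) :
    (site i (mser (tD N) (-w)) * site i (mser (tInv N) w) :
      Ten N m (MvPowerSeries σ (DY N))) = 1 := by
  rw [← site_mul, mser_mul_tInv hw, site_one]

theorem constantCoeff_neg_eq (hx : MvPowerSeries.constantCoeff x = 0) :
    MvPowerSeries.constantCoeff (-x) = 0 := by
  rw [map_neg, hx, neg_zero]

theorem tInv_site (hij : i ≠ j) (hx : MvPowerSeries.constantCoeff x = 0)
    (hy : MvPowerSeries.constantCoeff y = 0) :
    (rm (y - x) (hC Ch * x * y) i j : Ten N m (MvPowerSeries σ (DY N))) *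
      site i (mser (tInv N) x) * site j (mser (tInv N) y) =
    site j (mser (tInv N) y) * site i (mser (tInv N) x) * rm (y - x) (hC Ch * x * y) i j := by
  have h := tD_site (N := N) hij.symm (constantCoeff_neg_eq hy) (constantCoeff_neg_eq hx)
  rw [show -x - -y = y - x by ring, show hC Ch * -y * -x = hC Ch * x * y by ring,
    rm_comm _ _ j i] at h
  have h1 := site_tInv_mul (N := N) i hx
  have h2 := site_mul_tInv (N := N) i hx
  have h3 := site_tInv_mul (N := N) j hy
  have h4 := site_mul_tInv (N := N) j hy
  set r := (rm (y - x) (hC Ch * x * y) i j : Ten N m (MvPowerSeries σ (DY N)))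
  set a := (site i (mser (tD N) (-x)) : Ten N m (MvPowerSeries σ (DY N)))
  set b := (site j (mser (tD N) (-y)) : Ten N m (MvPowerSeries σ (DY N)))
  set a' := (site i (mser (tInv N) x) : Ten N m (MvPowerSeries σ (DY N)))
  set b' := (site j (mser (tInv N) y) : Ten N m (MvPowerSeries σ (DY N)))
  calc r * a' * b' = b' * (a' * a) * b * r * a' * b' := by
        rw [h1, mul_one, h3, one_mul]
    _ = b' * a' * (a * b * r) * a' * b' := by simp only [mul_assoc]
    _ = b' * a' * r * b * (a * a') * b' := by rw [← h]; simp only [mul_assoc]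
    _ = b' * a' * r := by rw [h2, mul_one, mul_assoc _ b b', h4, mul_one]

theorem tInv_tD_site (hij : i ≠ j) (hx : MvPowerSeries.constantCoeff x = 0)
    (hy : MvPowerSeries.constantCoeff y = 0) :
    (site j (mser (tInv N) y) : Ten N m (MvPowerSeries σ (DY N))) *
      rm (x + y) (hC Ch * x * y) i j * site i (mser (tD N) x) =
    site i (mser (tD N) x) * rm (x + y) (hC Ch * x * y) i j * site j (mser (tInv N) y) := by
  have h := tD_site (N := N) hij hx (constantCoeff_neg_eq hy)
  rw [show -y - x = -(x + y) by ring, show hC Ch * x * -y = -(hC Ch * x * y) by ring, rm_neg] at h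
  simp only [neg_mul, mul_neg, neg_inj] at h
  have h3 := site_tInv_mul (N := N) j hy
  have h4 := site_mul_tInv (N := N) j hy
  set r := (rm (x + y) (hC Ch * x * y) i j : Ten N m (MvPowerSeries σ (DY N)))
  set a := (site i (mser (tD N) x) : Ten N m (MvPowerSeries σ (DY N)))
  set b := (site j (mser (tD N) (-y)) : Ten N m (MvPowerSeries σ (DY N)))
  set b' := (site j (mser (tInv N) y) : Ten N m (MvPowerSeries σ (DY N)))
  calc b' * r * a = b' * (r * a * b) * b' := by
        simp only [mul_assoc, h4, mul_one]
    _ = (b' * b) * a * r * b' := by rw [h]; simp only [mul_assoc]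
    _ = a * r * b' := by rw [h3, one_mul]

/-- The reflection equation. -/
theorem bD_site (hij : i ≠ j) (hx : MvPowerSeries.constantCoeff x = 0)
    (hy : MvPowerSeries.constantCoeff y = 0) :
    (rm (y - x) (hC Ch * x * y) i j : Ten N m (MvPowerSeries σ (DY N))) *
      site i (mser (bD N) x) * rm (x + y) (hC Ch * x * y) i j * site j (mser (bD N) y) =
    site j (mser (bD N) y) * rm (x + y) (hC Ch * x * y) i j * site i (mser (bD N) x) *
      rm (y - x) (hC Ch * x * y) i j := by
  have h1 := tD_site (N := N) hij hx hy
  have h2 := tInv_site (N := N) hij hx hy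
  have h3 := tInv_tD_site (N := N) hij.symm hy hx
  have h4 := tInv_tD_site (N := N) hij hx hy
  rw [add_comm y x, show hC Ch * y * x = hC Ch * x * y by ring, rm_comm _ _ j i] at h3
  have h5 := rm_mul_rm_self (R := MvPowerSeries σ (DY N)) (N := N) (y - x) (hC Ch * x * y) (x + y)
    (hC Ch * x * y) i j
  rw [mser_bD hx, mser_bD hy, site_mul, site_mul]
  set r := (rm (y - x) (hC Ch * x * y) i j : Ten N m (MvPowerSeries σ (DY N)))
  set p := (rm (x + y) (hC Ch * x * y) i j : Ten N m (MvPowerSeries σ (DY N)))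
  set a := (site i (mser (tD N) x) : Ten N m (MvPowerSeries σ (DY N)))
  set b := (site j (mser (tD N) y) : Ten N m (MvPowerSeries σ (DY N)))
  set a' := (site i (mser (tInv N) x) : Ten N m (MvPowerSeries σ (DY N)))
  set b' := (site j (mser (tInv N) y) : Ten N m (MvPowerSeries σ (DY N)))
  calc r * (a * a') * p * (b * b') = r * a * (a' * p * b) * b' := by simp only [mul_assoc]
    _ = (r * a * b) * p * a' * b' := by rw [h3]; simp only [mul_assoc]
    _ = b * a * (r * p) * a' * b' := by rw [h1]; simp only [mul_assoc]
    _ = b * a * p * (r * a' * b') := by rw [h5]; simp only [mul_assoc]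
    _ = b * (a * p * b') * a' * r := by rw [h2]; simp only [mul_assoc]
    _ = _ := by rw [← h4]; simp only [mul_assoc]

end Yangian

/-! ### Inverses of linear forms -/

section LinInv

variable {σ τ : Type*}

/-- `1 / (p⁻¹ + v)`. -/
def linInv (p v : MvPowerSeries σ Ch) : MvPowerSeries σ Ch :=
  p * MvPowerSeries.invOfUnit (1 + p * v) 1

variable {p v : MvPowerSeries σ Ch}

theorem linInv_mul (hp : MvPowerSeries.constantCoeff p = 0) : linInv p v * (1 + p * v) = p := by
  rw [linInv, mul_assoc, MvPowerSeries.invOfUnit_mul, mul_one]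
  simp [hp]

theorem constantCoeff_linInv (hp : MvPowerSeries.constantCoeff p = 0) :
    MvPowerSeries.constantCoeff (linInv p v) = 0 := by
  rw [linInv, map_mul, hp, zero_mul]

theorem eq_linInv (hp : MvPowerSeries.constantCoeff p = 0) {w : MvPowerSeries σ Ch}
    (h : w * (1 + p * v) = p) : w = linInv p v :=
  eq_of_mul_unit (D := 1 + p * v) (by simp [hp]) (h.trans (linInv_mul hp).symm)

theorem substHom_linInv [Fintype σ] {w : σ → MvPowerSeries τ Ch}
    (hw : ∀ t, MvPowerSeries.constantCoeff (w t) = 0) (hp : MvPowerSeries.constantCoeff p = 0) :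
    substHom w hw (linInv p v) = linInv (substHom w hw p) (substHom w hw v) := by
  refine eq_linInv (by rw [constantCoeff_substHom, hp]) ?_
  rw [← map_one (substHom w hw), ← map_mul, ← map_add, ← map_mul, linInv_mul hp]

theorem linInv_sub {v' : MvPowerSeries σ Ch} (hp : MvPowerSeries.constantCoeff p = 0) :
    linInv p v' - linInv p v = linInv p v * linInv p v' * (v - v') := by
  have h := sub_of_mul_eq (x := p) (v₀ := -v') (v₁ := -v) hp
    (by rw [mul_neg, sub_neg_eq_add, linInv_mul hp])
    (by rw [mul_neg, sub_neg_eq_add, linInv_mul hp])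
  rw [h]
  ring

/-- `1/a + 1/b = (a + b)/(ab)`. -/
theorem linInv_add_mul {y v' : MvPowerSeries σ Ch} (hy : MvPowerSeries.constantCoeff y = 0) :
    (linInv (2 * y) v + linInv (2 * y) v') * linInv y (v + v') =
      linInv (2 * y) v * linInv (2 * y) v' := by
  have h2 : MvPowerSeries.constantCoeff (2 * y) = 0 := by rw [map_mul, hy, mul_zero]
  have h := linInv_mul (v := v) h2
  have h' := linInv_mul (v := v') h2
  have h'' := linInv_mul (v := v + v') hy
  refine eq_of_mul_unit (D := (1 + 2 * y * v) * (1 + 2 * y * v') * (1 + y * (v + v')))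
    (by simp [hy]) ?_
  set a := linInv (2 * y) v
  set b := linInv (2 * y) v'
  set c := linInv y (v + v')
  linear_combination (c * (1 + y * (v + v')) * (1 + 2 * y * v') -
    b * (1 + 2 * y * v') * (1 + y * (v + v'))) * h + (c * (1 + y * (v + v')) * (1 + 2 * y * v) -
    2 * y * (1 + y * (v + v'))) * h' + (2 * y * (1 + 2 * y * v') + 2 * y * (1 + 2 * y * v)) * h''

theorem linInv_linInv {v' : MvPowerSeries σ Ch} (hp : MvPowerSeries.constantCoeff p = 0) :
    linInv (linInv p v) v' = linInv p (v + v') := by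
  refine (eq_linInv (constantCoeff_linInv hp) ?_).symm
  refine eq_of_mul_unit (D := 1 + p * v) (by simp [hp]) ?_
  have h1 := linInv_mul (v := v) hp
  have h2 := linInv_mul (v := v + v') hp
  linear_combination h2 + (linInv p (v + v') * v' - 1) * h1

theorem NonTorsion.linInv {A : Type*} [Ring A] [Algebra Ch A]
    (hp : MvPowerSeries.constantCoeff p = 0) (h : NonTorsion A p) :
    NonTorsion A (ReflAlg.linInv p v) := by
  refine NonTorsion.mul h ?_
  refine NonTorsion.of_unit (t := 1 + p * v) (MvPowerSeries.mul_invOfUnit _ 1 ?_)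
  simp [hp]

end LinInv

/-! ### Operators on the maps from the dual Yangian to the double Yangian -/

section HomOperators

variable {N : ℕ}

/-- Linear maps from the dual Yangian to the double Yangian. -/
abbrev HomY (N : ℕ) : Type := Yp N →ₗ[Ch] DY N

theorem HTF.homY : HTF (HomY N) := HTF.linearMap HTF.dy

/-- Precomposition with an operator on the dual Yangian. -/
def preOp (N : ℕ) : EndY N →ₗ[Ch] Op (HomY N) where
  toFun f := Op.of
    { toFun := fun φ => φ.comp (f : Yp N →ₗ[Ch] Yp N)
      map_add' := fun _ _ => rfl
      map_smul' := fun _ _ => rfl }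
  map_add' f g := Op.ext fun φ => LinearMap.ext fun x => map_add φ (f x) (g x)
  map_smul' c f := Op.ext fun φ => LinearMap.ext fun x => map_smul φ c (f x)

theorem preOp_one : preOp N 1 = 1 := rfl

/-- Precomposition with the right multiplication. -/
def rightOp (N : ℕ) : Yp N →ₐ[Ch] Op (HomY N) :=
  AlgHom.ofLinearMap
    { toFun := fun t => preOp N (Op.of (LinearMap.mulRight Ch t))
      map_add' := fun s t => Op.ext fun φ => LinearMap.ext fun x => by
        rw [Op.add_apply, LinearMap.add_apply]
        change φ (x * (s + t)) = φ (x * s) + φ (x * t)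
        rw [mul_add, map_add]
      map_smul' := fun c t => Op.ext fun φ => LinearMap.ext fun x => by
        rw [RingHom.id_apply, Op.smul_apply, LinearMap.smul_apply]
        change φ (x * (c • t)) = c • φ (x * t)
        rw [mul_smul_comm, map_smul] }
    (Op.ext fun φ => LinearMap.ext fun x => by
      change φ (x * 1) = φ x
      rw [mul_one])
    (fun s t => Op.ext fun φ => LinearMap.ext fun x => by
      change φ (x * (s * t)) = φ (x * s * t)
      rw [mul_assoc])

/-- Postcomposition with the left multiplication. -/
def leftOp (N : ℕ) : DY N →ₐ[Ch] Op (HomY N) :=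
  AlgHom.ofLinearMap
    { toFun := fun b => Op.of
        { toFun := fun φ => (LinearMap.mulLeft Ch b).comp φ
          map_add' := fun φ φ' => LinearMap.ext fun x => mul_add b (φ x) (φ' x)
          map_smul' := fun c φ => LinearMap.ext fun x => mul_smul_comm c b (φ x) }
      map_add' := fun s t => Op.ext fun φ => LinearMap.ext fun x => add_mul s t (φ x)
      map_smul' := fun c t => Op.ext fun φ => LinearMap.ext fun x => smul_mul_assoc c t (φ x) }
    (Op.ext fun φ => LinearMap.ext fun x => one_mul (φ x))
    (fun s t => Op.ext fun φ => LinearMap.ext fun x => mul_assoc s t (φ x))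

/-- The series `T⁺(u)`, acting through the right multiplication. -/
def tH (N r : ℕ) : Matrix (Fin N) (Fin N) (Op (HomY N)) := (tY N r).map (rightOp N)

/-- The series `B(u)`, acting through the left multiplication. -/
def bH (N r : ℕ) : Matrix (Fin N) (Fin N) (Op (HomY N)) := (bD N r).map (leftOp N)

/-- The operators `S(u)`, obtained by precomposition from an evaluation homomorphism. -/
def sH (ψ : Yp N →ₐ[Ch] PowerSeries (MatY N)) (k : ℕ) : Matrix (Fin N) (Fin N) (Op (HomY N)) :=
  Matrix.of fun a b => preOp N (opE ψ k a b)

theorem coeff_subs_first_mul {A : Type*} [Ring A] [Algebra Ch A] (f : MvPowerSeries (Fin 2) A)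
    (a : ℕ → A) (k r : ℕ) : MvPowerSeries.coeff (ex k r) (subs a 𝐮 * f) =
      ∑ p ∈ Finset.HasAntidiagonal.antidiagonal k,
        a p.1 * MvPowerSeries.coeff (ex p.2 r) f := by
  rw [coeff_ex_mul]
  refine Finset.sum_congr rfl fun p _ => ?_
  rw [Finset.sum_eq_single (0, r)]
  · rw [coeff_subs_first, if_pos rfl]
  · intro q hq hne
    rw [coeff_subs_first, if_neg, zero_mul]
    intro h0
    rw [Finset.HasAntidiagonal.mem_antidiagonal, h0, zero_add] at hq
    exact hne (Prod.ext h0 hq)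
  · intro h
    exact absurd (Finset.HasAntidiagonal.mem_antidiagonal.2 (zero_add r)) h

theorem coeff_subs_second_mul_subs {A : Type*} [Ring A] [Algebra Ch A] (a b : ℕ → A) (k r : ℕ) :
    MvPowerSeries.coeff (ex k r) (subs b 𝐯 * subs a 𝐮) = b r * a k := by
  rw [coeff_mul_subs_first, Finset.sum_eq_single (0, k)]
  · rw [coeff_subs_second, if_pos rfl]
  · intro q hq hne
    rw [coeff_subs_second, if_neg, zero_mul]
    intro h0
    rw [Finset.HasAntidiagonal.mem_antidiagonal, h0, zero_add] at hq
    exact hne (Prod.ext h0 hq)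
  · intro h
    exact absurd (Finset.HasAntidiagonal.mem_antidiagonal.2 (zero_add k)) h

theorem preOp_exchange (ψ : Yp N →ₐ[Ch] PowerSeries (MatY N)) (y : ℕ → Yp N) (a b : Fin N)
    (Z : Fin N → MvPowerSeries (Fin 2) (Yp N))
    (hZ : ∀ k r c, PowerSeries.coeff k (ψ (y r)) c b = MvPowerSeries.coeff (ex k r) (Z c)) :
    subs (fun r => rightOp N (y r)) 𝐯 * subs (fun k => sH ψ k a b) 𝐮 =
      ∑ c, subs (fun k => sH ψ k a c) 𝐮 * MvPowerSeries.map (rightOp N).toRingHom (Z c) := by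
  refine MvPowerSeries.ext fun d => ?_
  rw [eq_ex d, coeff_subs_second_mul_subs, map_sum]
  refine Op.ext fun φ => LinearMap.ext fun x => ?_
  rw [Op.sum_apply, LinearMap.sum_apply]
  change φ (PowerSeries.coeff (d 0) (ψ (x * y (d 1))) a b) = _
  rw [map_mul, PowerSeries.coeff_mul, Matrix.sum_apply]
  simp only [Matrix.mul_apply, coeff_subs_first_mul, Op.sum_apply, LinearMap.sum_apply]
  rw [Finset.sum_comm, map_sum]
  refine Finset.sum_congr rfl fun c _ => ?_
  rw [map_sum]
  refine Finset.sum_congr rfl fun p _ => ?_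
  rw [hZ]
  rfl

theorem sum_mul_smul_sub {ι σ A A' : Type*} [Fintype ι] [Ring A] [Algebra Ch A] [Ring A']
    [Algebra Ch A'] (φ : A →ₐ[Ch] A') (s t : MvPowerSeries σ Ch) (f g : ι → MvPowerSeries σ A)
    (x : ι → MvPowerSeries σ A') :
    ∑ c, x c * MvPowerSeries.map φ.toRingHom (s • (f c - t • g c)) =
      s • ((∑ c, x c * MvPowerSeries.map φ.toRingHom (f c)) -
        t • ∑ c, x c * MvPowerSeries.map φ.toRingHom (g c)) := by
  rw [Finset.smul_sum, ← Finset.sum_sub_distrib, Finset.smul_sum]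
  refine Finset.sum_congr rfl fun c _ => ?_
  rw [map_smul_series, map_sub, map_smul_series, mul_smul_comm, mul_sub, mul_smul_comm]

theorem site_rm_site {S R : Type*} [CommRing S] [Ring R] [Algebra S R]
    (M T : Matrix (Fin N) (Fin N) R) (s α β : S) (a b : Fin 2 → Fin N) :
    (site 0 M * (s • rm α β 0 1) * site 1 T : Ten N 2 R) a b =
      s • (α • (M (a 0) (b 0) * T (a 1) (b 1)) -
        β • if a 1 = b 0 then ∑ c, M (a 0) c * T c (b 1) else 0) := by
  rw [mul_smul_comm, smul_mul_assoc, Matrix.smul_apply]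
  congr 1
  rw [rm, mul_sub, sub_mul, mul_smul_comm, mul_smul_comm, smul_mul_assoc, smul_mul_assoc, mul_one,
    Matrix.sub_apply, Matrix.smul_apply, Matrix.smul_apply, site_site_two]
  congr 2
  rw [mul_assoc, site_mul_apply]
  have h : ∀ c, (perm 0 1 * site 1 T : Ten N 2 R) (Function.update a 0 c) b =
      if a 1 = b 0 then T c (b 1) else 0 := by
    intro c
    rw [perm_eq, permOp_mul_apply, site_apply, Equiv.symm_swap]
    refine if_congr ⟨fun h => ?_, fun h k hk => ?_⟩ ?_ rfl
    · simpa using h 0 (by decide)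
    · fin_cases k
      · simpa using h
      · exact absurd rfl hk
    · simp
  simp only [h]
  split_ifs <;> simp

theorem map_right_mser (w : MvPowerSeries (Fin 2) Ch) (i j : Fin N) :
    MvPowerSeries.map (rightOp N).toRingHom (mser (tY N) w i j) = mser (tH N) w i j :=
  map_subs (rightOp N) (fun r => tY N r i j) w

/-- The exchange relation between `S` and `T`. -/
theorem tH_sH {ρ κ : MvPowerSeries (Fin 2) Ch} {ψ : Yp N →ₐ[Ch] PowerSeries (MatY N)}
    (hψ : ∀ i j r k a b, PowerSeries.coeff k (ψ (tY N r i j)) a b =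
        MvPowerSeries.coeff (ex k r) (ρ • ((if a = b then mser (tY N) 𝐯 i j else 0) -
          κ • if i = b then mser (tY N) 𝐯 a j else 0))) :
    (site 1 (mser (tH N) 𝐯) : Ten N 2 (MvPowerSeries (Fin 2) (Op (HomY N)))) *
        site 0 (mser (sH ψ) 𝐮) =
      site 0 (mser (sH ψ) 𝐮) * (ρ • rm 1 κ 0 1) * site 1 (mser (tH N) 𝐯) := by
  ext a b : 1
  rw [site_rm_site, site_mul_site_apply (by decide),
    if_pos (fun k h0 h1 => by fin_cases k <;> simp_all)]
  refine (preOp_exchange ψ (fun r => tY N r (a 1) (b 1)) (a 0) (b 0) _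
    fun k r c => hψ (a 1) (b 1) r k c (b 0)).trans ?_
  refine (sum_mul_smul_sub (rightOp N) ρ κ _ _ _).trans ?_
  rw [one_smul]
  congr 3
  · rw [Finset.sum_eq_single (b 0)]
    · rw [if_pos rfl, map_right_mser]
      rfl
    · intro c _ hc
      rw [if_neg hc, map_zero, mul_zero]
    · simp
  · split_ifs
    · refine Finset.sum_congr rfl fun c _ => ?_
      rw [map_right_mser]
      rfl
    · simp

end HomOperators

/-! ### The operators `S`, `B`, `T` -/

section Operators

variable {N m : ℕ} {σ τ : Type*}

/-- Precomposition, applied to the coefficients of a series of operators. -/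
def preS (N : ℕ) : MvPowerSeries σ (EndY N) →+ MvPowerSeries σ (Op (HomY N)) where
  toFun f := fun d => preOp N (MvPowerSeries.coeff d f)
  map_zero' := MvPowerSeries.ext fun d => by
    change preOp N (MvPowerSeries.coeff d (0 : MvPowerSeries σ (EndY N))) =
      MvPowerSeries.coeff d (0 : MvPowerSeries σ (Op (HomY N)))
    rw [map_zero, map_zero, map_zero]
  map_add' f g := MvPowerSeries.ext fun d => by
    change preOp N (MvPowerSeries.coeff d (f + g)) =
      preOp N (MvPowerSeries.coeff d f) + preOp N (MvPowerSeries.coeff d g)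
    rw [map_add, map_add]

theorem coeff_preS (f : MvPowerSeries σ (EndY N)) (d : σ →₀ ℕ) :
    MvPowerSeries.coeff d (preS N f) = preOp N (MvPowerSeries.coeff d f) := rfl

theorem preS_smul (s : MvPowerSeries σ Ch) (f : MvPowerSeries σ (EndY N)) :
    preS N (s • f) = s • preS N f := by
  classical
  refine MvPowerSeries.ext fun d => ?_
  rw [coeff_preS, coeff_series_smul, coeff_series_smul, map_sum]
  refine Finset.sum_congr rfl fun p _ => ?_
  rw [map_smul]
  rfl

theorem preS_mul (f g : MvPowerSeries σ (EndY N)) : preS N (f * g) = preS N g * preS N f := by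
  classical
  refine MvPowerSeries.ext fun d => ?_
  rw [coeff_preS, MvPowerSeries.coeff_mul, MvPowerSeries.coeff_mul, map_sum]
  refine Finset.sum_nbij' Prod.swap Prod.swap ?_ ?_ (fun _ _ => rfl) (fun _ _ => rfl)
    fun p _ => rfl
  · intro p hp
    rw [Finset.HasAntidiagonal.mem_antidiagonal] at hp ⊢
    rw [← hp]
    exact add_comm _ _
  · intro p hp
    rw [Finset.HasAntidiagonal.mem_antidiagonal] at hp ⊢
    rw [← hp]
    exact add_comm _ _

theorem preS_subs (a : ℕ → EndY N) (w : MvPowerSeries σ Ch) :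
    preS N (subs a w) = subs (fun r => preOp N (a r)) w := by
  refine MvPowerSeries.ext fun d => ?_
  rw [coeff_preS]
  change preOp N (∑ r ∈ Finset.range (d.degree + 1), MvPowerSeries.coeff d (w ^ r) • a r) =
    ∑ r ∈ Finset.range (d.degree + 1), MvPowerSeries.coeff d (w ^ r) • preOp N (a r)
  rw [map_sum]
  exact Finset.sum_congr rfl fun r _ => map_smul _ _ _

theorem series_mul_comm {A : Type*} [Ring A] {f g : MvPowerSeries σ A}
    (h : ∀ p q, MvPowerSeries.coeff p f * MvPowerSeries.coeff q g =
      MvPowerSeries.coeff q g * MvPowerSeries.coeff p f) : f * g = g * f := by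
  classical
  refine MvPowerSeries.ext fun d => ?_
  rw [MvPowerSeries.coeff_mul, MvPowerSeries.coeff_mul]
  refine Finset.sum_nbij' Prod.swap Prod.swap ?_ ?_ (fun _ _ => rfl) (fun _ _ => rfl)
    fun p _ => h p.1 p.2
  · intro p hp
    rw [Finset.HasAntidiagonal.mem_antidiagonal] at hp ⊢
    rw [← hp]
    exact add_comm _ _
  · intro p hp
    rw [Finset.HasAntidiagonal.mem_antidiagonal] at hp ⊢
    rw [← hp]
    exact add_comm _ _

theorem subs_mul_comm {A : Type*} [Ring A] [Algebra Ch A] {a b : ℕ → A}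
    (h : ∀ r s, a r * b s = b s * a r) (w w' : MvPowerSeries σ Ch) :
    subs a w * subs b w' = subs b w' * subs a w := by
  refine series_mul_comm fun p q => ?_
  change (∑ r ∈ Finset.range (p.degree + 1), MvPowerSeries.coeff p (w ^ r) • a r) *
      (∑ r ∈ Finset.range (q.degree + 1), MvPowerSeries.coeff q (w' ^ r) • b r) =
    (∑ r ∈ Finset.range (q.degree + 1), MvPowerSeries.coeff q (w' ^ r) • b r) *
      (∑ r ∈ Finset.range (p.degree + 1), MvPowerSeries.coeff p (w ^ r) • a r)
  rw [Finset.sum_mul_sum, Finset.sum_mul_sum, Finset.sum_comm]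
  refine Finset.sum_congr rfl fun r _ => Finset.sum_congr rfl fun s _ => ?_
  rw [smul_mul_smul_comm, smul_mul_smul_comm, h, mul_comm]

theorem mser_site_comm {A : Type*} [Ring A] [Algebra Ch A] {T T' : ℕ → Matrix (Fin N) (Fin N) A}
    (h : ∀ r s a b c d, T r a b * T' s c d = T' s c d * T r a b) {i j : Fin m} (hij : i ≠ j)
    (w w' : MvPowerSeries σ Ch) :
    (site i (mser T w) * site j (mser T' w') : Ten N m (MvPowerSeries σ A)) =
      site j (mser T' w') * site i (mser T w) :=
  site_comm hij fun a b c d => subs_mul_comm (fun r s => h r s a b c d) w w'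

theorem exists_evalS (N : ℕ) : ∃ ψ : Yp N →ₐ[Ch] PowerSeries (MatY N), ∀ i j r k a b,
    PowerSeries.coeff k (ψ (tY N r i j)) a b =
      MvPowerSeries.coeff (ex k r) (nser N (linInv 𝐮 𝐯) •
        ((if a = b then mser (tY N) 𝐯 i j else 0) -
          (hC Ch * linInv 𝐮 𝐯) • if i = b then mser (tY N) 𝐯 a j else 0)) := by
  obtain ⟨f, hf⟩ := exists_nser (N := N) (constantCoeff_linInv (p := 𝐮) (v := 𝐯) (by simp))
  refine exists_homV ⟨linInv 𝐮 𝐯, rfl⟩ ⟨_, hf⟩ ?_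
  have e : ∀ i : Fin 2, optSubst (σ := Fin 2) i (linInv 𝐮 𝐯 : MvPowerSeries (Fin 2) Ch) =
      linInv (MvPowerSeries.X none) (MvPowerSeries.X (some i)) := fun i => by
    rw [optSubst, substHom_linInv _ (by simp), substHom_X', substHom_X']
    rfl
  have e' : ∀ i : Fin 2, optSubst (σ := Fin 2) i (hC Ch : MvPowerSeries (Fin 2) Ch) = hC Ch :=
    fun i => substHom_hC _
  rw [map_mul, map_mul, e, e, e', e']
  have h := linInv_sub (p := (MvPowerSeries.X none : MvPowerSeries (Option (Fin 2)) Ch))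
    (v := MvPowerSeries.X (some 1)) (v' := MvPowerSeries.X (some 0)) (by simp)
  linear_combination (hC Ch * hC Ch) * h

/-- The evaluation homomorphism with `T(v) ↦ Rbar(u + v) T(v)`. -/
def evalS (N : ℕ) : Yp N →ₐ[Ch] PowerSeries (MatY N) := (exists_evalS N).choose

theorem evalS_spec : ∀ i j r k a b, PowerSeries.coeff k (evalS N (tY N r i j)) a b =
      MvPowerSeries.coeff (ex k r) (nser N (linInv 𝐮 𝐯) •
        ((if a = b then mser (tY N) 𝐯 i j else 0) -
          (hC Ch * linInv 𝐮 𝐯) • if i = b then mser (tY N) 𝐯 a j else 0)) :=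
  (exists_evalS N).choose_spec

theorem rtt_opE : RTT (𝐯 - 𝐮) (-(hC Ch * 𝐮 * 𝐯)) (mser (fun k => Matrix.of (opE (evalS N) k)) 𝐮)
    (mser (fun k => Matrix.of (opE (evalS N) k)) 𝐯) := by
  have hE : Exch (nser N (linInv 𝐮 𝐯)) (hC Ch * linInv 𝐮 𝐯) 1 0
      (fun k => Matrix.of (opE (evalS N) k)) := by
    have e : (1 : MvPowerSeries (Fin 2) Ch) •
        (rm (1 : MvPowerSeries (Fin 2) Ch) 0 0 1 : Ten N 2 (MvPowerSeries (Fin 2) (EndY N))) =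
          1 := by
      rw [one_smul, rm, one_smul, zero_smul, sub_zero]
    rw [Exch, opE_exchange_V evalS_spec, e, mul_one]
  have hc : ∀ i : Fin 3, MvPowerSeries.constantCoeff (MvPowerSeries.X i : MvPowerSeries (Fin 3) Ch)
    = 0 := fun i => MvPowerSeries.constantCoeff_X _
  refine hE.rtt (fun k a b => opE_one (evalS N) k a b) rfl rfl rfl rfl rfl rfl ?_ ?_
  · have e : ∀ v v' : MvPowerSeries (Fin 3) Ch, MvPowerSeries.constantCoeff v = 0 →
        linInv v v' * (1 - v * -v') = v := fun v v' hv => by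
      rw [mul_neg, sub_neg_eq_add, linInv_mul hv]
    have := inv_sub_inv_mul (e _ (MvPowerSeries.X 0) (hc 1)) (e _ (MvPowerSeries.X 0) (hc 2))
    simp only [map_sub, map_mul, map_neg, substHom_X', substHom_hC, Fin.succ_zero_eq_one,
      Fin.succ_one_eq_two, substHom_linInv _ (MvPowerSeries.constantCoeff_X (0 : Fin 2)),
      Matrix.cons_val_zero, Matrix.cons_val_one]
    linear_combination (hC Ch * hC Ch) * this
  · simp

variable {x y v : MvPowerSeries σ Ch}

theorem rtt_sH (hx : MvPowerSeries.constantCoeff x = 0) (hy : MvPowerSeries.constantCoeff y = 0) :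
    RTT (y - x) (hC Ch * x * y) (mser (sH (evalS N)) x) (mser (sH (evalS N)) y) := by
  have h := (rtt_opE (N := N)).mser_subst hy hx
  simp only [map_sub, map_mul, map_neg, substHom_X', substHom_hC, Matrix.cons_val_zero,
    Matrix.cons_val_one] at h
  have e : ∀ (w : MvPowerSeries σ Ch) (a b : Fin N), preS N
      (mser (fun k => Matrix.of (opE (evalS N) k)) w a b) = mser (sH (evalS N)) w a b :=
    fun w a b => preS_subs _ w
  intro i j k l
  have h1 := congrArg (preS N) (h k l i j)
  simp only [preS_smul, map_sub, preS_mul, e] at h1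
  rw [← neg_sub x y, neg_smul, h1]
  rw [mul_right_comm, ← neg_smul, neg_neg]

theorem rtt_tH (hx : MvPowerSeries.constantCoeff x = 0) (hy : MvPowerSeries.constantCoeff y = 0) :
    RTT (x - y) (hC Ch) (mser (tH N) x) (mser (tH N) y) := by
  have h := ((rtt_tY (N := N)).mser_map (rightOp N)).mser_subst hx hy
  simp only [map_sub, substHom_X', substHom_hC, Matrix.cons_val_zero, Matrix.cons_val_one] at h
  exact h

variable {i j : Fin m}

/-- The reflection equation for the operators `B`. -/
theorem bH_site (hij : i ≠ j) (hx : MvPowerSeries.constantCoeff x = 0)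
    (hy : MvPowerSeries.constantCoeff y = 0) :
    (rm (y - x) (hC Ch * x * y) i j : Ten N m (MvPowerSeries σ (Op (HomY N)))) *
      site i (mser (bH N) x) * rm (x + y) (hC Ch * x * y) i j * site j (mser (bH N) y) =
    site j (mser (bH N) y) * rm (x + y) (hC Ch * x * y) i j * site i (mser (bH N) x) *
      rm (y - x) (hC Ch * x * y) i j := by
  have h := congrArg (fun X => X.map (MvPowerSeries.map (leftOp N).toRingHom))
    (bD_site (N := N) hij hx hy)
  simp only [Ten.map_mul, site_map, mser_map, map_rm] at h
  exact h

theorem sH_tH_site [Finite σ] (hij : i ≠ j) (hx : MvPowerSeries.constantCoeff x = 0)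
    (hv : MvPowerSeries.constantCoeff v = 0) :
    (site j (mser (tH N) v) : Ten N m (MvPowerSeries σ (Op (HomY N)))) *
        site i (mser (sH (evalS N)) x) =
      site i (mser (sH (evalS N)) x) * rbar i j (linInv x v) * site j (mser (tH N) v) := by
  have h1 := congrArg (fun X => (substHom ![x, v] (constantCoeff_pair hx hv) :
    MvPowerSeries (Fin 2) (Op (HomY N)) →+* MvPowerSeries σ (Op (HomY N))).mapMatrix X)
      (tH_sH (N := N) evalS_spec)
  simp only [map_mul] at h1
  simp only [RingHom.mapMatrix_apply, mapMatrix_smul_rm, map_one, site_map,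
    mser_subst _ (MvPowerSeries.constantCoeff_X (0 : Fin 2)) (constantCoeff_pair hx hv),
    mser_subst _ (MvPowerSeries.constantCoeff_X (1 : Fin 2)) (constantCoeff_pair hx hv),
    substHom_X', substHom_nser _ (constantCoeff_linInv (p := 𝐮) (v := 𝐯) (by simp)), map_mul,
    substHom_hC, substHom_linInv _ (MvPowerSeries.constantCoeff_X (0 : Fin 2))] at h1
  have h2 := congrArg (emb ![i, j] (pair_injective hij)) h1
  simp only [map_mul, emb_smul, emb_rm, emb_site] at h2
  exact h2

end Operators

/-! ### The quadratic relation of `S B T` -/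

section Quadratic

theorem quadratic_mul {R : Type*} [Ring R] {r p S₁ S₂ B₁ B₂ T₁ T₂ : R}
    (hS : r * S₁ * S₂ = S₂ * S₁ * r) (hB : r * B₁ * p * B₂ = B₂ * p * B₁ * r)
    (hT : r * T₁ * T₂ = T₂ * T₁ * r) (hTS : T₁ * S₂ = S₂ * p * T₁) (hTS' : T₂ * S₁ = S₁ * p * T₂)
    (hBS : B₁ * S₂ = S₂ * B₁) (hBS' : B₂ * S₁ = S₁ * B₂) (hTB : T₁ * B₂ = B₂ * T₁)
    (hTB' : T₂ * B₁ = B₁ * T₂) :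
    r * (S₁ * B₁ * T₁) * (S₂ * B₂ * T₂) = (S₂ * B₂ * T₂) * (S₁ * B₁ * T₁) * r := by
  calc r * (S₁ * B₁ * T₁) * (S₂ * B₂ * T₂) = r * S₁ * B₁ * (T₁ * S₂) * B₂ * T₂ := by
        simp only [mul_assoc]
    _ = r * S₁ * (B₁ * S₂) * p * (T₁ * B₂) * T₂ := by rw [hTS]; simp only [mul_assoc]
    _ = (r * S₁ * S₂) * B₁ * p * B₂ * T₁ * T₂ := by rw [hBS, hTB]; simp only [mul_assoc]
    _ = S₂ * S₁ * (r * B₁ * p * B₂) * T₁ * T₂ := by rw [hS]; simp only [mul_assoc]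
    _ = S₂ * S₁ * B₂ * p * B₁ * (r * T₁ * T₂) := by rw [hB]; simp only [mul_assoc]
    _ = S₂ * (S₁ * B₂) * p * (B₁ * T₂) * T₁ * r := by rw [hT]; simp only [mul_assoc]
    _ = S₂ * B₂ * (S₁ * p * T₂) * B₁ * T₁ * r := by rw [← hBS', ← hTB']; simp only [mul_assoc]
    _ = _ := by rw [← hTS']; simp only [mul_assoc]

theorem smul_smul_left {S R : Type*} [CommRing S] [Ring R] [Algebra S R] (s t : S)
    (r b p b' : R) : s • r * b * t • p * b' = (s * t) • (r * b * p * b') := by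
  simp only [smul_mul_assoc, mul_smul_comm, smul_smul, mul_comm t]

theorem smul_smul_right {S R : Type*} [CommRing S] [Ring R] [Algebra S R] (s t : S)
    (r b p b' : R) : b' * t • p * b * s • r = (s * t) • (b' * p * b * r) := by
  simp only [smul_mul_assoc, mul_smul_comm, smul_smul]

variable {N : ℕ} {σ : Type*}

theorem two_mul_half (p : MvPowerSeries σ Ch) :
    2 * (MvPowerSeries.C (PowerSeries.C (1 / 2 : ℂ)) * p) = p := by
  have h : (2 : MvPowerSeries σ Ch) = MvPowerSeries.C (PowerSeries.C (2 : ℂ)) := by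
    rw [map_ofNat, map_ofNat]
  rw [h, ← mul_assoc, ← map_mul, ← map_mul]
  norm_num

theorem rbar_comm {A : Type*} [Ring A] [Algebra Ch A] {m : ℕ} (i j : Fin m)
    (w : MvPowerSeries σ Ch) :
    (rbar i j w : Ten N m (MvPowerSeries σ A)) = rbar j i w := by
  rw [rbar, rbar, rm_comm]

/-- The product `S(1/(2z + v)) B(1/(z + v)) T(v)`, where `y = 1/(2z)`. -/
def sbt (N : ℕ) (y v : MvPowerSeries σ Ch) :
    Matrix (Fin N) (Fin N) (MvPowerSeries σ (Op (HomY N))) :=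
  mser (sH (evalS N)) (linInv y v) * mser (bH N) (linInv (2 * y) v) * mser (tH N) v

theorem bH_sH_comm (r s : ℕ) (a b c d : Fin N) :
    bH N r a b * sH (evalS N) s c d = sH (evalS N) s c d * bH N r a b := rfl

theorem tH_bH_comm (r s : ℕ) (a b c d : Fin N) :
    tH N r a b * bH N s c d = bH N s c d * tH N r a b := rfl

theorem rtt_sbt [Finite σ] {y v v' : MvPowerSeries σ Ch}
    (hy : MvPowerSeries.constantCoeff y = 0)
    (hv : MvPowerSeries.constantCoeff v = 0) (hv' : MvPowerSeries.constantCoeff v' = 0)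
    (hnt : NonTorsion (Op (HomY N)) y) (hnt' : NonTorsion (Op (HomY N)) (2 * y)) :
    RTT (v - v') (hC Ch) (sbt N y v) (sbt N y v') := by
  have h2 : MvPowerSeries.constantCoeff (2 * y) = 0 := by rw [map_mul, hy, mul_zero]
  have c1 := constantCoeff_linInv (v := v) hy
  have c2 := constantCoeff_linInv (v := v') hy
  have c3 := constantCoeff_linInv (v := v) h2
  have c4 := constantCoeff_linInv (v := v') h2
  have h01 : (0 : Fin 2) ≠ 1 := by decide
  have hprod : NonTorsion (Op (HomY N)) (linInv (2 * y) v * linInv (2 * y) v') :=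
    (NonTorsion.linInv h2 hnt').mul (NonTorsion.linInv h2 hnt')
  have hsum : NonTorsion (Op (HomY N)) (linInv (2 * y) v + linInv (2 * y) v') := by
    intro f hf
    refine hprod f ?_
    rw [← linInv_add_mul hy, mul_comm, mul_smul, hf, smul_zero]
  have hS : RTT (v - v') (hC Ch) (mser (sH (evalS N)) (linInv y v))
      (mser (sH (evalS N)) (linInv y v')) := by
    refine RTT.cancel (s := linInv y v * linInv y v') ?_
      ((NonTorsion.linInv hy hnt).mul (NonTorsion.linInv hy hnt))
    have h := rtt_sH (N := N) c1 c2
    rw [linInv_sub hy] at h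
    rwa [mul_comm _ (hC Ch), ← mul_assoc]
  have hB : (rm (v - v') (hC Ch) 0 1 : Ten N 2 (MvPowerSeries σ (Op (HomY N)))) *
      site 0 (mser (bH N) (linInv (2 * y) v)) * rbar 0 1 (linInv y (v + v')) *
        site 1 (mser (bH N) (linInv (2 * y) v')) =
      site 1 (mser (bH N) (linInv (2 * y) v')) * rbar 0 1 (linInv y (v + v')) *
        site 0 (mser (bH N) (linInv (2 * y) v)) * rm (v - v') (hC Ch) 0 1 := by
    have h := bH_site (N := N) h01 c3 c4
    have e1 : (rm (linInv (2 * y) v' - linInv (2 * y) v)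
        (hC Ch * linInv (2 * y) v * linInv (2 * y) v') 0 1 :
          Ten N 2 (MvPowerSeries σ (Op (HomY N)))) =
        (linInv (2 * y) v * linInv (2 * y) v') • rm (v - v') (hC Ch) 0 1 := by
      rw [← rm_smul, linInv_sub h2, mul_comm _ (hC Ch), ← mul_assoc]
    have e2 : (rm (linInv (2 * y) v + linInv (2 * y) v')
        (hC Ch * linInv (2 * y) v * linInv (2 * y) v') 0 1 :
          Ten N 2 (MvPowerSeries σ (Op (HomY N)))) =
        (linInv (2 * y) v + linInv (2 * y) v') • rm 1 (hC Ch * linInv y (v + v')) 0 1 := by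
      rw [← rm_smul, mul_assoc (hC Ch), ← linInv_add_mul hy, mul_one, mul_left_comm]
    rw [e1, e2] at h
    rw [smul_smul_left, smul_smul_right] at h
    have h' := (hprod.mul hsum).matrix h
    rw [rbar, mul_smul_comm, smul_mul_assoc, h', mul_smul_comm, smul_mul_assoc, smul_mul_assoc]
  apply RTT.of_site
  simp only [sbt, site_mul]
  refine quadratic_mul (p := rbar 0 1 (linInv y (v + v'))) (hS.site h01) hB
    ((rtt_tH hv hv').site h01) ?_ ?_ ?_ ?_ ?_ ?_
  · rw [sH_tH_site h01.symm c2 hv, linInv_linInv hy, rbar_comm, add_comm]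
  · rw [sH_tH_site h01 c1 hv', linInv_linInv hy]
  · exact mser_site_comm bH_sH_comm h01 _ _
  · exact mser_site_comm bH_sH_comm h01.symm _ _
  · exact mser_site_comm tH_bH_comm h01 _ _
  · exact mser_site_comm tH_bH_comm h01.symm _ _

end Quadratic

/-! ### Normal ordering -/

section NormalOrder

variable {R I : Type*} [Ring R]

/-- The ordered product of `B_i R_{ij} R_{ik} ⋯`. -/
def ordProd (B : I → R) (Q : I → I → R) : List I → R
  | [] => 1
  | i :: l => B i * (l.map (Q i)).prod * ordProd B Q l

theorem ordProd_eq [LinearOrder I] (B : I → R) (Q : I → I → R) (l : List I)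
    (hl : l.Pairwise (· < ·)) : ordProd B Q l =
      (l.map fun i => B i * ((l.filter fun j => i < j).map (Q i)).prod).prod := by
  induction l with
  | nil => rfl
  | cons i l ih =>
    rw [List.pairwise_cons] at hl
    rw [ordProd, ih hl.2, List.map_cons, List.prod_cons]
    congr 1
    · congr 3
      rw [List.filter_cons_of_neg (by simp)]
      exact (List.filter_eq_self.2 fun j hj => by simpa using hl.1 j hj).symm
    · congr 1
      refine List.map_congr_left fun k hk => ?_
      rw [List.filter_cons_of_neg]
      simpa using (hl.1 k hk).le

variable {S B T : I → R} {Q : I → I → R}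

theorem mul_prod_comm (x : R) (l : List I) (f : I → R) (h : ∀ i ∈ l, x * f i = f i * x) :
    x * (l.map f).prod = (l.map f).prod * x := by
  induction l with
  | nil => simp
  | cons i l ih =>
    rw [List.map_cons, List.prod_cons, ← mul_assoc, h i (by simp), mul_assoc,
      ih fun j hj => h j (by simp [hj]), mul_assoc]

theorem normal_order_aux (hTS : ∀ i j, i ≠ j → T i * S j = S j * Q i j * T i)
    (hQS : ∀ i j k, i ≠ j → k ≠ i → k ≠ j → Q i j * S k = S k * Q i j) (i : I) (l : List I)
    (hl : l.Nodup) (hi : i ∉ l) :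
    T i * (l.map S).prod = (l.map S).prod * (l.map (Q i)).prod * T i := by
  induction l with
  | nil => simp
  | cons j l ih =>
    rw [List.nodup_cons] at hl
    have hij : i ≠ j := fun h => hi (by simp [h])
    have hil : i ∉ l := fun h => hi (by simp [h])
    have h1 : Q i j * (l.map S).prod = (l.map S).prod * Q i j :=
      mul_prod_comm _ l S fun k hk => hQS i j k hij (fun h => hil (h ▸ hk)) fun h => hl.1 (h ▸ hk)
    simp only [List.map_cons, List.prod_cons]
    calc T i * (S j * (l.map S).prod) = (T i * S j) * (l.map S).prod := by rw [mul_assoc]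
      _ = S j * Q i j * (T i * (l.map S).prod) := by rw [hTS i j hij]; simp only [mul_assoc]
      _ = S j * (Q i j * (l.map S).prod) * (l.map (Q i)).prod * T i := by
        rw [ih hl.2 hil]; simp only [mul_assoc]
      _ = _ := by rw [h1]; simp only [mul_assoc]

theorem mul_ordProd_comm (x : R) (l : List I) (hB : ∀ i ∈ l, x * B i = B i * x)
    (hQ : ∀ i ∈ l, ∀ j ∈ l, x * Q i j = Q i j * x) :
    x * ordProd B Q l = ordProd B Q l * x := by
  induction l with
  | nil => simp [ordProd]
  | cons i l ih =>
    have h1 := mul_prod_comm x l (Q i) fun j hj => hQ i (by simp) j (by simp [hj])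
    have h2 := ih (fun j hj => hB j (by simp [hj]))
      fun j hj k hk => hQ j (by simp [hj]) k (by simp [hk])
    have h3 := hB i (by simp)
    rw [ordProd]
    calc x * (B i * (l.map (Q i)).prod * ordProd B Q l)
        = (x * B i) * (l.map (Q i)).prod * ordProd B Q l := by simp only [mul_assoc]
      _ = B i * (x * (l.map (Q i)).prod) * ordProd B Q l := by rw [h3]; simp only [mul_assoc]
      _ = B i * (l.map (Q i)).prod * (x * ordProd B Q l) := by rw [h1]; simp only [mul_assoc]
      _ = _ := by rw [h2]; simp only [mul_assoc]

/-- Moving all `S` to the left and all `T` to the right in `∏ S_i B_i T_i`. -/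
theorem normal_order (hTS : ∀ i j, i ≠ j → T i * S j = S j * Q i j * T i)
    (hBS : ∀ i j, i ≠ j → B i * S j = S j * B i) (hTB : ∀ i j, i ≠ j → T i * B j = B j * T i)
    (hQS : ∀ i j k, i ≠ j → k ≠ i → k ≠ j → Q i j * S k = S k * Q i j)
    (hTQ : ∀ i j k, i ≠ j → k ≠ i → k ≠ j → T k * Q i j = Q i j * T k)
    (l : List I) (hl : l.Nodup) (hQ : ∀ i, Q i i = 1) :
    (l.map fun i => S i * B i * T i).prod =
      (l.map S).prod * ordProd B Q l * (l.map T).prod := by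
  induction l with
  | nil => simp [ordProd]
  | cons i l ih =>
    rw [List.nodup_cons] at hl
    have hne : ∀ j ∈ l, j ≠ i := fun j hj h => hl.1 (h ▸ hj)
    have h1 := normal_order_aux hTS hQS i l hl.2 hl.1
    have h2 : B i * (l.map S).prod = (l.map S).prod * B i :=
      mul_prod_comm _ l S fun j hj => hBS i j (hne j hj).symm
    have h3 : T i * ordProd B Q l = ordProd B Q l * T i := by
      refine mul_ordProd_comm _ l (fun j hj => hTB i j (hne j hj).symm) fun j hj k hk => ?_
      by_cases hjk : j = k
      · rw [hjk, hQ, mul_one, one_mul]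
      · exact hTQ j k i hjk (hne j hj).symm (hne k hk).symm
    simp only [List.map_cons, List.prod_cons]
    rw [ih hl.2, ordProd]
    calc S i * B i * T i * ((l.map S).prod * ordProd B Q l * (l.map T).prod)
        = S i * B i * (T i * (l.map S).prod) * ordProd B Q l * (l.map T).prod := by
          simp only [mul_assoc]
      _ = S i * (B i * (l.map S).prod) * (l.map (Q i)).prod * (T i * ordProd B Q l) *
          (l.map T).prod := by rw [h1]; simp only [mul_assoc]
      _ = _ := by rw [h2, h3]; simp only [mul_assoc]

end NormalOrder

/-! ### The homomorphism defined by `S B T` -/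

section SBT

variable {N : ℕ} {σ τ : Type*}

/-- `1/(2z)`, where `p` is `1/z` and `z` is rescaled by `h`. -/
def halfH (p : MvPowerSeries σ Ch) : MvPowerSeries σ Ch :=
  MvPowerSeries.C (PowerSeries.C (1 / 2 : ℂ)) * (hC Ch * p)

theorem constantCoeff_halfH {p : MvPowerSeries σ Ch} (hp : MvPowerSeries.constantCoeff p = 0) :
    MvPowerSeries.constantCoeff (halfH p) = 0 := by
  rw [halfH, map_mul, constantCoeff_hC_mul hp, mul_zero]

theorem linInv_hC_mul (c p v : MvPowerSeries σ Ch) :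
    ∃ g, linInv (c * (hC Ch * p)) v = hC Ch * (p * g) :=
  ⟨c * MvPowerSeries.invOfUnit (1 + c * (hC Ch * p) * v) 1, by rw [linInv]; ring⟩

theorem oneModH_mser {A : Type*} [Ring A] [Algebra Ch A] {T : ℕ → Matrix (Fin N) (Fin N) A}
    (h0 : T 0 = 1) {w : MvPowerSeries σ Ch} (hw : ∃ g, w = hC Ch * g)
    (hw0 : MvPowerSeries.constantCoeff w = 0) : OneModH (mser T w) := by
  obtain ⟨g, rfl⟩ := hw
  refine ⟨g • mser (fun r => T (r + 1)) (hC Ch * g), ?_⟩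
  rw [← hC_mul_smul_matrix]
  ext a b : 1
  refine (subs_eq_C_add hw0 _).trans ?_
  rw [h0, Matrix.add_apply, Matrix.smul_apply]
  congr 1
  rw [Matrix.one_apply, Matrix.one_apply]
  split_ifs <;> simp

theorem sH_zero : sH (evalS N) 0 = 1 := by
  obtain ⟨q, hq⟩ := exists_nser (N := N) (constantCoeff_linInv (p := 𝐮) (v := 𝐯) (by simp))
  ext a b
  have h : opE (evalS N) 0 a b = if a = b then 1 else 0 := by
    refine opE_zero (fun i j r a b => ?_) a b
    have e1 : ∃ g, nser N (linInv 𝐮 𝐯) = 1 + 𝐮 * g :=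
      ⟨hC Ch * MvPowerSeries.invOfUnit (1 + 𝐮 * 𝐯) 1 * q, by
        rw [hq]; simp only [linInv]; ring⟩
    have e2 : ∃ g, hC Ch * linInv 𝐮 𝐯 = 𝐮 * g :=
      ⟨hC Ch * MvPowerSeries.invOfUnit (1 + 𝐮 * 𝐯) 1, by rw [linInv]; ring⟩
    rw [evalS_spec, coeff_zero_smul_sub e1 e2]
    exact coeff_ex_zero_diag i j r a b
  change preOp N (opE (evalS N) 0 a b) = _
  rw [h, Matrix.one_apply]
  split_ifs
  · exact preOp_one
  · exact map_zero _

theorem bH_zero : bH N 0 = 1 := by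
  have : bH N = serMinus fun i j r => leftOp N (bCoeff i j r) :=
    funext fun r => serMinus_map (leftOp N) _ r
  rw [this]
  rfl

theorem tH_eq : tH N = serPlus fun i j r => rightOp N (yNeg i j r) :=
  funext fun r => serPlus_map (rightOp N) _ r

theorem oneModH_sbt {p v : MvPowerSeries σ Ch} (hp : MvPowerSeries.constantCoeff p = 0)
    (hv : MvPowerSeries.constantCoeff v = 0) : OneModH (sbt N (halfH p) v) := by
  have hc := constantCoeff_halfH hp
  refine ((oneModH_mser sH_zero ?_ ?_).mul (oneModH_mser bH_zero ?_ ?_)).mul ?_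
  · obtain ⟨g, hg⟩ := linInv_hC_mul (MvPowerSeries.C (PowerSeries.C (1 / 2 : ℂ))) p v
    exact ⟨_, hg⟩
  · exact constantCoeff_linInv hc
  · obtain ⟨g, hg⟩ := linInv_hC_mul 1 p v
    rw [one_mul] at hg
    exact ⟨_, by rw [halfH, two_mul_half, hg]⟩
  · exact constantCoeff_linInv (by rw [map_mul, hc, mul_zero])
  · rw [tH_eq]
    exact oneModH_serPlus hv _

theorem substHom_halfH [Fintype σ] {w : σ → MvPowerSeries τ Ch}
    (hw : ∀ t, MvPowerSeries.constantCoeff (w t) = 0) (p : MvPowerSeries σ Ch) :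
    substHom w hw (halfH p) = halfH (substHom w hw p) := by
  rw [halfH, halfH, map_mul, map_mul, substHom_hC]
  congr 1
  exact substHom_C hw _

theorem sbt_subst [Fintype σ] {w : σ → MvPowerSeries τ Ch}
    (hw : ∀ t, MvPowerSeries.constantCoeff (w t) = 0) {p v : MvPowerSeries σ Ch}
    (hp : MvPowerSeries.constantCoeff p = 0) (hv : MvPowerSeries.constantCoeff v = 0) :
    (sbt N (halfH p) v).map (substHom w hw) =
      sbt N (halfH (substHom w hw p)) (substHom w hw v) := by
  have hc := constantCoeff_halfH hp
  have hc2 : MvPowerSeries.constantCoeff (2 * halfH p) = 0 := by rw [map_mul, hc, mul_zero]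
  have h2 : substHom w hw (2 * halfH p) = 2 * halfH (substHom w hw p) := by
    rw [map_mul, substHom_halfH, map_ofNat]
  rw [sbt, sbt, ← h2, Matrix.map_mul, Matrix.map_mul, mser_subst _ hv,
    mser_subst _ (constantCoeff_linInv hc), substHom_linInv hw hc,
    mser_subst _ (constantCoeff_linInv hc2), substHom_linInv hw hc2, h2, substHom_halfH]

theorem NonTorsion.const {A : Type*} [Ring A] [Algebra Ch A] {c : ℂ} (hc : c ≠ 0) :
    NonTorsion A (MvPowerSeries.C (PowerSeries.C c) : MvPowerSeries σ Ch) := by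
  refine NonTorsion.of_unit (t := MvPowerSeries.C (PowerSeries.C c⁻¹)) ?_
  rw [← map_mul, ← map_mul, inv_mul_cancel₀ hc, map_one, map_one]

/-- The product `S B T` satisfies the relations of the dual Yangian. The generators `t^{(-r)}` carry
a factor `h⁻¹`; replacing `z⁻¹` by `h z⁻¹` makes `S B T` congruent to `1` modulo `h`, so that they
have images. -/
theorem exists_sbtHom (N : ℕ) : ∃ ψ : Yp N →ₐ[Ch] PowerSeries (Op (HomY N)), ∀ i j r k,
    PowerSeries.coeff k (ψ (tY N r i j)) =
      MvPowerSeries.coeff (ex k r) (sbt N (halfH 𝐮) 𝐯 i j) := by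
  have hu : MvPowerSeries.constantCoeff 𝐮 = 0 := by simp
  have hv : MvPowerSeries.constantCoeff 𝐯 = 0 := by simp
  obtain ⟨M', hM⟩ := oneModH_sbt (N := N) hu hv
  have hA : HTF (Op (HomY N)) := HTF.homY.op
  have hn : NonTorsion (Op (HomY N)) (hC Ch * MvPowerSeries.X none :
      MvPowerSeries (Option (Fin 2)) Ch) := (NonTorsion.hC hA).mul (NonTorsion.X _)
  refine Yp.exists_hom hA _ M' hM ?_
  rw [optSubst, optSubst, sbt_subst _ hu hv, sbt_subst _ hu hv]
  simp only [substHom_X']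
  refine rtt_sbt (constantCoeff_halfH (by simp [optPair])) (by simp)
    (by simp) ((NonTorsion.const (by norm_num)).mul hn) ?_
  rw [halfH, two_mul_half]
  exact hn

/-- The homomorphism from the dual Yangian with `T⁺(v) ↦ S(1/(2z+v)) B(1/(z+v)) T(v)`, where the
coefficient of `z^{-k}` is multiplied by `h^k`. -/
def sbtHom (N : ℕ) : Yp N →ₐ[Ch] PowerSeries (Op (HomY N)) := (exists_sbtHom N).choose

theorem sbtHom_spec (i j : Fin N) (r k : ℕ) : PowerSeries.coeff k (sbtHom N (tY N r i j)) =
    MvPowerSeries.coeff (ex k r) (sbt N (halfH 𝐮) 𝐯 i j) :=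
  (exists_sbtHom N).choose_spec i j r k

theorem coeff_sbtHom_yProd (m : ℕ) (a b : Fin m → Fin N) (d : Fin m →₀ ℕ) (k : ℕ) :
    PowerSeries.coeff k (sbtHom N (MvPowerSeries.coeff d (yProd N m a b))) =
      MvPowerSeries.coeff (d.optionElim k)
        (((List.finRange m).map fun i => (site i (sbt N (halfH (MvPowerSeries.X none))
          (MvPowerSeries.X (some i))) :
            Ten N m (MvPowerSeries (Option (Fin m)) (Op (HomY N))))).prod a b) := by
  have hu : MvPowerSeries.constantCoeff 𝐮 = 0 := by simp
  have hv : MvPowerSeries.constantCoeff 𝐯 = 0 := by simp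
  have h1 : ∀ i : Fin m, mser (fun r => (tY N r).map (sbtHom N))
      (MvPowerSeries.X i : MvPowerSeries (Fin m) Ch) =
        (sbt N (halfH (MvPowerSeries.X none)) (MvPowerSeries.X (some i))).map optHom := by
    intro i
    have e := sbt_subst (N := N) (w := fun t => MvPowerSeries.X (optPair i t))
      (fun _ => MvPowerSeries.constantCoeff_X _) hu hv
    rw [substHom_X', substHom_X'] at e
    have e' : sbt N (halfH (MvPowerSeries.X none)) (MvPowerSeries.X (some i)) =
      (sbt N (halfH 𝐮) 𝐯).map (optSubst i) := e.symm
    rw [e']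
    ext a b : 1
    rw [Matrix.map_apply, Matrix.map_apply, optHom_optSubst]
    change subs (fun r => sbtHom N (tY N r a b)) _ = _
    congr 1
    funext r
    refine PowerSeries.ext fun k => ?_
    rw [PowerSeries.coeff_mk, sbtHom_spec]
  have h2 : (yProd N m).map (MvPowerSeries.map (sbtHom N).toRingHom) =
      (((List.finRange m).map fun i => (site i (sbt N (halfH (MvPowerSeries.X none))
          (MvPowerSeries.X (some i))) :
            Ten N m (MvPowerSeries (Option (Fin m)) (Op (HomY N))))).prod).map optHom := by
    rw [yProd, Ten.map_list_prod, Ten.map_list_prod, List.ofFn_eq_map, List.map_map, List.map_map]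
    congr 1
    refine List.map_congr_left fun i _ => ?_
    simp only [Function.comp, siteSeries_map]
    rw [siteSeries_eq, h1, site_map]
  have h3 := congrArg (fun X => PowerSeries.coeff k (MvPowerSeries.coeff d (X a b))) h2
  simp only [Matrix.map_apply, coeff_optHom] at h3
  exact h3

end SBT

/-- The coefficient of the `k`-th power, as a linear map. -/
def seriesCoeff (A : Type*) [Ring A] [Algebra Ch A] (k : ℕ) : PowerSeries A →ₗ[Ch] A where
  toFun f := PowerSeries.coeff k f
  map_add' f g := map_add _ f g
  map_smul' _ _ := rfl

/-! ### The augmentation and the value at one -/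

section Augment

variable {N m : ℕ} {σ : Type*}

theorem htf_series : HTF Ch where
  tf x hx := by
    have h : PowerSeries.X * x = 0 := hx
    simpa using h
  sep x hx := PowerSeries.ext fun k => by
    obtain ⟨y, rfl⟩ := hx (k + 1)
    change PowerSeries.coeff k (PowerSeries.X ^ (k + 1) * y) = 0
    rw [PowerSeries.coeff_X_pow_mul', if_neg (by omega)]
  compl a := by
    refine ⟨PowerSeries.mk fun k => ∑ r ∈ Finset.range (k + 1), PowerSeries.coeff (k - r) (a r),
      fun n => ?_⟩
    obtain ⟨y, hy⟩ := (PowerSeries.X_pow_dvd_iff (n := n) (φ := (PowerSeries.mk fun k =>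
      ∑ r ∈ Finset.range (k + 1), PowerSeries.coeff (k - r) (a r)) -
        ∑ k ∈ Finset.range n, hbar ^ k • a k)).2 fun k hk => by
      have e : ∀ r, PowerSeries.coeff k (hbar ^ r • a r) =
          if r ≤ k then PowerSeries.coeff (k - r) (a r) else 0 := fun r =>
        PowerSeries.coeff_X_pow_mul' (a r) r k
      rw [map_sub, map_sum, PowerSeries.coeff_mk]
      simp only [e]
      rw [← Finset.sum_filter, sub_eq_zero]
      refine Finset.sum_congr (Finset.ext fun r => ?_) fun _ _ => rfl
      rw [Finset.mem_filter, Finset.mem_range, Finset.mem_range]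
      omega
    exact ⟨y, by rw [← sub_eq_iff_eq_add']; exact hy⟩

theorem RTT.one {S R : Type*} [CommRing S] [Ring R] [Algebra S R] (α β : S) :
    RTT α β (1 : Matrix (Fin N) (Fin N) R) 1 := by
  intro i j k l
  simp only [Matrix.one_apply]
  split_ifs <;> simp

theorem exists_augY (N : ℕ) : ∃ ε : Yp N →ₐ[Ch] Ch, ∀ i j r, ε (yNeg i j r) = 0 := by
  refine Yp.exists_lift htf_series (fun _ _ _ => 0) ?_
  have h : ∀ {w : MvPowerSeries (Fin 2) Ch}, MvPowerSeries.constantCoeff w = 0 →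
      mser (serPlus fun (_ _ : Fin N) _ => (0 : Ch)) w = 1 := by
    intro w hw
    rw [mser_serPlus hw, sub_eq_self]
    ext a b : 1
    refine MvPowerSeries.ext fun d => ?_
    change hbar • ∑ r ∈ Finset.range (d.degree + 1), MvPowerSeries.coeff d (w ^ r) • (0 : Ch) = 0
    simp
  rw [h (by simp), h (by simp)]
  exact RTT.one _ _

/-- The augmentation of the dual Yangian. -/
def augY (N : ℕ) : Yp N →ₐ[Ch] Ch := (exists_augY N).choose

theorem augY_tY (r : ℕ) (i j : Fin N) :
    augY N (tY N r i j) = if r = 0 then (1 : Matrix (Fin N) (Fin N) Ch) i j else 0 := by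
  rw [tY_map (augY N) (exists_augY N).choose_spec, serPlus]
  split_ifs <;> simp

/-- The augmentation, with values in the double Yangian. -/
def augD (N : ℕ) : HomY N := (Algebra.linearMap Ch (DY N)).comp (augY N).toLinearMap

/-- The value of an operator on the augmentation, at the unit. -/
def vacEval (N : ℕ) : Op (HomY N) →ₗ[Ch] DY N where
  toFun X := X (augD N) 1
  map_add' _ _ := rfl
  map_smul' _ _ := rfl

theorem vacEval_leftOp (b : DY N) : vacEval N (leftOp N b) = b := by
  change b * algebraMap Ch (DY N) (augY N 1) = b
  rw [map_one, map_one, mul_one]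

theorem vacEval_mul_rightOp (X : Op (HomY N)) (t : Yp N) :
    vacEval N (X * rightOp N t) = augY N t • vacEval N X := by
  have h : rightOp N t (augD N) = augY N t • augD N := LinearMap.ext fun x => by
    change algebraMap Ch (DY N) (augY N (x * t)) = augY N t • algebraMap Ch (DY N) (augY N x)
    rw [map_mul, map_mul, Algebra.smul_def]
    exact Algebra.commutes _ _
  change X (rightOp N t (augD N)) 1 = _
  rw [h, map_smul]
  rfl

theorem vacEval_sH_mul (X : Op (HomY N)) (k : ℕ) (a b : Fin N) :
    vacEval N (sH (evalS N) k a b * X) =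
      (if k = 0 then (1 : Matrix (Fin N) (Fin N) Ch) a b else 0) • vacEval N X := by
  change X (augD N) (opE (evalS N) k a b 1) = _
  rw [opE_one, Matrix.one_apply, Matrix.one_apply]
  split_ifs
  · rw [one_smul]
    rfl
  · rw [map_zero, zero_smul]
  · rw [map_zero, zero_smul]

theorem vacEval_mul_subs {D : Type*} [AddCommGroup D] [Module Ch D] {A : Type*} [Ring A]
    [Algebra Ch A] (E : A →ₗ[Ch] D) (X : A) (f : ℕ → A) (c : Ch)
    (h : ∀ r, E (X * f r) = (if r = 0 then c else 0) • E X) {w : MvPowerSeries σ Ch}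
    (hw : MvPowerSeries.constantCoeff w = 0) (d : σ →₀ ℕ) :
    E (X * MvPowerSeries.coeff d (subs f w)) =
      MvPowerSeries.coeff d (MvPowerSeries.C c : MvPowerSeries σ Ch) • E X := by
  rw [← subs_const hw c]
  change E (X * ∑ r ∈ Finset.range (d.degree + 1), MvPowerSeries.coeff d (w ^ r) • f r) =
    (∑ r ∈ Finset.range (d.degree + 1), MvPowerSeries.coeff d (w ^ r) • if r = 0 then c else 0) • E X
  rw [Finset.mul_sum, map_sum, Finset.sum_smul]
  refine Finset.sum_congr rfl fun r _ => ?_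
  rw [mul_smul_comm, map_smul, h, smul_assoc]

theorem vacEval_subs_mul {D : Type*} [AddCommGroup D] [Module Ch D] {A : Type*} [Ring A]
    [Algebra Ch A] (E : A →ₗ[Ch] D) (X : A) (f : ℕ → A) (c : Ch)
    (h : ∀ r, E (f r * X) = (if r = 0 then c else 0) • E X) {w : MvPowerSeries σ Ch}
    (hw : MvPowerSeries.constantCoeff w = 0) (d : σ →₀ ℕ) :
    E (MvPowerSeries.coeff d (subs f w) * X) =
      MvPowerSeries.coeff d (MvPowerSeries.C c : MvPowerSeries σ Ch) • E X := by
  rw [← subs_const hw c]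
  change E ((∑ r ∈ Finset.range (d.degree + 1), MvPowerSeries.coeff d (w ^ r) • f r) * X) =
    (∑ r ∈ Finset.range (d.degree + 1), MvPowerSeries.coeff d (w ^ r) • if r = 0 then c else 0) • E X
  rw [Finset.sum_mul, map_sum, Finset.sum_smul]
  refine Finset.sum_congr rfl fun r _ => ?_
  rw [smul_mul_assoc, map_smul, h, smul_assoc]

theorem coeff_one_smul {A : Type*} [Ring A] [Algebra Ch A] (x : A) (c c' : Fin m → Fin N)
    (d : σ →₀ ℕ) : MvPowerSeries.coeff d ((1 : Ten N m (MvPowerSeries σ Ch)) c c') • x =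
      x * MvPowerSeries.coeff d ((1 : Ten N m (MvPowerSeries σ A)) c c') := by
  classical
  rw [Matrix.one_apply, Matrix.one_apply]
  split_ifs
  · rw [MvPowerSeries.coeff_one, MvPowerSeries.coeff_one]
    split_ifs <;> simp
  · simp

theorem coeff_C_one_smul {D : Type*} [AddCommGroup D] [Module Ch D] (i : Fin m)
    (c c' : Fin m → Fin N) (d : σ →₀ ℕ) (x : D) (P : Prop) [Decidable P]
    (hP : P ↔ ∀ k, k ≠ i → c k = c' k) :
    (if P then MvPowerSeries.coeff d (MvPowerSeries.C ((1 : Matrix (Fin N) (Fin N) Ch)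
      (c i) (c' i)) : MvPowerSeries σ Ch) • x else 0) =
      MvPowerSeries.coeff d ((1 : Ten N m (MvPowerSeries σ Ch)) c c') • x := by
  have h : (c = c') ↔ (∀ k, k ≠ i → c k = c' k) ∧ c i = c' i :=
    ⟨fun h => ⟨fun k _ => congrFun h k, congrFun h i⟩, fun h => funext fun k => by
      by_cases hk : k = i
      · rw [hk]; exact h.2
      · exact h.1 k hk⟩
  rw [Matrix.one_apply, Matrix.one_apply, if_congr h rfl rfl]
  by_cases h1 : P
  · by_cases h2 : c i = c' i
    · rw [if_pos h1, if_pos h2, if_pos ⟨hP.1 h1, h2⟩, map_one]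
    · rw [if_pos h1, if_neg h2, if_neg (fun h => h2 h.2), map_zero]
  · rw [if_neg h1, if_neg (fun h => h1 (hP.2 h.1)), map_zero, zero_smul]

/-- A linear functional for which right multiplication by the coefficients of `T` acts by the
matrix elements of the identity does not see `T`. -/
theorem vacEval_mul_site {D : Type*} [AddCommGroup D] [Module Ch D] {A : Type*} [Ring A]
    [Algebra Ch A] (E : A →ₗ[Ch] D) (T : ℕ → Matrix (Fin N) (Fin N) A)
    (h : ∀ X r a b, E (X * T r a b) =
      (if r = 0 then (1 : Matrix (Fin N) (Fin N) Ch) a b else 0) • E X)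
    {w : MvPowerSeries σ Ch} (hw : MvPowerSeries.constantCoeff w = 0) (i : Fin m)
    (X : Ten N m (MvPowerSeries σ A)) (a b : Fin m → Fin N) (d : σ →₀ ℕ) :
    E (MvPowerSeries.coeff d ((X * site i (mser T w) : Ten N m (MvPowerSeries σ A)) a b)) =
      E (MvPowerSeries.coeff d (X a b)) := by
  classical
  have key : ∀ (x : A) (c c' : Fin m → Fin N) (q : σ →₀ ℕ),
      E (x * MvPowerSeries.coeff q ((site i (mser T w) : Ten N m (MvPowerSeries σ A)) c c')) =
      E (x * MvPowerSeries.coeff q ((1 : Ten N m (MvPowerSeries σ A)) c c')) := by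
    intro x c c' q
    rw [← coeff_one_smul, map_smul, ← coeff_C_one_smul i c c' q (E x) _ Iff.rfl, site_apply]
    split_ifs
    · exact vacEval_mul_subs E x _ _ (fun r => h x r _ _) hw q
    · rw [map_zero, mul_zero, map_zero]
  conv_rhs => rw [← mul_one X]
  simp only [Matrix.mul_apply, map_sum, MvPowerSeries.coeff_mul, key]

theorem vacEval_site_mul {D : Type*} [AddCommGroup D] [Module Ch D] {A : Type*} [Ring A]
    [Algebra Ch A] (E : A →ₗ[Ch] D) (T : ℕ → Matrix (Fin N) (Fin N) A)
    (h : ∀ X r a b, E (T r a b * X) =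
      (if r = 0 then (1 : Matrix (Fin N) (Fin N) Ch) a b else 0) • E X)
    {w : MvPowerSeries σ Ch} (hw : MvPowerSeries.constantCoeff w = 0) (i : Fin m)
    (X : Ten N m (MvPowerSeries σ A)) (a b : Fin m → Fin N) (d : σ →₀ ℕ) :
    E (MvPowerSeries.coeff d ((site i (mser T w) * X : Ten N m (MvPowerSeries σ A)) a b)) =
      E (MvPowerSeries.coeff d (X a b)) := by
  classical
  have key : ∀ (x : A) (c c' : Fin m → Fin N) (q : σ →₀ ℕ),
      E (MvPowerSeries.coeff q ((site i (mser T w) : Ten N m (MvPowerSeries σ A)) c c') * x) =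
      E (MvPowerSeries.coeff q ((1 : Ten N m (MvPowerSeries σ A)) c c') * x) := by
    intro x c c' q
    have e : MvPowerSeries.coeff q ((1 : Ten N m (MvPowerSeries σ A)) c c') * x =
        x * MvPowerSeries.coeff q ((1 : Ten N m (MvPowerSeries σ A)) c c') := by
      rw [Matrix.one_apply]
      split_ifs
      · rw [MvPowerSeries.coeff_one]
        split_ifs <;> simp
      · simp
    rw [e, ← coeff_one_smul, map_smul, ← coeff_C_one_smul i c c' q (E x) _ Iff.rfl, site_apply]
    split_ifs
    · exact vacEval_subs_mul E x _ _ (fun r => h x r _ _) hw q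
    · rw [map_zero, zero_mul, map_zero]
  conv_rhs => rw [← one_mul X]
  simp only [Matrix.mul_apply, map_sum, MvPowerSeries.coeff_mul, key]

theorem map_mul_prod_eq {R D I : Type*} [Ring R] (E : R → D) (T : I → R)
    (h : ∀ i X, E (X * T i) = E X) (l : List I) (X : R) : E (X * (l.map T).prod) = E X := by
  induction l generalizing X with
  | nil => simp
  | cons i l ih => rw [List.map_cons, List.prod_cons, ← mul_assoc, ih, h]

theorem map_prod_mul_eq {R D I : Type*} [Ring R] (E : R → D) (T : I → R)
    (h : ∀ i X, E (T i * X) = E X) (l : List I) (X : R) : E ((l.map T).prod * X) = E X := by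
  induction l with
  | nil => simp
  | cons i l ih => rw [List.map_cons, List.prod_cons, mul_assoc, h, ih]

theorem ordProd_map {R R' I : Type*} [Ring R] [Ring R'] (φ : R →+* R') (B : I → R) (Q : I → I → R)
    (l : List I) : φ (ordProd B Q l) = ordProd (fun i => φ (B i)) (fun i j => φ (Q i j)) l := by
  induction l with
  | nil => exact map_one φ
  | cons i l ih =>
    rw [ordProd, ordProd, map_mul, map_mul, ih, map_list_prod, List.map_map]
    rfl

/-- The product `∏ B_i(1/w_i) Rbar_{ij}(1/w_{ij})`, ordered as in the definition of
`B_{[m]}(u|z)`. -/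
def bProdD (N m : ℕ) (w : Fin m → MvPowerSeries σ Ch) (w' : Fin m → Fin m → MvPowerSeries σ Ch) :
    Ten N m (MvPowerSeries σ (DY N)) :=
  ordProd (fun i => site i (mser (bD N) (w i)))
    (fun i j => if i = j then 1 else rbar i j (w' i j)) (List.finRange m)

theorem rbar_map {A A' : Type*} [Ring A] [Algebra Ch A] [Ring A'] [Algebra Ch A'] (φ : A →ₐ[Ch] A')
    (i j : Fin m) (w : MvPowerSeries σ Ch) :
    (rbar i j w : Ten N m (MvPowerSeries σ A)).map (MvPowerSeries.map φ.toRingHom) =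
      rbar i j w := by
  rw [rbar, rbar, ← map_rm φ]
  ext a b : 1
  exact map_smul_series φ _ _

theorem rbar_subst {A : Type*} [Ring A] [Algebra Ch A] {τ : Type*} [Fintype σ]
    {v : σ → MvPowerSeries τ Ch} (hv : ∀ t, MvPowerSeries.constantCoeff (v t) = 0) (i j : Fin m)
    {w : MvPowerSeries σ Ch} (hw : MvPowerSeries.constantCoeff w = 0) :
    (rbar i j w : Ten N m (MvPowerSeries σ A)).map (substHom v hv) =
      rbar i j (substHom v hv w) := by
  have h := mapMatrix_smul_rm (A := A) (N := N) hv (nser N w) 1 (hC Ch * w) i j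
  rw [substHom_nser hv hw, map_mul, substHom_hC, map_one] at h
  exact h

theorem bProdD_subst {τ : Type*} [Fintype σ]
    {v : σ → MvPowerSeries τ Ch} (hv : ∀ t, MvPowerSeries.constantCoeff (v t) = 0)
    {w : Fin m → MvPowerSeries σ Ch} {w' : Fin m → Fin m → MvPowerSeries σ Ch}
    (hw : ∀ i, MvPowerSeries.constantCoeff (w i) = 0)
    (hw' : ∀ i j, MvPowerSeries.constantCoeff (w' i j) = 0) :
    (bProdD N m w w').map (substHom v hv) =
      bProdD N m (fun i => substHom v hv (w i)) fun i j => substHom v hv (w' i j) := by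
  have h := ordProd_map ((substHom v hv : MvPowerSeries σ (DY N) →+*
    MvPowerSeries τ (DY N)).mapMatrix (m := Fin m → Fin N))
    (fun i => site i (mser (bD N) (w i)))
    (fun i j => if i = j then 1 else rbar i j (w' i j)) (List.finRange m)
  refine h.trans ?_
  rw [bProdD]
  congr 1
  · funext i
    rw [RingHom.mapMatrix_apply, site_map, mser_subst _ (hw i)]
  · funext i j
    rw [RingHom.mapMatrix_apply]
    split_ifs
    · exact map_one ((substHom v hv : MvPowerSeries σ (DY N) →+*
        MvPowerSeries τ (DY N)).mapMatrix (m := Fin m → Fin N))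
    · exact rbar_subst hv i j (hw' i j)

/-- The coefficient of `z^{-k}` of the module map on the dual Yangian, multiplied by `h^k`. -/
def yHat (N k : ℕ) : Yp N →ₗ[Ch] DY N :=
  (vacEval N).comp ((seriesCoeff (Op (HomY N)) k).comp (sbtHom N).toLinearMap)

theorem yHat_yProd (m k : ℕ) (a b : Fin m → Fin N) (d : Fin m →₀ ℕ) :
    yHat N k (MvPowerSeries.coeff d (yProd N m a b)) = MvPowerSeries.coeff (d.optionElim k)
      (bProdD N m (fun i => linInv (hC Ch * MvPowerSeries.X none) (MvPowerSeries.X (some i)))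
        (fun i j => linInv (halfH (MvPowerSeries.X none))
          (MvPowerSeries.X (some i) + MvPowerSeries.X (some j))) a b) := by
  set p : MvPowerSeries (Option (Fin m)) Ch := MvPowerSeries.X none with hp
  have hp0 : MvPowerSeries.constantCoeff p = 0 := MvPowerSeries.constantCoeff_X _
  have hx0 : ∀ i : Fin m, MvPowerSeries.constantCoeff
    (MvPowerSeries.X (some i) : MvPowerSeries (Option (Fin m)) Ch) = 0 := fun i =>
      MvPowerSeries.constantCoeff_X _
  have hc := constantCoeff_halfH hp0
  have h2 : 2 * halfH p = hC Ch * p := two_mul_half _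
  have hc2 : MvPowerSeries.constantCoeff (hC Ch * p) = 0 := constantCoeff_hC_mul hp0
  let S : Fin m → Ten N m (MvPowerSeries (Option (Fin m)) (Op (HomY N))) := fun i =>
    site i (mser (sH (evalS N)) (linInv (halfH p) (MvPowerSeries.X (some i))))
  let B : Fin m → Ten N m (MvPowerSeries (Option (Fin m)) (Op (HomY N))) := fun i =>
    site i (mser (bH N) (linInv (hC Ch * p) (MvPowerSeries.X (some i))))
  let T : Fin m → Ten N m (MvPowerSeries (Option (Fin m)) (Op (HomY N))) := fun i =>
    site i (mser (tH N) (MvPowerSeries.X (some i)))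
  let Q : Fin m → Fin m → Ten N m (MvPowerSeries (Option (Fin m)) (Op (HomY N))) := fun i j =>
    if i = j then 1 else
      rbar i j (linInv (halfH p) (MvPowerSeries.X (some i) + MvPowerSeries.X (some j)))
  have hQ : ∀ {i j}, i ≠ j → Q i j = rbar i j (linInv (halfH p)
    (MvPowerSeries.X (some i) + MvPowerSeries.X (some j))) := fun h => if_neg h
  -- Moving the `S` to the left and the `T` to the right leaves the `R`-matrices between the `B`,
  -- with the arguments `2z + u_i + u_j`.
  have hno : ((List.finRange m).map fun i => S i * B i * T i).prod =
      ((List.finRange m).map S).prod * ordProd B Q (List.finRange m) *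
        ((List.finRange m).map T).prod := by
    refine normal_order ?_ ?_ ?_ ?_ ?_ _ (List.nodup_finRange m) fun i => if_pos rfl
    · intro i j hij
      rw [hQ hij, rbar_comm, add_comm, ← linInv_linInv hc]
      exact sH_tH_site hij.symm (constantCoeff_linInv hc) (hx0 i)
    · intro i j hij
      exact mser_site_comm bH_sH_comm hij _ _
    · intro i j hij
      exact mser_site_comm tH_bH_comm hij _ _
    · intro i j k hij hki hkj
      rw [hQ hij, rbar, smul_mul_assoc, mul_smul_comm, rm_site_of_ne hki hkj]
    · intro i j k hij hki hkj
      rw [hQ hij, rbar, smul_mul_assoc, mul_smul_comm, rm_site_of_ne hki hkj]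
  have hsbt : ∀ i : Fin m, (site i (sbt N (halfH p) (MvPowerSeries.X (some i))) :
      Ten N m (MvPowerSeries (Option (Fin m)) (Op (HomY N)))) = S i * B i * T i := by
    intro i
    rw [sbt, h2, site_mul, site_mul]
  change vacEval N (PowerSeries.coeff k (sbtHom N _)) = _
  rw [coeff_sbtHom_yProd]
  have h0 := congrArg (fun X : Ten N m (MvPowerSeries (Option (Fin m)) (Op (HomY N))) =>
    vacEval N (MvPowerSeries.coeff (d.optionElim k) (X a b)))
      ((congrArg List.prod (List.map_congr_left fun i _ => hsbt i)).trans hno)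
  refine h0.trans ?_
  -- The augmentation sends `T` to the identity.
  have h3 := map_mul_prod_eq (fun X : Ten N m (MvPowerSeries (Option (Fin m)) (Op (HomY N))) =>
    vacEval N (MvPowerSeries.coeff (d.optionElim k) (X a b))) T (fun i X =>
      vacEval_mul_site (vacEval N) (tH N) (fun X r a b => by
        have e : tH N r a b = rightOp N (tY N r a b) := rfl
        rw [e, vacEval_mul_rightOp, augY_tY]) (hx0 i) i X a b _) (List.finRange m)
        (((List.finRange m).map S).prod * ordProd B Q (List.finRange m))
  refine h3.trans ?_
  -- The value at `1` absorbs the factors `S`.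
  have h4 := map_prod_mul_eq (fun X : Ten N m (MvPowerSeries (Option (Fin m)) (Op (HomY N))) =>
    vacEval N (MvPowerSeries.coeff (d.optionElim k) (X a b))) S (fun i X =>
      vacEval_site_mul (vacEval N) (sH (evalS N)) (fun X r a b => vacEval_sH_mul X r a b)
        (constantCoeff_linInv hc) i X a b _) (List.finRange m) (ordProd B Q (List.finRange m))
  refine h4.trans ?_
  have h5 := ordProd_map ((MvPowerSeries.map (leftOp N).toRingHom :
    MvPowerSeries (Option (Fin m)) (DY N) →+* _).mapMatrix (m := Fin m → Fin N))
    (fun i => site i (mser (bD N) (linInv (hC Ch * p) (MvPowerSeries.X (some i)))))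
    (fun i j => if i = j then 1 else rbar i j (linInv (halfH p)
      (MvPowerSeries.X (some i) + MvPowerSeries.X (some j)))) (List.finRange m)
  have h6 : ordProd B Q (List.finRange m) = (bProdD N m
      (fun i => linInv (hC Ch * p) (MvPowerSeries.X (some i)))
      (fun i j => linInv (halfH p) (MvPowerSeries.X (some i) + MvPowerSeries.X (some j)))).map
        (MvPowerSeries.map (leftOp N).toRingHom) := by
    refine Eq.trans ?_ h5.symm
    congr 1
    · funext i
      rw [RingHom.mapMatrix_apply, site_map, mser_map]
      rfl
    · funext i j
      rw [RingHom.mapMatrix_apply]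
      change (if i = j then _ else _) = _
      split_ifs
      · exact (map_one ((MvPowerSeries.map (leftOp N).toRingHom :
          MvPowerSeries (Option (Fin m)) (DY N) →+* _).mapMatrix (m := Fin m → Fin N))).symm
      · exact (rbar_map (leftOp N) i j _).symm
  have h7 := congrArg (fun X : Ten N m (MvPowerSeries (Option (Fin m)) (Op (HomY N))) =>
    vacEval N (MvPowerSeries.coeff (d.optionElim k) (X a b))) h6
  exact h7.trans (vacEval_leftOp _)

end Augment

/-! ### The module map -/

section ModuleMap

variable {N m : ℕ} {σ τ : Type*}

theorem coeff_substHom_rescale {A : Type*} [Ring A] [Algebra Ch A] [Fintype τ]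
    {v : Option τ → MvPowerSeries (Option τ) Ch}
    (hv : ∀ t, MvPowerSeries.constantCoeff (v t) = 0) (h0 : v none = hC Ch * MvPowerSeries.X none)
    (h1 : ∀ i, v (some i) = MvPowerSeries.X (some i)) (f : MvPowerSeries (Option τ) A)
    (e : Option τ →₀ ℕ) : MvPowerSeries.coeff e (substHom v hv f) =
      hbar ^ e none • MvPowerSeries.coeff e f := by
  classical
  have hw : ∀ e : Option τ →₀ ℕ, wpow v e = MvPowerSeries.C (hbar ^ e none) *
      MvPowerSeries.monomial e 1 := by
    intro e
    have h := wpow_X (σ := Option τ) id e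
    rw [Finsupp.mapDomain_id] at h
    rw [← h, wpow, wpow, Fintype.prod_option, Fintype.prod_option, h0, mul_pow, hC, ← map_pow]
    simp only [h1, id, mul_assoc]
    rfl
  rw [substHom_apply, coeff_substFun_eq_single hv f e e]
  · rw [hw, MvPowerSeries.coeff_C_mul, MvPowerSeries.coeff_monomial_same, mul_one]
  · intro e' he'
    rw [hw, MvPowerSeries.coeff_C_mul, MvPowerSeries.coeff_monomial_ne he'.symm, mul_zero, zero_smul]

theorem coeff_bProdD_rescale (m k : ℕ) (a b : Fin m → Fin N) (d : Fin m →₀ ℕ) :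
    MvPowerSeries.coeff (d.optionElim k)
      (bProdD N m (fun i => linInv (hC Ch * MvPowerSeries.X none) (MvPowerSeries.X (some i)))
        (fun i j => linInv (halfH (MvPowerSeries.X none))
          (MvPowerSeries.X (some i) + MvPowerSeries.X (some j))) a b) =
      hbar ^ k • MvPowerSeries.coeff (d.optionElim k) (bProdD N m invZ invZZ a b) := by
  let v : Option (Fin m) → MvPowerSeries (Option (Fin m)) Ch := fun t => t.elim
    (hC Ch * MvPowerSeries.X none) fun i => MvPowerSeries.X (some i)
  have hv : ∀ t, MvPowerSeries.constantCoeff (v t) = 0 := by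
    rintro (_ | i)
    · exact constantCoeff_hC_mul (MvPowerSeries.constantCoeff_X _)
    · exact MvPowerSeries.constantCoeff_X _
  have hX : MvPowerSeries.constantCoeff
      (MvPowerSeries.X none : MvPowerSeries (Option (Fin m)) Ch) = 0 :=
    MvPowerSeries.constantCoeff_X _
  have hX' : MvPowerSeries.constantCoeff (MvPowerSeries.C (PowerSeries.C (1 / 2 : ℂ)) *
      (MvPowerSeries.X none : MvPowerSeries (Option (Fin m)) Ch)) = 0 := by
    rw [map_mul, hX, mul_zero]
  have h := bProdD_subst (N := N) (w := invZ) (w' := invZZ) hv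
    (fun i => constantCoeff_linInv hX) fun i j => constantCoeff_linInv hX'
  have e1 : (fun i : Fin m => substHom v hv (invZ i)) = fun i =>
      linInv (hC Ch * MvPowerSeries.X none) (MvPowerSeries.X (some i)) := funext fun i => by
    have := substHom_linInv (v := MvPowerSeries.X (some i)) hv hX
    rw [substHom_X', substHom_X'] at this
    exact this
  have e2 : (fun i j : Fin m => substHom v hv (invZZ i j)) = fun i j =>
      linInv (halfH (MvPowerSeries.X none))
        (MvPowerSeries.X (some i) + MvPowerSeries.X (some j)) := funext fun i => funext fun j => by
    have := substHom_linInv (v := MvPowerSeries.X (some i) + MvPowerSeries.X (some j)) hv hX'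
    rw [map_add, map_mul, substHom_X', substHom_X', substHom_X',
      (substHom_C hv _ : substHom v hv (MvPowerSeries.C (PowerSeries.C (1 / 2 : ℂ)) :
        MvPowerSeries (Option (Fin m)) Ch) = _)] at this
    exact this
  rw [e1, e2] at h
  rw [← h, Matrix.map_apply, coeff_substHom_rescale hv rfl fun _ => rfl,
    Finsupp.optionElim_apply_none]

theorem extScal_normR_self {A : Type*} [Ring A] [Algebra Ch A] (i j : Fin m)
    (w : MvPowerSeries σ Ch) :
    extScal (algebraMap Ch A) (normR i j w : Ten N m (MvPowerSeries σ Ch)) = rbar i j w := by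
  have h := extScal_normR (N := N) (A := A) (AlgHom.id Ch Ch) i j w
  refine Eq.trans ?_ (h.trans ?_)
  · rfl
  · congr 1

theorem Bprod_map (m : ℕ) : (Bprod N m).map (MvPowerSeries.map (reflAlg N).val.toRingHom) =
    bProdD N m invZ invZZ := by
  rw [bProdD, ordProd_eq _ _ _ (List.sortedLT_finRange m).pairwise, Bprod, Ten.map_list_prod,
    List.ofFn_eq_map, List.map_map]
  congr 1
  refine List.map_congr_left fun i _ => ?_
  rw [Function.comp, Ten.map_mul, siteSeries_map, Ten.map_list_prod, List.map_map, siteSeries_eq]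
  congr 2
  · congr 2
    funext r
    exact serMinus_map (reflAlg N).val bGen r
  · refine List.map_congr_left fun j hj => ?_
    have hij : i ≠ j := fun h => by
      rw [List.mem_filter] at hj
      simp [h] at hj
    rw [Function.comp, if_neg hij, extScal_normR_self, rbar_map]

theorem mem_reflAlg_of_congr {x : DY N} (h : ∀ n : ℕ, ∃ a ∈ reflAlg N, ∃ y, x = a + hbar ^ n • y) :
    x ∈ reflAlg N := by
  intro n
  obtain ⟨a, ha, y, rfl⟩ := h n
  obtain ⟨b, hb, y', rfl⟩ := ha n
  exact ⟨b, hb, y' + y, by rw [smul_add, add_assoc]⟩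

theorem yHat_mem {π : VacCrit N →ₗ[Ch] Yp N} {act : DY N →ₐ[Ch] EndY N}
    (hact : ∀ i j r, act (tNeg i j r) = lamY N (yNeg i j r)) (hπ : ∀ x, π (onVac x) = act x 1)
    (k : ℕ) {x : VacCrit N} (hx : x ∈ vacLattice N) :
    ∃ b ∈ reflAlg N, hbar ^ k • b = yHat N k (π x) := by
  have hD : HTF (DY N) := HTF.dy
  let U : Submodule Ch (VacCrit N) := (Submodule.map (LinearMap.lsmul Ch (DY N) (hbar ^ k))
    (Subalgebra.toSubmodule (reflAlg N))).comap ((yHat N k).comp π)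
  have hU : ∀ s, s ∈ Submodule.span Ch (vacCoeffs N) →
      ∃ b ∈ reflAlg N, hbar ^ k • b = yHat N k (π s) := by
    intro s hs
    have : s ∈ U := by
      refine Submodule.span_le.2 ?_ hs
      rintro _ ⟨m, a, b, d, rfl⟩
      refine ⟨_, (MvPowerSeries.coeff (d.optionElim k) (Bprod N m a b)).2, ?_⟩
      change hbar ^ k • _ = yHat N k (π _)
      rw [hπ, act_TplusProd hact, yHat_yProd, coeff_bProdD_rescale, ← Bprod_map]
      rfl
    obtain ⟨b, hb, hb'⟩ := this
    exact ⟨b, hb, hb'⟩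
  obtain ⟨s, hs, hx⟩ := hx
  choose b hb hb' using fun j => hU (s j) (hs j)
  obtain ⟨c, hc⟩ := hD.compl b
  refine ⟨c, mem_reflAlg_of_congr fun n => ?_, hD.eq_of_congr fun n => ?_⟩
  · obtain ⟨y, hy⟩ := hc n
    exact ⟨_, sum_mem fun j _ => (reflAlg N).smul_mem (hb j) _, y, hy⟩
  · obtain ⟨y, hy⟩ := hc n
    obtain ⟨z, hz⟩ := hx n
    refine ⟨hbar ^ k • y - yHat N k (π z), ?_⟩
    rw [hy, hz]
    simp only [map_add, map_sum, map_smul, ← hb', smul_add, Finset.smul_sum, smul_sub,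
      smul_comm (hbar ^ k)]
    abel

theorem exists_moduleMap (N : ℕ) :
    ∃ Y : vacLattice N →ₗ[Ch] PowerSeries (reflAlg N), IsModuleMap Y := by
  obtain ⟨π, act, hact, hπ⟩ := exists_vacCrit_map N
  -- The coefficient of `z^{-k}` was multiplied by `h^k`, and is divided by it again; the quotient
  -- is unique because there is no `h`-torsion.
  have key : ∀ (x : vacLattice N) (k : ℕ), ∃ b : reflAlg N,
      hbar ^ k • (b : DY N) = yHat N k (π x) := fun x k => by
    obtain ⟨b, hb, hb'⟩ := yHat_mem hact hπ k x.2
    exact ⟨⟨b, hb⟩, hb'⟩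
  choose B hB using key
  refine ⟨
    { toFun := fun x => PowerSeries.mk (B x)
      map_add' := fun x y => PowerSeries.ext fun k => ?_
      map_smul' := fun c x => PowerSeries.ext fun k => ?_ }, fun m a b d k => ?_⟩
  · rw [map_add, PowerSeries.coeff_mk, PowerSeries.coeff_mk, PowerSeries.coeff_mk]
    refine Subtype.ext (HTF.dy.tf_pow_inj k ?_)
    rw [hB, Subalgebra.coe_add, smul_add, hB, hB, Submodule.coe_add, map_add, map_add]
  · rw [PowerSeries.coeff_mk]
    change B (c • x) k = c • PowerSeries.coeff k (PowerSeries.mk (B x))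
    rw [PowerSeries.coeff_mk]
    refine Subtype.ext (HTF.dy.tf_pow_inj k ?_)
    rw [hB, Subalgebra.coe_smul, smul_comm, hB, Submodule.coe_smul, map_smul, map_smul]
  · refine Subtype.ext (HTF.dy.tf_pow_inj k ?_)
    have e : PowerSeries.coeff k (PowerSeries.mk (B (TplusVac N m a b d))) =
      B (TplusVac N m a b d) k := PowerSeries.coeff_mk _ _
    refine (congrArg (fun b : reflAlg N => hbar ^ k • (b : DY N)) e).trans ?_
    rw [hB]
    change yHat N k (π (onVac _)) = _
    rw [hπ, act_TplusProd hact, yHat_yProd, coeff_bProdD_rescale, ← Bprod_map]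
    rfl

theorem vac_tf {x : VacCrit N} (h : hbar • x = 0) : x = 0 := by
  obtain ⟨x, rfl⟩ := Submodule.Quotient.mk_surjective _ x
  have h' : (Submodule.Quotient.mk (hbar • x) : VacCrit N) = 0 := h
  rw [Submodule.Quotient.mk_eq_zero] at h' ⊢
  rw [vacIdeal, Submodule.mem_sInf] at h' ⊢
  exact fun L hL => hL.2.2.1 x (h' L hL)

theorem vac_tf_pow_inj {x y : VacCrit N} (n : ℕ) (h : hbar ^ n • x = hbar ^ n • y) : x = y := by
  rw [← sub_eq_zero, ← smul_sub] at h
  rw [← sub_eq_zero]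
  generalize x - y = z at h
  induction n with
  | zero => simpa using h
  | succ n ih =>
    rw [pow_succ', mul_smul] at h
    exact ih (vac_tf h)

/-- The remainders of a convergent series in the lattice lie in the lattice. -/
theorem remainder_mem_vacLattice {x : VacCrit N} {s : ℕ → VacCrit N}
    (hs : ∀ k, s k ∈ Submodule.span Ch (vacCoeffs N))
    (hx : ∀ n, ∃ y : VacCrit N, x = ∑ k ∈ Finset.range n, hbar ^ k • s k + hbar ^ n • y) (n : ℕ) :
    ∃ y ∈ vacLattice N, x = ∑ k ∈ Finset.range n, hbar ^ k • s k + hbar ^ n • y := by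
  obtain ⟨y, hy⟩ := hx n
  refine ⟨y, ⟨fun k => s (n + k), fun k => hs _, fun l => ?_⟩, hy⟩
  obtain ⟨z, hz⟩ := hx (n + l)
  refine ⟨z, vac_tf_pow_inj n ?_⟩
  rw [hy, Finset.sum_range_add, add_assoc, add_left_cancel_iff] at hz
  rw [hz, smul_add, Finset.smul_sum, smul_smul, ← pow_add]
  simp only [pow_add, mul_smul]

theorem span_le_vacLattice (N : ℕ) : Submodule.span Ch (vacCoeffs N) ≤ vacLattice N :=
  Submodule.span_le.2 fun _ hx => vacCoeffs_subset N hx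

/-- A linear map on the lattice is `h`-adically continuous. -/
theorem map_vacLattice_congr {M : Type*} [AddCommGroup M] [Module Ch M]
    (L : vacLattice N →ₗ[Ch] M) {x : VacCrit N} {s : ℕ → VacCrit N}
    (hs : ∀ k, s k ∈ Submodule.span Ch (vacCoeffs N))
    (hx : ∀ n, ∃ y : VacCrit N, x = ∑ k ∈ Finset.range n, hbar ^ k • s k + hbar ^ n • y) (n : ℕ) :
    ∃ w, L ⟨x, s, hs, hx⟩ =
      ∑ k ∈ Finset.range n, hbar ^ k • L ⟨s k, span_le_vacLattice N (hs k)⟩ + hbar ^ n • w := by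
  obtain ⟨y, hy, hxy⟩ := remainder_mem_vacLattice hs hx n
  have e : (⟨x, s, hs, hx⟩ : vacLattice N) = ∑ k ∈ Finset.range n, hbar ^ k •
      (⟨s k, span_le_vacLattice N (hs k)⟩ : vacLattice N) + hbar ^ n • ⟨y, hy⟩ := by
    refine Subtype.ext ?_
    rw [Submodule.coe_add, Submodule.coe_sum]
    exact hxy
  refine ⟨L ⟨y, hy⟩, ?_⟩
  rw [e, map_add, map_sum, map_smul]
  congr 1
  exact Finset.sum_congr rfl fun k _ => map_smul _ _ _

theorem moduleMap_unique {Y Y' : vacLattice N →ₗ[Ch] PowerSeries (reflAlg N)}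
    (h : IsModuleMap Y) (h' : IsModuleMap Y') : Y' = Y := by
  have hspan : ∀ x (hx : x ∈ Submodule.span Ch (vacCoeffs N)),
      (Y' - Y) ⟨x, span_le_vacLattice N hx⟩ = 0 := by
    have : Submodule.span Ch (vacCoeffs N) ≤
        (LinearMap.ker (Y' - Y)).map (vacLattice N).subtype := by
      refine Submodule.span_le.2 ?_
      rintro _ ⟨m, a, b, d, rfl⟩
      refine ⟨TplusVac N m a b d, ?_, rfl⟩
      change Y' _ - Y _ = 0
      exact PowerSeries.ext fun k => by rw [map_sub, h, h', sub_self, map_zero]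
    intro x hx
    obtain ⟨y, hy, rfl⟩ := this hx
    exact hy
  rw [← sub_eq_zero]
  refine LinearMap.ext fun x => PowerSeries.ext fun k => Subtype.ext ?_
  -- The difference vanishes on the span of the coefficients, hence has values in every `h^n`.
  refine HTF.dy.sep _ fun n => ?_
  obtain ⟨x, s, hs, hx⟩ := x
  obtain ⟨w, hw⟩ := map_vacLattice_congr (Y' - Y) hs hx n
  rw [hw, Finset.sum_eq_zero fun j _ => by rw [hspan _ (hs j), smul_zero], zero_add]
  exact ⟨(PowerSeries.coeff k w : reflAlg N), rfl⟩

end ModuleMap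

/-! ### Evaluation of a series at `h` -/

section EvalH

variable {A : Type*} [Ring A] [Algebra Ch A]

/-- `x` is the value at `h` of the series `f`. -/
def IsHSum (f : PowerSeries A) (x : A) : Prop :=
  ∀ n : ℕ, ∃ y : A, x = ∑ k ∈ Finset.range n, hbar ^ k • PowerSeries.coeff k f + hbar ^ n • y

theorem IsHSum.unique (hA : HTF A) {f : PowerSeries A} {x y : A} (hx : IsHSum f x)
    (hy : IsHSum f y) : x = y := hA.eq_of_congr fun n => by
  obtain ⟨w, rfl⟩ := hx n
  obtain ⟨w', rfl⟩ := hy n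
  exact ⟨w - w', by rw [smul_sub]; abel⟩

theorem IsHSum.add {f g : PowerSeries A} {x y : A} (hx : IsHSum f x) (hy : IsHSum g y) :
    IsHSum (f + g) (x + y) := fun n => by
  obtain ⟨w, rfl⟩ := hx n
  obtain ⟨w', rfl⟩ := hy n
  refine ⟨w + w', ?_⟩
  simp only [map_add, smul_add, Finset.sum_add_distrib]
  abel

theorem IsHSum.C_mul (a : A) {f : PowerSeries A} {x : A} (hx : IsHSum f x) :
    IsHSum (PowerSeries.C a * f) (a * x) := fun n => by
  obtain ⟨w, rfl⟩ := hx n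
  refine ⟨a * w, ?_⟩
  simp only [PowerSeries.coeff_C_mul, mul_add, Finset.mul_sum, mul_smul_comm]

theorem IsHSum.one : IsHSum (1 : PowerSeries A) 1 := fun n => by
  cases n with
  | zero => exact ⟨1, by simp⟩
  | succ n =>
    refine ⟨0, ?_⟩
    rw [Finset.sum_range_succ', Finset.sum_eq_zero fun k _ => by
      rw [PowerSeries.coeff_one, if_neg k.succ_ne_zero, smul_zero]]
    simp

theorem IsHSum.X_mul {f : PowerSeries A} {x : A} (hx : IsHSum f x) :
    IsHSum (PowerSeries.X * f) (hbar • x) := fun n => by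
  cases n with
  | zero => exact ⟨hbar • x, by simp⟩
  | succ n =>
    obtain ⟨w, rfl⟩ := hx n
    refine ⟨w, ?_⟩
    rw [Finset.sum_range_succ', PowerSeries.coeff_zero_X_mul, smul_zero, add_zero, smul_add,
      Finset.smul_sum, pow_succ', mul_smul]
    congr 1
    exact Finset.sum_congr rfl fun k _ => by
      rw [PowerSeries.coeff_succ_X_mul, pow_succ', mul_smul]

/-- The value of a series at `h`. -/
def evalFun (hA : HTF A) (f : PowerSeries A) : A :=
  (hA.compl fun k => PowerSeries.coeff k f).choose

theorem isHSum_evalFun (hA : HTF A) (f : PowerSeries A) : IsHSum f (evalFun hA f) :=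
  (hA.compl fun k => PowerSeries.coeff k f).choose_spec

theorem evalFun_mul (hA : HTF A) (f g : PowerSeries A) :
    evalFun hA (f * g) = evalFun hA f * evalFun hA g := by
  refine hA.eq_of_congr fun n => ?_
  induction n generalizing f with
  | zero => exact ⟨evalFun hA (f * g) - evalFun hA f * evalFun hA g, by simp⟩
  | succ n ih =>
    obtain ⟨a, f', rfl⟩ : ∃ a f', f = PowerSeries.C a * 1 + PowerSeries.X * f' :=
      ⟨_, _, by rw [mul_one, add_comm]; exact PowerSeries.eq_X_mul_shift_add_const f⟩
    obtain ⟨w, hw⟩ := ih f'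
    have h1 := (isHSum_evalFun hA _).unique hA
      ((IsHSum.one.C_mul a).add (isHSum_evalFun hA f').X_mul)
    have h2 : evalFun hA ((PowerSeries.C a * 1 + PowerSeries.X * f') * g) =
        a * evalFun hA g + hbar • evalFun hA (f' * g) := by
      refine (isHSum_evalFun hA _).unique hA ?_
      rw [mul_one, add_mul, mul_assoc PowerSeries.X]
      exact ((isHSum_evalFun hA g).C_mul a).add (isHSum_evalFun hA (f' * g)).X_mul
    refine ⟨w, ?_⟩
    rw [h1, h2, hw, mul_one, add_mul, smul_add, smul_mul_assoc, pow_succ', mul_smul, add_assoc]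

/-- The evaluation at `h`. -/
def evalH (hA : HTF A) : PowerSeries A →+* A where
  toFun := evalFun hA
  map_one' := (isHSum_evalFun hA _).unique hA IsHSum.one
  map_mul' := evalFun_mul hA
  map_zero' := (isHSum_evalFun hA _).unique hA fun n => ⟨0, by simp⟩
  map_add' f g := (isHSum_evalFun hA _).unique hA
    ((isHSum_evalFun hA f).add (isHSum_evalFun hA g))

end EvalH

/-! ### The fused elements -/

section Fused

variable {N n : ℕ}

/-- The variable of a series in one variable. -/
notation "𝐱" => (MvPowerSeries.X () : MvPowerSeries Unit Ch)

theorem coeff_unit_mul_pow (c : Ch) (r j : ℕ) :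
    MvPowerSeries.coeff (Finsupp.single () j) (MvPowerSeries.C c * 𝐱 ^ r) =
      if r = j then c else 0 := by
  classical
  rw [MvPowerSeries.coeff_C_mul, MvPowerSeries.coeff_X_pow]
  by_cases h : r = j
  · simp [h]
  · rw [if_neg, if_neg h, mul_zero]
    exact fun h' => h (Finsupp.single_injective () h').symm

theorem coeff_subs_smul_X {A : Type*} [Ring A] [Algebra Ch A] (a : ℕ → A) (c : Ch) (j : ℕ) :
    MvPowerSeries.coeff (Finsupp.single () j) (subs a (MvPowerSeries.C c * 𝐱)) = c ^ j • a j := by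
  rw [coeff_subs (by simp) a _ j (by simp), Finset.sum_eq_single j]
  · rw [mul_pow, ← map_pow, coeff_unit_mul_pow, if_pos rfl]
  · intro r _ hr
    rw [mul_pow, ← map_pow, coeff_unit_mul_pow, if_neg hr, zero_smul]
  · intro h
    exact absurd (Finset.mem_range.2 (Nat.lt_succ_self j)) h

/-- The points `u_i = -i X`; the evaluation at `X = h` yields the points `-i h`. -/
def evPt (i : Fin n) : MvPowerSeries Unit Ch := MvPowerSeries.C (-((i : ℕ) : Ch)) * 𝐱

theorem constantCoeff_evPt (i : Fin n) : MvPowerSeries.constantCoeff (evPt i) = 0 := by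
  simp [evPt]

theorem TplusAt_eq (k : ℕ) : TplusAt N k =
    (mser (serPlus tNeg) (MvPowerSeries.C (-(k : Ch)) * 𝐱)).map (evalH HTF.dy) := by
  ext i j
  refine IsHSum.unique HTF.dy (fun n => ?_) (isHSum_evalFun HTF.dy _)
  obtain ⟨y, hy⟩ := FreeTop.exists_hSum (fun r =>
    (-(k : Ch)) ^ r • serPlus (fun i j s => FreeTop.gen (Gen.neg (N := N) i j s)) r i j) n
  refine ⟨Pres.mk (dyRel N) y, ?_⟩
  have h := congrArg (Pres.mk (dyRel N)) hy
  rw [map_add, map_sum, map_smul] at h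
  refine h.trans ?_
  congr 1
  refine Finset.sum_congr rfl fun r _ => ?_
  rw [map_smul, map_smul]
  have e := coeff_subs_smul_X (fun r => serPlus (tNeg (N := N)) r i j) (-(k : Ch)) r
  refine congrArg (hbar ^ r • ·) (Eq.trans ?_ e.symm)
  congr 1
  exact congrFun (congrFun (serPlus_map (Pres.mk (dyRel N)) _ r) i) j

theorem prod_TplusAt (n : ℕ) :
    (List.ofFn fun i : Fin n => (site i (TplusAt N i) : Ten N n (DY N))).prod =
      ((TplusProd N n).map (substHom evPt constantCoeff_evPt)).map (evalH HTF.dy) := by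
  rw [TplusProd, Ten.map_list_prod, Ten.map_list_prod, List.ofFn_eq_map, List.ofFn_eq_map,
    List.map_map, List.map_map]
  congr 1
  refine List.map_congr_left fun i _ => ?_
  rw [Function.comp, Function.comp, siteSeries_eq, site_map, mser_subst _ (by simp), substHom_X',
    site_map, TplusAt_eq]
  rfl

/-- The matrix elements of the anti-symmetrizer. -/
def antiCoeff (N n : ℕ) (a b : Fin n → Fin N) : Ch :=
  PowerSeries.C ((n.factorial : ℂ)⁻¹) *
    ∑ p : Equiv.Perm (Fin n), if a = b ∘ p then ((Equiv.Perm.sign p : ℤ) : Ch) else 0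

theorem trace_antisym_mul {A : Type*} [Ring A] [Algebra Ch A] (X : Ten N n A) :
    Matrix.trace (antisym N n A * X) = ∑ a, ∑ b, antiCoeff N n a b • X b a := by
  simp only [Matrix.trace, Matrix.diag, Matrix.mul_apply, Algebra.smul_def]
  rfl

/-- The terms of the expansion of the fused element in powers of `h`. -/
def fusedTerm (N n j : ℕ) : vacLattice N :=
  ∑ a, ∑ b, antiCoeff N n a b • ∑ d ∈ expo (Fin n) j,
    MvPowerSeries.coeff (Finsupp.single () j) (wpow evPt d) • TplusVac N n b a d

theorem fusedTerm_mem_span (j : ℕ) :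
    (fusedTerm N n j : VacCrit N) ∈ Submodule.span Ch (vacCoeffs N) := by
  simp only [fusedTerm, Submodule.coe_sum, Submodule.coe_smul]
  refine Submodule.sum_mem _ fun a _ => Submodule.sum_mem _ fun b _ => Submodule.smul_mem _ _ <|
    Submodule.sum_mem _ fun d _ => Submodule.smul_mem _ _ <| Submodule.subset_span ?_
  exact ⟨n, b, a, d, rfl⟩

/-- The projection to the vacuum module. -/
def vacMk (N : ℕ) : DY N →ₗ[Ch] VacCrit N where
  toFun := onVac
  map_add' _ _ := rfl
  map_smul' _ _ := rfl

theorem fused_eq (n k : ℕ) : ∃ y : VacCrit N, fused N n =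
    ∑ j ∈ Finset.range k, hbar ^ j • (fusedTerm N n j : VacCrit N) + hbar ^ k • y := by
  have h : ∀ a b, ∃ y, (List.ofFn fun i : Fin n => (site i (TplusAt N i) : Ten N n (DY N))).prod a b =
      ∑ j ∈ Finset.range k, hbar ^ j • (∑ d ∈ expo (Fin n) j,
        MvPowerSeries.coeff (Finsupp.single () j) (wpow evPt d) •
          MvPowerSeries.coeff d (TplusProd N n a b)) + hbar ^ k • y := by
    intro a b
    obtain ⟨y, hy⟩ := isHSum_evalFun HTF.dy
      (((TplusProd N n).map (substHom evPt constantCoeff_evPt)) a b) k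
    refine ⟨y, ?_⟩
    rw [prod_TplusAt]
    refine hy.trans ?_
    congr 1
    refine Finset.sum_congr rfl fun j _ => ?_
    congr 1
    exact coeff_substFun constantCoeff_evPt _ _ j (by simp)
  choose y hy using h
  refine ⟨vacMk N (∑ a, ∑ b, antiCoeff N n a b • y b a), ?_⟩
  rw [fused, trace_antisym_mul]
  simp only [hy]
  have e : ∀ j, (fusedTerm N n j : VacCrit N) = vacMk N (∑ a, ∑ b, antiCoeff N n a b •
      ∑ d ∈ expo (Fin n) j, MvPowerSeries.coeff (Finsupp.single () j) (wpow evPt d) •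
        MvPowerSeries.coeff d (TplusProd N n b a)) := by
    intro j
    simp only [fusedTerm, Submodule.coe_sum, Submodule.coe_smul, map_sum, map_smul]
    rfl
  simp only [e, ← map_smul, ← map_sum, ← map_add]
  change vacMk N _ = vacMk N _
  congr 1
  simp only [smul_add, Finset.sum_add_distrib, Finset.smul_sum]
  congr 1
  · refine Eq.trans (Finset.sum_congr rfl fun a _ => ?_) Finset.sum_comm
    refine Eq.trans (Finset.sum_congr rfl fun b _ => ?_) Finset.sum_comm
    exact Finset.sum_congr rfl fun j _ => Finset.sum_congr rfl fun d _ => smul_comm _ _ _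
  · simp only [smul_comm (hbar ^ k)]

theorem fused_mem (N n : ℕ) : fused N n ∈ vacLattice N :=
  ⟨fun j => fusedTerm N n j, fusedTerm_mem_span, fused_eq n⟩

end Fused

/-! ### Substitutions in two variables -/

section TwoVars

variable {A : Type*} [Ring A] [Algebra Ch A] {n : ℕ} {N : ℕ}

theorem coeff_monomial_smul {σ : Type*} [DecidableEq σ] (c : Ch) (d e : σ →₀ ℕ) (x : A) :
    MvPowerSeries.coeff d (MvPowerSeries.C c * MvPowerSeries.monomial e 1) • x =
      if d = e then c • x else 0 := by
  rw [MvPowerSeries.coeff_C_mul, MvPowerSeries.coeff_monomial]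
  split_ifs <;> simp

/-- The variables `z⁻¹ = 𝐮` and `u_i = c_i 𝐯`. -/
def lineVar (c : Fin n → Ch) (t : Option (Fin n)) : MvPowerSeries (Fin 2) Ch :=
  t.elim 𝐮 fun i => MvPowerSeries.C (c i) * 𝐯

theorem constantCoeff_lineVar (c : Fin n → Ch) (t : Option (Fin n)) :
    MvPowerSeries.constantCoeff (lineVar c t) = 0 := by
  cases t <;> simp [lineVar]

theorem two_monomial (p q : ℕ) : 𝐮 ^ p * 𝐯 ^ q = MvPowerSeries.monomial (ex p q) 1 := by
  rw [MvPowerSeries.X_pow_eq, MvPowerSeries.X_pow_eq, MvPowerSeries.monomial_mul_monomial, one_mul]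
  rfl

theorem wpow_lineVar (c : Fin n → Ch) (e : Option (Fin n) →₀ ℕ) : wpow (lineVar c) e =
    MvPowerSeries.C (∏ i, c i ^ e (some i)) *
      MvPowerSeries.monomial (ex (e none) (∑ i, e (some i))) 1 := by
  rw [wpow, Fintype.prod_option, ← two_monomial]
  simp only [lineVar, Option.elim, mul_pow, Finset.prod_mul_distrib, Finset.prod_pow_eq_pow_sum,
    map_prod, map_pow]
  ring

theorem wpow_evPt (d : Fin n →₀ ℕ) : wpow evPt d =
    MvPowerSeries.C (∏ i : Fin n, (-((i : ℕ) : Ch)) ^ d i) * 𝐱 ^ (∑ i, d i) := by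
  rw [wpow]
  simp only [evPt, mul_pow, Finset.prod_mul_distrib, Finset.prod_pow_eq_pow_sum,
    map_prod, map_pow]

/-- Substituting `u_i = c_i v` in the coefficients of `z^{-k}`. -/
theorem coeff_substHom_lineVar (f : MvPowerSeries (Option (Fin n)) A) (k j : ℕ) :
    MvPowerSeries.coeff (ex k j) (substHom (lineVar fun i : Fin n => -((i : ℕ) : Ch))
        (constantCoeff_lineVar _) f) =
      ∑ d ∈ expo (Fin n) j, MvPowerSeries.coeff (Finsupp.single () j) (wpow evPt d) •
        MvPowerSeries.coeff (d.optionElim k) f := by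
  classical
  rw [substHom_apply, coeff_substFun (constantCoeff_lineVar _) f _ (k + j) (by simp [ex])]
  symm
  refine Finset.sum_of_injOn (fun d => d.optionElim k) ?_ ?_ ?_ ?_
  · intro d _ d' _ h
    have h1 := congrArg Finsupp.some h
    simpa using h1
  · intro d hd
    rw [Finset.mem_coe, mem_expo] at hd ⊢
    rw [Finsupp.degree_eq_sum, Fintype.sum_option] at *
    simp only [Finsupp.optionElim_apply_none, Finsupp.optionElim_apply_some]
    omega
  · intro e _ he
    rw [wpow_lineVar, coeff_monomial_smul, if_neg]
    intro h
    rw [ex_inj] at h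
    refine he ⟨e.some, ?_, ?_⟩
    · rw [Finset.mem_coe, mem_expo, Finsupp.degree_eq_sum]
      exact h.2.ge
    · rw [h.1]
      ext t
      cases t <;> simp
  · intro d _
    rw [wpow_lineVar, coeff_monomial_smul, wpow_evPt, coeff_unit_mul_pow]
    simp only [Finsupp.optionElim_apply_none, Finsupp.optionElim_apply_some, ex_inj, true_and]
    by_cases h : j = ∑ i, d i
    · rw [if_pos h.symm, if_pos h]
    · rw [if_neg (Ne.symm h), if_neg h, zero_smul]

theorem wpow_two {σ : Type*} (v : Fin 2 → MvPowerSeries σ Ch) (e : Fin 2 →₀ ℕ) :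
    wpow v e = v 0 ^ e 0 * v 1 ^ e 1 := by
  rw [wpow, Fin.prod_univ_two]

theorem constantCoeff_first_mul (t : Fin 2) :
    MvPowerSeries.constantCoeff (![𝐮, 𝐮 * 𝐯] t) = 0 := by
  fin_cases t <;> simp

theorem constantCoeff_var_h (t : Fin 2) :
    MvPowerSeries.constantCoeff (![𝐱, hC Ch * 𝐱] t) = 0 := by
  fin_cases t <;> simp

theorem coeff_substHom_first_mul (f : MvPowerSeries (Fin 2) A) (k j : ℕ) :
    MvPowerSeries.coeff (ex k j) (substHom ![𝐮, 𝐮 * 𝐯] constantCoeff_first_mul f) =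
      if j ≤ k then MvPowerSeries.coeff (ex (k - j) j) f else 0 := by
  classical
  have hw : ∀ e : Fin 2 →₀ ℕ, wpow ![𝐮, 𝐮 * 𝐯] e = MvPowerSeries.C 1 *
      MvPowerSeries.monomial (ex (e 0 + e 1) (e 1)) 1 := by
    intro e
    rw [wpow_two, ← two_monomial, map_one MvPowerSeries.C]
    change 𝐮 ^ e 0 * (𝐮 * 𝐯) ^ e 1 = _
    ring
  have hz : ∀ e : Fin 2 →₀ ℕ, ex k j = ex (e 0 + e 1) (e 1) → j ≤ k ∧ e = ex (k - j) j := by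
    intro e h
    rw [ex_inj] at h
    refine ⟨by omega, ?_⟩
    rw [eq_ex e, ex_inj]
    omega
  rw [substHom_apply]
  split_ifs with hj
  · rw [coeff_substFun_eq_single constantCoeff_first_mul f _ (ex (k - j) j), hw,
      coeff_monomial_smul, if_pos, one_smul]
    · rw [ex_zero, ex_one, Nat.sub_add_cancel hj]
    · intro e he
      rw [hw, coeff_monomial_smul, if_neg fun h => he (hz e h).2]
  · rw [coeff_substFun constantCoeff_first_mul f _ _ le_rfl]
    refine Finset.sum_eq_zero fun e _ => ?_
    rw [hw, coeff_monomial_smul, if_neg fun h => hj (hz e h).1]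

theorem coeff_substHom_var_h (f : MvPowerSeries (Fin 2) A) (k : ℕ) :
    MvPowerSeries.coeff (Finsupp.single () k) (substHom ![𝐱, hC Ch * 𝐱] constantCoeff_var_h f) =
      ∑ j ∈ Finset.range (k + 1), hbar ^ j • MvPowerSeries.coeff (ex (k - j) j) f := by
  classical
  have hw : ∀ e : Fin 2 →₀ ℕ, wpow ![𝐱, hC Ch * 𝐱] e =
      MvPowerSeries.C (hbar ^ e 1) * 𝐱 ^ (e 0 + e 1) := by
    intro e
    rw [wpow_two]
    change 𝐱 ^ e 0 * (hC Ch * 𝐱) ^ e 1 = _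
    rw [mul_pow, hC, ← map_pow, pow_add]
    exact mul_left_comm _ _ _
  rw [substHom_apply, coeff_substFun constantCoeff_var_h f _ k (by simp)]
  symm
  refine Finset.sum_of_injOn (fun j => ex (k - j) j) ?_ ?_ ?_ ?_
  · intro j _ j' _ h
    exact (ex_inj.1 h).2
  · intro j hj
    rw [Finset.mem_coe, Finset.mem_range] at hj
    rw [Finset.mem_coe, mem_expo, Finsupp.degree_eq_sum, Fin.sum_univ_two, ex_zero, ex_one]
    omega
  · intro e _ he
    rw [hw, coeff_unit_mul_pow, if_neg, zero_smul]
    intro h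
    refine he ⟨e 1, ?_, ?_⟩
    · rw [Finset.mem_coe, Finset.mem_range]
      omega
    · change ex (k - e 1) (e 1) = e
      rw [eq_ex e, ex_inj, ex_one]
      omega
  · intro j hj
    rw [Finset.mem_range] at hj
    rw [hw, coeff_unit_mul_pow, ex_zero, ex_one, if_pos (by omega)]

/-- The series `α u / (1 + c v)`. -/
def ratio (α c : Ch) : MvPowerSeries (Fin 2) Ch :=
  MvPowerSeries.C α * 𝐮 * MvPowerSeries.invOfUnit (1 + MvPowerSeries.C c * 𝐯) 1

theorem constantCoeff_ratio (α c : Ch) : MvPowerSeries.constantCoeff (ratio α c) = 0 := by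
  simp [ratio]

theorem substHom_ratio {σ : Type*} {v : Fin 2 → MvPowerSeries σ Ch}
    (hv : ∀ t, MvPowerSeries.constantCoeff (v t) = 0) (α c : Ch) {t : MvPowerSeries σ Ch}
    (ht : MvPowerSeries.C α * v 0 * t = MvPowerSeries.C c * v 1) :
    substHom v hv (ratio α c) = linInv (MvPowerSeries.C α * v 0) t := by
  refine eq_linInv (by rw [map_mul, hv, mul_zero]) ?_
  have h : ratio α c * (1 + MvPowerSeries.C c * 𝐯) = MvPowerSeries.C α * 𝐮 := by
    rw [ratio, mul_assoc, MvPowerSeries.invOfUnit_mul _ _ (by simp), mul_one]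
  have h' := congrArg (substHom v hv : MvPowerSeries (Fin 2) Ch →+* MvPowerSeries σ Ch) h
  rw [map_mul, map_add, map_one, map_mul, map_mul, substHom_X', substHom_X',
    (substHom_C hv _ : substHom v hv (MvPowerSeries.C c : MvPowerSeries (Fin 2) Ch) = _),
    (substHom_C hv _ : substHom v hv (MvPowerSeries.C α : MvPowerSeries (Fin 2) Ch) = _)] at h'
  rw [ht]
  exact h'

/-- `1/(z - ih)` as a series in `z⁻¹`. -/
def fusZ (i : Fin n) : MvPowerSeries Unit Ch :=
  linInv 𝐱 (MvPowerSeries.C (-((i : ℕ) : Ch)) * hC Ch)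

/-- `1/(2z - ih - jh)` as a series in `z⁻¹`. -/
def fusZZ (i j : Fin n) : MvPowerSeries Unit Ch :=
  linInv (MvPowerSeries.C (PowerSeries.C (1 / 2 : ℂ)) * 𝐱)
    (MvPowerSeries.C (-((i : ℕ) : Ch)) * hC Ch + MvPowerSeries.C (-((j : ℕ) : Ch)) * hC Ch)

/-- The evaluation of `B_{[n]}(u|z)` at `u_i = - i h`. This is legitimate since the coefficients of
`z^{-k}` are polynomials in `u` of degree at most `k`. -/
theorem sum_coeff_eval (n k l : ℕ) (a b : Fin n → Fin N) :
    ∑ j ∈ Finset.range (k + 1 + l), hbar ^ j • ∑ d ∈ expo (Fin n) j,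
      MvPowerSeries.coeff (Finsupp.single () j) (wpow evPt d) •
        MvPowerSeries.coeff (d.optionElim k) (bProdD N n invZ invZZ a b) =
      PowerSeries.coeff k (bProdD N n fusZ fusZZ a b : MvPowerSeries Unit (DY N)) := by
  let c : Fin n → Ch := fun i => -((i : ℕ) : Ch)
  let H : Ten N n (MvPowerSeries (Fin 2) (DY N)) := bProdD N n (fun i => ratio 1 (c i))
    fun i j => ratio (PowerSeries.C (1 / 2 : ℂ)) (PowerSeries.C (1 / 2 : ℂ) * (c i + c j))
  have hX : MvPowerSeries.constantCoeff
      (MvPowerSeries.X none : MvPowerSeries (Option (Fin n)) Ch) = 0 :=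
    MvPowerSeries.constantCoeff_X _
  have hX' : MvPowerSeries.constantCoeff (MvPowerSeries.C (PowerSeries.C (1 / 2 : ℂ)) *
      (MvPowerSeries.X none : MvPowerSeries (Option (Fin n)) Ch)) = 0 := by
    rw [map_mul, hX, mul_zero]
  have h1 : (bProdD N n invZ invZZ).map (substHom (lineVar c) (constantCoeff_lineVar c)) =
      H.map (substHom ![𝐮, 𝐮 * 𝐯] constantCoeff_first_mul) := by
    rw [bProdD_subst (w := invZ) (w' := invZZ) _ (fun i => constantCoeff_linInv hX)
      fun i j => constantCoeff_linInv hX',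
      bProdD_subst _ (fun i => constantCoeff_ratio _ _)
        fun i j => constantCoeff_ratio _ _]
    congr 1
    · funext i
      refine (substHom_linInv (constantCoeff_lineVar c) hX).trans ?_
      rw [substHom_X', substHom_X', substHom_ratio (t := MvPowerSeries.C (c i) * 𝐯)]
      · simp [lineVar]
      · simp
        ring
    · funext i j
      refine (substHom_linInv (constantCoeff_lineVar c) hX').trans ?_
      rw [map_add, map_mul, substHom_X', substHom_X', substHom_X',
        (substHom_C _ _ : substHom _ (constantCoeff_lineVar c)
          (MvPowerSeries.C (PowerSeries.C (1 / 2 : ℂ)) : MvPowerSeries (Option (Fin n)) Ch) = _),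
        substHom_ratio (t := MvPowerSeries.C (c i) * 𝐯 + MvPowerSeries.C (c j) * 𝐯)]
      · simp [lineVar]
      · simp
        ring
  have h2 : bProdD N n fusZ fusZZ = H.map (substHom ![𝐱, hC Ch * 𝐱] constantCoeff_var_h) := by
    rw [bProdD_subst _ (fun i => constantCoeff_ratio _ _) fun i j => constantCoeff_ratio _ _]
    congr 1
    · funext i
      rw [substHom_ratio (t := MvPowerSeries.C (c i) * hC Ch)]
      · simp [fusZ, c]
      · simp
        ring
    · funext i j
      rw [substHom_ratio (t := MvPowerSeries.C (c i) * hC Ch + MvPowerSeries.C (c j) * hC Ch)]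
      · simp [fusZZ, c]
      · simp
        ring
  have e : ∀ j, ∑ d ∈ expo (Fin n) j,
      MvPowerSeries.coeff (Finsupp.single () j) (wpow evPt d) •
        MvPowerSeries.coeff (d.optionElim k) (bProdD N n invZ invZZ a b) =
      if j ≤ k then MvPowerSeries.coeff (ex (k - j) j) (H a b) else 0 := by
    intro j
    rw [← coeff_substHom_first_mul, ← coeff_substHom_lineVar]
    exact congrArg (MvPowerSeries.coeff (ex k j)) (congrFun (congrFun h1 a) b)
  have h3 := congrArg (MvPowerSeries.coeff (Finsupp.single () k)) (congrFun (congrFun h2 a) b)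
  refine Eq.trans ?_ h3.symm
  refine Eq.trans ?_ (coeff_substHom_var_h (H a b) k).symm
  rw [Finset.sum_range_add, Finset.sum_eq_zero (s := Finset.range l), add_zero]
  · refine Finset.sum_congr rfl fun j hj => ?_
    rw [e, if_pos (by rw [Finset.mem_range] at hj; omega)]
  · intro j _
    rw [e, if_neg (by omega), smul_zero]

/-- The image of the fused element under the module map. -/
theorem moduleMap_fused {Y : vacLattice N →ₗ[Ch] PowerSeries (reflAlg N)} (hY : IsModuleMap Y)
    (n k : ℕ) : ((PowerSeries.coeff k (Y ⟨fused N n, fused_mem N n⟩) : reflAlg N) : DY N) =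
      ∑ a, ∑ b, antiCoeff N n a b •
        PowerSeries.coeff k (bProdD N n fusZ fusZZ b a : MvPowerSeries Unit (DY N)) := by
  let L : vacLattice N →ₗ[Ch] DY N := (reflAlg N).val.toLinearMap.comp
    ((seriesCoeff (reflAlg N) k).comp Y)
  have hL : ∀ a b d, L (TplusVac N n a b d) =
      MvPowerSeries.coeff (d.optionElim k) (bProdD N n invZ invZZ a b) := by
    intro a b d
    rw [← Bprod_map]
    exact congrArg Subtype.val (hY n a b d k)
  refine HTF.dy.eq_of_congr fun l => ?_
  obtain ⟨w, hw⟩ := map_vacLattice_congr L (fusedTerm_mem_span (N := N) (n := n)) (fused_eq n)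
    (k + 1 + l)
  refine ⟨hbar ^ (k + 1) • w, hw.trans ?_⟩
  rw [smul_smul, ← pow_add, add_comm l]
  congr 1
  simp only [← sum_coeff_eval n k l]
  have hT : ∀ j, L ⟨fusedTerm N n j, span_le_vacLattice N (fusedTerm_mem_span j)⟩ =
      ∑ a, ∑ b, antiCoeff N n a b • ∑ d ∈ expo (Fin n) j,
        MvPowerSeries.coeff (Finsupp.single () j) (wpow evPt d) •
          MvPowerSeries.coeff (d.optionElim k) (bProdD N n invZ invZZ b a) := by
    intro j
    change L (fusedTerm N n j) = _
    simp only [fusedTerm, map_sum, map_smul, hL]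
  simp only [hT, Finset.smul_sum]
  refine Eq.symm ?_
  refine Eq.trans (Finset.sum_congr rfl fun a _ => ?_) Finset.sum_comm
  refine Eq.trans (Finset.sum_congr rfl fun b _ => ?_) Finset.sum_comm
  exact Finset.sum_congr rfl fun j _ => Finset.sum_congr rfl fun d _ => smul_comm _ _ _

end TwoVars

/-! ### Commutativity of the trace of `B` -/

section TraceB

variable {N : ℕ}

theorem site_rm_site' {S R : Type*} [CommRing S] [Ring R] [Algebra S R]
    (M T : Matrix (Fin N) (Fin N) R) (α β : S) (a b : Fin 2 → Fin N) :
    (site 0 M * rm α β 0 1 * site 1 T : Ten N 2 R) a b =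
      α • (M (a 0) (b 0) * T (a 1) (b 1)) -
        β • if a 1 = b 0 then ∑ c, M (a 0) c * T c (b 1) else 0 := by
  have h := site_rm_site M T (1 : S) α β a b
  rwa [one_smul, one_smul] at h

theorem site_rm_site_swap {S R : Type*} [CommRing S] [Ring R] [Algebra S R]
    (M T : Matrix (Fin N) (Fin N) R) (α β : S) (a b : Fin 2 → Fin N) :
    (site 1 M * rm α β 0 1 * site 0 T : Ten N 2 R) a b =
      α • (M (a 1) (b 1) * T (a 0) (b 0)) -
        β • if a 0 = b 1 then ∑ c, M (a 1) c * T c (b 0) else 0 := by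
  have hr : (perm 0 1 * rm α β 0 1 : Ten N 2 R) = rm α β 0 1 * perm 0 1 := by
    simp only [rm, mul_sub, sub_mul, mul_smul_comm, smul_mul_assoc, mul_one, one_mul]
  have e : (site 1 M * rm α β 0 1 * site 0 T : Ten N 2 R) =
      perm 0 1 * (site 0 M * rm α β 0 1 * site 1 T) * perm 0 1 := by
    have h2 := perm_mul_self (N := N) (R := R) (0 : Fin 2) 1
    calc (site 1 M * rm α β 0 1 * site 0 T : Ten N 2 R)
        = site 1 M * (rm α β 0 1 * perm 0 1) * (perm 0 1 * site 0 T) := by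
          rw [mul_assoc, mul_assoc (site 1 M), mul_assoc (rm α β 0 1), ← mul_assoc (perm 0 1), h2,
            one_mul]
      _ = (site 1 M * perm 0 1) * rm α β 0 1 * (perm 0 1 * site 0 T) := by
          rw [← hr]; simp only [mul_assoc]
      _ = _ := by
          rw [perm_site_left, ← perm_site_left]; simp only [mul_assoc]
  rw [e, perm_eq, mul_permOp_apply, permOp_mul_apply, Equiv.symm_swap, site_rm_site']
  simp

variable {σ : Type*}

/-- The trace of `B(1/w)`. -/
def trB (N : ℕ) (w : MvPowerSeries σ Ch) : MvPowerSeries σ (DY N) := ∑ i, mser (bD N) w i i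

theorem trace_relations {S M : Type*} [CommRing S] [AddCommGroup M] [Module S M] {α β δ n : S}
    {U U' V V' : M}
    (h1 : α • (δ • U - β • V) - β • (δ • V - β • n • V) =
      α • (δ • U' - β • V') - β • (δ • V' - β • n • V'))
    (h2 : α • (δ • V - β • n • V) - β • (δ • U - β • V) =
      α • (δ • V' - β • n • V') - β • (δ • U' - β • V')) :
    ((α + β) * (α - β) * (δ - n * β)) • (V - V') = 0 ∧
      δ • α • (U - U') = (β * (α + δ - n * β)) • (V - V') := by
  rw [← sub_eq_zero] at h1 h2
  constructor
  · have e := congrArg₂ (fun x y => α • y + β • x) h1 h2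
    simp only [smul_zero, add_zero] at e
    rw [← e]
    module
  · rw [← sub_eq_zero, ← h1]
    module

theorem sum_sum_ite {M : Type*} [AddCommMonoid M] (f : Fin N → Fin N → M) :
    (∑ x, ∑ y, if x = y then f x y else 0) =
      ∑ x, f x x := by
  refine Finset.sum_congr rfl fun x _ => ?_
  rw [Finset.sum_eq_single x]
  · exact if_pos rfl
  · exact fun y _ hy => if_neg hy.symm
  · simp

theorem trB_comm : trB N 𝐮 * trB N 𝐯 = trB N 𝐯 * trB N 𝐮 := by
  have hD : HTF (DY N) := HTF.dy
  set α : MvPowerSeries (Fin 2) Ch := 𝐯 - 𝐮 with hα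
  set β : MvPowerSeries (Fin 2) Ch := hC Ch * 𝐮 * 𝐯 with hβ
  set δ : MvPowerSeries (Fin 2) Ch := 𝐮 + 𝐯 with hδ
  set B : Matrix (Fin N) (Fin N) (MvPowerSeries (Fin 2) (DY N)) := mser (bD N) 𝐮 with hB
  set B' : Matrix (Fin N) (Fin N) (MvPowerSeries (Fin 2) (DY N)) := mser (bD N) 𝐯 with hB'
  set V : MvPowerSeries (Fin 2) (DY N) := ∑ i, ∑ j, B i j * B' j i with hV
  set V' : MvPowerSeries (Fin 2) (DY N) := ∑ i, ∑ j, B' i j * B j i with hV'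
  have hU : trB N 𝐮 * trB N 𝐯 = ∑ i, ∑ j, B i i * B' j j := Finset.sum_mul_sum _ _ _ _
  have hU' : trB N 𝐯 * trB N 𝐮 = ∑ i, ∑ j, B' j j * B i i :=
    (Finset.sum_mul_sum _ _ _ _).trans Finset.sum_comm
  have hVs : ∑ i, ∑ j, B j i * B' i j = V := Finset.sum_comm
  have hVs' : ∑ i, ∑ j, B' j i * B i j = V' := Finset.sum_comm
  have key : ∀ a b : Fin 2 → Fin N,
      α • (δ • (B (a 0) (b 0) * B' (a 1) (b 1)) -
          β • if a 1 = b 0 then ∑ c, B (a 0) c * B' c (b 1) else 0) -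
        β • (δ • (B (a 1) (b 0) * B' (a 0) (b 1)) -
          β • if a 0 = b 0 then ∑ c, B (a 1) c * B' c (b 1) else 0) =
      α • (δ • (B' (a 1) (b 1) * B (a 0) (b 0)) -
          β • if a 0 = b 1 then ∑ c, B' (a 1) c * B c (b 0) else 0) -
        β • (δ • (B' (a 1) (b 0) * B (a 0) (b 1)) -
          β • if a 0 = b 0 then ∑ c, B' (a 1) c * B c (b 1) else 0) := by
    intro a b
    have h := congrFun (congrFun (bD_site (N := N) (i := (0 : Fin 2)) (j := 1) (by decide)
      (MvPowerSeries.constantCoeff_X (0 : Fin 2)) (MvPowerSeries.constantCoeff_X (1 : Fin 2))) a) b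
    rw [mul_assoc, mul_assoc, ← mul_assoc (site 0 _), rm_mul_apply, mul_rm_apply, site_rm_site',
      site_rm_site', site_rm_site_swap, site_rm_site_swap] at h
    simpa using h
  -- Summing the diagonal entries of the reflection equation, and the entries which the flip makes
  -- diagonal, gives two linear relations between `tr B tr B'`, `tr B B'` and their opposites.
  have k1 : ∀ i j : Fin N,
      α • (δ • (B i i * B' j j) - β • if i = j then ∑ c, B i c * B' c j else 0) -
        β • (δ • (B j i * B' i j) - β • ∑ c, B j c * B' c j) =
      α • (δ • (B' j j * B i i) - β • if i = j then ∑ c, B' j c * B c i else 0) -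
        β • (δ • (B' j i * B i j) - β • ∑ c, B' j c * B c j) := by
    intro i j
    have h := key ![i, j] ![i, j]
    simp only [Matrix.cons_val_zero, Matrix.cons_val_one, if_true] at h
    by_cases hij : i = j
    · simpa [hij] using h
    · simpa [hij, Ne.symm hij] using h
  have k2 : ∀ i j : Fin N,
      α • (δ • (B i j * B' j i) - β • ∑ c, B i c * B' c i) -
        β • (δ • (B j j * B' i i) - β • if i = j then ∑ c, B j c * B' c i else 0) =
      α • (δ • (B' j i * B i j) - β • ∑ c, B' j c * B c j) -
        β • (δ • (B' j j * B i i) - β • if i = j then ∑ c, B' j c * B c i else 0) := by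
    intro i j
    have h := key ![i, j] ![j, i]
    simp only [Matrix.cons_val_zero, Matrix.cons_val_one, if_true] at h
    by_cases hij : i = j
    · simpa [hij] using h
    · simpa [hij, Ne.symm hij] using h
  have h1 := Finset.sum_congr (rfl : (Finset.univ : Finset (Fin N)) = Finset.univ) fun i _ =>
    Finset.sum_congr (rfl : (Finset.univ : Finset (Fin N)) = Finset.univ) fun j _ => k1 i j
  have h2 := Finset.sum_congr (rfl : (Finset.univ : Finset (Fin N)) = Finset.univ) fun i _ =>
    Finset.sum_congr (rfl : (Finset.univ : Finset (Fin N)) = Finset.univ) fun j _ => k2 i j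
  have hU2 : ∑ i, ∑ j, B j j * B' i i = trB N 𝐮 * trB N 𝐯 := Finset.sum_comm.trans hU.symm
  simp only [Finset.sum_sub_distrib, ← Finset.smul_sum, sum_sum_ite, ← hV, ← hV', ← hU, ← hU', hU2,
    hVs, hVs', Finset.sum_const, Finset.card_univ, Fintype.card_fin,
    ← Nat.cast_smul_eq_nsmul (MvPowerSeries (Fin 2) Ch)] at h1 h2
  set n : MvPowerSeries (Fin 2) Ch := (N : MvPowerSeries (Fin 2) Ch) with hn
  obtain ⟨h3, h4⟩ := trace_relations h1 h2
  have h01 : (0 : Fin 2) ≠ 1 := by decide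
  have hX : ∀ (c c' : Ch), c' * c = 1 → ∀ v : MvPowerSeries (Fin 2) Ch,
      NonTorsion (DY N) (𝐮 * v + MvPowerSeries.C c * 𝐯) := fun c c' hc v =>
    NonTorsion.X_add h01 v hc
  -- The coefficients of the resulting relations are not zero divisors.
  have n1 : NonTorsion (DY N) (α + β) := by
    have := hX 1 1 (mul_one 1) (hC Ch * 𝐯 - 1)
    rwa [map_one, one_mul, show 𝐮 * (hC Ch * 𝐯 - 1) + 𝐯 = α + β by rw [hα, hβ]; ring] at this
  have n2 : NonTorsion (DY N) (α - β) := by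
    have := hX 1 1 (mul_one 1) (-(hC Ch * 𝐯) - 1)
    rwa [map_one, one_mul, show 𝐮 * (-(hC Ch * 𝐯) - 1) + 𝐯 = α - β by rw [hα, hβ]; ring] at this
  have n3 : NonTorsion (DY N) (δ - n * β) := by
    have := hX 1 1 (mul_one 1) (1 - n * (hC Ch * 𝐯))
    rwa [map_one, one_mul, show 𝐮 * (1 - n * (hC Ch * 𝐯)) + 𝐯 = δ - n * β by
      rw [hδ, hβ]; ring] at this
  have n4 : NonTorsion (DY N) δ := by
    have := hX 1 1 (mul_one 1) 1
    rwa [map_one, one_mul, mul_one] at this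
  have n5 : NonTorsion (DY N) α := by
    have := hX 1 1 (mul_one 1) (-1)
    rwa [map_one, one_mul, show 𝐮 * -1 + 𝐯 = α by rw [hα]; ring] at this
  have hVV : V - V' = 0 := ((n1.mul n2).mul n3) _ h3
  rw [hVV, smul_zero] at h4
  exact sub_eq_zero.1 (n5 _ (n4 _ h4))

theorem trace_bD_comm (k l : ℕ) :
    (∑ i, bD N k i i) * (∑ i, bD N l i i) = (∑ i, bD N l i i) * ∑ i, bD N k i i := by
  have e : ∀ w : MvPowerSeries (Fin 2) Ch, trB N w = subs (fun r => ∑ i, bD N r i i) w := by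
    intro w
    refine MvPowerSeries.ext fun d => ?_
    rw [trB, map_sum]
    change ∑ i, ∑ r ∈ Finset.range (d.degree + 1), MvPowerSeries.coeff d (w ^ r) • bD N r i i =
      ∑ r ∈ Finset.range (d.degree + 1), MvPowerSeries.coeff d (w ^ r) • ∑ i, bD N r i i
    rw [Finset.sum_comm]
    simp only [Finset.smul_sum]
  have h := congrArg (MvPowerSeries.coeff (ex k l)) (trB_comm (N := N))
  rwa [e, e, coeff_subs_mul_subs, coeff_subs_second_mul_subs] at h

end TraceB

/-! ### The anti-symmetrizer -/

section Antisym

variable {N n : ℕ} {R : Type*} [Ring R]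

theorem add_self_eq_zero' {M : Type*} [AddCommGroup M] [Module Ch M] {x : M} (h : x + x = 0) :
    x = 0 := by
  have h2 : (2 : Ch) * PowerSeries.C (1 / 2 : ℂ) = 1 := by
    rw [show (2 : Ch) = PowerSeries.C (2 : ℂ) from (map_ofNat _ 2).symm, ← map_mul]
    norm_num
  rw [← two_smul Ch x] at h
  rw [← one_smul Ch x, ← h2, mul_comm, mul_smul, h, smul_zero]

/-- The totally antisymmetric symbol. -/
def levi (b : Fin n → Fin n) : ℤ :=
  open scoped Classical in
  if h : Function.Bijective b then (Equiv.Perm.sign (Equiv.ofBijective b h) : ℤ) else 0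

theorem eq_levi_smul {M : Type*} [AddCommGroup M] [Module Ch M] {f : (Fin n → Fin n) → M}
    (hf : ∀ b (p : Equiv.Perm (Fin n)), f (b ∘ p) = (Equiv.Perm.sign p : ℤ) • f b)
    (b : Fin n → Fin n) : f b = levi b • f id := by
  classical
  rw [levi]
  split_ifs with h
  · exact hf id (Equiv.ofBijective b h)
  · rw [zero_smul]
    have h' : ¬ Function.Injective b := fun hi => h (Finite.injective_iff_bijective.1 hi)
    obtain ⟨i, j, hij, hne⟩ := Function.not_injective_iff.1 h'
    have hb : b ∘ Equiv.swap i j = b := by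
      funext k
      rw [Function.comp, Equiv.swap_apply_def]
      split_ifs with h1 h2
      · rw [h1, hij]
      · rw [h2, hij]
      · rfl
    have h2 := hf b (Equiv.swap i j)
    rw [hb, Equiv.Perm.sign_swap hne] at h2
    simp only [Units.val_neg, Units.val_one, neg_smul, one_smul] at h2
    exact add_self_eq_zero' (eq_neg_iff_add_eq_zero.1 h2)

theorem antisym_apply [Algebra Ch R] (a b : Fin n → Fin N) :
    antisym N n R a b = algebraMap Ch R (antiCoeff N n a b) := rfl

theorem antiCoeff_comp_right (a b : Fin n → Fin N) (p : Equiv.Perm (Fin n)) :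
    antiCoeff N n a (b ∘ p) = (Equiv.Perm.sign p : ℤ) • antiCoeff N n a b := by
  rw [antiCoeff, antiCoeff, ← mul_smul_comm]
  congr 1
  rw [Finset.smul_sum]
  refine Fintype.sum_equiv (Equiv.mulLeft p) _ _ fun q => ?_
  rw [Equiv.coe_mulLeft, Equiv.Perm.sign_mul]
  change (if a = b ∘ (p * q) then _ else _) = _
  split_ifs
  · rw [← Int.cast_smul_eq_zsmul Ch, smul_eq_mul]
    push_cast
    rw [← mul_assoc, ← Int.cast_mul, ← Units.val_mul, Int.units_mul_self]
    simp
  · simp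

theorem antiCoeff_comp_left (a b : Fin n → Fin N) (p : Equiv.Perm (Fin n)) :
    antiCoeff N n (a ∘ p) b = (Equiv.Perm.sign p : ℤ) • antiCoeff N n a b := by
  rw [antiCoeff, antiCoeff, ← mul_smul_comm]
  congr 1
  rw [Finset.smul_sum]
  refine Fintype.sum_equiv (Equiv.mulRight p⁻¹) _ _ fun q => ?_
  rw [Equiv.coe_mulRight, Equiv.Perm.sign_mul, Equiv.Perm.sign_inv]
  have h : a ∘ p = b ∘ q ↔ a = b ∘ (q * p⁻¹ : Equiv.Perm (Fin n)) := by
    constructor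
    · intro h
      funext k
      have := congrFun h (p⁻¹ k)
      simpa using this
    · rintro rfl
      funext k
      simp
  rw [if_congr h rfl rfl]
  split_ifs
  · rw [← Int.cast_smul_eq_zsmul Ch, smul_eq_mul]
    push_cast
    rw [mul_comm, mul_assoc, ← Int.cast_mul, ← Units.val_mul, Int.units_mul_self]
    simp
  · simp

theorem antisym_mul_perm [Algebra Ch R] {i j : Fin n} (hij : i ≠ j) :
    (antisym N n R * perm i j : Ten N n R) = -antisym N n R := by
  ext a b
  rw [perm_eq, mul_permOp_apply, Matrix.neg_apply, antisym_apply, antisym_apply,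
    antiCoeff_comp_right, Equiv.Perm.sign_swap hij]
  simp

theorem antiCoeff_id (N : ℕ) : antiCoeff N N id id = PowerSeries.C ((N.factorial : ℂ)⁻¹) := by
  rw [antiCoeff, Finset.sum_eq_single 1]
  · simp
  · intro p _ hp
    rw [if_neg]
    intro h
    exact hp (Equiv.ext fun k => (congrFun h k).symm)
  · simp

/-- The space of antisymmetric tensors in `(ℂ^N)^{⊗N}` is one-dimensional. -/
theorem eq_mul_antisym [Algebra Ch R] {X Z : Ten N N R} (hZ : Z = antisym N N R * X)
    (h : ∀ (p : Equiv.Perm (Fin N)), Z * permOp p = (Equiv.Perm.sign p : ℤ) • Z)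
    (a b : Fin N → Fin N) :
    Z a b = (PowerSeries.C (N.factorial : ℂ) : Ch) • Z id id * antisym N N R a b := by
  have hcol : ∀ a b, Z a b = levi b • Z a id := fun a b => eq_levi_smul (f := fun b => Z a b)
    (fun b p => by
      have := congrFun (congrFun (h p) a) b
      rwa [mul_permOp_apply] at this) b
  have hrow : ∀ a, Z a id = levi a • Z id id := eq_levi_smul (f := fun a => Z a id) fun a p => by
    rw [hZ, Matrix.mul_apply, Matrix.mul_apply, Finset.smul_sum]
    refine Finset.sum_congr rfl fun c _ => ?_
    rw [antisym_apply, antisym_apply, antiCoeff_comp_left, map_zsmul, smul_mul_assoc]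
  have hE : antiCoeff N N a b = levi b • levi a • PowerSeries.C ((N.factorial : ℂ)⁻¹) := by
    rw [← antiCoeff_id, ← eq_levi_smul (f := fun a => antiCoeff N N a id)
      (fun a p => antiCoeff_comp_left a id p) a]
    exact eq_levi_smul (fun b p => antiCoeff_comp_right a b p) b
  have hN : (N.factorial : ℂ) ≠ 0 := Nat.cast_ne_zero.2 (Nat.factorial_ne_zero N)
  have hz : ∀ z : R, (PowerSeries.C (N.factorial : ℂ)⁻¹ : Ch) •
      (PowerSeries.C (N.factorial : ℂ) : Ch) • z = z := fun z => by
    rw [smul_smul, ← map_mul, inv_mul_cancel₀ hN, map_one, one_smul]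
  rw [antisym_apply, hcol, hrow, hE, map_zsmul, map_zsmul, mul_smul_comm, mul_smul_comm,
    ← Algebra.commutes, ← Algebra.smul_def, hz]

/-- Antisymmetry with respect to adjacent transpositions is antisymmetry. -/
theorem mul_permOp_of_adjacent {m : ℕ} {Z : Ten N (m + 1) R}
    (h : ∀ i : Fin m, Z * perm i.castSucc i.succ = -Z) (p : Equiv.Perm (Fin (m + 1))) :
    Z * permOp p = (Equiv.Perm.sign p : ℤ) • Z := by
  have hp : p ∈ Submonoid.closure
      (Set.range fun i : Fin m => Equiv.swap i.castSucc i.succ) := by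
    rw [Equiv.Perm.mclosure_swap_castSucc_succ]
    trivial
  induction hp using Submonoid.closure_induction with
  | mem p hp =>
    obtain ⟨i, rfl⟩ := hp
    rw [← perm_eq, h, Equiv.Perm.sign_swap (Fin.castSucc_lt_succ).ne]
    simp
  | one => rw [permOp_one, mul_one]; simp
  | mul p q _ _ hp hq =>
    rw [← permOp_mul, ← mul_assoc, hq, smul_mul_assoc, hp, smul_smul, Equiv.Perm.sign_mul,
      Units.val_mul, mul_comm]

theorem fusion_aux [Algebra Ch R] {E P x m m' y : R} (hE : E * P = -E) (hP : P * P = 1) (hx : x * P = P * x)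
    (hy : y * P = P * y) (hm : (1 - P) * m * m' = m' * m * (1 - P)) :
    E * (x * (m * (m' * y))) * P = -(E * (x * (m * (m' * y)))) := by
  rw [eq_neg_iff_add_eq_zero]
  refine add_self_eq_zero' ?_
  have h0 : (1 - P) * (1 + P) = 0 := by rw [sub_mul, one_mul, mul_add, mul_one, hP]; abel
  have h1 : E + E = E * (1 - P) := by rw [mul_sub, hE]; simp
  have h2 : (1 - P) * x = x * (1 - P) := by rw [sub_mul, mul_sub, hx]; simp
  have h3 : y * (1 + P) = (1 + P) * y := by rw [add_mul, mul_add, hy]; simp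
  have h4 : E * (x * (m * (m' * y))) * P + E * (x * (m * (m' * y))) =
      E * (x * (m * (m' * (y * (1 + P))))) := by
    simp only [mul_add, mul_one, mul_assoc]
    abel
  rw [h4, ← add_mul, h1, h3]
  calc E * (1 - P) * (x * (m * (m' * ((1 + P) * y))))
      = E * ((1 - P) * x) * m * m' * (1 + P) * y := by simp only [mul_assoc]
    _ = E * x * ((1 - P) * m * m') * (1 + P) * y := by rw [h2]; simp only [mul_assoc]
    _ = E * x * m' * m * ((1 - P) * (1 + P)) * y := by rw [hm]; simp only [mul_assoc]
    _ = 0 := by rw [h0, mul_zero, zero_mul]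

theorem finRange_split {m : ℕ} (i : Fin m) : ∃ l₁ l₂ : List (Fin (m + 1)),
    List.finRange (m + 1) = l₁ ++ i.castSucc :: i.succ :: l₂ := by
  refine ⟨(List.finRange (m + 1)).take i, (List.finRange (m + 1)).drop (i + 1 + 1), ?_⟩
  have h1 : (i : ℕ) < (List.finRange (m + 1)).length := by
    rw [List.length_finRange]
    omega
  have h2 : (i : ℕ) + 1 < (List.finRange (m + 1)).length := by
    rw [List.length_finRange]
    omega
  conv_lhs => rw [← List.take_append_drop i (List.finRange (m + 1)),
    List.drop_eq_getElem_cons h1, List.drop_eq_getElem_cons h2]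
  simp only [List.getElem_finRange]
  rfl

/-- The fusion procedure: the anti-symmetrizer divides the product from the right. -/
theorem antisym_mul_prod [Algebra Ch R] {M : Fin N → Ten N N R}
    (hM : ∀ i j k, k ≠ i → k ≠ j → perm i j * M k = M k * perm i j)
    (hadj : ∀ i j : Fin N, (j : ℕ) = i + 1 → (1 - perm i j) * M i * M j = M j * M i * (1 - perm i j))
    (a b : Fin N → Fin N) :
    (antisym N N R * ((List.finRange N).map M).prod) a b = (PowerSeries.C (N.factorial : ℂ) : Ch) •
      (antisym N N R * ((List.finRange N).map M).prod) id id * antisym N N R a b := by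
  refine eq_mul_antisym rfl ?_ a b
  cases N with
  | zero =>
    intro p
    rw [Subsingleton.elim p 1, permOp_one, mul_one]
    simp
  | succ m =>
    refine mul_permOp_of_adjacent fun i => ?_
    obtain ⟨l₁, l₂, hl⟩ := finRange_split i
    have hnd := List.nodup_finRange (m + 1)
    rw [hl] at hnd
    rw [List.nodup_append] at hnd
    obtain ⟨-, h2, h3⟩ := hnd
    rw [List.nodup_cons, List.nodup_cons] at h2
    rw [hl, List.map_append, List.prod_append, List.map_cons, List.map_cons, List.prod_cons,
      List.prod_cons]
    refine fusion_aux (antisym_mul_perm (Fin.castSucc_lt_succ).ne) (perm_mul_self _ _) ?_ ?_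
      (hadj _ _ (by simp))
    · exact (mul_prod_comm _ l₁ M fun k hk => hM _ _ k (h3 k hk _ (by simp))
        (h3 k hk _ (by simp))).symm
    · refine (mul_prod_comm _ l₂ M fun k hk => hM _ _ k ?_ ?_).symm
      · rintro rfl
        exact h2.1 (by simp [hk])
      · rintro rfl
        exact h2.2.1 hk

end Antisym

/-! ### Fusion of the ordered products -/

section Split

variable {R I : Type*} [Ring R] {T T' : I → R} {Q : I → I → R}

theorem ordProd_mul_aux (hT : ∀ i j, i ≠ j → T' i * Q i j * T j = T j * Q i j * T' i)
    (hQ : ∀ i j k, k ≠ i → k ≠ j → Q i j * T k = T k * Q i j) (i : I) (l : List I)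
    (hl : l.Nodup) (hi : i ∉ l) :
    T' i * (l.map (Q i)).prod * (l.map T).prod = (l.map T).prod * (l.map (Q i)).prod * T' i := by
  induction l with
  | nil => simp
  | cons j l ih =>
    rw [List.nodup_cons] at hl
    rw [List.mem_cons, not_or] at hi
    have h1 : T j * (l.map (Q i)).prod = (l.map (Q i)).prod * T j :=
      mul_prod_comm _ l _ fun k hk => (hQ i k j (Ne.symm hi.1) fun h => hl.1 (h ▸ hk)).symm
    have h2 : Q i j * (l.map T).prod = (l.map T).prod * Q i j :=
      mul_prod_comm _ l _ fun k hk => hQ i j k (fun h => hi.2 (h ▸ hk)) fun h => hl.1 (h ▸ hk)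
    simp only [List.map_cons, List.prod_cons]
    calc T' i * (Q i j * (l.map (Q i)).prod) * (T j * (l.map T).prod)
        = T' i * Q i j * ((l.map (Q i)).prod * T j) * (l.map T).prod := by simp only [mul_assoc]
      _ = (T' i * Q i j * T j) * ((l.map (Q i)).prod * (l.map T).prod) := by
          rw [← h1]; simp only [mul_assoc]
      _ = T j * Q i j * (T' i * (l.map (Q i)).prod * (l.map T).prod) := by
          rw [hT i j hi.1]; simp only [mul_assoc]
      _ = T j * (Q i j * (l.map T).prod) * (l.map (Q i)).prod * T' i := by
          rw [ih hl.2 hi.2]; simp only [mul_assoc]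
      _ = _ := by rw [h2]; simp only [mul_assoc]

/-- Reordering of a product of factors `T_i T'_i`, which moves all `T` to the left and all `T'` to
the right. -/
theorem ordProd_mul (hT : ∀ i j, i ≠ j → T' i * Q i j * T j = T j * Q i j * T' i)
    (hQ : ∀ i j k, k ≠ i → k ≠ j → Q i j * T k = T k * Q i j)
    (hQ' : ∀ i j k, k ≠ i → k ≠ j → T' k * Q i j = Q i j * T' k) (l : List I) (hl : l.Nodup) :
    ordProd (fun i => T i * T' i) Q l =
      (l.map T).prod * ordProd (fun _ => 1) Q l * (l.map T').prod := by
  induction l with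
  | nil => simp [ordProd]
  | cons i l ih =>
    rw [List.nodup_cons] at hl
    have h1 := ordProd_mul_aux hT hQ i l hl.2 hl.1
    have h2 : T' i * ordProd (fun _ => 1) Q l = ordProd (fun _ => 1) Q l * T' i :=
      mul_ordProd_comm _ l (fun _ _ => by rw [mul_one, one_mul]) fun j hj k hk =>
        hQ' j k i (fun h => hl.1 (h ▸ hj)) fun h => hl.1 (h ▸ hk)
    simp only [ordProd, List.map_cons, List.prod_cons]
    rw [ih hl.2, one_mul]
    calc T i * T' i * (l.map (Q i)).prod *
          ((l.map T).prod * ordProd (fun _ => 1) Q l * (l.map T').prod)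
        = T i * (T' i * (l.map (Q i)).prod * (l.map T).prod) *
            ordProd (fun _ => 1) Q l * (l.map T').prod := by simp only [mul_assoc]
      _ = T i * (l.map T).prod * (l.map (Q i)).prod *
            (T' i * ordProd (fun _ => 1) Q l) * (l.map T').prod := by
          rw [h1]; simp only [mul_assoc]
      _ = _ := by rw [h2]; simp only [mul_assoc]

end Split

section QDet

variable {N n : ℕ} {σ : Type*} {A : Type*} [Ring A] [Algebra Ch A]

theorem antisym_mul_rm {S R : Type*} [CommRing S] [Ring R] [Algebra Ch R] [Algebra S R] {i j : Fin n}
    (hij : i ≠ j) (α β : S) :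
    (antisym N n R * rm α β i j : Ten N n R) = (α + β) • antisym N n R := by
  rw [rm, mul_sub, mul_smul_comm, mul_smul_comm, mul_one, antisym_mul_perm hij, smul_neg,
    sub_neg_eq_add, add_smul]

theorem antisym_mul_list_prod {S R I : Type*} [CommRing S] [Ring R] [Algebra Ch R] [Algebra S R]
    (f : I → Ten N n R) (h : ∀ i, ∃ c : S, antisym N n R * f i = c • antisym N n R) (l : List I) :
    ∃ c : S, antisym N n R * (l.map f).prod = c • antisym N n R := by
  induction l with
  | nil => exact ⟨1, by simp⟩
  | cons i l ih =>
    obtain ⟨c, hc⟩ := h i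
    obtain ⟨d, hd⟩ := ih
    exact ⟨c * d, by rw [List.map_cons, List.prod_cons, ← mul_assoc, hc, smul_mul_assoc, hd,
      smul_smul]⟩

theorem antisym_mul_ordProd {S R : Type*} [CommRing S] [Ring R] [Algebra Ch R] [Algebra S R]
    {Q : Fin n → Fin n → Ten N n R} (hQ : ∀ i j, ∃ c : S, antisym N n R * Q i j = c • antisym N n R)
    (l : List (Fin n)) :
    ∃ c : S, antisym N n R * ordProd (fun _ => 1) Q l = c • antisym N n R := by
  induction l with
  | nil => exact ⟨1, by simp [ordProd]⟩
  | cons i l ih =>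
    obtain ⟨c, hc⟩ := antisym_mul_list_prod (Q i) (hQ i) l
    obtain ⟨d, hd⟩ := ih
    refine ⟨c * d, ?_⟩
    rw [ordProd, one_mul, ← mul_assoc, hc, smul_mul_assoc, hd, smul_smul]

theorem NonTorsion.X_unit : NonTorsion A (𝐱) := NonTorsion.X ()

theorem constantCoeff_unitVar : MvPowerSeries.constantCoeff (𝐱) = 0 :=
  MvPowerSeries.constantCoeff_X ()

theorem constantCoeff_fusZ (i : Fin n) : MvPowerSeries.constantCoeff (fusZ i) = 0 :=
  constantCoeff_linInv constantCoeff_unitVar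

theorem NonTorsion.fusZ (i : Fin n) : NonTorsion A (ReflAlg.fusZ i) :=
  NonTorsion.linInv constantCoeff_unitVar NonTorsion.X_unit

/-- The RTT relation at arbitrary points. -/
theorem RTT.mser_minus {T : ℕ → Matrix (Fin N) (Fin N) A}
    (hT : RTT (𝐯 - 𝐮) (hC Ch * 𝐮 * 𝐯) (mser T 𝐮) (mser T 𝐯)) {x y : MvPowerSeries σ Ch}
    (hx : MvPowerSeries.constantCoeff x = 0) (hy : MvPowerSeries.constantCoeff y = 0) :
    RTT (y - x) (hC Ch * x * y) (mser T x) (mser T y) := by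
  have := hT.mser_subst hx hy
  simpa only [map_sub, map_mul, substHom_X', substHom_hC, Matrix.cons_val_zero,
    Matrix.cons_val_one] using this

/-- The quantum determinant of `T`: the coefficient of the product
`E_{[N]} T_1(z) T_2(z - h) ⋯ T_N(z - (N-1) h)` with respect to `E_{[N]}`. -/
def qDet (T : ℕ → Matrix (Fin N) (Fin N) A) : MvPowerSeries Unit A :=
  (PowerSeries.C (N.factorial : ℂ) : Ch) •
    (antisym N N (MvPowerSeries Unit A) *
      ((List.finRange N).map fun i => site i (mser T (fusZ i))).prod : Ten N N _) id id

/-- The product `T_1(z) T_2(z - h) ⋯ T_N(z - (N-1) h)` becomes proportional to the anti-symmetrizer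
after multiplication by it. -/
theorem antisym_mul_fused (hA : HTF A) {T : ℕ → Matrix (Fin N) (Fin N) A}
    (hT : RTT (𝐯 - 𝐮) (hC Ch * 𝐮 * 𝐯) (mser T 𝐮) (mser T 𝐯)) :
    (antisym N N (MvPowerSeries Unit A) *
      ((List.finRange N).map fun i => site i (mser T (fusZ i))).prod : Ten N N _) =
        qDet T • antisym N N (MvPowerSeries Unit A) := by
  refine Matrix.ext fun a b => antisym_mul_prod (fun i j k hi hj => perm_site_of_ne hi hj _)
    (fun i j hij => ?_) a b
  have hne : i ≠ j := by
    rintro rfl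
    omega
  have hnt : NonTorsion A (hC Ch * fusZ i * fusZ j) :=
    ((NonTorsion.hC hA).mul (NonTorsion.fusZ i)).mul (NonTorsion.fusZ j)
  have h := (hT.mser_minus (constantCoeff_fusZ i) (constantCoeff_fusZ j)).site hne
  -- Neighbouring points differ by `h`, where the `R`-matrix is a multiple of `1 - P`.
  have e : (fusZ j : MvPowerSeries Unit Ch) - fusZ i = hC Ch * fusZ i * fusZ j := by
    rw [fusZ, fusZ, linInv_sub constantCoeff_unitVar, hij, ← sub_mul, ← map_sub]
    have : -((i : ℕ) : Ch) - -(((i + 1 : ℕ)) : Ch) = 1 := by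
      push_cast
      ring
    rw [this, map_one]
    ring
  have h1 : (rm (hC Ch * fusZ i * fusZ j) (hC Ch * fusZ i * fusZ j) i j :
      Ten N N (MvPowerSeries Unit A)) = (hC Ch * fusZ i * fusZ j) • (1 - perm i j) := by
    rw [rm, smul_sub]
  rw [e, h1, smul_mul_assoc, smul_mul_assoc, mul_smul_comm] at h
  exact hnt.matrix h

theorem rtt_tInv : RTT (𝐯 - 𝐮) (hC Ch * 𝐮 * 𝐯) (mser (tInv N) 𝐮) (mser (tInv N) 𝐯) :=
  RTT.of_site (tInv_site (by decide) (MvPowerSeries.constantCoeff_X (0 : Fin 2))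
    (MvPowerSeries.constantCoeff_X (1 : Fin 2)))

theorem rtt_tD' : RTT (𝐯 - 𝐮) (hC Ch * 𝐮 * 𝐯) (mser (tD N) 𝐮) (mser (tD N) 𝐯) :=
  rtt_tD (MvPowerSeries.constantCoeff_X (0 : Fin 2)) (MvPowerSeries.constantCoeff_X (1 : Fin 2))

/-- The crossing relation between the two factors of `B`. -/
theorem tInv_rbar_tD {i j : Fin n} (hij : i ≠ j) :
    (site i (mser (tInv N) (fusZ i)) * rbar i j (fusZZ i j) * site j (mser (tD N) (fusZ j)) :
      Ten N n (MvPowerSeries Unit (DY N))) =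
    site j (mser (tD N) (fusZ j)) * rbar i j (fusZZ i j) * site i (mser (tInv N) (fusZ i)) := by
  have hy : MvPowerSeries.constantCoeff
      (MvPowerSeries.C (PowerSeries.C (1 / 2 : ℂ)) * 𝐱) = 0 := by
    rw [map_mul, constantCoeff_unitVar, mul_zero]
  have e := linInv_add_mul (v := MvPowerSeries.C (-((i : ℕ) : Ch)) * hC Ch)
    (v' := MvPowerSeries.C (-((j : ℕ) : Ch)) * hC Ch) hy
  rw [two_mul_half] at e
  change (fusZ i + fusZ j) * fusZZ i j = fusZ i * fusZ j at e
  have hsum : NonTorsion (DY N) (fusZ i + fusZ j : MvPowerSeries Unit Ch) := by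
    intro f hf
    refine ((NonTorsion.fusZ i).mul (NonTorsion.fusZ j)) f ?_
    rw [← e, mul_comm, mul_smul, hf, smul_zero]
  have h := tInv_tD_site (N := N) hij.symm (constantCoeff_fusZ j) (constantCoeff_fusZ i)
  have e2 : (rm (fusZ j + fusZ i) (hC Ch * fusZ j * fusZ i) j i :
      Ten N n (MvPowerSeries Unit (DY N))) =
      (fusZ i + fusZ j) • rm 1 (hC Ch * fusZZ i j) i j := by
    rw [← rm_smul, mul_left_comm, e, mul_one, rm_comm, add_comm (fusZ j), mul_assoc,
      mul_comm (fusZ j)]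
  rw [e2, mul_smul_comm, smul_mul_assoc, mul_smul_comm, smul_mul_assoc] at h
  have h' := hsum.matrix h
  rw [rbar, mul_smul_comm, smul_mul_assoc, h', mul_smul_comm, smul_mul_assoc]

theorem antisym_mul_bProd (N : ℕ) : ∃ c : MvPowerSeries Unit Ch,
    (antisym N N (MvPowerSeries Unit (DY N)) * bProdD N N fusZ fusZZ : Ten N N _) =
      (qDet (tD N) * c • qDet (tInv N)) • antisym N N (MvPowerSeries Unit (DY N)) := by
  obtain ⟨c, hc⟩ := antisym_mul_ordProd (N := N) (n := N) (S := MvPowerSeries Unit Ch)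
    (R := MvPowerSeries Unit (DY N)) (Q := fun i j => if i = j then 1 else rbar i j (fusZZ i j))
    (fun i j => by
      by_cases hij : i = j
      · exact ⟨1, by simp [hij]⟩
      · refine ⟨nser N (fusZZ i j) * (1 + hC Ch * fusZZ i j), ?_⟩
        rw [if_neg hij, rbar, mul_smul_comm, antisym_mul_rm hij, smul_smul]) (List.finRange N)
  refine ⟨c, ?_⟩
  have hQ : ∀ (M : Matrix (Fin N) (Fin N) (MvPowerSeries Unit (DY N))) (i j k : Fin N), k ≠ i →
      k ≠ j → (if i = j then 1 else rbar i j (fusZZ i j) : Ten N N (MvPowerSeries Unit (DY N))) *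
        site k M = site k M * if i = j then 1 else rbar i j (fusZZ i j) := by
    intro M i j k hi hj
    split_ifs
    · rw [mul_one, one_mul]
    · rw [rbar, smul_mul_assoc, mul_smul_comm, rm_site_of_ne hi hj]
  -- The crossing relation collects the factors `T` of the matrices `B` on the left and the factors
  -- `T⁻¹` on the right; on the `R`-matrices between them the anti-symmetrizer is a scalar.
  have hB : (bProdD N N fusZ fusZZ : Ten N N (MvPowerSeries Unit (DY N))) = _ :=
    Eq.trans (by
      rw [bProdD]
      congr 1
      funext i
      rw [mser_bD (constantCoeff_fusZ i), site_mul])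
    (ordProd_mul (T := fun i => site i (mser (tD N) (fusZ i)))
      (T' := fun i => site i (mser (tInv N) (fusZ i)))
      (Q := fun i j => if i = j then 1 else rbar i j (fusZZ i j))
      (fun i j hij => by
        simp only [if_neg hij]
        exact tInv_rbar_tD hij)
      (fun i j k hi hj => hQ _ i j k hi hj) (fun i j k hi hj => (hQ _ i j k hi hj).symm)
      (List.finRange N) (List.nodup_finRange N))
  rw [hB, ← mul_assoc, ← mul_assoc, antisym_mul_fused HTF.dy rtt_tD', smul_mul_assoc, hc,
    smul_mul_assoc, smul_mul_assoc, antisym_mul_fused HTF.dy rtt_tInv, mul_smul, smul_assoc]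

end QDet

/-! ### Centrality of the quantum determinant -/

section Transfer

variable {S R I : Type*} [CommRing S] [Ring R] [Algebra S R]

/-- Moving `T₀` through an ordered product. -/
theorem prod_intertwine {r T : I → R} {t : R} (h : ∀ i, r i * t * T i = T i * t * r i)
    (hc : ∀ i j, i ≠ j → r i * T j = T j * r i) (l : List I) (hl : l.Nodup) :
    (l.reverse.map r).prod * t * (l.map T).prod = (l.map T).prod * t * (l.reverse.map r).prod := by
  induction l with
  | nil => simp
  | cons i l ih =>
    rw [List.nodup_cons] at hl
    have h1 : r i * (l.map T).prod = (l.map T).prod * r i :=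
      mul_prod_comm _ l _ fun k hk => hc i k fun h => hl.1 (h ▸ hk)
    have h2 : T i * (l.reverse.map r).prod = (l.reverse.map r).prod * T i :=
      mul_prod_comm _ l.reverse _ fun k hk =>
        (hc k i fun h => hl.1 (h ▸ List.mem_reverse.1 hk)).symm
    simp only [List.reverse_cons, List.map_append, List.prod_append, List.map_cons, List.map_nil,
      List.prod_cons, List.prod_nil, mul_one]
    calc (l.reverse.map r).prod * r i * t * (T i * (l.map T).prod)
        = (l.reverse.map r).prod * (r i * t * T i) * (l.map T).prod := by simp only [mul_assoc]
      _ = ((l.reverse.map r).prod * T i) * t * (r i * (l.map T).prod) := by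
          rw [h]; simp only [mul_assoc]
      _ = T i * ((l.reverse.map r).prod * t * (l.map T).prod) * r i := by
          rw [h1, ← h2]; simp only [mul_assoc]
      _ = _ := by rw [ih hl.2]; simp only [mul_assoc]

theorem smul_intertwine {s w : S} {r r' x y : R} (e : s • r = w • r')
    (h : r * x * y = y * x * r) : w • (r' * x * y) = w • (y * x * r') := by
  rw [← smul_mul_assoc, ← smul_mul_assoc, ← e, smul_mul_assoc, smul_mul_assoc, h, ← mul_smul_comm,
    e, mul_smul_comm]

theorem fusion_step (E P y : R) (a c d β : S) (ha : a + β = c) (hy : y * P = -y) :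
    ((d * c) • E - (β * d) • y) * (a • 1 - β • P) =
      (d * c * a) • E - (β * (d * c)) • (E * P + y) := by
  subst ha
  simp only [mul_sub, sub_mul, smul_mul_assoc, mul_smul_comm, mul_one, hy, smul_neg, smul_add]
  module

/-- The product of the R-matrices `R_{0 i}` at the points of an arithmetic progression, multiplied
by an operator which is antisymmetric in the other tensor factors. -/
theorem mul_prod_of_chain {E : R} {P : I → R} {α : I → S} {β : S}
    (hE : ∀ i j, i ≠ j → E * P i * P j = -(E * P i)) (p : S → Prop) (h1 : p 1)
    (hp : ∀ d j, p d → p (d * α j)) (l : List I) (i : I) (hl : (i :: l).Nodup)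
    (hch : (i :: l).IsChain fun i j => α i + β = α j) : ∃ d, p d ∧
      E * ((i :: l).reverse.map fun j => α j • 1 - β • P j).prod =
        (d * α i) • E - (β * d) • ((i :: l).map fun j => E * P j).sum := by
  induction l generalizing i with
  | nil => exact ⟨1, h1, by simp [mul_sub]⟩
  | cons j l ih =>
    rw [List.isChain_cons_cons] at hch
    obtain ⟨d, hd, h⟩ := ih j (List.nodup_cons.1 hl).2 hch.2
    refine ⟨d * α j, hp d j hd, ?_⟩
    rw [List.reverse_cons, List.map_append, List.prod_append, ← mul_assoc, h, List.map_singleton,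
      List.prod_singleton, List.map_cons (a := i), List.sum_cons]
    refine fusion_step E (P i) _ (α i) (α j) d β hch.1 ?_
    have hz : ∀ l' : List I, i ∉ l' → (l'.map fun j => E * P j).sum * P i =
        -(l'.map fun j => E * P j).sum := by
      intro l' hl'
      induction l' with
      | nil => simp
      | cons k l' ih' =>
        rw [List.mem_cons, not_or] at hl'
        rw [List.map_cons, List.sum_cons, add_mul, ih' hl'.2, hE k i (Ne.symm hl'.1), neg_add]
    exact hz _ (List.nodup_cons.1 hl).1

end Transfer

section Central

variable {N n : ℕ} {R : Type*} [Ring R] [Algebra Ch R]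

/-- The anti-symmetrizer acting in the tensor factors `1, …, n` of `0, …, n`. -/
def antisymSucc (N n : ℕ) (R : Type*) [Ring R] [Algebra Ch R] : Ten N (n + 1) R :=
  emb Fin.succ (Fin.succ_injective n) (antisym N n R)

theorem antisymSucc_mul_perm_perm {i j : Fin n} (hij : i ≠ j) :
    (antisymSucc N n R * perm 0 i.succ * perm 0 j.succ : Ten N (n + 1) R) =
      -(antisymSucc N n R * perm 0 i.succ) := by
  have h : (antisymSucc N n R * perm i.succ j.succ : Ten N (n + 1) R) = -antisymSucc N n R := by
    rw [antisymSucc, ← emb_perm (Fin.succ_injective n), ← map_mul, antisym_mul_perm hij, map_neg]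
  rw [mul_assoc, perm_perm_left (Fin.succ_ne_zero j).symm
    (fun h => hij (Fin.succ_injective n h)), ← mul_assoc, h, neg_mul]

/-- There are no nonzero antisymmetric tensors of degree `N + 1` in `ℂ^N`. -/
theorem sum_antisymSucc_mul_perm (N : ℕ) :
    (∑ i : Fin N, antisymSucc N N R * perm 0 i.succ : Ten N (N + 1) R) = antisymSucc N N R := by
  set E := antisymSucc N N R
  set W : Ten N (N + 1) R := E - ∑ i : Fin N, E * perm 0 i.succ with hW
  have h0 : ∀ i : Fin N, W * perm 0 i.succ = -W := by
    intro i
    have h1 : ∑ k : Fin N, (E * perm 0 k.succ * perm 0 i.succ + E * perm 0 k.succ) =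
        E + E * perm 0 i.succ := by
      rw [Finset.sum_eq_single i]
      · rw [mul_assoc, perm_mul_self, mul_one]
      · intro k _ hk
        rw [antisymSucc_mul_perm_perm hk, neg_add_cancel]
      · simp
    rw [Finset.sum_add_distrib] at h1
    rw [eq_neg_iff_add_eq_zero, hW, sub_mul, Finset.sum_mul]
    have h2 : ∀ a b c d : Ten N (N + 1) R, a + b = c + d → d - a + (c - b) = 0 := by
      intro a b c d h
      rw [show d - a + (c - b) = (c + d) - (a + b) by abel, h, sub_self]
    exact h2 _ _ _ _ h1
  have h : ∀ i j : Fin (N + 1), i ≠ j → W * perm i j = -W := by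
    intro i j hij
    cases i using Fin.cases with
    | zero =>
      cases j using Fin.cases with
      | zero => exact absurd rfl hij
      | succ j => exact h0 j
    | succ i =>
      cases j using Fin.cases with
      | zero => rw [perm_comm]; exact h0 i
      | succ j =>
        have e : (perm i.succ j.succ : Ten N (N + 1) R) =
            perm 0 i.succ * perm 0 j.succ * perm 0 i.succ := by
          rw [perm_perm_left (Fin.succ_ne_zero j).symm hij, mul_assoc, perm_mul_self, mul_one]
        rw [e, ← mul_assoc, ← mul_assoc, h0, neg_mul, h0, neg_neg, h0]
  have hW0 : W = 0 := by
    refine Matrix.ext fun a b => ?_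
    -- Two of the `N + 1` column indices agree, and the transposition of them changes the sign.
    obtain ⟨i, j, hne, hij⟩ := Fintype.exists_ne_map_eq_of_card_lt b (by simp)
    have hb : b ∘ Equiv.swap i j = b := by
      funext k
      rw [Function.comp, Equiv.swap_apply_def]
      split_ifs with h1 h2
      · rw [h1, hij]
      · rw [h2, hij]
      · rfl
    have h2 := congrFun (congrFun (h i j hne) a) b
    rw [perm_eq, mul_permOp_apply, hb, Matrix.neg_apply] at h2
    exact add_self_eq_zero' (eq_neg_iff_add_eq_zero.1 h2)
  exact (sub_eq_zero.1 hW0).symm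

theorem antisymSucc_mul_prod {S : Type*} [CommRing S] [Algebra S R] (hN : N ≠ 0) {α : ℕ → S} {β : S}
    (hα : ∀ i, α i + β = α (i + 1)) (p : S → Prop) (h1 : p 1)
    (hp : ∀ d j, p d → p (d * α j)) : ∃ d, p d ∧ (antisymSucc N N R *
      ((List.finRange N).reverse.map fun i : Fin N => rm (α i) β 0 i.succ).prod : Ten N (N + 1) R) =
        (d * (α 0 - β)) • antisymSucc N N R := by
  obtain ⟨m, rfl⟩ := Nat.exists_eq_succ_of_ne_zero hN
  have hch : (List.finRange (m + 1)).IsChain fun i j : Fin (m + 1) => α i + β = α j := by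
    rw [List.isChain_iff_getElem]
    intro i hi
    simpa using hα i
  have hnd := List.nodup_finRange (m + 1)
  have hs : ((List.finRange (m + 1)).map fun i =>
      (antisymSucc (m + 1) (m + 1) R * perm 0 i.succ : Ten (m + 1) (m + 2) R)).sum =
        antisymSucc (m + 1) (m + 1) R := by
    rw [← Fin.sum_univ_def]
    exact sum_antisymSucc_mul_perm _
  rw [List.finRange_succ] at hch hnd hs
  obtain ⟨d, hd, h⟩ := mul_prod_of_chain (E := antisymSucc (m + 1) (m + 1) R)
    (P := fun i : Fin (m + 1) => perm 0 i.succ)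
    (α := fun i => α i) (β := β) (fun i j hij => antisymSucc_mul_perm_perm hij)
    p h1 (fun d j => hp d j) _ _ hnd hch
  refine ⟨d, hd, ?_⟩
  rw [hs] at h
  rw [mul_sub, sub_smul, mul_comm d β, List.finRange_succ]
  exact h

theorem antisymSucc_apply_cons (i j : Fin N) (a b : Fin n → Fin N) :
    antisymSucc N n R (Fin.cons i a : Fin (n + 1) → Fin N) (Fin.cons j b : Fin (n + 1) → Fin N) =
      if i = j then antisym N n R a b else 0 := by
  rw [antisymSucc, emb_apply]
  refine if_congr ⟨fun h => ?_, ?_⟩ ?_ rfl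
  · simpa using h 0 (by simp)
  · rintro rfl l hl
    cases l using Fin.cases with
    | zero => simp
    | succ l => simp at hl
  · congr 1

/-- The anti-symmetrizer in the tensor factors `1, …, n` commutes with the factor `0`. -/
theorem antisymSucc_mul_site (M : Matrix (Fin N) (Fin N) R) :
    antisymSucc N n R * site 0 M = site 0 M * antisymSucc N n R := by
  refine Matrix.ext fun a b => ?_
  obtain ⟨i, a', rfl⟩ : ∃ i a', a = Fin.cons i a' := ⟨a 0, Fin.tail a, (Fin.cons_self_tail a).symm⟩
  obtain ⟨j, b', rfl⟩ : ∃ j b', b = Fin.cons j b' := ⟨b 0, Fin.tail b, (Fin.cons_self_tail b).symm⟩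
  rw [antisymSucc, emb_succ_mul_site_apply, ← antisymSucc, site_mul_apply, Finset.sum_eq_single j]
  · rw [Fin.update_cons_zero, antisymSucc_apply_cons, if_pos rfl, antisym_apply]
    exact Algebra.commutes _ _
  · intro c _ hc
    rw [Fin.update_cons_zero, antisymSucc_apply_cons, if_neg hc, mul_zero]
  · simp

theorem emb_smul_left {R : Type*} [Ring R] {m : ℕ} {ι : Fin m → Fin n}
    (hι : Function.Injective ι) (q : R) (X : Ten N m R) : emb ι hι (q • X) = q • emb ι hι X := by
  refine Matrix.ext fun a b => ?_
  change emb ι hι (q • X) a b = q • emb ι hι X a b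
  rw [emb_apply, emb_apply]
  split_ifs <;> simp

theorem comm_of_antisymSucc {q : R} {M : Matrix (Fin N) (Fin N) R}
    (h : site 0 M * (q • antisymSucc N N R) = q • (site 0 M * antisymSucc N N R)) (k l : Fin N) :
    M k l * q = q * M k l := by
  have hN : (N.factorial : ℂ) ≠ 0 := Nat.cast_ne_zero.2 (Nat.factorial_ne_zero N)
  have h1 := congrFun (congrFun h (Fin.cons k id : Fin (N + 1) → Fin N))
    (Fin.cons l id : Fin (N + 1) → Fin N)
  rw [Matrix.smul_apply, site_mul_apply, site_mul_apply, Finset.sum_eq_single l,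
    Finset.sum_eq_single l] at h1
  · rw [Matrix.smul_apply, Fin.update_cons_zero, antisymSucc_apply_cons, if_pos rfl, antisym_apply,
      antiCoeff_id, smul_eq_mul, smul_eq_mul, ← mul_assoc, ← mul_assoc] at h1
    have h2 := congrArg (· * algebraMap Ch R (PowerSeries.C (N.factorial : ℂ))) h1
    simp only [mul_assoc, ← map_mul] at h2
    rw [inv_mul_cancel₀ hN] at h2
    simpa using h2
  · intro c _ hc
    rw [Fin.update_cons_zero, antisymSucc_apply_cons, if_neg hc, mul_zero]
  · simp
  · intro c _ hc
    rw [Matrix.smul_apply, Fin.update_cons_zero, antisymSucc_apply_cons, if_neg hc, smul_zero,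
      mul_zero]
  · simp

end Central

section QDetCentral

variable {N n : ℕ} {A : Type*} [Ring A] [Algebra Ch A]

theorem constantCoeff_firstVar (_ : Unit) :
    MvPowerSeries.constantCoeff (𝐮) = 0 := MvPowerSeries.constantCoeff_X (0 : Fin 2)

/-- The point `1/(u⁻¹ - ih)`. -/
def fusU (i : Fin n) : MvPowerSeries (Fin 2) Ch :=
  linInv 𝐮 (MvPowerSeries.C (-((i : ℕ) : Ch)) * hC Ch)

theorem constantCoeff_fusU (i : Fin n) : MvPowerSeries.constantCoeff (fusU i) = 0 :=
  constantCoeff_linInv (constantCoeff_firstVar ())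

theorem substHom_fusZ (i : Fin n) :
    substHom (fun _ : Unit => 𝐮) constantCoeff_firstVar (fusZ i) = fusU i := by
  refine (substHom_linInv constantCoeff_firstVar constantCoeff_unitVar).trans ?_
  rw [map_mul, substHom_X', substHom_hC,
    (substHom_C _ _ : substHom _ constantCoeff_firstVar
      (MvPowerSeries.C (-((i : ℕ) : Ch)) : MvPowerSeries Unit Ch) = _), fusU]

theorem antisymSucc_mul_fused (hA : HTF A) {T : ℕ → Matrix (Fin N) (Fin N) A}
    (hT : RTT (𝐯 - 𝐮) (hC Ch * 𝐮 * 𝐯) (mser T 𝐮) (mser T 𝐯)) :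
    (antisymSucc N N (MvPowerSeries (Fin 2) A) *
      ((List.finRange N).map fun i => site i.succ (mser T (fusU i))).prod : Ten N (N + 1) _) =
        substHom (fun _ : Unit => 𝐮) constantCoeff_firstVar (qDet T) •
          antisymSucc N N (MvPowerSeries (Fin 2) A) := by
  have hE : (antisym N N (MvPowerSeries Unit A)).map
      (substHom (fun _ : Unit => 𝐮) constantCoeff_firstVar) =
        antisym N N (MvPowerSeries (Fin 2) A) := by
    refine Matrix.ext fun a b => ?_
    rw [Matrix.map_apply, antisym_apply, antisym_apply]
    rw [MvPowerSeries.algebraMap_apply, MvPowerSeries.algebraMap_apply]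
    exact substHom_C constantCoeff_firstVar _
  have h := congrArg (fun X : Ten N N (MvPowerSeries Unit A) =>
    X.map (substHom (fun _ : Unit => 𝐮) constantCoeff_firstVar)) (antisym_mul_fused hA hT)
  have h' : (antisym N N (MvPowerSeries (Fin 2) A) *
      ((List.finRange N).map fun i => site i (mser T (fusU i))).prod : Ten N N _) =
        substHom (fun _ : Unit => 𝐮) constantCoeff_firstVar (qDet T) •
          antisym N N (MvPowerSeries (Fin 2) A) := by
    refine Eq.trans ?_ (h.trans ?_)
    · rw [Matrix.map_mul, hE, Ten.map_list_prod, List.map_map]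
      congr 3
      funext i
      rw [Function.comp, site_map, mser_subst _ (constantCoeff_fusZ i), substHom_fusZ]
    · rw [← hE]
      refine Matrix.ext fun a b => ?_
      exact (substHom (fun _ : Unit => 𝐮) constantCoeff_firstVar).map_mul (qDet T)
        (antisym N N (MvPowerSeries Unit A) a b)
  have h2 := congrArg (emb Fin.succ (Fin.succ_injective N)) h'
  rw [map_mul, map_list_prod, List.map_map, emb_smul_left] at h2
  refine Eq.trans ?_ h2
  rw [antisymSucc]
  congr 3
  funext i
  exact (emb_site _ _ _).symm

theorem subs_qDet (T : ℕ → Matrix (Fin N) (Fin N) A) :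
    substHom (fun _ : Unit => 𝐮) constantCoeff_firstVar (qDet T) =
      subs (fun r => MvPowerSeries.coeff (Finsupp.single () r) (qDet T)) 𝐮 := by
  have h : qDet T = subs (fun r => MvPowerSeries.coeff (Finsupp.single () r) (qDet T)) 𝐱 := by
    classical
    refine MvPowerSeries.ext fun d => ?_
    rw [coeff_subs_X, if_pos]
    · congr 2
      ext
      simp
    · ext
      simp
  conv_lhs => rw [h]
  rw [substHom_subs constantCoeff_unitVar constantCoeff_firstVar, substHom_X']

/-- The coefficients of the quantum determinant commute with the coefficients of `T`. -/
theorem qDet_comm (hA : HTF A) {T : ℕ → Matrix (Fin N) (Fin N) A}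
    (hT : RTT (𝐯 - 𝐮) (hC Ch * 𝐮 * 𝐯) (mser T 𝐮) (mser T 𝐯)) (hN : N ≠ 0) (s r : ℕ)
    (k l : Fin N) : T r k l * MvPowerSeries.coeff (Finsupp.single () s) (qDet T) =
      MvPowerSeries.coeff (Finsupp.single () s) (qDet T) * T r k l := by
  let R := MvPowerSeries (Fin 2) A
  let β : MvPowerSeries (Fin 2) Ch := hC Ch * 𝐮 * 𝐯
  let α : ℕ → MvPowerSeries (Fin 2) Ch := fun i => 𝐮 - 𝐯 + (i : MvPowerSeries (Fin 2) Ch) * β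
  let q : R := substHom (fun _ : Unit => 𝐮) constantCoeff_firstVar (qDet T)
  let E : Ten N (N + 1) R := antisymSucc N N R
  let t : Ten N (N + 1) R := site 0 (mser T 𝐯)
  let W : Ten N (N + 1) R := ((List.finRange N).map fun i => site i.succ (mser T (fusU i))).prod
  let P : Ten N (N + 1) R :=
    ((List.finRange N).reverse.map fun i : Fin N => rm (α i) β 0 i.succ).prod
  have hv : MvPowerSeries.constantCoeff (𝐯) = 0 := MvPowerSeries.constantCoeff_X (1 : Fin 2)
  have hX : ∀ v : MvPowerSeries (Fin 2) Ch, NonTorsion A (𝐮 * v + MvPowerSeries.C (-1) * 𝐯) :=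
    fun v => NonTorsion.X_add (by decide) v (c' := -1) (by ring)
  have hα : ∀ i, NonTorsion A (α i) := by
    intro i
    have := hX (1 + (i : MvPowerSeries (Fin 2) Ch) * (hC Ch * 𝐯))
    rw [map_neg, map_one] at this
    convert this using 1
    simp only [α, β]
    ring
  have hα0 : NonTorsion A (α 0 - β) := by
    have := hX (1 - hC Ch * 𝐯)
    rw [map_neg, map_one] at this
    convert this using 1
    simp only [α, β]
    push_cast
    ring
  have hw : ∀ i : Fin N, NonTorsion A (fusU i) := fun i =>
    NonTorsion.linInv (constantCoeff_firstVar ()) (NonTorsion.X _)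
  have hrtt : ∀ i : Fin N, (rm (α i) β 0 i.succ * t * site i.succ (mser T (fusU i)) :
      Ten N (N + 1) R) = site i.succ (mser T (fusU i)) * t * rm (α i) β 0 i.succ := by
    intro i
    have h := (hT.mser_minus hv (constantCoeff_fusU i)).site (m := N + 1) (Fin.succ_ne_zero i).symm
    have hl : fusU i * (1 + 𝐮 * (MvPowerSeries.C (-((i : ℕ) : Ch)) * hC Ch)) = 𝐮 :=
      linInv_mul (constantCoeff_firstVar ())
    rw [map_neg, map_natCast] at hl
    -- With `fusU i = 1/(z - i h)`, the `R`-matrix between `1/𝐯` and `z - i h` is rescaled so that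
    -- its coefficients form an arithmetic progression.
    have e : (𝐮 • rm (fusU i - 𝐯) (hC Ch * 𝐯 * fusU i) 0 i.succ : Ten N (N + 1) R) =
        fusU i • rm (α i) β 0 i.succ := by
      rw [← rm_smul, ← rm_smul]
      congr 1
      · simp only [α, β]
        linear_combination 𝐯 * hl
      · simp only [β]
        ring
    exact (hw i).matrix (smul_intertwine e h)
  have h1 : P * t * W = W * t * P := prod_intertwine hrtt
    (fun i j hij => rm_site_of_ne (Fin.succ_ne_zero j)
      (fun h => hij (Fin.succ_injective N h).symm) _ _ _) _ (List.nodup_finRange N)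
  -- The anti-symmetrizer reduces the product of `R`-matrices to a scalar that is no zero divisor.
  obtain ⟨γ, hγ, h2⟩ : ∃ γ, NonTorsion A γ ∧ E * P = γ • E := by
    obtain ⟨d, hd, h⟩ := antisymSucc_mul_prod (R := R) hN (α := α) (β := β) (fun i => by
      simp only [α]
      push_cast
      ring) (NonTorsion A) (fun f hf => by rwa [one_smul] at hf) (fun d j hd => hd.mul (hα j))
    exact ⟨_, hd.mul hα0, h⟩
  have h3 : E * W = q • E := antisymSucc_mul_fused hA hT
  have h4 : E * t = t * E := antisymSucc_mul_site _
  have h5 : t * (q • E) = q • (t * E) := by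
    refine hγ.matrix ?_
    calc γ • (t * (q • E)) = (γ • E) * t * W := by
          rw [← h3, smul_mul_assoc, h4, smul_mul_assoc, mul_assoc]
      _ = E * (P * t * W) := by rw [← h2]; simp only [mul_assoc]
      _ = (E * W) * t * P := by rw [h1]; simp only [mul_assoc]
      _ = q • (t * (E * P)) := by
          rw [h3, smul_mul_assoc, smul_mul_assoc, h4, mul_assoc]
      _ = γ • (q • (t * E)) := by rw [h2, mul_smul_comm, smul_comm]
  have h6 := congrArg (MvPowerSeries.coeff (ex s r)) (comm_of_antisymSucc h5 k l)
  simp only [q] at h6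
  rw [subs_qDet] at h6
  exact ((coeff_subs_second_mul_subs _ _ s r).symm.trans h6).trans (coeff_subs_mul_subs _ _ s r)

end QDetCentral

/-! ### The center of the reflection algebra -/

section Center

variable {N : ℕ}

theorem comm_of_mem_hClosure {A : Type*} [Ring A] [Algebra Ch A]
    (hA : ∀ x y : A, (∀ n : ℕ, ∃ w, x = y + hbar ^ n • w) → x = y) {S : Set A} {x : A}
    (h : ∀ s ∈ S, x * s = s * x) {y : A} (hy : y ∈ hClosure (Algebra.adjoin Ch S)) :
    x * y = y * x := by
  have h1 : ∀ a ∈ Algebra.adjoin Ch S, x * a = a * x := by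
    intro a ha
    have : a ∈ Subalgebra.centralizer Ch {x} :=
      Algebra.adjoin_le (fun s hs => (Subalgebra.mem_centralizer_iff Ch).2 fun g hg => by
        rw [Set.mem_singleton_iff.1 hg, h s hs]) ha
    exact (Subalgebra.mem_centralizer_iff Ch).1 this x rfl
  refine hA _ _ fun n => ?_
  obtain ⟨a, ha, w, rfl⟩ := hy n
  refine ⟨x * w - w * x, ?_⟩
  rw [mul_add, add_mul, h1 a ha, smul_sub, mul_smul_comm, smul_mul_assoc]
  abel

theorem dy_sep (x y : DY N) (h : ∀ n : ℕ, ∃ w, x = y + hbar ^ n • w) : x = y :=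
  HTF.dy.eq_of_congr h

theorem reflAlg_sep (x y : reflAlg N) (h : ∀ n : ℕ, ∃ w, x = y + hbar ^ n • w) : x = y :=
  Subtype.ext <| dy_sep _ _ fun n => by
    obtain ⟨w, hw⟩ := h n
    exact ⟨w, congrArg Subtype.val hw⟩

variable {σ : Type*} {A : Type*} [Ring A] [Algebra Ch A]

theorem C_mul_mser_comm {T : ℕ → Matrix (Fin N) (Fin N) A} {x : A}
    (h : ∀ r k l, x * T r k l = T r k l * x) (w : MvPowerSeries σ Ch) (k l : Fin N) :
    MvPowerSeries.C x * mser T w k l = mser T w k l * MvPowerSeries.C x := by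
  refine MvPowerSeries.ext fun d => ?_
  rw [MvPowerSeries.coeff_C_mul, MvPowerSeries.coeff_mul_C]
  change x * (∑ r ∈ Finset.range (d.degree + 1), MvPowerSeries.coeff d (w ^ r) • T r k l) =
    (∑ r ∈ Finset.range (d.degree + 1), MvPowerSeries.coeff d (w ^ r) • T r k l) * x
  rw [Finset.mul_sum, Finset.sum_mul]
  exact Finset.sum_congr rfl fun r _ => by rw [mul_smul_comm, smul_mul_assoc, h]

theorem coeff_mser_unit (T : ℕ → Matrix (Fin N) (Fin N) A) (r : ℕ) (k l : Fin N) :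
    MvPowerSeries.coeff (Finsupp.single () r) (mser T 𝐱 k l) = T r k l := by
  classical
  refine (coeff_subs_X () (fun r => T r k l) (Finsupp.single () r)).trans ?_
  simp

theorem comm_of_C_mul_mser {T : ℕ → Matrix (Fin N) (Fin N) A} {x : A}
    (h : ∀ k l, MvPowerSeries.C x * mser T 𝐱 k l = mser T 𝐱 k l * MvPowerSeries.C x)
    (r : ℕ) (k l : Fin N) : x * T r k l = T r k l * x := by
  have := congrArg (MvPowerSeries.coeff (Finsupp.single () r)) (h k l)
  rwa [MvPowerSeries.coeff_C_mul, MvPowerSeries.coeff_mul_C, coeff_mser_unit] at this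

/-- An element which commutes with the entries of a matrix commutes with those of its inverse. -/
theorem comm_inverse {R : Type*} [Ring R] {x : R} {M M' : Matrix (Fin N) (Fin N) R}
    (h1 : M * M' = 1) (h2 : M' * M = 1) (h : ∀ k l, x * M k l = M k l * x) (k l : Fin N) :
    x * M' k l = M' k l * x := by
  have e : Matrix.scalar (Fin N) x * M = M * Matrix.scalar (Fin N) x := by
    refine Matrix.ext fun k l => ?_
    rw [Matrix.scalar_apply, Matrix.diagonal_mul, Matrix.mul_diagonal, h]
  have e' : Matrix.scalar (Fin N) x * M' = M' * Matrix.scalar (Fin N) x := by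
    calc Matrix.scalar (Fin N) x * M' = M' * (M * Matrix.scalar (Fin N) x) * M' := by
          rw [← mul_assoc M', h2, one_mul]
      _ = M' * Matrix.scalar (Fin N) x := by rw [← e, mul_assoc, mul_assoc, h1, mul_one]
  have := congrFun (congrFun e' k) l
  rwa [Matrix.scalar_apply, Matrix.diagonal_mul, Matrix.mul_diagonal] at this

theorem comm_tInv_of_tD {x : DY N} (h : ∀ r k l, x * tD N r k l = tD N r k l * x) (r : ℕ)
    (k l : Fin N) : x * tInv N r k l = tInv N r k l * x :=
  comm_of_C_mul_mser (comm_inverse (mser_mul_tInv constantCoeff_unitVar)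
    (mser_tInv_mul constantCoeff_unitVar) (C_mul_mser_comm h _)) r k l

theorem comm_tD_of_tInv {x : DY N} (h : ∀ r k l, x * tInv N r k l = tInv N r k l * x) (r : ℕ)
    (k l : Fin N) : x * tD N r k l = tD N r k l * x := by
  have h0 : MvPowerSeries.constantCoeff (-𝐱) = 0 := constantCoeff_neg_eq constantCoeff_unitVar
  have h1 := mser_tInv_mul (N := N) h0
  have h2 := mser_mul_tInv (N := N) h0
  rw [neg_neg] at h1 h2
  exact comm_of_C_mul_mser (comm_inverse h1 h2 (C_mul_mser_comm h _)) r k l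

theorem comm_reflAlg {x : DY N} (h : ∀ r k l, x * tD N r k l = tD N r k l * x) {y : DY N}
    (hy : y ∈ reflAlg N) : x * y = y * x := by
  have hb : ∀ r k l, x * bD N r k l = bD N r k l * x := comm_of_C_mul_mser fun k l => by
    have h1 := C_mul_mser_comm (σ := Unit) h 𝐱
    have h2 := C_mul_mser_comm (σ := Unit) (comm_tInv_of_tD h) 𝐱
    rw [mser_bD constantCoeff_unitVar, Matrix.mul_apply, Finset.mul_sum, Finset.sum_mul]
    refine Finset.sum_congr rfl fun c _ => ?_
    rw [← mul_assoc, h1, mul_assoc, h2, mul_assoc]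
  refine comm_of_mem_hClosure dy_sep ?_ hy
  rintro _ ⟨i, j, r, rfl⟩
  have h3 := hb (r + 1) i j
  change x * (hbar • bCoeff i j r) = (hbar • bCoeff i j r) * x at h3
  rw [mul_smul_comm, smul_mul_assoc] at h3
  exact HTF.dy.tf_inj h3

theorem qDet_tD_comm (hN : N ≠ 0) (s : ℕ) {y : DY N} (hy : y ∈ reflAlg N) :
    y * MvPowerSeries.coeff (Finsupp.single () s) (qDet (tD N)) =
      MvPowerSeries.coeff (Finsupp.single () s) (qDet (tD N)) * y :=
  (comm_reflAlg (fun r k l => (qDet_comm HTF.dy rtt_tD' hN s r k l).symm) hy).symm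

theorem qDet_tInv_comm (hN : N ≠ 0) (s : ℕ) {y : DY N} (hy : y ∈ reflAlg N) :
    y * MvPowerSeries.coeff (Finsupp.single () s) (qDet (tInv N)) =
      MvPowerSeries.coeff (Finsupp.single () s) (qDet (tInv N)) * y :=
  (comm_reflAlg (comm_tD_of_tInv
    fun r k l => (qDet_comm HTF.dy rtt_tInv hN s r k l).symm) hy).symm

theorem C_mul_comm_of_coeff {A : Type*} [Ring A] {x : A} {f : MvPowerSeries Unit A}
    (h : ∀ s, x * MvPowerSeries.coeff (Finsupp.single () s) f =
      MvPowerSeries.coeff (Finsupp.single () s) f * x) :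
    MvPowerSeries.C x * f = f * MvPowerSeries.C x := by
  refine MvPowerSeries.ext fun d => ?_
  have hd : d = Finsupp.single () (d ()) := by
    ext
    simp
  rw [MvPowerSeries.coeff_C_mul, MvPowerSeries.coeff_mul_C, hd, h]

variable {Y : vacLattice N →ₗ[Ch] PowerSeries (reflAlg N)}

theorem moduleMap_fused_trace (hY : IsModuleMap Y) (n k : ℕ) :
    ((PowerSeries.coeff k (Y ⟨fused N n, fused_mem N n⟩) : reflAlg N) : DY N) =
      MvPowerSeries.coeff (Finsupp.single () k)
        (Matrix.trace (antisym N n (MvPowerSeries Unit (DY N)) * bProdD N n fusZ fusZZ)) := by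
  rw [moduleMap_fused hY, trace_antisym_mul, map_sum]
  refine Finset.sum_congr rfl fun a _ => ?_
  rw [map_sum]
  exact Finset.sum_congr rfl fun b _ => rfl

/-- The coefficients of `𝔹_{[N]}(z)` are central. -/
theorem moduleMap_fused_central (hN : N ≠ 0) (hY : IsModuleMap Y) (k : ℕ) (y : reflAlg N) :
    y * PowerSeries.coeff k (Y ⟨fused N N, fused_mem N N⟩) =
      PowerSeries.coeff k (Y ⟨fused N N, fused_mem N N⟩) * y := by
  refine Subtype.ext ?_
  rw [MulMemClass.coe_mul, MulMemClass.coe_mul, moduleMap_fused_trace hY]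
  obtain ⟨c, hc⟩ := antisym_mul_bProd N
  rw [hc]
  have h1 : Commute (MvPowerSeries.C (σ := Unit) (y : DY N)) (qDet (tD N)) :=
    C_mul_comm_of_coeff fun s => qDet_tD_comm hN s y.2
  have h2 : Commute (MvPowerSeries.C (σ := Unit) (y : DY N)) (qDet (tInv N)) :=
    C_mul_comm_of_coeff fun s => qDet_tInv_comm hN s y.2
  have h3 : Commute (MvPowerSeries.C (σ := Unit) (y : DY N)) (Matrix.trace
      ((qDet (tD N) * c • qDet (tInv N)) • antisym N N (MvPowerSeries Unit (DY N)))) := by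
    rw [Matrix.trace_smul, smul_eq_mul]
    refine (h1.mul_right (h2.smul_right c)).mul_right ?_
    refine Commute.sum_right _ _ _ fun a _ => ?_
    exact (Algebra.commutes (antiCoeff N N a a) (MvPowerSeries.C (σ := Unit) (y : DY N))).symm
  have h4 := congrArg (MvPowerSeries.coeff (Finsupp.single () k)) h3.eq
  rwa [MvPowerSeries.coeff_C_mul, MvPowerSeries.coeff_mul_C] at h4

theorem fusZ_zero : (fusZ (0 : Fin 1) : MvPowerSeries Unit Ch) = 𝐱 := by
  refine (eq_linInv constantCoeff_unitVar ?_).symm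
  simp

/-- The coefficients of `𝔹_{[1]}(z)` are those of the trace of `B(z)`. -/
theorem moduleMap_fused_one (hY : IsModuleMap Y) (k : ℕ) :
    ((PowerSeries.coeff k (Y ⟨fused N 1, fused_mem N 1⟩) : reflAlg N) : DY N) =
      ∑ i, bD N k i i := by
  have h1 : antisym N 1 (MvPowerSeries Unit (DY N)) = 1 := by
    refine Matrix.ext fun a b => ?_
    rw [antisym_apply, antiCoeff, Fintype.sum_unique, Matrix.one_apply]
    simp only [Nat.factorial_one, Nat.cast_one, inv_one, map_one, one_mul]
    have : b ∘ (default : Equiv.Perm (Fin 1)) = b := rfl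
    rw [this, apply_ite (algebraMap Ch _)]
    simp
  have h2 : (bProdD N 1 fusZ fusZZ : Ten N 1 (MvPowerSeries Unit (DY N))) =
      site 0 (mser (bD N) 𝐱) := by
    rw [← fusZ_zero]
    simp [bProdD, ordProd, List.finRange_succ]
  rw [moduleMap_fused_trace hY, h1, h2, one_mul, Matrix.trace, map_sum]
  refine Fintype.sum_equiv (Equiv.funUnique (Fin 1) (Fin N)) _ _ fun a => ?_
  rw [Matrix.diag, site_apply, if_pos fun _ _ => rfl, coeff_mser_unit]
  rfl

end Center

end

end ReflAlg

open ReflAlg in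
theorem corollary5p2 (N : ℕ) (hN : 2 ≤ N) :
    ∃ (h₁ : fused N 1 ∈ vacLattice N) (h₂ : fused N N ∈ vacLattice N)
      (Y : vacLattice N →ₗ[Ch] PowerSeries (reflAlg N)),
      IsModuleMap Y ∧ (∀ Y' : vacLattice N →ₗ[Ch] PowerSeries (reflAlg N),
        IsModuleMap Y' → Y' = Y) ∧
      (∀ x ∈ hClosure (Algebra.adjoin Ch
          (serCoeffs (Y ⟨fused N 1, h₁⟩) ∪ serCoeffs (Y ⟨fused N N, h₂⟩))),
        ∀ y ∈ hClosure (Algebra.adjoin Ch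
          (serCoeffs (Y ⟨fused N 1, h₁⟩) ∪ serCoeffs (Y ⟨fused N N, h₂⟩))),
          x * y = y * x) ∧
      (∀ x ∈ serCoeffs (Y ⟨fused N N, h₂⟩), x ∈ Subalgebra.center Ch (reflAlg N)) := by
  obtain ⟨Y, hY⟩ := exists_moduleMap N
  have hN' : N ≠ 0 := by omega
  have hc : ∀ (k : ℕ) (y : reflAlg N), y * PowerSeries.coeff k (Y ⟨fused N N, fused_mem N N⟩) =
      PowerSeries.coeff k (Y ⟨fused N N, fused_mem N N⟩) * y := moduleMap_fused_central hN' hY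
  refine ⟨fused_mem N 1, fused_mem N N, Y, hY, fun Y' hY' => moduleMap_unique hY hY', ?_, ?_⟩
  · intro x hx y hy
    refine comm_of_mem_hClosure reflAlg_sep (fun s hs => ?_) hy
    refine (comm_of_mem_hClosure reflAlg_sep (fun t ht => ?_) hx).symm
    rcases hs with ⟨k, rfl⟩ | ⟨k, rfl⟩
    · rcases ht with ⟨l, rfl⟩ | ⟨l, rfl⟩
      · refine Subtype.ext ?_
        rw [MulMemClass.coe_mul, MulMemClass.coe_mul, moduleMap_fused_one hY,
          moduleMap_fused_one hY]
        exact trace_bD_comm k l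
      · exact hc l _
    · exact (hc k t).symm
  · rintro _ ⟨k, rfl⟩
    exact Subalgebra.mem_center_iff.2 fun y => hc k y
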